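/- Let $n,m\ge 0$ be integers. In the Laurent polynomial ring $\Lambda_{n,m}=\mathbb Z[x_1^{\pm1},\dots,x_n^{\pm1},y_1^{\pm1},\dots,y_m^{\pm1}]$ let $$J_{0,0}=\Big\{f\in\Lambda_{n,m}^{S_n\times S_m}\ \Big|\ y_p\frac{\partial f}{\partial y_p}+x_i\frac{\partial f}{\partial x_i}\in (y_p-x_i)\Lambda_{n,m}\ \text{ for all } 1\le i\le n,\ 1\le p\le m\Big\},$$ where $S_n$ permutes the $x_i$ and $S_m$ permutes the $y_p$. Put $$\Delta=\frac{y_1\cdots y_m}{x_1\cdots x_n},\qquad \Delta^*=\Delta^{-1},\qquad \sum_{k\ge0}h_kt^k=\frac{\prod_{p=1}^m(1-y_pt)}{\prod_{i=1}^n(1-x_it)},\qquad h_k^*=h_k(x_1^{-1},\dots,x_n^{-1},y_1^{-1},\dots,y_m^{-1}).$$ 1. $J_{0,0}$ is a subring of $\Lambda_{n,m}$, and it is generated as a ring (over $\mathbb Z$) by $\Delta$, $\Delta^*$, $h_k$ and $h_k^*$ for $k\in\mathbb N$. 2. Let $K(GL(n,m))$ be the Grothendieck ring of finite-dimensional representations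 of the complex algebraic supergroup $GL(n,m)$, that is, of the group-valued functor that assigns to a supercommutative $\mathbb C$-superalgebra $A$ the group of invertible even $(n|m)\times(n|m)$ supermatrices over $A$; a representation in a finite-dimensional superspace $V$ is a natural homomorphism $GL(n,m)(A)\to GL(V)(A)$. As a group, $K(GL(n,m))$ is the free abelian group on such representations $V=V_0\oplus V_1$ modulo the relations $[V']-[V]+[V'']=0$ for all short exact sequences $0\to V'\to V\to V''\to 0$ (with even maps) and $[V]+[\Pi V]=0$, where $\Pi$ is the change of parity; the product is $[V][W]=[V\otimes W]$. Then the supercharacter map $$[V]\longmapsto \sum_{(\lambda,\mu)\in\mathbb Z^n\times\mathbb Z^m}\big(\dim (V_{\lambda,\mu})_0-\dim (V_{\lambda,\mu})_1\big)\,x_1^{\lambda_1}\cdots x_n^{\lambda_n}\,y_1^{\mu_1}\cdots y_m^{\mu_m},$$ where $V_{\lambda,\mu}$ is the subspace of $V$ on which the diagonal matrices in $GL(n,m)(\mathbb C)$ act by the character $(\lambda,\mu)$, is a well-defined ring isomorphism $K(GL(n,m))\to J_{0,0}$. -/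

import Mathlib

/-!
# Supersymmetric Laurent polynomials and representations of the supergroup `GL(n|m)`

* `LaurentRing n m` is `ℤ[x₁^{±1}, …, xₙ^{±1}, y₁^{±1}, …, yₘ^{±1}]`, realised as the integral group
  ring of the lattice `ℤⁿ ⊕ ℤᵐ`; `J00 n m` is its subring of `Sₙ × Sₘ`-invariant elements that
  satisfy the isotropic divisibility conditions.
* `GLRep n m` is the type of finite dimensional representations of the complex algebraic supergroup
  `GL(n|m)`, viewed as a group valued functor on commutative superalgebras, and `GrothRing n m` is
  its Grothendieck ring (with `[ΠV] = -[V]`).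
-/

noncomputable section

namespace SuperGL

/-! ### The Laurent polynomial ring and the subring `J₀₀` -/

/-- The exponent lattice: `Sum.inl i` is the exponent of `xᵢ`, `Sum.inr p` that of `y_p`. -/
abbrev Wt (n m : ℕ) : Type := Fin n ⊕ Fin m → ℤ

/-- The ring of Laurent polynomials over `ℤ` in `x₁, …, xₙ, y₁, …, yₘ`. -/
abbrev LaurentRing (n m : ℕ) : Type := AddMonoidAlgebra ℤ (Wt n m)

section Laurent

variable {n m : ℕ}

/-- The Laurent monomial with exponent vector `w`. -/
def mono (w : Wt n m) : LaurentRing n m := AddMonoidAlgebra.single w 1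

/-- The variable `xᵢ`. -/
def x (i : Fin n) : LaurentRing n m := mono (Pi.single (Sum.inl i) 1)

/-- The variable `y_p`. -/
def y (p : Fin m) : LaurentRing n m := mono (Pi.single (Sum.inr p) 1)

/-- The automorphism of the lattice that permutes the coordinates by `σ`. -/
def permWt (σ : Equiv.Perm (Fin n ⊕ Fin m)) : Wt n m ≃+ Wt n m where
  toFun w := fun j => w (σ.symm j)
  invFun w := fun j => w (σ j)
  left_inv w := by ext j; simp
  right_inv w := by ext j; simp
  map_add' _ _ := rfl

/-- The action of `(σ, τ) ∈ Sₙ × Sₘ` on Laurent polynomials, `xᵢ ↦ x_{σ i}`, `y_p ↦ y_{τ p}`. -/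
def permAct (σ : Equiv.Perm (Fin n)) (τ : Equiv.Perm (Fin m)) :
    LaurentRing n m ≃ₐ[ℤ] LaurentRing n m :=
  AddMonoidAlgebra.domCongr ℤ ℤ (permWt (Equiv.sumCongr σ τ))

/-- The substitution `xᵢ ↦ xᵢ⁻¹`, `y_p ↦ y_p⁻¹`. -/
def invAct : LaurentRing n m ≃ₐ[ℤ] LaurentRing n m :=
  AddMonoidAlgebra.domCongr ℤ ℤ (AddEquiv.neg (Wt n m))

/-- The Euler operator `z_j ∂/∂z_j`, where `z_j` is the variable with index `j`: it multiplies the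
monomial with exponent vector `w` by `w j`. -/
def euler (j : Fin n ⊕ Fin m) (f : LaurentRing n m) : LaurentRing n m :=
  f.coeff.sum fun w c => AddMonoidAlgebra.single w (w j * c)

theorem euler_single (j : Fin n ⊕ Fin m) (w : Wt n m) (c : ℤ) :
    euler j (AddMonoidAlgebra.single w c) = AddMonoidAlgebra.single w (w j * c) := by
  simp [euler]

theorem euler_add (j : Fin n ⊕ Fin m) (f g : LaurentRing n m) :
    euler j (f + g) = euler j f + euler j g := by
  unfold euler
  rw [AddMonoidAlgebra.coeff_add, Finsupp.sum_add_index']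
  · intro w; simp
  · intro w a b; rw [mul_add, AddMonoidAlgebra.single_add]

theorem euler_zero (j : Fin n ⊕ Fin m) : euler j (0 : LaurentRing n m) = 0 := by
  simp [euler]

theorem euler_one (j : Fin n ⊕ Fin m) : euler j (1 : LaurentRing n m) = 0 := by
  rw [AddMonoidAlgebra.one_def, euler_single]; simp

theorem euler_neg (j : Fin n ⊕ Fin m) (f : LaurentRing n m) : euler j (-f) = -euler j f := by
  rw [eq_neg_iff_add_eq_zero, ← euler_add, neg_add_cancel, euler_zero]

theorem euler_mul (j : Fin n ⊕ Fin m) (f g : LaurentRing n m) :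
    euler j (f * g) = euler j f * g + f * euler j g := by
  induction f using AddMonoidAlgebra.induction_linear with
  | zero => simp [euler_zero]
  | add f₁ f₂ h₁ h₂ => rw [add_mul, euler_add, euler_add, h₁, h₂]; ring
  | single w c =>
    induction g using AddMonoidAlgebra.induction_linear with
    | zero => simp [euler_zero]
    | add g₁ g₂ h₁ h₂ => rw [mul_add, euler_add, euler_add, h₁, h₂]; ring
    | single v d =>
      simp only [euler_single, AddMonoidAlgebra.single_mul_single, ← AddMonoidAlgebra.single_add,
        Pi.add_apply]
      congr 1
      ring

end Laurent

/-- The ring `J(gl(n,m))₀₀`: the `Sₙ × Sₘ`-invariant Laurent polynomials `f` such that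
`y_p ∂f/∂y_p + xᵢ ∂f/∂xᵢ` lies in the principal ideal `(y_p - xᵢ)` for all `i` and `p`. -/
def J00 (n m : ℕ) : Subring (LaurentRing n m) where
  carrier := {f | (∀ σ τ, permAct σ τ f = f) ∧
    ∀ (i : Fin n) (p : Fin m),
      euler (Sum.inr p) f + euler (Sum.inl i) f ∈ Ideal.span {(y p - x i : LaurentRing n m)}}
  mul_mem' := by
    rintro f g ⟨hf, hf'⟩ ⟨hg, hg'⟩
    refine ⟨fun σ τ => by rw [map_mul, hf, hg], fun i p => ?_⟩
    have h := Ideal.add_mem _ (Ideal.mul_mem_right g _ (hf' i p)) (Ideal.mul_mem_left _ f (hg' i p))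
    rw [euler_mul, euler_mul]
    convert h using 1
    ring
  one_mem' := ⟨fun σ τ => map_one _, fun i p => by simp [euler_one]⟩
  add_mem' := by
    rintro f g ⟨hf, hf'⟩ ⟨hg, hg'⟩
    refine ⟨fun σ τ => by rw [map_add, hf, hg], fun i p => ?_⟩
    rw [euler_add, euler_add]
    convert Ideal.add_mem _ (hf' i p) (hg' i p) using 1
    ring
  zero_mem' := ⟨fun σ τ => map_zero _, fun i p => by simp [euler_zero]⟩
  neg_mem' := by
    rintro f ⟨hf, hf'⟩
    refine ⟨fun σ τ => by rw [map_neg, hf], fun i p => ?_⟩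
    rw [euler_neg, euler_neg]
    convert (Ideal.neg_mem_iff _).2 (hf' i p) using 1
    ring

section Generators

variable (n m : ℕ)

/-- `Δ = (y₁ ⋯ yₘ) / (x₁ ⋯ xₙ)`. -/
def Delta : LaurentRing n m := mono (Sum.elim (fun _ => -1) (fun _ => 1))

/-- `Δ* = (x₁ ⋯ xₙ) / (y₁ ⋯ yₘ)`. -/
def DeltaStar : LaurentRing n m := mono (Sum.elim (fun _ => 1) (fun _ => -1))

/-- The expansion at `t = 0` of `χ(t) = ∏ (1 - y_p t) / ∏ (1 - xᵢ t)`. -/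
def chi : PowerSeries (LaurentRing n m) :=
  (∏ p : Fin m, (1 - PowerSeries.C (y p) * PowerSeries.X)) *
    PowerSeries.invOfUnit (∏ i : Fin n, (1 - PowerSeries.C (x i) * PowerSeries.X)) 1

/-- `h_k`, the coefficient of `t ^ k` in the expansion of `χ(t)` at `0`. -/
def h (k : ℕ) : LaurentRing n m := PowerSeries.coeff k (chi n m)

/-- `h_k* = h_k(x₁⁻¹, …, xₙ⁻¹, y₁⁻¹, …, yₘ⁻¹)`. -/
def hStar (k : ℕ) : LaurentRing n m := invAct (h n m k)

end Generators

/-! ### Commutative superalgebras and supermatrices -/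

/-- A supercommutative superalgebra over `ℂ`. (Odd elements square to zero automatically.) -/
structure SuperAlg : Type 1 where
  carrier : Type
  [ring : Ring carrier]
  [algebra : Algebra ℂ carrier]
  grading : ZMod 2 → Submodule ℂ carrier
  [graded : GradedAlgebra grading]
  comm_even : ∀ a ∈ grading 0, ∀ b, a * b = b * a
  comm_odd : ∀ a ∈ grading 1, ∀ b ∈ grading 1, a * b = -(b * a)

attribute [instance] SuperAlg.ring SuperAlg.algebra SuperAlg.graded

instance : CoeSort SuperAlg Type := ⟨SuperAlg.carrier⟩

/-- The even homomorphisms of superalgebras. -/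
structure SuperAlg.Hom (A B : SuperAlg) where
  toAlgHom : A →ₐ[ℂ] B
  map_mem : ∀ (e : ZMod 2) (a : A), a ∈ A.grading e → toAlgHom a ∈ B.grading e

/-- The purely even grading of a commutative algebra. -/
def evenGrading (R : Type) [CommRing R] [Algebra ℂ R] (e : ZMod 2) : Submodule ℂ R :=
  if e = 0 then ⊤ else ⊥

instance (R : Type) [CommRing R] [Algebra ℂ R] : GradedAlgebra (evenGrading R) where
  one_mem := by simp [evenGrading]
  mul_mem := by
    intro i j a b ha hb
    unfold evenGrading at *
    split_ifs at * <;> simp_all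
  decompose' a := DirectSum.of (fun e => evenGrading R e) 0 ⟨a, by simp [evenGrading]⟩
  left_inv a := by simp
  right_inv a := by
    induction a using DirectSum.induction_on with
    | zero =>
      rw [map_zero]
      exact map_zero (DirectSum.of (fun e => evenGrading R e) 0)
    | of e a =>
      obtain ⟨a, ha⟩ := a
      by_cases he : e = 0
      · subst he; simp
      · have h0 : a = 0 := by simpa [evenGrading, he] using ha
        subst h0
        have h1 : (⟨0, ha⟩ : evenGrading R e) = 0 := rfl
        rw [h1, map_zero, map_zero]
        exact map_zero (DirectSum.of (fun e => evenGrading R e) 0)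
    | add a b ha hb =>
      refine Eq.trans ?_ (congrArg₂ (· + ·) ha hb)
      beta_reduce
      rw [← map_add]
      congr 1
      exact Subtype.ext (map_add _ _ _)

/-- A commutative algebra, seen as a purely even superalgebra. -/
abbrev SuperAlg.ofComm (R : Type) [CommRing R] [Algebra ℂ R] : SuperAlg where
  carrier := R
  grading := evenGrading R
  comm_even a _ b := mul_comm a b
  comm_odd a ha b hb := by
    have h0 : a = 0 := by simpa [evenGrading] using ha
    simp [h0]

/-- The sign `(-1)^e` of a parity `e`. -/
def sgn (e : ZMod 2) : ℤ := if e = 0 then 1 else -1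

theorem sgn_zero : sgn 0 = 1 := rfl

theorem sgn_add (a b : ZMod 2) : sgn (a + b) = sgn a * sgn b := by
  revert a b; decide

theorem SuperAlg.mul_comm_sgn (A : SuperAlg) {d e : ZMod 2} {a b : A} (ha : a ∈ A.grading d)
    (hb : b ∈ A.grading e) : a * b = sgn (d * e) • (b * a) := by
  have key : ∀ e : ZMod 2, e = 0 ∨ e = 1 := by decide
  rcases key d with rfl | rfl
  · simp [sgn, A.comm_even a ha b]
  · rcases key e with rfl | rfl
    · simp [sgn, A.comm_even b hb a]
    · simp [sgn, A.comm_odd a ha b hb]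

section Matrices

variable {ι κ : Type} [Fintype ι] [DecidableEq ι] [Fintype κ] [DecidableEq κ]

/-- The ring of even supermatrices over `A`, with rows and columns of parities `p i`; these are the
even (parity preserving) endomorphisms of the free right supermodule over `A` with basis vectors
`eᵢ` of parity `p i`, a matrix `g` acting by `e_j ↦ ∑ eᵢ g_{ij}`. -/
def SuperMat (p : ι → ZMod 2) (A : SuperAlg) : Subring (Matrix ι ι A) where
  carrier := {M | ∀ i j, M i j ∈ A.grading (p i + p j)}
  mul_mem' := by
    intro M N hM hN i j
    rw [Matrix.mul_apply]
    refine Submodule.sum_mem _ fun k _ => ?_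
    have h := SetLike.mul_mem_graded (hM i k) (hN k j)
    rwa [show p i + p k + (p k + p j) = p i + p j by
      generalize p i = a; generalize p j = b; generalize p k = c
      revert a b c; decide] at h
  one_mem' := by
    intro i j
    by_cases hij : i = j
    · subst hij
      rw [Matrix.one_apply_eq, show p i + p i = 0 by generalize p i = a; revert a; decide]
      exact SetLike.one_mem_graded _
    · rw [Matrix.one_apply_ne hij]; exact Submodule.zero_mem _
  add_mem' hM hN i j := Submodule.add_mem _ (hM i j) (hN i j)
  zero_mem' i j := Submodule.zero_mem _
  neg_mem' hM i j := Submodule.neg_mem _ (hM i j)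

/-- The group `GL(p)(A)` of invertible even supermatrices. -/
abbrev SGL (p : ι → ZMod 2) (A : SuperAlg) : Type := (SuperMat p A)ˣ

/-- Extension of scalars for even supermatrices. -/
def SuperMat.map (p : ι → ZMod 2) {A B : SuperAlg} (φ : A.Hom B) :
    SuperMat p A →+* SuperMat p B :=
  (φ.toAlgHom.toRingHom.mapMatrix.comp (SuperMat p A).subtype).codRestrict (SuperMat p B)
    fun M i j => φ.map_mem _ _ (M.2 i j)

/-- Functoriality of `A ↦ GL(p)(A)`. -/
def SGL.map (p : ι → ZMod 2) {A B : SuperAlg} (φ : A.Hom B) : SGL p A →* SGL p B :=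
  Units.map (SuperMat.map p φ).toMonoidHom

/-- The tensor product of two even supermatrices; the sign comes from moving `g_{ij}` past the
basis vector `f_k` in `(e_j ⊗ f_l) ↦ ∑ eᵢ g_{ij} ⊗ f_k h_{kl}`. -/
def kron (p : ι → ZMod 2) (q : κ → ZMod 2) {A : SuperAlg} (M : Matrix ι ι A) (N : Matrix κ κ A) :
    Matrix (ι × κ) (ι × κ) A :=
  Matrix.of fun a b => sgn ((p a.1 + p b.1) * q a.2) • (M a.1 b.1 * N a.2 b.2)

/-- The parity function of a tensor product. -/
def tensorParity (p : ι → ZMod 2) (q : κ → ZMod 2) (a : ι × κ) : ZMod 2 := p a.1 + q a.2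

theorem kron_mem (p : ι → ZMod 2) (q : κ → ZMod 2) {A : SuperAlg} {M : Matrix ι ι A}
    {N : Matrix κ κ A} (hM : M ∈ SuperMat p A) (hN : N ∈ SuperMat q A) :
    kron p q M N ∈ SuperMat (tensorParity p q) A := by
  rintro ⟨i, k⟩ ⟨j, l⟩
  refine zsmul_mem ?_ _
  have h := SetLike.mul_mem_graded (hM i j) (hN k l)
  rwa [add_add_add_comm] at h

theorem kron_mul (p : ι → ZMod 2) (q : κ → ZMod 2) {A : SuperAlg} {M M' : Matrix ι ι A}
    {N N' : Matrix κ κ A} (hM' : M' ∈ SuperMat p A) (hN : N ∈ SuperMat q A) :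
    kron p q (M * M') (N * N') = kron p q M N * kron p q M' N' := by
  ext ⟨i, k⟩ ⟨j, l⟩
  simp only [kron, Matrix.of_apply, Matrix.mul_apply, Fintype.sum_prod_type, Finset.sum_mul_sum, Finset.smul_sum]
  refine Finset.sum_congr rfl fun a _ => Finset.sum_congr rfl fun b _ => ?_
  have h1 : M i a * M' a j * (N k b * N' b l) = M i a * (M' a j * N k b) * N' b l := by
    simp only [mul_assoc]
  rw [h1, A.mul_comm_sgn (hM' a j) (hN k b)]
  simp only [mul_smul_comm, smul_mul_assoc, smul_smul, mul_assoc]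
  congr 1
  generalize p i = pi; generalize p a = pa; generalize p j = pj
  generalize q k = qk; generalize q b = qb
  revert pi pa pj qk qb; decide

set_option linter.unusedSectionVars false in
theorem kron_one (p : ι → ZMod 2) (q : κ → ZMod 2) {A : SuperAlg} :
    kron p q (1 : Matrix ι ι A) (1 : Matrix κ κ A) = 1 := by
  ext ⟨i, k⟩ ⟨j, l⟩
  by_cases h1 : i = j
  · subst h1
    have h0 : p i + p i = 0 := by generalize p i = a; revert a; decide
    simp [kron, h0, sgn_zero, Matrix.one_apply, Prod.ext_iff]
  · simp [kron, h1, Matrix.one_apply]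

theorem diagonal_mem (p : ι → ZMod 2) {R : Type} [CommRing R] [Algebra ℂ R] (d : ι → R) :
    Matrix.diagonal d ∈ SuperMat p (SuperAlg.ofComm R) := by
  intro i j
  by_cases hij : i = j
  · subst hij
    rw [show p i + p i = 0 by generalize p i = a; revert a; decide]
    exact Submodule.mem_top
  · have h0 : Matrix.diagonal d i j = 0 := Matrix.diagonal_apply_ne _ hij
    exact h0 ▸ Submodule.zero_mem (evenGrading R (p i + p j))

end Matrices

/-! ### Representations of `GL(n|m)` -/

/-- The parities of the standard basis of `ℂ^{n|m}`. -/
def stdParity (n m : ℕ) : Fin n ⊕ Fin m → ZMod 2 := Sum.elim (fun _ => 0) (fun _ => 1)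

/-- A finite dimensional representation of the algebraic supergroup `GL(n|m)`: a finite dimensional
superspace `V`, given with a basis `(eᵢ)` of homogeneous vectors of parities `parity i`, and a
natural transformation of group functors `GL(n|m)(A) → GL(V)(A)` on commutative superalgebras. -/
structure GLRep (n m : ℕ) : Type 1 where
  ι : Type
  [fintype : Fintype ι]
  [decEq : DecidableEq ι]
  parity : ι → ZMod 2
  ρ : ∀ A : SuperAlg, SGL (stdParity n m) A →* SGL parity A
  natural : ∀ (A B : SuperAlg) (φ : A.Hom B) (g : SGL (stdParity n m) A),
    ρ B (SGL.map (stdParity n m) φ g) = SGL.map parity φ (ρ A g)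

attribute [instance] GLRep.fintype GLRep.decEq

namespace GLRep

variable {n m : ℕ}

/-- The matrix by which `g` acts. -/
def mat (V : GLRep n m) {A : SuperAlg} (g : SGL (stdParity n m) A) : Matrix V.ι V.ι A :=
  ((V.ρ A g : SuperMat V.parity A) : Matrix V.ι V.ι A)

theorem mat_mem (V : GLRep n m) {A : SuperAlg} (g : SGL (stdParity n m) A) :
    V.mat g ∈ SuperMat V.parity A := (V.ρ A g : SuperMat V.parity A).2

theorem mat_one (V : GLRep n m) {A : SuperAlg} :
    V.mat (1 : SGL (stdParity n m) A) = 1 := by simp [mat]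

theorem mat_mul (V : GLRep n m) {A : SuperAlg} (g g' : SGL (stdParity n m) A) :
    V.mat (g * g') = V.mat g * V.mat g' := by simp [mat]

theorem mat_map (V : GLRep n m) {A B : SuperAlg} (φ : A.Hom B) (g : SGL (stdParity n m) A) :
    V.mat (SGL.map (stdParity n m) φ g) = (V.mat g).map φ.toAlgHom := by
  unfold mat
  rw [V.natural]
  rfl

/-- A representation from a natural multiplicative family of even supermatrices. -/
abbrev ofMat (ι : Type) [Fintype ι] [DecidableEq ι] (parity : ι → ZMod 2)
    (r : ∀ {A : SuperAlg}, SGL (stdParity n m) A → Matrix ι ι A)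
    (hmem : ∀ {A : SuperAlg} (g : SGL (stdParity n m) A), r g ∈ SuperMat parity A)
    (hone : ∀ {A : SuperAlg}, r (1 : SGL (stdParity n m) A) = 1)
    (hmul : ∀ {A : SuperAlg} (g g' : SGL (stdParity n m) A), r (g * g') = r g * r g')
    (hmap : ∀ {A B} (φ : SuperAlg.Hom A B) (g : SGL (stdParity n m) A),
      r (SGL.map (stdParity n m) φ g) = (r g).map φ.toAlgHom) : GLRep n m where
  ι := ι
  parity := parity
  ρ A := MonoidHom.toHomUnits
    { toFun := fun g => (⟨r g, hmem g⟩ : SuperMat parity A)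
      map_one' := Subtype.ext hone
      map_mul' := fun g g' => Subtype.ext (hmul g g') }
  natural _ _ φ g := Units.ext (Subtype.ext (hmap φ g))

/-- The trivial representation `ℂ^{1|0}`. -/
abbrev triv (n m : ℕ) : GLRep n m :=
  ofMat Unit (fun _ => 0) (fun {_} _ => 1) (fun _ => Subring.one_mem _) rfl
    (fun _ _ => (one_mul _).symm) (fun φ _ => by simp)

/-- The zero representation. -/
abbrev zero (n m : ℕ) : GLRep n m :=
  ofMat Empty (fun _ => 0) (fun {_} _ => 1) (fun _ => Subring.one_mem _) rfl
    (fun _ _ => (one_mul _).symm) (fun φ _ => by simp)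

/-- The parity change `ΠV`. The supermatrices are those of `V`; in terms of the Lie superalgebra
this means `a * v = (-1)^{p(a)} a v`. -/
abbrev parityShift (V : GLRep n m) : GLRep n m :=
  ofMat V.ι (fun i => V.parity i + 1) (fun {_} g => V.mat g)
    (fun g i j => by
      have h := V.mat_mem g i j
      rwa [show V.parity i + V.parity j = V.parity i + 1 + (V.parity j + 1) by
        generalize V.parity i = a; generalize V.parity j = b; revert a b; decide] at h)
    V.mat_one V.mat_mul V.mat_map

/-- The tensor product of representations. -/
abbrev tensor (V W : GLRep n m) : GLRep n m :=
  ofMat (V.ι × W.ι) (tensorParity V.parity W.parity)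
    (fun {_} g => kron V.parity W.parity (V.mat g) (W.mat g))
    (fun g => kron_mem _ _ (V.mat_mem g) (W.mat_mem g))
    (by intro A; rw [V.mat_one, W.mat_one, kron_one])
    (fun g g' => by
      rw [V.mat_mul, W.mat_mul, kron_mul _ _ (V.mat_mem g') (W.mat_mem g)])
    (fun φ g => by
      rw [V.mat_map, W.mat_map]
      ext a b
      simp [kron])

/-- A homomorphism of representations `V → W`: an even linear map (given by its matrix over `ℂ`)
that commutes with the action of `GL(n|m)(A)` for every `A`. -/
structure Hom (V W : GLRep n m) where
  toMat : Matrix W.ι V.ι ℂ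
  even : ∀ k i, W.parity k ≠ V.parity i → toMat k i = 0
  comm : ∀ (A : SuperAlg) (g : SGL (stdParity n m) A),
    toMat.map (algebraMap ℂ A) * V.mat g = W.mat g * toMat.map (algebraMap ℂ A)

/-- The underlying linear map of a homomorphism of representations. -/
def Hom.lin {V W : GLRep n m} (f : V.Hom W) : (V.ι → ℂ) →ₗ[ℂ] (W.ι → ℂ) := f.toMat.mulVecLin

/-- The exactness of `0 → V₁ → V → V₂ → 0`. -/
def IsShortExact {V₁ V V₂ : GLRep n m} (f : V₁.Hom V) (g : V.Hom V₂) : Prop :=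
  Function.Injective f.lin ∧ Function.Exact f.lin g.lin ∧ Function.Surjective g.lin

/-! Tensoring with a representation preserves homomorphisms and exactness. -/

/-- `f ⊗ id`. -/
def Hom.tensorRight {V V' : GLRep n m} (f : V.Hom V') (W : GLRep n m) :
    (V.tensor W).Hom (V'.tensor W) where
  toMat := Matrix.of fun (a : V'.ι × W.ι) (b : V.ι × W.ι) => if a.2 = b.2 then f.toMat a.1 b.1 else 0
  even := by
    rintro ⟨i, k⟩ ⟨j, l⟩ hne
    change V'.parity i + W.parity k ≠ V.parity j + W.parity l at hne
    change (if k = l then f.toMat i j else 0) = 0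
    split_ifs with hkl
    · subst hkl
      exact f.even _ _ fun he => hne (by rw [he])
    · rfl
  comm := by
    intro A g
    ext ⟨i, k⟩ ⟨j, l⟩
    have hf := congrFun (congrFun (f.comm A g) i) j
    rw [Matrix.mul_apply, Matrix.mul_apply] at hf ⊢
    change ∑ c : V.ι × W.ι, algebraMap ℂ A (if k = c.2 then f.toMat i c.1 else 0) *
        (sgn ((V.parity c.1 + V.parity j) * W.parity c.2) • (V.mat g c.1 j * W.mat g c.2 l)) =
      ∑ c : V'.ι × W.ι, (sgn ((V'.parity i + V'.parity c.1) * W.parity k) •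
        (V'.mat g i c.1 * W.mat g k c.2)) *
          algebraMap ℂ A (if c.2 = l then f.toMat c.1 j else 0)
    rw [Fintype.sum_prod_type, Fintype.sum_prod_type]
    have hL : ∀ c, (∑ d, algebraMap ℂ A (if k = d then f.toMat i c else 0) *
        (sgn ((V.parity c + V.parity j) * W.parity d) • (V.mat g c j * W.mat g d l))) =
        sgn ((V'.parity i + V.parity j) * W.parity k) •
          (algebraMap ℂ A (f.toMat i c) * V.mat g c j * W.mat g k l) := by
      intro c
      rw [Finset.sum_eq_single k (fun d _ hd => by simp [hd.symm]) (by simp), if_pos rfl]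
      by_cases hp : V'.parity i = V.parity c
      · rw [hp, mul_smul_comm, mul_assoc]
      · rw [f.even _ _ hp]; simp
    have hR : ∀ c, (∑ d, (sgn ((V'.parity i + V'.parity c) * W.parity k) •
        (V'.mat g i c * W.mat g k d)) * algebraMap ℂ A (if d = l then f.toMat c j else 0)) =
        sgn ((V'.parity i + V.parity j) * W.parity k) •
          (V'.mat g i c * algebraMap ℂ A (f.toMat c j) * W.mat g k l) := by
      intro c
      rw [Finset.sum_eq_single l (fun d _ hd => by simp [hd]) (by simp), if_pos rfl]
      by_cases hp : V'.parity c = V.parity j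
      · rw [hp, smul_mul_assoc, mul_assoc, mul_assoc, Algebra.commutes]
      · rw [f.even _ _ hp]; simp
    simp only [hL, hR, ← Finset.smul_sum, ← Finset.sum_mul]
    exact congrArg (fun z => sgn ((V'.parity i + V.parity j) * W.parity k) • (z * W.mat g k l)) hf

/-- `id ⊗ f`. -/
def Hom.tensorLeft (V : GLRep n m) {W W' : GLRep n m} (f : W.Hom W') :
    (V.tensor W).Hom (V.tensor W') where
  toMat := Matrix.of fun (a : V.ι × W'.ι) (b : V.ι × W.ι) => if a.1 = b.1 then f.toMat a.2 b.2 else 0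
  even := by
    rintro ⟨i, k⟩ ⟨j, l⟩ hne
    change V.parity i + W'.parity k ≠ V.parity j + W.parity l at hne
    change (if i = j then f.toMat k l else 0) = 0
    split_ifs with hij
    · subst hij
      exact f.even _ _ fun he => hne (by rw [he])
    · rfl
  comm := by
    intro A g
    ext ⟨i, k⟩ ⟨j, l⟩
    have hf := congrFun (congrFun (f.comm A g) k) l
    rw [Matrix.mul_apply, Matrix.mul_apply] at hf ⊢
    change ∑ c : V.ι × W.ι, algebraMap ℂ A (if i = c.1 then f.toMat k c.2 else 0) *
        (sgn ((V.parity c.1 + V.parity j) * W.parity c.2) • (V.mat g c.1 j * W.mat g c.2 l)) =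
      ∑ c : V.ι × W'.ι, (sgn ((V.parity i + V.parity c.1) * W'.parity k) •
        (V.mat g i c.1 * W'.mat g k c.2)) *
          algebraMap ℂ A (if c.1 = j then f.toMat c.2 l else 0)
    rw [Fintype.sum_prod_type_right, Fintype.sum_prod_type_right]
    have hL : ∀ d, (∑ c, algebraMap ℂ A (if i = c then f.toMat k d else 0) *
        (sgn ((V.parity c + V.parity j) * W.parity d) • (V.mat g c j * W.mat g d l))) =
        sgn ((V.parity i + V.parity j) * W'.parity k) •
          (V.mat g i j * (algebraMap ℂ A (f.toMat k d) * W.mat g d l)) := by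
      intro d
      rw [Finset.sum_eq_single i (fun c _ hc => by simp [hc.symm]) (by simp), if_pos rfl]
      by_cases hp : W'.parity k = W.parity d
      · rw [hp, mul_smul_comm, ← mul_assoc, Algebra.commutes, mul_assoc]
      · rw [f.even _ _ hp]; simp
    have hR : ∀ d, (∑ c, (sgn ((V.parity i + V.parity c) * W'.parity k) •
        (V.mat g i c * W'.mat g k d)) * algebraMap ℂ A (if c = j then f.toMat d l else 0)) =
        sgn ((V.parity i + V.parity j) * W'.parity k) •
          (V.mat g i j * (W'.mat g k d * algebraMap ℂ A (f.toMat d l))) := by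
      intro d
      rw [Finset.sum_eq_single j (fun c _ hc => by simp [hc]) (by simp), if_pos rfl,
        smul_mul_assoc, mul_assoc]
    simp only [hL, hR, ← Finset.smul_sum, ← Finset.mul_sum]
    exact congrArg (fun z => sgn ((V.parity i + V.parity j) * W'.parity k) • (V.mat g i j * z)) hf

theorem Hom.tensorRight_lin {V V' : GLRep n m} (f : V.Hom V') (W : GLRep n m)
    (v : V.ι × W.ι → ℂ) (i : V'.ι) (k : W.ι) :
    (f.tensorRight W).lin v (i, k) = f.lin (fun j => v (j, k)) i := by
  change ∑ c : V.ι × W.ι, (if k = c.2 then f.toMat i c.1 else 0) * v c = _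
  rw [Fintype.sum_prod_type]
  exact Finset.sum_congr rfl fun j _ => by simp

theorem Hom.tensorLeft_lin (V : GLRep n m) {W W' : GLRep n m} (f : W.Hom W')
    (v : V.ι × W.ι → ℂ) (i : V.ι) (k : W'.ι) :
    (f.tensorLeft V).lin v (i, k) = f.lin (fun l => v (i, l)) k := by
  change ∑ c : V.ι × W.ι, (if i = c.1 then f.toMat k c.2 else 0) * v c = _
  rw [Fintype.sum_prod_type_right]
  exact Finset.sum_congr rfl fun j _ => by simp

theorem IsShortExact.tensorRight {V₁ V V₂ : GLRep n m} {f : V₁.Hom V} {g : V.Hom V₂}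
    (h : IsShortExact f g) (W : GLRep n m) :
    IsShortExact (f.tensorRight W) (g.tensorRight W) := by
  obtain ⟨hi, he, hs⟩ := h
  refine ⟨fun v w hvw => ?_, fun v => ⟨fun hv => ?_, ?_⟩, fun v => ?_⟩
  · funext ⟨i, k⟩
    have := @hi (fun j => v (j, k)) (fun j => w (j, k)) (by
      funext j
      rw [← Hom.tensorRight_lin, ← Hom.tensorRight_lin, hvw])
    exact congrFun this i
  · have h1 : ∀ k, ∃ u, f.lin u = fun j => v (j, k) := fun k => (he _).1 (by
      funext j
      rw [← Hom.tensorRight_lin g W v, hv]; rfl)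
    choose u hu using h1
    refine ⟨fun a => u a.2 a.1, ?_⟩
    funext ⟨i, k⟩
    rw [Hom.tensorRight_lin]
    exact congrFun (hu k) i
  · rintro ⟨u, rfl⟩
    funext ⟨i, k⟩
    rw [Hom.tensorRight_lin]
    have : (fun j => (f.tensorRight W).lin u (j, k)) = f.lin (fun j => u (j, k)) := by
      funext j; rw [Hom.tensorRight_lin]
    rw [this, (he _).2 ⟨_, rfl⟩]; rfl
  · have h1 : ∀ k, ∃ u, g.lin u = fun j => v (j, k) := fun k => hs _
    choose u hu using h1
    refine ⟨fun a => u a.2 a.1, ?_⟩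
    funext ⟨i, k⟩
    rw [Hom.tensorRight_lin]
    exact congrFun (hu k) i

theorem IsShortExact.tensorLeft (V : GLRep n m) {W₁ W W₂ : GLRep n m} {f : W₁.Hom W}
    {g : W.Hom W₂} (h : IsShortExact f g) :
    IsShortExact (f.tensorLeft V) (g.tensorLeft V) := by
  obtain ⟨hi, he, hs⟩ := h
  refine ⟨fun v w hvw => ?_, fun v => ⟨fun hv => ?_, ?_⟩, fun v => ?_⟩
  · funext ⟨i, k⟩
    have := @hi (fun l => v (i, l)) (fun l => w (i, l)) (by
      funext j
      rw [← Hom.tensorLeft_lin, ← Hom.tensorLeft_lin, hvw])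
    exact congrFun this k
  · have h1 : ∀ i, ∃ u, f.lin u = fun l => v (i, l) := fun i => (he _).1 (by
      funext j
      rw [← Hom.tensorLeft_lin V g v, hv]; rfl)
    choose u hu using h1
    refine ⟨fun a => u a.1 a.2, ?_⟩
    funext ⟨i, k⟩
    rw [Hom.tensorLeft_lin]
    exact congrFun (hu i) k
  · rintro ⟨u, rfl⟩
    funext ⟨i, k⟩
    rw [Hom.tensorLeft_lin]
    have : (fun l => (f.tensorLeft V).lin u (i, l)) = f.lin (fun l => u (i, l)) := by
      funext j; rw [Hom.tensorLeft_lin]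
    rw [this, (he _).2 ⟨_, rfl⟩]; rfl
  · have h1 : ∀ i, ∃ u, g.lin u = fun l => v (i, l) := fun i => hs _
    choose u hu using h1
    refine ⟨fun a => u a.1 a.2, ?_⟩
    funext ⟨i, k⟩
    rw [Hom.tensorLeft_lin]
    exact congrFun (hu i) k

end GLRep

/-! ### The Grothendieck ring -/

/-- The defining relations of the Grothendieck group: `[V₁] - [V] + [V₂]` for all short exact
sequences and `[V] + [ΠV]` for all representations. -/
inductive GrothRel (n m : ℕ) : FreeAbelianGroup (GLRep n m) → Prop
  | exact {V₁ V V₂ : GLRep n m} (f : V₁.Hom V) (g : V.Hom V₂) (h : GLRep.IsShortExact f g) :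
      GrothRel n m (FreeAbelianGroup.of V₁ - FreeAbelianGroup.of V + FreeAbelianGroup.of V₂)
  | shift (V : GLRep n m) :
      GrothRel n m (FreeAbelianGroup.of V + FreeAbelianGroup.of V.parityShift)

/-- The subgroup generated by the defining relations. -/
def grothSubgroup (n m : ℕ) : AddSubgroup (FreeAbelianGroup (GLRep n m)) :=
  AddSubgroup.closure {a | GrothRel n m a}

/-- The Grothendieck ring of finite dimensional representations of `GL(n|m)`. (Isomorphic
representations are identified by the relations of the exact sequences `0 → V → W → 0 → 0`.) -/
def GrothRing (n m : ℕ) : Type 1 := FreeAbelianGroup (GLRep n m) ⧸ grothSubgroup n m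

namespace GrothRing

variable {n m : ℕ}

instance : AddCommGroup (GrothRing n m) :=
  inferInstanceAs (AddCommGroup (FreeAbelianGroup (GLRep n m) ⧸ grothSubgroup n m))

/-- The class `[V]`. -/
def cls (V : GLRep n m) : GrothRing n m :=
  QuotientAddGroup.mk' (grothSubgroup n m) (FreeAbelianGroup.of V)

theorem cls_exact {V₁ V V₂ : GLRep n m} {f : V₁.Hom V} {g : V.Hom V₂}
    (h : GLRep.IsShortExact f g) : cls V₁ - cls V + cls V₂ = 0 :=
  (QuotientAddGroup.eq_zero_iff _).2 (AddSubgroup.subset_closure (GrothRel.exact f g h))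

theorem cls_shift (V : GLRep n m) : cls V + cls V.parityShift = 0 :=
  (QuotientAddGroup.eq_zero_iff _).2 (AddSubgroup.subset_closure (GrothRel.shift V))

/-- The universal property of the Grothendieck group. -/
def lift {G : Type*} [AddCommGroup G] (F : GLRep n m → G)
    (hex : ∀ {V₁ V V₂ : GLRep n m} (f : V₁.Hom V) (g : V.Hom V₂), GLRep.IsShortExact f g →
      F V₁ - F V + F V₂ = 0)
    (hsh : ∀ V, F V + F V.parityShift = 0) : GrothRing n m →+ G :=
  QuotientAddGroup.lift (grothSubgroup n m) (FreeAbelianGroup.lift F) (by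
    rw [grothSubgroup, AddSubgroup.closure_le]
    rintro a (⟨f, g, h⟩ | V)
    · simpa using hex f g h
    · simpa using hsh V)

theorem lift_cls {G : Type*} [AddCommGroup G] (F : GLRep n m → G) (hex) (hsh) (V : GLRep n m) :
    lift F hex hsh (cls V) = F V :=
  FreeAbelianGroup.lift_apply_of F V

theorem hom_ext {G : Type*} [AddCommGroup G] {F F' : GrothRing n m →+ G}
    (hF : ∀ V, F (cls V) = F' (cls V)) : F = F' := by
  refine QuotientAddGroup.addMonoidHom_ext _ (FreeAbelianGroup.lift_ext _ _ fun V => hF V)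

/-- Isomorphic representations have the same class; an isomorphism is given by a relabelling of the
basis with signs. -/
theorem cls_eq_of_equiv (V W : GLRep n m) (e : V.ι ≃ W.ι) (s : V.ι → ZMod 2)
    (hp : ∀ i, W.parity (e i) = V.parity i)
    (hm : ∀ (A : SuperAlg) (g : SGL (stdParity n m) A) (i j : V.ι),
      sgn (s i) • V.mat g i j = sgn (s j) • W.mat g (e i) (e j)) : cls V = cls W := by
  have hs : ∀ a, ((sgn a : ℤ) : ℂ) * ((sgn a : ℤ) : ℂ) = 1 := by
    intro a; unfold sgn; split_ifs <;> norm_num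
  let f : V.Hom W :=
    { toMat := Matrix.of fun k i => if k = e i then ((sgn (s i) : ℤ) : ℂ) else 0
      even := by
        intro k i hne
        refine if_neg ?_
        rintro rfl
        exact hne (hp i)
      comm := by
        intro A g
        ext k j
        obtain ⟨i, rfl⟩ := e.surjective k
        rw [Matrix.mul_apply, Matrix.mul_apply, Finset.sum_eq_single i, Finset.sum_eq_single (e j)]
        · simp only [Matrix.map_apply, Matrix.of_apply, if_true, map_intCast]
          have h1 := hm A g i j
          rw [zsmul_eq_mul, zsmul_eq_mul] at h1
          rw [h1, Int.cast_comm]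
        · intro b _ hb; simp [hb]
        · simp
        · intro b _ hb; simp [hb.symm]
        · simp }
  have hf : ∀ v i, f.lin v (e i) = ((sgn (s i) : ℤ) : ℂ) * v i := by
    intro v i
    change ∑ j, (if e i = e j then ((sgn (s j) : ℤ) : ℂ) else 0) * v j = _
    rw [Finset.sum_eq_single i (fun b _ hb => by simp [hb.symm]) (by simp), if_pos rfl]
  let z : W.Hom (GLRep.zero n m) :=
    { toMat := 0
      even := fun _ _ _ => rfl
      comm := fun A g => by ext k; exact k.elim }
  have h : GLRep.IsShortExact f z := by
    refine ⟨fun v w hvw => ?_, fun v => ⟨fun _ => ?_, fun _ => ?_⟩, fun v => ⟨0, ?_⟩⟩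
    · funext i
      have h1 := congrFun hvw (e i)
      rw [hf, hf] at h1
      have h2 := congrArg (fun c => ((sgn (s i) : ℤ) : ℂ) * c) h1
      simpa only [← mul_assoc, hs, one_mul] using h2
    · refine ⟨fun i => ((sgn (s i) : ℤ) : ℂ) * v (e i), ?_⟩
      funext k
      obtain ⟨i, rfl⟩ := e.surjective k
      rw [hf, ← mul_assoc, hs, one_mul]
    · funext k; exact k.elim
    · funext k; exact k.elim
  have h0 : cls (GLRep.zero n m) = 0 := by
    let w : (GLRep.zero n m).Hom (GLRep.zero n m) :=
      { toMat := 0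
        even := fun _ _ _ => rfl
        comm := fun A g => by ext k; exact k.elim }
    have hw : GLRep.IsShortExact w w := by
      refine ⟨fun v w _ => ?_, fun v => ⟨fun _ => ⟨0, ?_⟩, fun _ => ?_⟩, fun v => ⟨0, ?_⟩⟩ <;>
        · funext k; exact k.elim
    simpa using cls_exact hw
  have h1 := cls_exact h
  rw [h0, add_zero, sub_eq_zero] at h1
  exact h1

/-- The product on the Grothendieck group, `[V] [W] = [V ⊗ W]`. -/
def mulHom : GrothRing n m →+ GrothRing n m →+ GrothRing n m :=
  lift
    (fun V => lift (fun W => cls (V.tensor W))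
      (fun _ _ hfg => cls_exact (hfg.tensorLeft V))
      (fun W => by
        have h : cls (V.tensor W.parityShift) = cls (V.tensor W).parityShift := by
          refine cls_eq_of_equiv _ _ (Equiv.refl _) (fun a => V.parity a.1) (fun a => ?_) ?_
          · exact add_assoc _ _ _
          · rintro A g ⟨i, k⟩ ⟨j, l⟩
            change sgn (V.parity i) • (sgn ((V.parity i + V.parity j) * (W.parity k + 1)) •
                (V.mat g i j * W.mat g k l)) =
              sgn (V.parity j) • (sgn ((V.parity i + V.parity j) * W.parity k) •
                (V.mat g i j * W.mat g k l))
            rw [smul_smul, smul_smul]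
            congr 1
            generalize V.parity i = a; generalize V.parity j = b; generalize W.parity k = c
            revert a b c; decide
        rw [h, cls_shift]))
    (fun f g hfg => hom_ext fun W => by
      simp only [AddMonoidHom.add_apply, AddMonoidHom.sub_apply, lift_cls, AddMonoidHom.zero_apply]
      exact cls_exact (hfg.tensorRight W))
    (fun V => hom_ext fun W => by
      simp only [AddMonoidHom.add_apply, lift_cls, AddMonoidHom.zero_apply]
      have h : cls (V.parityShift.tensor W) = cls (V.tensor W).parityShift := by
        refine cls_eq_of_equiv _ _ (Equiv.refl _) (fun _ => 0) (fun a => ?_) ?_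
        · exact add_right_comm _ _ _
        · rintro A g ⟨i, k⟩ ⟨j, l⟩
          change sgn 0 • (sgn ((V.parity i + 1 + (V.parity j + 1)) * W.parity k) •
              (V.mat g i j * W.mat g k l)) =
            sgn 0 • (sgn ((V.parity i + V.parity j) * W.parity k) •
              (V.mat g i j * W.mat g k l))
          congr 2
          generalize V.parity i = a; generalize V.parity j = b; generalize W.parity k = c
          revert a b c; decide
      rw [h, cls_shift])

theorem mulHom_cls (V W : GLRep n m) : mulHom (cls V) (cls W) = cls (V.tensor W) := by
  simp only [mulHom, lift_cls]

instance : Ring (GrothRing n m) :=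
  { (inferInstance : AddCommGroup (GrothRing n m)) with
    mul := fun a b => mulHom a b
    one := cls (GLRep.triv n m)
    left_distrib := fun a b c => map_add (mulHom a) b c
    right_distrib := fun a b c => by
      change mulHom (a + b) c = mulHom a c + mulHom b c
      rw [map_add, AddMonoidHom.add_apply]
    zero_mul := fun a => by
      change mulHom 0 a = 0
      rw [map_zero, AddMonoidHom.zero_apply]
    mul_zero := fun a => map_zero (mulHom a)
    one_mul := fun a => by
      have h : mulHom (cls (GLRep.triv n m)) = AddMonoidHom.id (GrothRing n m) :=
        hom_ext fun V => by
          rw [mulHom_cls]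
          refine cls_eq_of_equiv _ V (Equiv.punitProd V.ι) (fun _ => 0)
            (fun a => (zero_add _).symm) ?_
          rintro A g ⟨i, k⟩ ⟨j, l⟩
          change sgn 0 • (sgn ((0 + 0) * V.parity k) • ((1 : Matrix Unit Unit A) i j * V.mat g k l))
            = sgn 0 • V.mat g k l
          simp [sgn_zero]
      exact DFunLike.congr_fun h a
    mul_one := fun a => by
      have h : mulHom.flip (cls (GLRep.triv n m)) = AddMonoidHom.id (GrothRing n m) :=
        hom_ext fun V => by
          rw [AddMonoidHom.flip_apply, mulHom_cls]
          refine cls_eq_of_equiv _ V (Equiv.prodPUnit V.ι) (fun _ => 0)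
            (fun a => (add_zero _).symm) ?_
          rintro A g ⟨i, k⟩ ⟨j, l⟩
          change sgn 0 • (sgn ((V.parity i + V.parity j) * 0) •
            (V.mat g i j * (1 : Matrix Unit Unit A) k l)) = sgn 0 • V.mat g i j
          simp [sgn_zero]
      exact DFunLike.congr_fun h a
    mul_assoc := fun a b c => by
      change mulHom (mulHom a b) c = mulHom a (mulHom b c)
      have h : (AddMonoidHom.compHom (mulHom (n := n) (m := m))).comp mulHom =
          (AddMonoidHom.compHom.flip mulHom).comp (AddMonoidHom.compHom.comp mulHom) := by
        refine hom_ext fun U => hom_ext fun V => hom_ext fun W => ?_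
        change mulHom (mulHom (cls U) (cls V)) (cls W) = mulHom (cls U) (mulHom (cls V) (cls W))
        simp only [mulHom_cls]
        refine cls_eq_of_equiv _ _ (Equiv.prodAssoc U.ι V.ι W.ι) (fun _ => 0)
          (fun a => (add_assoc _ _ _).symm) ?_
        rintro A g ⟨⟨i, i'⟩, i''⟩ ⟨⟨j, j'⟩, j''⟩
        change sgn 0 • (sgn ((U.parity i + V.parity i' + (U.parity j + V.parity j')) * W.parity i'') •
            (sgn ((U.parity i + U.parity j) * V.parity i') • (U.mat g i j * V.mat g i' j') *
              W.mat g i'' j'')) =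
          sgn 0 • (sgn ((U.parity i + U.parity j) * (V.parity i' + W.parity i'')) •
            (U.mat g i j * (sgn ((V.parity i' + V.parity j') * W.parity i'') •
              (V.mat g i' j' * W.mat g i'' j''))))
        simp only [smul_mul_assoc, mul_smul_comm, smul_smul, mul_assoc]
        congr 1
        generalize U.parity i = a; generalize U.parity j = b
        generalize V.parity i' = c; generalize V.parity j' = d; generalize W.parity i'' = e
        revert a b c d e; decide
      exact DFunLike.congr_fun (DFunLike.congr_fun (DFunLike.congr_fun h a) b) c }

theorem cls_mul (V W : GLRep n m) : cls V * cls W = cls (V.tensor W) := mulHom_cls V W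

theorem one_eq_cls : (1 : GrothRing n m) = cls (GLRep.triv n m) := rfl

end GrothRing

/-! ### Weights and superdimensions -/

/-- The diagonal matrix with entries `t`, an element of `GL(n|m)(ℂ)`. -/
def torus {n m : ℕ} (t : Fin n ⊕ Fin m → ℂˣ) : SGL (stdParity n m) (SuperAlg.ofComm ℂ) where
  val := ⟨Matrix.diagonal fun j => (t j : ℂ), diagonal_mem _ _⟩
  inv := ⟨Matrix.diagonal fun j => ((t j)⁻¹ : ℂˣ).val, diagonal_mem _ _⟩
  val_inv := Subtype.ext ((Matrix.diagonal_mul_diagonal _ _).trans ((by simp :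
    _ = Matrix.diagonal fun _ => (1 : ℂ)).trans Matrix.diagonal_one))
  inv_val := Subtype.ext ((Matrix.diagonal_mul_diagonal _ _).trans ((by simp :
    _ = Matrix.diagonal fun _ => (1 : ℂ)).trans Matrix.diagonal_one))

namespace GLRep

variable {n m : ℕ}

/-- The complex matrix by which `diag(t)` acts on `V`. -/
def torusMat (V : GLRep n m) (t : Fin n ⊕ Fin m → ℂˣ) : Matrix V.ι V.ι ℂ := V.mat (torus t)

/-- The weight space `V_w = {v | diag(t) v = t^w v for all t}` of the diagonal torus. -/
def weightSpace (V : GLRep n m) (w : Wt n m) : Submodule ℂ (V.ι → ℂ) where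
  carrier := {v | ∀ t : Fin n ⊕ Fin m → ℂˣ,
    (V.torusMat t).mulVec v = ((∏ j, t j ^ w j : ℂˣ) : ℂ) • v}
  add_mem' := fun hv hw t => by rw [Matrix.mulVec_add, hv t, hw t, smul_add]
  zero_mem' := fun t => by rw [Matrix.mulVec_zero, smul_zero]
  smul_mem' := fun c v hv t => by rw [Matrix.mulVec_smul, hv t, smul_comm]

/-- The homogeneous component `V_e` of `V`, spanned by the basis vectors of parity `e`. -/
def component (V : GLRep n m) (e : ZMod 2) : Submodule ℂ (V.ι → ℂ) where
  carrier := {v | ∀ i, V.parity i ≠ e → v i = 0}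
  add_mem' := fun hv hw i hi => by simp [hv i hi, hw i hi]
  zero_mem' := fun _ _ => rfl
  smul_mem' := fun c v hv i hi => by simp [hv i hi]

/-- The superdimension `dim (V_w)₀ - dim (V_w)₁` of the weight space `V_w`; this is the coefficient
of the monomial with exponent `w` in the supercharacter of `V`. -/
def sdimWeight (V : GLRep n m) (w : Wt n m) : ℤ :=
  (Module.finrank ℂ ↥(V.weightSpace w ⊓ V.component 0) : ℤ) -
    (Module.finrank ℂ ↥(V.weightSpace w ⊓ V.component 1) : ℤ)

end GLRep

end SuperGL

end

/-! Let R be the ring generated by Δ, Δ*, h_k, h_k* and let Sch be the supercharacter map. The proof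
closes the circle R ⊆ im Sch ⊆ J₀₀ ⊆ R and shows separately that Sch is injective.

im Sch ⊆ J₀₀ (`GLRep.sch_mem_J00`). Permutation matrices give the symmetry. The odd root vectors X =
E_{ip} and Y = E_{pi} satisfy XY + YX = E_{ii} + E_{pp}. Taking supertraces on weight spaces gives
(w_i + w_p) sdim V_w = d(w) - d(w + α), where α is the weight of Y and d(w) = str(YX on V_w). So the
sum of the two Euler derivatives is divisible by 1 - x_i/y_p over ℂ. Since (y_p - x_i) is the kernel
of the substitution x_i ↦ y_p, divisibility over ℤ follows.

J₀₀ ⊆ R (`J00_le_genRing`). The difference of the expansions of ∏(1 - y_p t)/∏(1 - x_i t) at 0 and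
at ∞ has coefficients ∑ r_i x_i^k with the residues r_i, and the constant joining the two expansions
is ±Δ. Determinants in these coefficients are Schur functions in x times ∏(x_i - y_p), so ∏(x_i -
y_p) · s(x) lies in R for symmetric s (`resultant_mul_symX_mem`), and then for all S_n ×
S_m-invariants (`resultant_mul_mem`). An element of J₀₀ that vanishes at x_0 = y_0 = 1 vanishes
whenever x_i = y_p, hence is an invariant multiple of ∏(x_i - y_p). Induction along the
specialization x_0 = y_0 = 1, under which generators go to generators, does the rest.

Injectivity (`schHom_injective`). The Grothendieck group is generated by simple representations. A
simple one has a unique weight of maximal height, with a one-dimensional weight space, and it is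
determined by this weight and its parity (`GLRep.IsSimple.cls_eq`). Supercharacters of simples are
therefore unitriangular. The same fact gives saturation: an integral Laurent polynomial that is a
complex combination of supercharacters is an integral one (`GLRep.mem_range_schHom`).

R ⊆ im Sch (`genRing_le_range`). The Berezinian and its dual give Δ* and Δ. The super power sums are
supertraces of cyclic permutations on tensor powers of the standard representation and its dual,
hence complex combinations of supercharacters. Newton's identities give h_k and h_k* over ℂ, and
saturation makes them integral.

Representations are only natural families of matrices, so their structure is extracted from
universal points: the generic torus element, 1 + X·E_{jk} over ℂ[X], and 1 + θ·E_{jk} over ℂ[θ] with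
θ odd. Statements about all points are reduced to products of lower triangular, diagonal and upper
triangular points by `GLRep.sandwich_eq_zero` and `exists_block_factor`. -/

noncomputable section

set_option linter.unusedSectionVars false

namespace SuperGL

/-! ### Linear recurrences attached to a rational function -/

section Recurrence

open Polynomial

variable {K : Type*} [Field K] {n m : ℕ}

/-- The polynomial `∏ (1 - xᵢ t)`. -/
def revPoly (x : Fin n → K) : K[X] := ∏ i, (1 - C (x i) * X)

/-- Factor by factor, 1 - x t reverses to t - x = -x (1 - x⁻¹ t). This compares the expansion at
infinity with the expansion at 0 for the inverted variables. -/
theorem reflect_revPoly (x : Fin n → K) (hx : ∀ i, x i ≠ 0) :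
    (revPoly x).reflect n = C (∏ i, -x i) * revPoly (fun i => (x i)⁻¹) := by
  classical
  have key : ∀ s : Finset (Fin n), (∏ i ∈ s, (1 - C (x i) * X)).natDegree ≤ s.card ∧
      (∏ i ∈ s, (1 - C (x i) * X)).reflect s.card =
        C (∏ i ∈ s, -x i) * ∏ i ∈ s, (1 - C (x i)⁻¹ * X) := by
    intro s
    induction s using Finset.induction_on with
    | empty => simp
    | insert a s ha ih =>
      have hd : (1 - C (x a) * X : K[X]).natDegree ≤ 1 := by compute_degree
      rw [Finset.prod_insert ha, Finset.prod_insert ha, Finset.prod_insert ha,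
        Finset.card_insert_of_notMem ha, add_comm]
      refine ⟨(natDegree_mul_le).trans (add_le_add hd ih.1), ?_⟩
      rw [reflect_mul _ _ hd ih.1, ih.2]
      have h1 : (1 - C (x a) * X : K[X]).reflect 1 = C (-x a) * (1 - C (x a)⁻¹ * X) := by
        have : (C (-x a) * C (x a)⁻¹ : K[X]) = -1 := by
          rw [← C_mul, neg_mul, mul_inv_cancel₀ (hx a)]; simp
        rw [mul_sub, ← mul_assoc, this, sub_eq_add_neg, sub_eq_add_neg, reflect_add, reflect_neg]
        have h2 : (1 : K[X]).reflect 1 = X := by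
          simp
        have h3 : (C (x a) * X : K[X]).reflect 1 = C (x a) := by
          simp
        rw [h2, h3]; simp; ring
      rw [h1, C_mul]; ring
  have := (key Finset.univ).2
  simpa [revPoly] using this

theorem natDegree_revPoly_le (x : Fin n → K) : (revPoly x).natDegree ≤ n := by
  refine (natDegree_prod_le _ _).trans ?_
  refine (Finset.sum_le_card_nsmul _ _ 1 fun i _ => ?_).trans (by simp)
  compute_degree

theorem coeff_revPoly_rev (x : Fin n → K) (hx : ∀ i, x i ≠ 0) {j : ℕ} (hj : j ≤ n) :
    (revPoly x).coeff (n - j) = (∏ i, -x i) * (revPoly fun i => (x i)⁻¹).coeff j := by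
  have := congrArg (fun p => coeff p j) (reflect_revPoly x hx)
  simpa only [coeff_reflect, revAt_le hj, coeff_C_mul] using this

/-- Extension of a sequence by zero to negative indices. -/
def extZ {R : Type*} [Zero R] (f : ℕ → R) (k : ℤ) : R := if 0 ≤ k then f k.toNat else 0

theorem extZ_natCast {R : Type*} [Zero R] (f : ℕ → R) (k : ℕ) : extZ f (k : ℤ) = f k := by
  simp [extZ]

theorem extZ_of_neg {R : Type*} [Zero R] (f : ℕ → R) {k : ℤ} (hk : k < 0) : extZ f k = 0 := by
  simp [extZ, not_le.2 hk]

/-- Extending by zero to negative indices makes a product with a polynomial a recurrence valid at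
every integer, with no boundary cases. -/
theorem sum_coeff_mul_extZ (q : K[X]) (hq : q.natDegree ≤ n) (f : ℕ → K) (k : ℤ) :
    ∑ j ∈ Finset.range (n + 1), q.coeff j * extZ f (k - j) =
      extZ (fun k => PowerSeries.coeff k ((q : PowerSeries K) * PowerSeries.mk f)) k := by
  have hq' : (q : PowerSeries K) =
      ∑ j ∈ Finset.range (n + 1), PowerSeries.C (q.coeff j) * PowerSeries.X ^ j := by
    conv_lhs => rw [q.as_sum_range' (n + 1) (Nat.lt_succ_of_le hq)]
    rw [← Polynomial.coeToPowerSeries.ringHom_apply, map_sum]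
    exact Finset.sum_congr rfl fun j _ => by simp [← C_mul_X_pow_eq_monomial]
  rcases lt_or_ge k 0 with hk | hk
  · rw [extZ_of_neg _ hk]
    exact Finset.sum_eq_zero fun j _ => by rw [extZ_of_neg _ (by omega), mul_zero]
  · lift k to ℕ using hk
    rw [extZ_natCast, hq', Finset.sum_mul, map_sum]
    refine Finset.sum_congr rfl fun j _ => ?_
    rw [mul_assoc, PowerSeries.coeff_C_mul, PowerSeries.coeff_X_pow_mul']
    split_ifs with h
    · rw [← Nat.cast_sub h, extZ_natCast, PowerSeries.coeff_mk]
    · rw [extZ_of_neg _ (by omega)]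

theorem extZ_coeff_coe (p : K[X]) (k : ℤ) :
    extZ (fun k => PowerSeries.coeff k (p : PowerSeries K)) k = extZ p.coeff k := by
  simp [extZ]

variable (x : Fin n → K) (y : Fin m → K) (f fs : ℕ → K)

/-- The difference of the expansions at `0` and at `∞` of `∏ (1 - y_p t) / ∏ (1 - xᵢ t)`, where `f`
and `fs` are the coefficients of the expansions at `0` for `(x, y)` and for `(x⁻¹, y⁻¹)`. -/
def twoSided (k : ℤ) : K :=
  extZ f k - (∏ p, -y p) / (∏ i, -x i) * extZ fs (m - n - k)

variable {x y f fs}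

/-- Both expansions represent the same rational function, so multiplying either by the denominator
gives the numerator ∏(1 - y_p t); in the difference the numerators cancel. -/
theorem sum_coeff_mul_twoSided (hx : ∀ i, x i ≠ 0) (hy : ∀ p, y p ≠ 0)
    (hf : (revPoly x : PowerSeries K) * PowerSeries.mk f = revPoly y)
    (hfs : (revPoly (fun i => (x i)⁻¹) : PowerSeries K) * PowerSeries.mk fs =
      revPoly (fun p => (y p)⁻¹)) (k : ℤ) :
    ∑ j ∈ Finset.range (n + 1), (revPoly x).coeff j * twoSided x y f fs (k - j) = 0 := by
  have h1 := sum_coeff_mul_extZ (revPoly x) (natDegree_revPoly_le x) f k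
  rw [hf, extZ_coeff_coe] at h1
  have h2 := sum_coeff_mul_extZ (revPoly fun i => (x i)⁻¹) (natDegree_revPoly_le _) fs (m - k)
  rw [hfs, extZ_coeff_coe] at h2
  have hX : (∏ i, -x i) ≠ 0 := Finset.prod_ne_zero_iff.2 fun i _ => neg_ne_zero.2 (hx i)
  have h3 : ∑ j ∈ Finset.range (n + 1), (revPoly x).coeff j * extZ fs (m - n - (k - j)) =
      (∏ i, -x i) * extZ (revPoly fun p => (y p)⁻¹).coeff (m - k) := by
    -- Reversing the sum, j ↦ n - j, turns the coefficients of ∏(1 - x_i t) into those of ∏(1 -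
    -- x_i⁻¹ t), up to the factor ∏(-x_i).
    rw [← h2, Finset.mul_sum, ← Finset.sum_range_reflect]
    refine Finset.sum_congr rfl fun j hj => ?_
    have hj' : j ≤ n := by simpa [Nat.lt_succ_iff] using hj
    rw [show n + 1 - 1 - j = n - j by omega, coeff_revPoly_rev x hx hj', Nat.cast_sub hj', mul_assoc]
    congr 3; ring
  have h4 : (∏ p, -y p) * extZ (revPoly fun p => (y p)⁻¹).coeff (m - k) =
      extZ (revPoly y).coeff k := by
    rcases lt_or_ge k 0 with hk | hk
    · rw [extZ_of_neg _ hk]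
      obtain ⟨l, hl⟩ : ∃ l : ℕ, (m : ℤ) - k = l := ⟨(m - k).toNat, by omega⟩
      rw [hl, extZ_natCast, coeff_eq_zero_of_natDegree_lt, mul_zero]
      exact (natDegree_revPoly_le _).trans_lt (by omega)
    · lift k to ℕ using hk
      rcases lt_or_ge m k with hm | hm
      · rw [extZ_of_neg _ (by omega), extZ_natCast, coeff_eq_zero_of_natDegree_lt, mul_zero]
        exact (natDegree_revPoly_le _).trans_lt hm
      · rw [← Nat.cast_sub hm, extZ_natCast, extZ_natCast,
          ← coeff_revPoly_rev y hy (Nat.sub_le m k), Nat.sub_sub_self hm]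
  simp only [twoSided, mul_sub, Finset.sum_sub_distrib, h1]
  rw [sub_eq_zero, ← h4]
  calc _ = (∏ p, -y p) / (∏ i, -x i) *
        ((∏ i, -x i) * extZ (revPoly fun p => (y p)⁻¹).coeff (m - k)) := by
        rw [← mul_assoc, div_mul_cancel₀ _ hX]
    _ = _ := by rw [← h3, Finset.mul_sum]; exact Finset.sum_congr rfl fun j _ => by ring

/-- A solution of the recurrence with characteristic polynomial `∏ (1 - xᵢ t)` that vanishes for large
indices vanishes identically. -/
theorem eq_zero_of_recurrence (hx : ∀ i, x i ≠ 0) (u : ℤ → K)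
    (hu : ∀ k : ℤ, ∑ j ∈ Finset.range (n + 1), (revPoly x).coeff j * u (k - j) = 0)
    (N : ℤ) (hN : ∀ k, N ≤ k → u k = 0) (k : ℤ) : u k = 0 := by
  -- The coefficient at t^n is nonzero because no x_i vanishes, so the recurrence can also be solved
  -- for the term of smallest index and run downwards.
  have hc : (revPoly x).coeff n ≠ 0 := by
    have := coeff_revPoly_rev x hx (Nat.zero_le n)
    rw [Nat.sub_zero] at this
    rw [this]
    refine mul_ne_zero (Finset.prod_ne_zero_iff.2 fun i _ => neg_ne_zero.2 (hx i)) ?_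
    simp [revPoly, coeff_zero_eq_eval_zero, eval_prod]
  have key : ∀ d : ℕ, ∀ k, N - d ≤ k → u k = 0 := by
    intro d
    induction d with
    | zero => intro k hk; exact hN k (by simpa using hk)
    | succ d ih =>
      intro k hk
      have h := hu (k + n)
      rw [Finset.sum_range_succ, Finset.sum_eq_zero, zero_add, add_sub_cancel_right] at h
      · exact (mul_eq_zero.1 h).resolve_left hc
      · intro j hj
        rw [ih, mul_zero]
        have := Finset.mem_range.1 hj
        push_cast at hk
        omega
  exact key (N - k).toNat k (by omega)

theorem isCoprime_one_sub {a b : K} (hab : a ≠ b) :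
    IsCoprime (1 - C a * X : K[X]) (1 - C b * X) := by
  have hba : b - a ≠ 0 := sub_ne_zero.2 hab.symm
  refine ⟨C (b / (b - a)), -C (a / (b - a)), ?_⟩
  have h1 : b / (b - a) - a / (b - a) = 1 := by rw [← sub_div, div_self hba]
  have h2 : b / (b - a) * a = a / (b - a) * b := by ring
  calc _ = C (b / (b - a) - a / (b - a)) -
        (C (b / (b - a) * a) - C (a / (b - a) * b)) * X := by simp only [C_sub, C_mul]; ring
    _ = 1 := by rw [h1, h2]; simp

theorem one_sub_dvd_of_eval {a : K} (ha : a ≠ 0) {p : K[X]} (hp : p.eval a⁻¹ = 0) :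
    (1 - C a * X : K[X]) ∣ p := by
  obtain ⟨q, rfl⟩ := dvd_iff_isRoot.2 hp
  refine ⟨-C a⁻¹ * q, ?_⟩
  have : (C a * C a⁻¹ : K[X]) = 1 := by rw [← C_mul, mul_inv_cancel₀ ha, C_1]
  linear_combination (-X * q) * this

/-- The residues of `∏ (1 - y_p t) / ∏ (1 - xᵢ t)` at its poles. -/
def residue (x : Fin n → K) (y : Fin m → K) (i : Fin n) : K :=
  (∏ p, (1 - y p * (x i)⁻¹)) / ∏ j ∈ Finset.univ.erase i, (1 - x j * (x i)⁻¹)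

/-- Partial fractions without denominators: the subtracted sum interpolates the numerator at the
points x_i⁻¹, which are the roots of the pairwise coprime factors of the denominator. -/
theorem revPoly_sub_dvd (hx : ∀ i, x i ≠ 0) (hinj : Function.Injective x) (y : Fin m → K) :
    revPoly x ∣ revPoly y -
      ∑ i, C (residue x y i) * ∏ j ∈ Finset.univ.erase i, (1 - C (x j) * X) := by
  refine Finset.prod_dvd_of_coprime (fun i _ j _ hij => isCoprime_one_sub (hinj.ne hij))
    fun i _ => one_sub_dvd_of_eval (hx i) ?_
  have hne : ∏ j ∈ Finset.univ.erase i, (1 - x j * (x i)⁻¹) ≠ 0 := by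
    refine Finset.prod_ne_zero_iff.2 fun j hj h => (Finset.ne_of_mem_erase hj) (hinj ?_)
    rw [sub_eq_zero] at h
    field_simp [hx i] at h
    exact h.symm
  rw [eval_sub, eval_finsetSum, Finset.sum_eq_single i]
  · simp only [revPoly, residue, eval_mul, eval_C, eval_prod, eval_sub, eval_one, eval_X]
    rw [div_mul_cancel₀ _ hne, sub_self]
  · intro k _ hk
    rw [eval_mul, eval_prod, Finset.prod_eq_zero (i := i), mul_zero]
    · simpa using hk.symm
    · simp [hx i]
  · simp

/-- By partial fractions the expansion at 0 is a polynomial plus geometric series, so the equality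
holds for large k. Both sides satisfy the recurrence of the denominator, hence they agree at every
integer. -/
theorem twoSided_eq_sum (hx : ∀ i, x i ≠ 0) (hinj : Function.Injective x) (hy : ∀ p, y p ≠ 0)
    (hf : (revPoly x : PowerSeries K) * PowerSeries.mk f = revPoly y)
    (hfs : (revPoly (fun i => (x i)⁻¹) : PowerSeries K) * PowerSeries.mk fs =
      revPoly (fun p => (y p)⁻¹)) (k : ℤ) :
    twoSided x y f fs k = ∑ i, residue x y i * x i ^ k := by
  obtain ⟨G, hG⟩ := revPoly_sub_dvd hx hinj y
  have hroot : ∀ i, ∑ j ∈ Finset.range (n + 1), (revPoly x).coeff j * ((x i)⁻¹) ^ j = 0 := by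
    intro i
    rw [← eval_eq_sum_range' (Nat.lt_succ_of_le (natDegree_revPoly_le x)), revPoly, eval_prod]
    exact Finset.prod_eq_zero (Finset.mem_univ i) (by simp [hx i])
  have hgeom : ∀ a : K, ((1 - C a * X : K[X]) : PowerSeries K) * PowerSeries.mk (fun k => a ^ k) = 1 := by
    intro a
    have h := PowerSeries.mk_one_mul_one_sub_eq_one K
    have h2 := congrArg (PowerSeries.rescale a) h
    rw [map_mul, map_sub, map_one, PowerSeries.rescale_X] at h2
    rw [mul_comm]
    convert h2 using 2
    · ext k; simp [PowerSeries.coeff_rescale]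
    · simp
  have hser : PowerSeries.mk f = (G : PowerSeries K) +
      ∑ i, PowerSeries.C (residue x y i) * PowerSeries.mk (fun k => x i ^ k) := by
    have hne : (revPoly x : PowerSeries K) ≠ 0 := by
      intro h0
      have := congrArg (PowerSeries.coeff 0) h0
      simp [revPoly, coeff_zero_eq_eval_zero, eval_prod] at this
    refine mul_left_cancel₀ hne ?_
    have hG' := congrArg (fun p : K[X] => (p : PowerSeries K)) (sub_eq_iff_eq_add.1 hG)
    simp only [← Polynomial.coeToPowerSeries.ringHom_apply, map_add, map_mul, map_sum] at hG' hf ⊢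
    rw [hf, hG', mul_add, Finset.mul_sum]
    congr 1
    refine Finset.sum_congr rfl fun i _ => ?_
    have h := hgeom (x i)
    rw [revPoly, ← Finset.mul_prod_erase _ _ (Finset.mem_univ i), map_mul]
    simp only [← Polynomial.coeToPowerSeries.ringHom_apply] at h ⊢
    rw [show Polynomial.coeToPowerSeries.ringHom (C (residue x y i)) =
      PowerSeries.C (residue x y i) by simp]
    linear_combination (-(PowerSeries.C (residue x y i)) * Polynomial.coeToPowerSeries.ringHom
      (∏ j ∈ Finset.univ.erase i, (1 - C (x j) * X))) * h
  -- Beyond m - n the index m - n - k of `fs` is negative, and beyond the degree of `G` the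
  -- polynomial part no longer contributes.
  have := eq_zero_of_recurrence hx (fun k => twoSided x y f fs k - ∑ i, residue x y i * x i ^ k) ?_
    (max (m - n + 1) (G.natDegree + 1)) ?_ k
  · exact sub_eq_zero.1 this
  · intro k
    simp only [mul_sub, Finset.sum_sub_distrib]
    rw [sum_coeff_mul_twoSided hx hy hf hfs k, zero_sub, neg_eq_zero]
    simp only [Finset.mul_sum]
    rw [Finset.sum_comm]
    refine Finset.sum_eq_zero fun i _ => ?_
    calc _ = residue x y i * x i ^ k *
          ∑ j ∈ Finset.range (n + 1), (revPoly x).coeff j * ((x i)⁻¹) ^ j := by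
          rw [Finset.mul_sum]
          refine Finset.sum_congr rfl fun j _ => ?_
          rw [zpow_sub₀ (hx i), zpow_natCast, inv_pow]; ring
      _ = 0 := by rw [hroot, mul_zero]
  · intro k hk
    have hk1 := (le_max_left _ _).trans hk
    have hk2 := (le_max_right _ _).trans hk
    lift k to ℕ using by omega
    simp only [twoSided]
    rw [extZ_of_neg fs (by omega), mul_zero, sub_zero, extZ_natCast, sub_eq_zero]
    have := congrArg (PowerSeries.coeff k) hser
    rw [PowerSeries.coeff_mk, map_add, Polynomial.coeff_coe,
      coeff_eq_zero_of_natDegree_lt (by omega), zero_add, map_sum] at this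
    rw [this]
    exact Finset.sum_congr rfl fun i _ => by
      rw [PowerSeries.coeff_C_mul, PowerSeries.coeff_mk, zpow_natCast]

theorem prod_prod_erase_sub (x : Fin n → K) :
    ∏ i, ∏ j ∈ Finset.univ.erase i, (x i - x j) =
      (∏ i : Fin n, ∏ _j ∈ Finset.Ioi i, (-1 : K)) * (Matrix.vandermonde x).det ^ 2 := by
  have h1 : ∀ i : Fin n, Finset.univ.erase i = Finset.Iio i ∪ Finset.Ioi i := by
    intro i; ext j; simp [lt_or_lt_iff_ne]
  have h2 : ∀ i : Fin n, Disjoint (Finset.Iio i) (Finset.Ioi i) := fun i =>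
    Finset.disjoint_left.2 fun j hj hj' => by simp at hj hj'; exact lt_asymm hj hj'
  have h3 : ∏ i : Fin n, ∏ j ∈ Finset.Iio i, (x i - x j) = (Matrix.vandermonde x).det := by
    rw [Matrix.det_vandermonde]
    exact Finset.prod_comm' (by simp)
  have h4 : ∏ i : Fin n, ∏ j ∈ Finset.Ioi i, (x i - x j) =
      (∏ i : Fin n, ∏ _j ∈ Finset.Ioi i, (-1 : K)) * (Matrix.vandermonde x).det := by
    rw [Matrix.det_vandermonde, ← Finset.prod_mul_distrib]
    refine Finset.prod_congr rfl fun i _ => ?_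
    rw [← Finset.prod_mul_distrib]
    exact Finset.prod_congr rfl fun j _ => by ring
  simp_rw [h1, Finset.prod_union (h2 _)]
  rw [Finset.prod_mul_distrib, h3, h4]; ring

/-- Clearing denominators, r_i ∏_{j≠i}(x_i - x_j) = x_i^(n-1-m) ∏_p (x_i - y_p). In the product over
i the differences of the x's form the discriminant, a sign times the square of the Vandermonde
determinant. -/
theorem prod_residue (hx : ∀ i, x i ≠ 0) (hinj : Function.Injective x) (y : Fin m → K) :
    (∏ i, residue x y i) * (Matrix.vandermonde x).det ^ 2 =
      (∏ i : Fin n, ∏ _j ∈ Finset.Ioi i, (-1 : K)) *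
      (∏ i, x i ^ (n - 1 - m : ℤ)) * ∏ i, ∏ p, (x i - y p) := by
  have hs : (∏ i : Fin n, ∏ _j ∈ Finset.Ioi i, (-1 : K)) *
      (∏ i : Fin n, ∏ _j ∈ Finset.Ioi i, (-1 : K)) = 1 := by
    rw [← Finset.prod_mul_distrib]
    refine Finset.prod_eq_one fun i _ => ?_
    rw [← Finset.prod_mul_distrib]
    simp
  have hE : ∏ i, ∏ j ∈ Finset.univ.erase i, (x i - x j) ≠ 0 :=
    Finset.prod_ne_zero_iff.2 fun i _ => Finset.prod_ne_zero_iff.2 fun j hj =>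
      sub_ne_zero.2 (hinj.ne (Finset.ne_of_mem_erase hj).symm)
  have hr : ∀ i, residue x y i * ∏ j ∈ Finset.univ.erase i, (x i - x j) =
      x i ^ (n - 1 - m : ℤ) * ∏ p, (x i - y p) := by
    intro i
    have h1 : ∏ j ∈ Finset.univ.erase i, (x i - x j) =
        x i ^ (n - 1 : ℤ) * ∏ j ∈ Finset.univ.erase i, (1 - x j * (x i)⁻¹) := by
      have : (x i ^ (n - 1 : ℤ)) = ∏ j ∈ Finset.univ.erase i, x i := by
        rw [Finset.prod_const, Finset.card_erase_of_mem (Finset.mem_univ i), Finset.card_fin,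
          ← zpow_natCast, Nat.cast_sub (by have := i.2; omega)]
        simp
      rw [this, ← Finset.prod_mul_distrib]
      refine Finset.prod_congr rfl fun j _ => ?_
      field_simp [hx i]
    have h2 : ∏ p, (x i - y p) = x i ^ (m : ℤ) * ∏ p, (1 - y p * (x i)⁻¹) := by
      have : (x i ^ (m : ℤ)) = ∏ _p : Fin m, x i := by simp
      rw [this, ← Finset.prod_mul_distrib]
      refine Finset.prod_congr rfl fun j _ => ?_
      field_simp [hx i]
    have hne : ∏ j ∈ Finset.univ.erase i, (1 - x j * (x i)⁻¹) ≠ 0 := by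
      refine Finset.prod_ne_zero_iff.2 fun j hj h => (Finset.ne_of_mem_erase hj) (hinj ?_)
      rw [sub_eq_zero] at h
      field_simp [hx i] at h
      exact h.symm
    rw [h1, h2, ← mul_assoc (x i ^ (n - 1 - m : ℤ)), ← zpow_add₀ (hx i), residue,
      mul_left_comm, div_mul_cancel₀ _ hne, sub_add_cancel]
  have := Finset.prod_congr rfl fun i (_ : i ∈ Finset.univ) => hr i
  rw [Finset.prod_mul_distrib, Finset.prod_mul_distrib, prod_prod_erase_sub] at this
  rw [mul_assoc (∏ i : Fin n, ∏ _j ∈ Finset.Ioi i, (-1 : K)), ← this]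
  linear_combination (-(∏ i, residue x y i) * (Matrix.vandermonde x).det ^ 2) * hs

/-- Determinants in the coefficients `twoSided` are Schur functions times `∏ (xᵢ - y_p)`. -/
theorem det_mul_prod_sub (hx : ∀ i, x i ≠ 0) (hinj : Function.Injective x) (hy : ∀ p, y p ≠ 0)
    (hf : (revPoly x : PowerSeries K) * PowerSeries.mk f = revPoly y)
    (hfs : (revPoly (fun i => (x i)⁻¹) : PowerSeries K) * PowerSeries.mk fs =
      revPoly (fun p => (y p)⁻¹)) (l : Fin n → ℤ) :
    (Matrix.of fun a i => x i ^ l a).det * ∏ i, ∏ p, (x i - y p) =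
      (Matrix.vandermonde x).det * ((∏ i : Fin n, ∏ _j ∈ Finset.Ioi i, (-1 : K)) *
        (Matrix.of fun a b : Fin n => twoSided x y f fs (l a - (n - 1 - m) + b)).det) := by
  -- Since the entries are ∑ r_i x_i^k, the matrix factors through the alternant matrix, a diagonal
  -- matrix of residues and the Vandermonde matrix. The shift by n - 1 - m cancels the powers of x_i
  -- in `prod_residue`.
  have hM : (Matrix.of fun a b : Fin n => twoSided x y f fs (l a - (n - 1 - m) + b)) =
      (Matrix.of fun a i => x i ^ l a) *
        Matrix.diagonal (fun i => x i ^ (-(n - 1 - m) : ℤ) * residue x y i) *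
        Matrix.vandermonde x := by
    ext a b
    rw [Matrix.mul_apply]
    simp only [Matrix.of_apply, Matrix.mul_diagonal, Matrix.vandermonde_apply]
    rw [twoSided_eq_sum hx hinj hy hf hfs]
    refine Finset.sum_congr rfl fun i _ => ?_
    rw [sub_eq_add_neg, zpow_add₀ (hx i), zpow_add₀ (hx i), zpow_natCast]; ring
  have hs : (∏ i : Fin n, ∏ _j ∈ Finset.Ioi i, (-1 : K)) *
      (∏ i : Fin n, ∏ _j ∈ Finset.Ioi i, (-1 : K)) = 1 := by
    rw [← Finset.prod_mul_distrib]
    refine Finset.prod_eq_one fun i _ => ?_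
    rw [← Finset.prod_mul_distrib]
    simp
  have hz : (∏ i, x i ^ (-(n - 1 - m) : ℤ)) * (∏ i, x i ^ (n - 1 - m : ℤ)) = 1 := by
    rw [← Finset.prod_mul_distrib]
    refine Finset.prod_eq_one fun i _ => ?_
    rw [← zpow_add₀ (hx i)]; simp
  have hp := prod_residue hx hinj y
  rw [hM, Matrix.det_mul, Matrix.det_mul, Matrix.det_diagonal, Finset.prod_mul_distrib]
  generalize (Matrix.of fun a i => x i ^ l a).det = D at *
  generalize (Matrix.vandermonde x).det = V at *
  generalize (∏ i : Fin n, ∏ _j ∈ Finset.Ioi i, (-1 : K)) = s at *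
  generalize (∏ i, x i ^ (-(n - 1 - m) : ℤ)) = z at *
  generalize (∏ i, x i ^ (n - 1 - m : ℤ)) = z' at *
  generalize (∏ i, residue x y i) = r at *
  generalize (∏ i, ∏ p, (x i - y p)) = P at *
  linear_combination (-s * D * z) * hp - D * P * z * z' * hs - D * P * hz

end Recurrence

/-! ### Symmetric Laurent polynomials -/

section Symmetric

variable {n m : ℕ}

/-- The subring generated by `Δ`, `Δ*`, `h_k` and `h_k*`. -/
def genRing (n m : ℕ) : Subring (LaurentRing n m) :=
  Subring.closure ({Delta n m, DeltaStar n m} ∪ Set.range (h n m) ∪ Set.range (hStar n m))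

theorem mono_add (v w : Wt n m) : mono (v + w) = mono v * mono w := by
  simp [mono, AddMonoidAlgebra.single_mul_single]

theorem mono_zero : mono (0 : Wt n m) = 1 := rfl

theorem permAct_mono (σ : Equiv.Perm (Fin n)) (τ : Equiv.Perm (Fin m)) (w : Wt n m) :
    permAct σ τ (mono w) = mono (permWt (Equiv.sumCongr σ τ) w) := by
  simp [permAct, mono]

theorem coeff_permAct (σ : Equiv.Perm (Fin n)) (τ : Equiv.Perm (Fin m)) (f : LaurentRing n m)
    (w : Wt n m) : (permAct σ τ f).coeff w = f.coeff (fun j => w (Equiv.sumCongr σ τ j)) := by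
  rw [permAct, AddMonoidAlgebra.coeff_domCongr]; rfl

theorem permWt_single (σ : Equiv.Perm (Fin n ⊕ Fin m)) (j : Fin n ⊕ Fin m) (c : ℤ) :
    permWt σ (Pi.single j c) = Pi.single (σ j) c := by
  ext k
  simp only [permWt, AddEquiv.coe_mk, Equiv.coe_fn_mk, Pi.single_apply, Equiv.symm_apply_eq]

theorem permAct_x (σ : Equiv.Perm (Fin n)) (τ : Equiv.Perm (Fin m)) (i : Fin n) :
    permAct σ τ (x i) = x (σ i) := by
  rw [x, permAct_mono, permWt_single]; rfl

theorem permAct_y (σ : Equiv.Perm (Fin n)) (τ : Equiv.Perm (Fin m)) (p : Fin m) :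
    permAct σ τ (y p) = y (τ p) := by
  rw [y, permAct_mono, permWt_single]; rfl

theorem coeff_euler (j : Fin n ⊕ Fin m) (f : LaurentRing n m) (w : Wt n m) :
    (euler j f).coeff w = w j * f.coeff w := by
  induction f using AddMonoidAlgebra.induction_linear with
  | zero => simp [euler_zero]
  | add f g hf hg => rw [euler_add, AddMonoidAlgebra.coeff_add, Finsupp.add_apply, hf, hg,
      AddMonoidAlgebra.coeff_add, Finsupp.add_apply, mul_add]
  | single v c =>
    rw [euler_single, AddMonoidAlgebra.coeff_single, AddMonoidAlgebra.coeff_single]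
    by_cases hv : v = w
    · subst hv; simp
    · rw [Finsupp.single_eq_of_ne' hv, Finsupp.single_eq_of_ne' hv, mul_zero]

theorem euler_eq_zero_iff (j : Fin n ⊕ Fin m) (f : LaurentRing n m) :
    euler j f = 0 ↔ ∀ w, f.coeff w ≠ 0 → w j = 0 := by
  constructor
  · intro h0 w hw
    have := coeff_euler j f w
    rw [h0] at this
    simpa [hw] using this.symm
  · intro h0
    ext w
    rw [coeff_euler]
    by_cases hw : f.coeff w = 0
    · simp [hw]
    · simp [h0 w hw]

theorem euler_mono (j : Fin n ⊕ Fin m) (w : Wt n m) :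
    euler j (mono w) = AddMonoidAlgebra.single w (w j) := by
  rw [mono, euler_single, mul_one]

/-- The ring of symmetric Laurent polynomials in `x₁, …, xₙ`. -/
def symX (n m : ℕ) : Subring (LaurentRing n m) where
  carrier := {f | (∀ σ, permAct σ 1 f = f) ∧ ∀ p, euler (Sum.inr p) f = 0}
  mul_mem' := by
    rintro f g ⟨hf, hf'⟩ ⟨hg, hg'⟩
    exact ⟨fun σ => by rw [map_mul, hf, hg], fun p => by rw [euler_mul, hf', hg']; simp⟩
  one_mem' := ⟨fun σ => map_one _, fun p => euler_one _⟩
  add_mem' := by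
    rintro f g ⟨hf, hf'⟩ ⟨hg, hg'⟩
    exact ⟨fun σ => by rw [map_add, hf, hg], fun p => by rw [euler_add, hf', hg']; simp⟩
  zero_mem' := ⟨fun σ => map_zero _, fun p => euler_zero _⟩
  neg_mem' := by
    rintro f ⟨hf, hf'⟩
    exact ⟨fun σ => by rw [map_neg, hf], fun p => by rw [euler_neg, hf']; simp⟩

theorem coeff_prod_one_sub {R ι : Type*} [CommRing R] (s : Finset ι) (a : ι → R) (k : ℕ) :
    PowerSeries.coeff k (∏ i ∈ s, (1 - PowerSeries.C (a i) * PowerSeries.X)) =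
      (-1) ^ k * ∑ t ∈ s.powersetCard k, ∏ i ∈ t, a i := by
  classical
  have h1 : ∀ i, (1 - PowerSeries.C (a i) * PowerSeries.X : PowerSeries R) =
      1 + PowerSeries.C (-a i) * PowerSeries.X := fun i => by rw [map_neg]; ring
  simp_rw [h1]
  rw [Finset.prod_one_add, map_sum, Finset.mul_sum]
  have h2 : ∀ t : Finset ι, PowerSeries.coeff k (∏ i ∈ t, PowerSeries.C (-a i) * PowerSeries.X) =
      if t.card = k then (-1) ^ k * ∏ i ∈ t, a i else 0 := by
    intro t
    rw [Finset.prod_mul_distrib, Finset.prod_const, ← map_prod, PowerSeries.coeff_C_mul,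
      PowerSeries.coeff_X_pow, Finset.prod_neg]
    by_cases hk : k = t.card
    · subst hk; simp
    · rw [if_neg hk, if_neg (Ne.symm hk), mul_zero]
  simp_rw [h2]
  rw [← Finset.sum_filter]
  refine Finset.sum_congr ?_ fun _ _ => rfl
  ext t; simp [Finset.mem_powersetCard]

theorem constantCoeff_prod_one_sub {R ι : Type*} [CommRing R] (s : Finset ι) (a : ι → R) :
    PowerSeries.constantCoeff (∏ i ∈ s, (1 - PowerSeries.C (a i) * PowerSeries.X)) = 1 := by
  simp [map_prod]

theorem prod_mul_chi (n m : ℕ) :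
    (∏ i : Fin n, (1 - PowerSeries.C (x i) * PowerSeries.X)) * chi n m =
      ∏ p : Fin m, (1 - PowerSeries.C (y p) * PowerSeries.X) := by
  rw [chi, mul_left_comm, PowerSeries.mul_invOfUnit _ _ (constantCoeff_prod_one_sub _ _), mul_one]

theorem prod_symX (s : Finset (Fin n)) (k : ℕ) (hs : s = Finset.univ) :
    PowerSeries.coeff k (∏ i ∈ s, (1 - PowerSeries.C (x (m := m) i) * PowerSeries.X)) ∈
      symX n m := by
  subst hs
  constructor
  · intro σ
    have h1 : PowerSeries.map (permAct σ (1 : Equiv.Perm (Fin m)) : _ →+* LaurentRing n m)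
        (∏ i : Fin n, (1 - PowerSeries.C (x (m := m) i) * PowerSeries.X)) =
        ∏ i : Fin n, (1 - PowerSeries.C (x i) * PowerSeries.X) := by
      rw [map_prod, ← Equiv.prod_comp σ fun i => 1 - PowerSeries.C (x (m := m) i) * PowerSeries.X]
      refine Finset.prod_congr rfl fun i _ => ?_
      simp [permAct_x]
    conv_rhs => rw [← h1]
    rw [PowerSeries.coeff_map]; rfl
  · intro p
    rw [coeff_prod_one_sub]
    let E : Subring (LaurentRing n m) :=
      { carrier := {f | euler (Sum.inr p) f = 0}
        mul_mem' := fun {f g} hf hg => by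
          simp only [Set.mem_ofPred_eq] at *; rw [euler_mul, hf, hg]; simp
        one_mem' := euler_one _
        add_mem' := fun {f g} hf hg => by
          simp only [Set.mem_ofPred_eq] at *; rw [euler_add, hf, hg]; simp
        zero_mem' := euler_zero _
        neg_mem' := fun {f} hf => by
          simp only [Set.mem_ofPred_eq] at *; rw [euler_neg, hf]; simp }
    refine E.mul_mem (E.pow_mem (E.neg_mem E.one_mem) _) (E.sum_mem fun t _ => E.prod_mem fun i _ => ?_)
    change euler _ _ = 0
    rw [x, euler_mono]; simp

theorem Delta_mul_mono (n m : ℕ) :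
    Delta n m * mono (Sum.elim (fun _ => 1) 0) = mono (Sum.elim 0 (fun _ => 1)) := by
  rw [Delta, ← mono_add]
  congr 1
  ext j; cases j <;> simp

theorem prod_x (n m : ℕ) : ∏ i : Fin n, x (m := m) i = mono (Sum.elim (fun _ => 1) 0) := by
  simp only [x, mono]
  rw [AddMonoidAlgebra.prod_single]
  simp only [Finset.prod_const_one]
  congr 1
  ext j
  rw [Finset.sum_apply]
  cases j <;> simp [Pi.single_apply]

theorem prod_y (n m : ℕ) : ∏ p : Fin m, y (n := n) p = mono (Sum.elim 0 (fun _ => 1)) := by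
  simp only [y, mono]
  rw [AddMonoidAlgebra.prod_single]
  simp only [Finset.prod_const_one]
  congr 1
  ext j
  rw [Finset.sum_apply]
  cases j <;> simp [Pi.single_apply]

/-- The product `∏ (xᵢ - y_p)`. -/
def resultant (n m : ℕ) : LaurentRing n m := ∏ i : Fin n, ∏ p : Fin m, (x i - y p)

/-- The alternant `∑ sgn(σ) σ(x^l)`. -/
def alternant (l : Fin n → ℤ) : LaurentRing n m :=
  ∑ σ : Equiv.Perm (Fin n), ((Equiv.Perm.sign σ : ℤˣ) : ℤ) •
    permAct σ 1 (mono (Sum.elim l 0))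

/-- A symmetric factor can be moved inside the antisymmetrization, so the product antisymmetrizes f
· x^l, which is then expanded into monomials. -/
theorem mul_alternant {f : LaurentRing n m} (hf : f ∈ symX n m) (l : Fin n → ℤ) :
    f * alternant l = f.coeff.sum fun w c => c • alternant (fun i => w (Sum.inl i) + l i) := by
  have h1 : f * alternant l = ∑ σ : Equiv.Perm (Fin n), ((Equiv.Perm.sign σ : ℤˣ) : ℤ) •
      permAct σ 1 (f * mono (Sum.elim l 0)) := by
    rw [alternant, Finset.mul_sum]
    refine Finset.sum_congr rfl fun σ _ => ?_
    rw [map_mul, hf.1, mul_smul_comm]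
  have h2 : f * mono (Sum.elim l 0) =
      ∑ w ∈ f.coeff.support, f.coeff w • mono (Sum.elim (fun i => w (Sum.inl i) + l i) 0) := by
    conv_lhs => rw [← AddMonoidAlgebra.sum_coeff_single f, Finsupp.sum, Finset.sum_mul]
    refine Finset.sum_congr rfl fun w hw => ?_
    rw [mono, mono, AddMonoidAlgebra.single_mul_single, AddMonoidAlgebra.smul_single, mul_one,
      smul_eq_mul, mul_one]
    congr 1
    ext j
    cases j with
    | inl i => simp
    | inr p => simpa using (euler_eq_zero_iff _ _).1 (hf.2 p) w (Finsupp.mem_support_iff.1 hw)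
  rw [h1, Finsupp.sum, h2]
  simp only [alternant, map_sum, Finset.smul_sum, map_zsmul]
  rw [Finset.sum_comm]
  exact Finset.sum_congr rfl fun w _ => Finset.sum_congr rfl fun σ _ => smul_comm _ _ _

instance : IsDomain (LaurentRing n m) := inferInstance

/-! ### Schur functions times `∏ (xᵢ - y_p)`, computed in the field of fractions -/

section Fraction

/-- The field of rational functions. -/
abbrev FracL (n m : ℕ) : Type := FractionRing (LaurentRing n m)

/-- The image of `xᵢ` in the field of fractions. -/
def xF (n m : ℕ) (i : Fin n) : FracL n m := algebraMap (LaurentRing n m) (FracL n m) (x i)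

/-- The image of `y_p` in the field of fractions. -/
def yF (n m : ℕ) (p : Fin m) : FracL n m := algebraMap (LaurentRing n m) (FracL n m) (y p)

theorem isUnit_mono (w : Wt n m) : IsUnit (mono w) :=
  IsUnit.of_mul_eq_one (mono (-w)) (by rw [← mono_add, add_neg_cancel, mono_zero])

theorem xF_ne (i : Fin n) : (xF n m i : (FracL n m)) ≠ 0 := ((isUnit_mono _).map (algebraMap (LaurentRing n m) (FracL n m))).ne_zero

theorem yF_ne (p : Fin m) : (yF n m p : (FracL n m)) ≠ 0 := ((isUnit_mono _).map (algebraMap (LaurentRing n m) (FracL n m))).ne_zero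

theorem xF_injective : Function.Injective (xF n m) := by
  intro i j hij
  have := (IsFractionRing.injective (LaurentRing n m) (FracL n m)) hij
  rw [x, x, mono, mono, AddMonoidAlgebra.single_left_inj one_ne_zero] at this
  by_contra hne
  have h1 := congrFun this (Sum.inl i)
  simp [hne] at h1

theorem invAct_mono (w : Wt n m) : invAct (mono w) = mono (-w) := by
  simp [invAct, mono]

theorem algebraMap_mono_neg (w : Wt n m) :
    algebraMap _ (FracL n m) (mono (-w)) = (algebraMap _ (FracL n m) (mono w))⁻¹ := by
  refine eq_inv_of_mul_eq_one_left ?_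
  rw [← map_mul, ← mono_add, neg_add_cancel, mono_zero, map_one]

theorem algebraMap_mono_nsmul (k : ℤ) (w : Wt n m) :
    algebraMap _ (FracL n m) (mono (k • w)) = (algebraMap _ (FracL n m) (mono w)) ^ k := by
  have hn : ∀ k : ℕ, algebraMap _ (FracL n m) (mono (k • w)) = (algebraMap _ (FracL n m) (mono w)) ^ k := by
    intro k
    rw [← map_pow]
    congr 1
    simp [mono, AddMonoidAlgebra.single_pow]
  cases k with
  | ofNat k => simpa using hn k
  | negSucc k =>
    rw [Int.negSucc_eq, neg_smul, algebraMap_mono_neg, zpow_neg]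
    congr 1
    exact_mod_cast hn (k + 1)

theorem algebraMap_mono_elim (l : Fin n → ℤ) :
    algebraMap (LaurentRing n m) (FracL n m) (mono (Sum.elim l 0)) = ∏ i, xF n m i ^ l i := by
  have h1 : (Sum.elim l 0 : Wt n m) = ∑ i, l i • Pi.single (Sum.inl i) 1 := by
    ext j
    rw [Finset.sum_apply]
    cases j <;> simp [Pi.single_apply]
  have h2 : ∀ s : Finset (Fin n), mono (n := n) (m := m) (∑ i ∈ s, l i • Pi.single (Sum.inl i) 1) =
      ∏ i ∈ s, mono (l i • Pi.single (Sum.inl i) 1) := by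
    classical
    intro s
    induction s using Finset.induction_on with
    | empty => simp [mono_zero]
    | insert a s ha ih => rw [Finset.sum_insert ha, Finset.prod_insert ha, mono_add, ih]
  rw [h1, h2, map_prod]
  exact Finset.prod_congr rfl fun i _ => algebraMap_mono_nsmul _ _

theorem algebraMap_alternant (l : Fin n → ℤ) :
    algebraMap (LaurentRing n m) (FracL n m) (alternant l) = (Matrix.of fun a i => xF n m i ^ l a).det := by
  rw [← Matrix.det_transpose, Matrix.det_apply, alternant, map_sum]
  refine Finset.sum_congr rfl fun σ _ => ?_
  rw [map_zsmul, permAct_mono]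
  congr 1
  rw [show permWt (Equiv.sumCongr σ 1) (Sum.elim l 0) = (Sum.elim (fun i => l (σ.symm i)) 0 : Wt n m) by
    ext j; cases j <;> simp [permWt], algebraMap_mono_elim, ← Equiv.prod_comp σ]
  simp

theorem revPoly_xF : ((revPoly (xF n m)) : PowerSeries (FracL n m)) =
    PowerSeries.map (algebraMap (LaurentRing n m) (FracL n m))
      (∏ i : Fin n, (1 - PowerSeries.C (x i) * PowerSeries.X)) := by
  rw [revPoly, ← Polynomial.coeToPowerSeries.ringHom_apply, map_prod, map_prod]
  exact Finset.prod_congr rfl fun i _ => by simp [xF]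

theorem revPoly_yF : ((revPoly (yF n m)) : PowerSeries (FracL n m)) =
    PowerSeries.map (algebraMap (LaurentRing n m) (FracL n m))
      (∏ i : Fin m, (1 - PowerSeries.C (y i) * PowerSeries.X)) := by
  rw [revPoly, ← Polynomial.coeToPowerSeries.ringHom_apply, map_prod, map_prod]
  exact Finset.prod_congr rfl fun i _ => by simp [yF]

theorem revPoly_xF_inv : ((revPoly fun i => (xF n m i)⁻¹ : Polynomial (FracL n m)) : PowerSeries (FracL n m)) =
    PowerSeries.map ((algebraMap (LaurentRing n m) (FracL n m)).comp (RingHomClass.toRingHom (invAct (n := n) (m := m))))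
      (∏ i : Fin n, (1 - PowerSeries.C (x i) * PowerSeries.X)) := by
  rw [revPoly, ← Polynomial.coeToPowerSeries.ringHom_apply, map_prod, map_prod]
  refine Finset.prod_congr rfl fun i _ => ?_
  have : ((algebraMap (LaurentRing n m) (FracL n m)).comp (RingHomClass.toRingHom (invAct (n := n) (m := m)))) (x i) =
    (xF n m i)⁻¹ := by
    rw [xF, x, ← algebraMap_mono_neg, ← invAct_mono]; rfl
  rw [map_sub (PowerSeries.map _), map_mul (PowerSeries.map _), PowerSeries.map_C, this]
  simp

theorem revPoly_yF_inv : ((revPoly fun i => (yF n m i)⁻¹ : Polynomial (FracL n m)) : PowerSeries (FracL n m)) =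
    PowerSeries.map ((algebraMap (LaurentRing n m) (FracL n m)).comp (RingHomClass.toRingHom (invAct (n := n) (m := m))))
      (∏ i : Fin m, (1 - PowerSeries.C (y i) * PowerSeries.X)) := by
  rw [revPoly, ← Polynomial.coeToPowerSeries.ringHom_apply, map_prod, map_prod]
  refine Finset.prod_congr rfl fun i _ => ?_
  have : ((algebraMap (LaurentRing n m) (FracL n m)).comp (RingHomClass.toRingHom (invAct (n := n) (m := m)))) (y i) =
    (yF n m i)⁻¹ := by
    rw [yF, y, ← algebraMap_mono_neg, ← invAct_mono]; rfl
  rw [map_sub (PowerSeries.map _), map_mul (PowerSeries.map _), PowerSeries.map_C, this]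
  simp

/-- The product of f with the Vandermonde alternant is an integral combination of alternants, and
each alternant times ∏(x_i - y_p) is the Vandermonde determinant times a determinant in the
two-sided coefficients. Cancelling the Vandermonde determinant leaves an integral combination of
determinants whose entries lie in the generated ring. -/
theorem resultant_mul_symX_mem {f : LaurentRing n m} (hf : f ∈ symX n m) :
    resultant n m * f ∈ genRing n m := by
  let ι := algebraMap (LaurentRing n m) (FracL n m)
  have hι : Function.Injective ι := IsFractionRing.injective _ _
  let R' := (genRing n m).map ι
  suffices hs : ι (resultant n m * f) ∈ R' by
    obtain ⟨g, hg, hg'⟩ := hs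
    rwa [← hι hg']
  let F : ℕ → (FracL n m) := fun k => ι (h n m k)
  let Fs : ℕ → (FracL n m) := fun k => ι (hStar n m k)
  have hF : ((revPoly (xF n m)) : PowerSeries (FracL n m)) * PowerSeries.mk F = (revPoly (yF n m) : Polynomial _) := by
    rw [revPoly_xF, revPoly_yF, ← prod_mul_chi, map_mul]
    congr 1
    ext k
    rw [PowerSeries.coeff_map, PowerSeries.coeff_mk]; rfl
  have hFs : ((revPoly fun i => (xF n m i)⁻¹ : Polynomial (FracL n m)) : PowerSeries (FracL n m)) * PowerSeries.mk Fs =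
      (revPoly fun p => (yF n m p)⁻¹ : Polynomial (FracL n m)) := by
    rw [revPoly_xF_inv, revPoly_yF_inv, ← prod_mul_chi, map_mul]
    congr 1
    ext k
    rw [PowerSeries.coeff_map, PowerSeries.coeff_mk]; rfl
  have hmem : ∀ g ∈ genRing n m, ι g ∈ R' := fun g hg => ⟨g, hg, rfl⟩
  have hh : ∀ k, F k ∈ R' := fun k => hmem _ (Subring.subset_closure (Or.inl (Or.inr ⟨k, rfl⟩)))
  have hhs : ∀ k, Fs k ∈ R' := fun k => hmem _ (Subring.subset_closure (Or.inr ⟨k, rfl⟩))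
  have hD : ι (Delta n m) ∈ R' := hmem _ (Subring.subset_closure (Or.inl (Or.inl (Or.inl rfl))))
  have hext : ∀ (u : ℕ → (FracL n m)), (∀ k, u k ∈ R') → ∀ k, extZ u k ∈ R' := by
    intro u hu k
    unfold extZ
    split_ifs
    · exact hu _
    · exact R'.zero_mem
  have hX : (∏ i : Fin n, -xF n m i : (FracL n m)) ≠ 0 :=
    Finset.prod_ne_zero_iff.2 fun i _ => neg_ne_zero.2 (xF_ne i)
  -- The constant that joins the two expansions is Δ up to sign; this is where Δ enters the
  -- generating set.
  have hc : ((∏ p : Fin m, -yF n m p : (FracL n m)) / ∏ i : Fin n, -xF n m i) = (-1) ^ m * (-1) ^ n * ι (Delta n m) := by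
    rw [div_eq_iff hX, Finset.prod_neg, Finset.prod_neg]
    have h1 : ∏ i : Fin n, (xF n m i : (FracL n m)) = ι (mono (Sum.elim (fun _ => 1) 0)) := by
      rw [← prod_x, map_prod]; rfl
    have h2 : ∏ i : Fin m, (yF n m i : (FracL n m)) = ι (mono (Sum.elim 0 (fun _ => 1))) := by
      rw [← prod_y, map_prod]; rfl
    have h3 := congrArg ι (Delta_mul_mono n m)
    rw [map_mul] at h3
    rw [h1, h2, ← h3, Finset.card_fin, Finset.card_fin]
    have h4 : ((-1 : (FracL n m)) ^ n) * (-1) ^ n = 1 := by rw [← mul_pow]; simp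
    linear_combination (-(-1) ^ m * (ι (Delta n m) * ι (mono (Sum.elim (fun _ => 1) 0)))) * h4
  have htwo : ∀ k, twoSided (xF n m) (yF n m) F Fs k ∈ R' := by
    intro k
    rw [twoSided, hc]
    refine R'.sub_mem (hext _ hh _) (R'.mul_mem (R'.mul_mem (R'.mul_mem ?_ ?_) hD) (hext _ hhs _)) <;>
      exact R'.pow_mem (R'.neg_mem R'.one_mem) _
  have hres : ι (resultant n m) = ∏ i, ∏ p, (xF n m i - yF n m p) := by
    simp only [resultant, map_prod, map_sub]; rfl
  have halt : ∀ l : Fin n → ℤ, ∃ r ∈ R', ι (alternant l) * ι (resultant n m) =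
      (Matrix.vandermonde (xF n m)).det * r := by
    intro l
    refine ⟨_, ?_, by rw [algebraMap_alternant, hres]; exact
      det_mul_prod_sub xF_ne xF_injective yF_ne hF hFs l⟩
    refine R'.mul_mem (R'.prod_mem fun i _ => R'.prod_mem fun _ _ => R'.neg_mem R'.one_mem) ?_
    rw [Matrix.det_apply]
    exact R'.sum_mem fun σ _ => R'.zsmul_mem (R'.prod_mem fun i _ => htwo _) _
  have hV : ι (alternant fun i : Fin n => (i : ℤ)) = (Matrix.vandermonde (xF n m)).det := by
    rw [algebraMap_alternant, ← Matrix.det_transpose]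
    congr 1
  have hV0 : (Matrix.vandermonde (xF n m)).det ≠ 0 :=
    Matrix.det_vandermonde_ne_zero_iff.2 xF_injective
  choose r hr hr' using halt
  have key := congrArg ι (mul_alternant hf fun i : Fin n => (i : ℤ))
  rw [map_mul, hV, Finsupp.sum, map_sum] at key
  have : ι (resultant n m * f) = ∑ w ∈ f.coeff.support,
      f.coeff w • r (fun i => w (Sum.inl i) + i) := by
    refine mul_left_cancel₀ hV0 ?_
    rw [map_mul, Finset.mul_sum]
    calc _ = (ι f * (Matrix.vandermonde (xF n m)).det) * ι (resultant n m) := by ring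
      _ = _ := by
        rw [key, Finset.sum_mul]
        refine Finset.sum_congr rfl fun w _ => ?_
        rw [map_zsmul, smul_mul_assoc, hr', mul_smul_comm]
  rw [this]
  exact R'.sum_mem fun w _ => R'.zsmul_mem (hr _) _

end Fraction

end Symmetric

/-! ### From symmetric functions of x to all `Sₙ × Sₘ`-invariants -/

section Invariants

variable {n m : ℕ}

/-- The multiplier ring of the set `{F | ∏ (xᵢ - y_p) F s ∈ R for all symmetric s = s(x)}`, where `R`
is the ring generated by `Δ`, `Δ*`, `h_k`, `h_k*`. -/
def multRing (n m : ℕ) : Subring (LaurentRing n m) where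
  carrier := {G | ∀ F : LaurentRing n m, (∀ s ∈ symX n m, resultant n m * F * s ∈ genRing n m) →
    ∀ s ∈ symX n m, resultant n m * (F * G) * s ∈ genRing n m}
  mul_mem' := by
    intro G G' hG hG' F hF s hs
    have := hG' (F * G) (hG F hF) s hs
    rwa [mul_assoc F] at this
  one_mem' := by
    intro F hF s hs
    rw [mul_one]; exact hF s hs
  add_mem' := by
    intro G G' hG hG' F hF s hs
    have := (genRing n m).add_mem (hG F hF s hs) (hG' F hF s hs)
    convert this using 1; ring
  zero_mem' := by
    intro F hF s hs
    simp
  neg_mem' := by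
    intro G hG F hF s hs
    have := (genRing n m).neg_mem (hG F hF s hs)
    convert this using 1; ring

theorem genRing_le_multRing : genRing n m ≤ multRing n m := by
  intro G hG F hF s hs
  have := (genRing n m).mul_mem (hF s hs) hG
  convert this using 1; ring

/-- The condition on F ranges over all symmetric s, so the multiplier is absorbed into s. This is
why `multRing` quantifies over s. -/
theorem symX_le_multRing : symX n m ≤ multRing n m := by
  intro G hG F hF s hs
  have := hF (G * s) ((symX n m).mul_mem hG hs)
  convert this using 1; ring

/-- The multiplier is applied to F = 1, which is admissible by `resultant_mul_symX_mem`. -/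
theorem resultant_mul_mem_of_multRing {G : LaurentRing n m} (hG : G ∈ multRing n m) :
    resultant n m * G ∈ genRing n m := by
  have := hG 1 (fun s hs => by rw [mul_one]; exact resultant_mul_symX_mem hs) 1 (symX n m).one_mem
  simpa using this

theorem h_mem (k : ℕ) : h n m k ∈ genRing n m :=
  Subring.subset_closure (Or.inl (Or.inr ⟨k, rfl⟩))

theorem hStar_mem (k : ℕ) : hStar n m k ∈ genRing n m := Subring.subset_closure (Or.inr ⟨k, rfl⟩)

theorem Delta_mem : Delta n m ∈ genRing n m :=
  Subring.subset_closure (Or.inl (Or.inl (Or.inl rfl)))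

theorem DeltaStar_mem : DeltaStar n m ∈ genRing n m :=
  Subring.subset_closure (Or.inl (Or.inl (Or.inr rfl)))

/-- Comparing coefficients in ∏(1 - y_p t) = ∏(1 - x_i t) · χ(t) writes an elementary symmetric
function of y in terms of elementary symmetric functions of x and the h_k, all of which are
multipliers. -/
theorem esymm_y_mem (k : ℕ) :
    ∑ t ∈ (Finset.univ : Finset (Fin m)).powersetCard k, ∏ p ∈ t, y (n := n) p ∈ multRing n m := by
  have h1 := coeff_prod_one_sub Finset.univ (y (n := n) (m := m)) k
  rw [← prod_mul_chi, PowerSeries.coeff_mul] at h1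
  have h2 : (-1 : LaurentRing n m) ^ k * (-1) ^ k = 1 := by rw [← mul_pow]; simp
  have h3 := congrArg (fun z => (-1) ^ k * z) h1
  simp only [← mul_assoc, h2, one_mul] at h3
  rw [← h3]
  refine (multRing n m).mul_mem ((multRing n m).pow_mem ((multRing n m).neg_mem
    (multRing n m).one_mem) _) ((multRing n m).sum_mem fun a _ => (multRing n m).mul_mem ?_ ?_)
  · exact symX_le_multRing (prod_symX _ _ rfl)
  · exact genRing_le_multRing (h_mem _)

theorem permAct_mono_const (σ : Equiv.Perm (Fin n)) (τ : Equiv.Perm (Fin m)) (a b : ℤ) :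
    permAct σ τ (mono (Sum.elim (fun _ => a) (fun _ => b))) =
      mono (Sum.elim (fun _ => a) (fun _ => b)) := by
  rw [permAct_mono]
  congr 1
  ext j; cases j <;> simp [permWt]

/-- Powers of ∏ y_p are powers of Δ or Δ* times powers of ∏ x_i, and the latter are symmetric in x.
-/
theorem mono_const_mem (a b : ℤ) :
    mono (Sum.elim (fun _ => a) (fun _ => b) : Wt n m) ∈ multRing n m := by
  have hx : ∀ a : ℤ, mono (Sum.elim (fun _ => a) (fun _ => 0) : Wt n m) ∈ multRing n m := by
    intro a
    refine symX_le_multRing ⟨fun σ => permAct_mono_const σ 1 _ _, fun p => ?_⟩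
    rw [euler_mono]; simp
  have hD : ∀ b : ℕ, mono (Sum.elim (fun _ => (-b : ℤ)) (fun _ => (b : ℤ)) : Wt n m) ∈
      multRing n m := by
    intro b
    have : mono (Sum.elim (fun _ => (-b : ℤ)) (fun _ => (b : ℤ)) : Wt n m) = Delta n m ^ b := by
      rw [Delta, mono, mono, AddMonoidAlgebra.single_pow, one_pow]
      congr 1
      ext j; cases j <;> simp
    rw [this]
    exact (multRing n m).pow_mem (genRing_le_multRing Delta_mem) _
  have hD' : ∀ b : ℕ, mono (Sum.elim (fun _ => (b : ℤ)) (fun _ => (-b : ℤ)) : Wt n m) ∈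
      multRing n m := by
    intro b
    have : mono (Sum.elim (fun _ => (b : ℤ)) (fun _ => (-b : ℤ)) : Wt n m) = DeltaStar n m ^ b := by
      rw [DeltaStar, mono, mono, AddMonoidAlgebra.single_pow, one_pow]
      congr 1
      ext j; cases j <;> simp
    rw [this]
    exact (multRing n m).pow_mem (genRing_le_multRing DeltaStar_mem) _
  have hDz : mono (Sum.elim (fun _ => -b) (fun _ => b) : Wt n m) ∈ multRing n m := by
    rcases Int.eq_nat_or_neg b with ⟨k, rfl | rfl⟩
    · exact hD k
    · simpa using hD' k
  have : mono (Sum.elim (fun _ => a) (fun _ => b) : Wt n m) =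
      mono (Sum.elim (fun _ => a + b) (fun _ => 0)) * mono (Sum.elim (fun _ => -b) (fun _ => b)) := by
    rw [← mono_add]
    congr 1
    ext j; cases j <;> simp
  rw [this]
  exact (multRing n m).mul_mem (hx _) hDz

/-- A symmetric polynomial in the `y_p` is a multiplier. -/
theorem aeval_y_mem {q : MvPolynomial (Fin m) ℤ} (hq : q.IsSymmetric) :
    MvPolynomial.aeval (y (n := n)) q ∈ multRing n m := by
  obtain ⟨r, hr⟩ := MvPolynomial.esymmAlgHom_surjective (σ := Fin m) (n := m) ℤ
    (Fintype.card_fin m).le ⟨q, hq⟩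
  have h1 : MvPolynomial.aeval (fun i : Fin m => MvPolynomial.esymm (Fin m) ℤ (i + 1)) r = q := by
    rw [← MvPolynomial.esymmAlgHom_apply, hr]
  rw [← h1]
  clear h1 hr
  induction r using MvPolynomial.induction_on with
  | C a => simp
  | add a b ha hb =>
    rw [map_add, map_add]
    exact (multRing n m).add_mem ha hb
  | mul_X a i ha =>
    rw [map_mul, map_mul, MvPolynomial.aeval_X]
    refine (multRing n m).mul_mem ha ?_
    rw [MvPolynomial.esymm, map_sum]
    simp only [map_prod, MvPolynomial.aeval_X]
    exact esymm_y_mem _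

/-- The coefficient of `y^v` in `f`. -/
def xPart (v : Fin m → ℤ) (f : LaurentRing n m) : LaurentRing n m :=
  f.coeff.sum fun w c =>
    if (fun p => w (Sum.inr p)) = v then AddMonoidAlgebra.single (Sum.elim (fun i => w (Sum.inl i)) 0) c
    else 0

theorem coeff_xPart (v : Fin m → ℤ) (f : LaurentRing n m) (u : Wt n m) :
    (xPart v f).coeff u = if (fun p => u (Sum.inr p)) = 0 then
      f.coeff (Sum.elim (fun i => u (Sum.inl i)) v) else 0 := by
  have hadd : ∀ f g : LaurentRing n m, xPart v (f + g) = xPart v f + xPart v g := by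
    intro f g
    unfold xPart
    rw [AddMonoidAlgebra.coeff_add, Finsupp.sum_add_index']
    · intro w; simp
    · intro w a b; split_ifs <;> simp [AddMonoidAlgebra.single_add]
  induction f using AddMonoidAlgebra.induction_linear with
  | zero => simp [xPart]
  | add f g hf hg =>
    rw [hadd, AddMonoidAlgebra.coeff_add, Finsupp.add_apply, hf, hg, AddMonoidAlgebra.coeff_add,
      Finsupp.add_apply]
    split_ifs <;> simp
  | single w c =>
    rw [xPart, AddMonoidAlgebra.coeff_single, Finsupp.sum_single_index (by split_ifs <;> simp),
      Finsupp.single_apply]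
    by_cases h1 : (fun p => w (Sum.inr p)) = v
    · subst h1
      rw [if_pos rfl, AddMonoidAlgebra.coeff_single, Finsupp.single_apply]
      by_cases h2 : (fun p => u (Sum.inr p)) = 0
      · rw [if_pos h2]
        refine if_congr ?_ rfl rfl
        constructor
        · rintro rfl; ext j; cases j <;> simp
        · intro hw
          ext j
          cases j with
          | inl i => exact congrFun hw (Sum.inl i)
          | inr p => exact (congrFun h2 p).symm
      · rw [if_neg h2, if_neg]
        rintro rfl
        exact h2 rfl
    · rw [if_neg h1]
      have : ¬ w = Sum.elim (fun i => u (Sum.inl i)) v := by rintro rfl; exact h1 rfl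
      simp [this]

theorem xPart_mem_symX {f : LaurentRing n m} (hf : ∀ σ τ, permAct σ τ f = f) (v : Fin m → ℤ) :
    xPart v f ∈ symX n m := by
  constructor
  · intro σ
    ext u
    rw [coeff_permAct, coeff_xPart, coeff_xPart]
    refine if_congr (by simp) ?_ rfl
    conv_rhs => rw [← hf σ 1, coeff_permAct]
    congr 1
    ext j; cases j <;> simp
  · intro p
    rw [euler_eq_zero_iff]
    intro w hw
    rw [coeff_xPart] at hw
    by_contra hne
    exact hw (if_neg fun h0 => hne (congrFun h0 p))

theorem xPart_comp {f : LaurentRing n m} (hf : ∀ σ τ, permAct σ τ f = f) (v : Fin m → ℤ)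
    (τ : Equiv.Perm (Fin m)) : xPart (v ∘ τ) f = xPart v f := by
  ext u
  rw [coeff_xPart, coeff_xPart]
  refine if_congr Iff.rfl ?_ rfl
  conv_rhs => rw [← hf 1 τ, coeff_permAct]
  congr 1
  ext j; cases j <;> simp

/-- The coefficient of y^v in an invariant is symmetric in x and depends only on the S_m-orbit of v.
Collecting orbits writes f as a sum of products of a symmetric function of x with an orbit sum in y,
and both factors are multipliers. -/
theorem mem_multRing_of_invariant {f : LaurentRing n m} (hf : ∀ σ τ, permAct σ τ f = f) :
    f ∈ multRing n m := by
  classical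
  let T : Finset (Fin m → ℤ) := f.coeff.support.image fun w p => w (Sum.inr p)
  have hT : ∀ (v) (τ : Equiv.Perm (Fin m)), v ∈ T → v ∘ τ ∈ T := by
    intro v τ hv
    obtain ⟨w, hw, rfl⟩ := Finset.mem_image.1 hv
    refine Finset.mem_image.2 ⟨fun j => w (Equiv.sumCongr 1 τ j), ?_, by ext; simp⟩
    rw [Finsupp.mem_support_iff, ← coeff_permAct, hf]
    exact Finsupp.mem_support_iff.1 hw
  have hsum : f = ∑ v ∈ T, xPart v f * mono (Sum.elim 0 v) := by
    ext u
    rw [AddMonoidAlgebra.coeff_sum, Finsupp.finsetSum_apply]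
    have h1 : ∀ v, (xPart v f * mono (Sum.elim 0 v)).coeff u =
        if (fun p => u (Sum.inr p)) = v then f.coeff u else 0 := by
      intro v
      rw [mono, AddMonoidAlgebra.coeff_mul_single_apply, mul_one, coeff_xPart]
      by_cases hv : (fun p => u (Sum.inr p)) = v
      · subst hv
        rw [if_pos rfl, if_pos (by ext p; simp)]
        congr 1
        ext j; cases j <;> simp
      · rw [if_neg hv, if_neg]
        intro h0
        apply hv
        ext p
        have := congrFun h0 p
        simp at this
        omega
    simp_rw [h1]
    rw [Finset.sum_ite_eq]
    split_ifs with h2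
    · rfl
    · by_contra h3
      exact h2 (Finset.mem_image.2 ⟨u, Finsupp.mem_support_iff.2 h3, rfl⟩)
  -- Sorting the exponents selects a representative of each orbit.
  let key : (Fin m → ℤ) → (Fin m → ℤ) := fun v => v ∘ Tuple.sort v
  rw [hsum, ← Finset.sum_fiberwise_of_maps_to (s := T) (t := T.image key) (g := key)
    (fun v hv => Finset.mem_image_of_mem _ hv)]
  refine (multRing n m).sum_mem fun k _ => ?_
  have h1 : ∑ v ∈ T with key v = k, xPart v f * mono (Sum.elim 0 v) =
      xPart k f * ∑ v ∈ T with key v = k, mono (Sum.elim 0 v) := by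
    rw [Finset.mul_sum]
    refine Finset.sum_congr rfl fun v hv => ?_
    rw [← (Finset.mem_filter.1 hv).2, xPart_comp hf]
  rw [h1]
  refine (multRing n m).mul_mem (symX_le_multRing (xPart_mem_symX hf k)) ?_
  -- A uniform shift makes all exponents nonnegative, so that the orbit sum becomes a symmetric
  -- polynomial; the factor (y_1⋯y_m)^(-N) is put back by `mono_const_mem`.
  obtain ⟨N, hN⟩ : ∃ N : ℕ, ∀ v ∈ T, ∀ p, 0 ≤ v p + N := by
    refine ⟨∑ v ∈ T, ∑ p, (v p).natAbs, fun v hv p => ?_⟩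
    have h2 : (v p).natAbs ≤ ∑ v ∈ T, ∑ p, (v p).natAbs :=
      (Finset.single_le_sum (f := fun p => (v p).natAbs) (fun _ _ => Nat.zero_le _)
        (Finset.mem_univ p)).trans
        (Finset.single_le_sum (f := fun v : Fin m → ℤ => ∑ p, (v p).natAbs)
          (fun _ _ => Nat.zero_le _) hv)
    omega
  let q : MvPolynomial (Fin m) ℤ := ∑ v ∈ T with key v = k, ∏ p, MvPolynomial.X p ^ (v p + N).toNat
  have hq : q.IsSymmetric := by
    intro τ
    simp only [q, map_sum, map_prod, map_pow, MvPolynomial.rename_X]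
    refine Finset.sum_bij' (fun v _ => v ∘ τ.symm) (fun v _ => v ∘ τ) ?_ ?_ ?_ ?_ ?_
    · intro v hv
      rw [Finset.mem_filter] at hv ⊢
      exact ⟨hT _ _ hv.1, by rw [← hv.2]; exact Tuple.comp_perm_comp_sort_eq_comp_sort⟩
    · intro v hv
      rw [Finset.mem_filter] at hv ⊢
      exact ⟨hT _ _ hv.1, by rw [← hv.2]; exact Tuple.comp_perm_comp_sort_eq_comp_sort⟩
    · intro v _; ext p; simp
    · intro v _; ext p; simp
    · intro v _
      rw [← Equiv.prod_comp τ fun p => MvPolynomial.X p ^ ((v ∘ τ.symm) p + N).toNat]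
      simp
  have hy : ∀ v : Fin m → ℤ, (∀ p, 0 ≤ v p) →
      ∏ p, y (n := n) p ^ (v p).toNat = mono (Sum.elim 0 v) := by
    intro v hv
    simp only [y, mono, AddMonoidAlgebra.single_pow, one_pow]
    rw [AddMonoidAlgebra.prod_single]
    simp only [Finset.prod_const_one]
    congr 1
    ext j
    rw [Finset.sum_apply]
    cases j with
    | inl i => simp
    | inr p => simp [Pi.single_apply, hv p]
  have h2 : ∑ v ∈ T with key v = k, mono (Sum.elim 0 v : Wt n m) =
      mono (Sum.elim (fun _ => 0) (fun _ => (-N : ℤ))) * MvPolynomial.aeval (y (n := n)) q := by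
    simp only [q, map_sum, map_prod, map_pow, MvPolynomial.aeval_X]
    rw [Finset.mul_sum]
    refine Finset.sum_congr rfl fun v hv => ?_
    rw [hy (fun p => v p + N) (hN v (Finset.mem_filter.1 hv).1), ← mono_add]
    congr 1
    ext j; cases j <;> simp
  rw [h2]
  exact (multRing n m).mul_mem (mono_const_mem _ _) (aeval_y_mem hq)

/-- Multiples of `∏ (xᵢ - y_p)` by invariants lie in the ring generated by `Δ`, `Δ*`, `h_k`, `h_k*`. -/
theorem resultant_mul_mem {f : LaurentRing n m} (hf : ∀ σ τ, permAct σ τ f = f) :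
    resultant n m * f ∈ genRing n m :=
  resultant_mul_mem_of_multRing (mem_multRing_of_invariant hf)

end Invariants

/-! ### The substitutions `xᵢ ↦ y_p` and `x₀, y₀ ↦ 1`, and induction on the rank -/

section Restriction

variable {n m : ℕ}

theorem mapDomain_single' {n' m' : ℕ} (f : Wt n m →+ Wt n' m') (w : Wt n m) (c : ℤ) :
    AddMonoidAlgebra.mapDomainAlgHom ℤ ℤ f (AddMonoidAlgebra.single w c) =
      AddMonoidAlgebra.single (f w) c := by
  simp

/-- The map of lattices dual to the substitution `xᵢ ↦ y_p`. -/
def mergeWt (i : Fin n) (p : Fin m) : Wt n m →+ Wt n m where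
  toFun w j := if j = Sum.inl i then 0 else if j = Sum.inr p then w (Sum.inr p) + w (Sum.inl i)
    else w j
  map_zero' := by ext j; simp
  map_add' v w := by
    ext j
    simp only [Pi.add_apply]
    split_ifs <;> ring

/-- The substitution `xᵢ ↦ y_p`. -/
def merge (i : Fin n) (p : Fin m) : LaurentRing n m →ₐ[ℤ] LaurentRing n m :=
  AddMonoidAlgebra.mapDomainAlgHom ℤ ℤ (mergeWt i p)

theorem merge_single (i : Fin n) (p : Fin m) (w : Wt n m) (c : ℤ) :
    merge i p (AddMonoidAlgebra.single w c) = AddMonoidAlgebra.single (mergeWt i p w) c :=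
  mapDomain_single' _ _ _

theorem merge_x_self (i : Fin n) (p : Fin m) : merge i p (x i) = y p := by
  rw [x, y, mono, mono, merge_single]
  congr 1
  ext j
  by_cases h1 : j = Sum.inl i
  · subst h1; simp [mergeWt]
  · by_cases h2 : j = Sum.inr p
    · subst h2; simp [mergeWt]
    · simp [mergeWt, h1, h2]

theorem merge_y (i : Fin n) (p q : Fin m) : merge i p (y q) = y q := by
  rw [y, mono, merge_single]
  congr 1
  ext j
  by_cases h1 : j = Sum.inl i
  · subst h1; simp [mergeWt]
  · by_cases h2 : j = Sum.inr p
    · subst h2; simp [mergeWt]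
    · simp [mergeWt, h1, h2]

theorem merge_x_of_ne {i k : Fin n} (p : Fin m) (hk : k ≠ i) : merge i p (x k) = x k := by
  rw [x, mono, merge_single]
  congr 1
  ext j
  by_cases h1 : j = Sum.inl i
  · subst h1; simp [mergeWt, hk.symm]
  · by_cases h2 : j = Sum.inr p
    · subst h2; simp [mergeWt, hk.symm]
    · simp [mergeWt, h1, h2]

/-- The congruence of x_i and y_p modulo y_p - x_i passes to powers. Negative powers are included
because x_i is a unit: the downward step multiplies by its inverse. -/
theorem mono_zsmul_sub_mem (i : Fin n) (p : Fin m) (k : ℤ) :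
    mono (k • Pi.single (Sum.inl i) 1) - mono (k • Pi.single (Sum.inr p) 1) ∈
      Ideal.span {(y p - x i : LaurentRing n m)} := by
  have hyx : (y p - x i : LaurentRing n m) ∈ Ideal.span {(y p - x i : LaurentRing n m)} :=
    Ideal.subset_span rfl
  have hs : ∀ (k : ℤ) (j : Fin n ⊕ Fin m), mono (n := n) (m := m) ((k + 1) • Pi.single j 1) =
      mono (k • Pi.single j 1) * mono (Pi.single j 1) := by
    intro k j; rw [add_smul, one_smul, mono_add]
  have hxinv : (mono (-Pi.single (Sum.inl i) 1) : LaurentRing n m) * x i = 1 := by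
    rw [x, ← mono_add, neg_add_cancel, mono_zero]
  induction k using Int.induction_on with
  | zero => simp
  | succ k ih =>
    rw [hs, hs]
    have := Ideal.sub_mem _ (Ideal.mul_mem_left _ (x i) ih)
      (Ideal.mul_mem_left _ (mono ((k : ℤ) • Pi.single (Sum.inr p) 1)) hyx)
    convert this using 1
    change _ * x i - _ * y p = _
    ring
  | pred k ih =>
    have h1 := hs (-(k : ℤ) - 1) (Sum.inl i)
    have h2 := hs (-(k : ℤ) - 1) (Sum.inr p)
    rw [sub_add_cancel] at h1 h2
    have h1' : mono (n := n) (m := m) ((-(k : ℤ)) • Pi.single (Sum.inl i) 1) =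
      mono ((-(k : ℤ) - 1) • Pi.single (Sum.inl i) 1) * x i := h1
    have h2' : mono (n := n) (m := m) ((-(k : ℤ)) • Pi.single (Sum.inr p) 1) =
      mono ((-(k : ℤ) - 1) • Pi.single (Sum.inr p) 1) * y p := h2
    rw [h1', h2'] at ih
    have := Ideal.mul_mem_left _ (mono (-Pi.single (Sum.inl i) 1)) (Ideal.add_mem _ ih
      (Ideal.mul_mem_left _ (mono ((-(k : ℤ) - 1) • Pi.single (Sum.inr p) 1)) hyx))
    convert this using 1
    linear_combination (mono ((-(k : ℤ) - 1) • Pi.single (Sum.inr p) 1) -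
      mono ((-(k : ℤ) - 1) • Pi.single (Sum.inl i) 1) : LaurentRing n m) * hxinv

theorem sub_merge_mem (i : Fin n) (p : Fin m) (f : LaurentRing n m) :
    f - merge i p f ∈ Ideal.span {(y p - x i : LaurentRing n m)} := by
  induction f using AddMonoidAlgebra.induction_linear with
  | zero => simp
  | add f g hf hg =>
    rw [map_add, add_sub_add_comm]
    exact Ideal.add_mem _ hf hg
  | single w c =>
    rw [merge_single]
    have h1 : (AddMonoidAlgebra.single w c : LaurentRing n m) - AddMonoidAlgebra.single (mergeWt i p w) c =
        AddMonoidAlgebra.single (w - w (Sum.inl i) • Pi.single (Sum.inl i) 1) c *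
        (mono (w (Sum.inl i) • Pi.single (Sum.inl i) 1) -
          mono (w (Sum.inl i) • Pi.single (Sum.inr p) 1)) := by
      rw [mul_sub, mono, mono, AddMonoidAlgebra.single_mul_single,
        AddMonoidAlgebra.single_mul_single, mul_one, sub_add_cancel]
      congr 2
      ext j
      by_cases h1 : j = Sum.inl i
      · subst h1; simp [mergeWt]
      · by_cases h2 : j = Sum.inr p
        · subst h2; simp [mergeWt]
        · simp [mergeWt, h1, h2]
    rw [h1]
    exact Ideal.mul_mem_left _ _ (mono_zsmul_sub_mem i p _)

/-- Every f is congruent to its image under x_i ↦ y_p modulo y_p - x_i. Divisibility thus becomes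
the vanishing of a ring homomorphism, which can also be tested after extending scalars to ℂ. -/
theorem mem_span_sub_iff (i : Fin n) (p : Fin m) (f : LaurentRing n m) :
    f ∈ Ideal.span {(y p - x i : LaurentRing n m)} ↔ merge i p f = 0 := by
  constructor
  · intro hf
    obtain ⟨g, rfl⟩ := Ideal.mem_span_singleton.1 hf
    rw [map_mul, map_sub, merge_y, merge_x_self, sub_self, zero_mul]
  · intro hf
    simpa [hf] using sub_merge_mem i p f

/-- This is the chain rule. The divisibility condition of J₀₀ therefore says that after x_i = y_p =
t the result does not depend on t. -/
theorem merge_euler (i : Fin n) (p : Fin m) (f : LaurentRing n m) :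
    merge i p (euler (Sum.inr p) f + euler (Sum.inl i) f) = euler (Sum.inr p) (merge i p f) := by
  induction f using AddMonoidAlgebra.induction_linear with
  | zero => simp [euler_zero]
  | add f g hf hg =>
    rw [euler_add, euler_add, add_add_add_comm, map_add, hf, hg, map_add, euler_add]
  | single w c =>
    rw [euler_single, euler_single, ← AddMonoidAlgebra.single_add, merge_single, merge_single,
      euler_single]
    congr 1
    simp [mergeWt]; ring

theorem euler_inl_merge (i : Fin n) (p : Fin m) (f : LaurentRing n m) :
    euler (Sum.inl i) (merge i p f) = 0 := by
  induction f using AddMonoidAlgebra.induction_linear with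
  | zero => simp [euler_zero]
  | add f g hf hg => rw [map_add, euler_add, hf, hg, add_zero]
  | single w c => rw [merge_single, euler_single]; simp [mergeWt]

theorem y_ne_y {i j : Fin m} (hij : i ≠ j) : (y i : LaurentRing n m) ≠ y j := by
  intro h0
  rw [y, y, mono, mono, AddMonoidAlgebra.single_left_inj one_ne_zero] at h0
  have h1 := congrFun h0 (Sum.inr i)
  simp [hij] at h1

theorem x_ne_y (i : Fin n) (p : Fin m) : (x i : LaurentRing n m) ≠ y p := by
  intro h0
  rw [x, y, mono, mono, AddMonoidAlgebra.single_left_inj one_ne_zero] at h0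
  have h1 := congrFun h0 (Sum.inl i)
  simp at h1

/-- The factors x_i - y_p are split off one at a time. A factor already removed stays nonzero under
the substitution for a different pair, so in a domain the remaining cofactor must vanish there. -/
theorem resultant_dvd {f : LaurentRing n m} (hf : ∀ i p, merge i p f = 0) :
    resultant n m ∣ f := by
  classical
  have key : ∀ s : Finset (Fin n × Fin m), (∏ a ∈ s, (x a.1 - y a.2 : LaurentRing n m)) ∣ f := by
    intro s
    induction s using Finset.induction_on with
    | empty => simp
    | insert a s ha ih =>
      obtain ⟨g, hg⟩ := ih
      have h1 := hf a.1 a.2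
      rw [hg, map_mul, map_prod, mul_eq_zero, Finset.prod_eq_zero_iff] at h1
      have h2 : merge a.1 a.2 g = 0 := by
        refine h1.resolve_left ?_
        rintro ⟨b, hb, hb0⟩
        rw [map_sub, merge_y, sub_eq_zero] at hb0
        by_cases hi : b.1 = a.1
        · rw [hi, merge_x_self] at hb0
          have : a.2 = b.2 := by
            by_contra hne; exact y_ne_y hne hb0
          exact ha (by rwa [show a = b from Prod.ext hi.symm this])
        · rw [merge_x_of_ne _ hi] at hb0
          exact x_ne_y _ _ hb0
      obtain ⟨g', hg'⟩ := Ideal.mem_span_singleton.1 ((mem_span_sub_iff _ _ _).2 h2)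
      rw [Finset.prod_insert ha]
      refine ⟨-g', ?_⟩
      rw [hg, hg']; ring
  have := key Finset.univ
  rwa [← Finset.univ_product_univ, Finset.prod_product] at this

theorem permAct_resultant (σ : Equiv.Perm (Fin n)) (τ : Equiv.Perm (Fin m)) :
    permAct σ τ (resultant n m) = resultant n m := by
  simp only [resultant, map_prod, map_sub, permAct_x, permAct_y]
  rw [Equiv.prod_comp σ fun i => ∏ p, (x i - y (τ p) : LaurentRing n m)]
  refine Finset.prod_congr rfl fun i _ => ?_
  rw [Equiv.prod_comp τ fun p => (x i - y p : LaurentRing n m)]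

theorem resultant_ne_zero : resultant n m ≠ 0 :=
  Finset.prod_ne_zero_iff.2 fun i _ => Finset.prod_ne_zero_iff.2 fun p _ =>
    sub_ne_zero.2 (x_ne_y i p)

/-- An element of `J₀₀` that vanishes under all substitutions `xᵢ ↦ y_p` is a combination of the
generators. -/
theorem mem_genRing_of_merge {f : LaurentRing n m} (hf : ∀ σ τ, permAct σ τ f = f)
    (hf' : ∀ i p, merge i p f = 0) : f ∈ genRing n m := by
  obtain ⟨g, rfl⟩ := resultant_dvd hf'
  refine resultant_mul_mem fun σ τ => ?_
  have := hf σ τ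
  rw [map_mul, permAct_resultant] at this
  exact mul_left_cancel₀ resultant_ne_zero this

/-- The map of lattices that forgets the exponents of `x₀` and `y₀`. -/
def dropWt : Wt (n + 1) (m + 1) →+ Wt n m where
  toFun w := Sum.elim (fun i => w (Sum.inl i.succ)) (fun p => w (Sum.inr p.succ))
  map_zero' := by ext j; cases j <;> simp
  map_add' v w := by ext j; cases j <;> simp

/-- The map of lattices that inserts zero exponents for `x₀` and `y₀`. -/
def consWt : Wt n m →+ Wt (n + 1) (m + 1) where
  toFun w := Sum.elim (Fin.cons 0 fun i => w (Sum.inl i)) (Fin.cons 0 fun p => w (Sum.inr p))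
  map_zero' := by ext j; rcases j with j | j <;> refine Fin.cases ?_ (fun j => ?_) j <;> simp
  map_add' v w := by ext j; rcases j with j | j <;> refine Fin.cases ?_ (fun j => ?_) j <;> simp

/-- The substitution `x₀, y₀ ↦ 1`. -/
def res (n m : ℕ) : LaurentRing (n + 1) (m + 1) →ₐ[ℤ] LaurentRing n m :=
  AddMonoidAlgebra.mapDomainAlgHom ℤ ℤ dropWt

theorem res_single (w : Wt (n + 1) (m + 1)) (c : ℤ) :
    res n m (AddMonoidAlgebra.single w c) = AddMonoidAlgebra.single (dropWt w) c :=
  mapDomain_single' _ _ _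

theorem dropWt_single_inl_succ (i : Fin n) (c : ℤ) :
    dropWt (m := m) (Pi.single (Sum.inl i.succ) c) = Pi.single (Sum.inl i) c := by
  ext j; cases j <;> simp [dropWt, Pi.single_apply]

theorem dropWt_single_inr_succ (p : Fin m) (c : ℤ) :
    dropWt (n := n) (Pi.single (Sum.inr p.succ) c) = Pi.single (Sum.inr p) c := by
  ext j; cases j <;> simp [dropWt, Pi.single_apply]

theorem res_x_succ (i : Fin n) : res n m (x i.succ) = x i := by
  rw [x, mono, res_single, dropWt_single_inl_succ]; rfl

theorem res_y_succ (p : Fin m) : res n m (y p.succ) = y p := by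
  rw [y, mono, res_single, dropWt_single_inr_succ]; rfl

theorem res_x_zero : res n m (x 0) = 1 := by
  rw [x, mono, res_single, ← mono_zero, mono]
  congr 1
  ext j; cases j <;> simp [dropWt]

theorem res_y_zero : res n m (y 0) = 1 := by
  rw [y, mono, res_single, ← mono_zero, mono]
  congr 1
  ext j; cases j <;> simp [dropWt]

theorem res_euler_inl (i : Fin n) (f : LaurentRing (n + 1) (m + 1)) :
    res n m (euler (Sum.inl i.succ) f) = euler (Sum.inl i) (res n m f) := by
  induction f using AddMonoidAlgebra.induction_linear with
  | zero => simp [euler_zero]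
  | add f g hf hg => rw [euler_add, map_add, hf, hg, map_add, euler_add]
  | single w c => rw [euler_single, res_single, res_single, euler_single]; rfl

theorem res_euler_inr (p : Fin m) (f : LaurentRing (n + 1) (m + 1)) :
    res n m (euler (Sum.inr p.succ) f) = euler (Sum.inr p) (res n m f) := by
  induction f using AddMonoidAlgebra.induction_linear with
  | zero => simp [euler_zero]
  | add f g hf hg => rw [euler_add, map_add, hf, hg, map_add, euler_add]
  | single w c => rw [euler_single, res_single, res_single, euler_single]; rfl

/-- `Equiv.Perm.decomposeFin.symm (0, σ)` extends σ by fixing the index 0, so it commutes with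
dropping that index. -/
theorem res_permAct (σ : Equiv.Perm (Fin n)) (τ : Equiv.Perm (Fin m))
    (f : LaurentRing (n + 1) (m + 1)) :
    res n m (permAct (Equiv.Perm.decomposeFin.symm (0, σ)) (Equiv.Perm.decomposeFin.symm (0, τ)) f) =
      permAct σ τ (res n m f) := by
  have hσ : ∀ {k : ℕ} (σ : Equiv.Perm (Fin k)) (i : Fin k),
      (Equiv.Perm.decomposeFin.symm (0, σ)).symm i.succ = (σ.symm i).succ := by
    intro k σ i
    rw [Equiv.symm_apply_eq, Equiv.Perm.decomposeFin_symm_apply_succ]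
    simp
  induction f using AddMonoidAlgebra.induction_linear with
  | zero => simp
  | add f g hf hg => rw [map_add, map_add, hf, hg, map_add, map_add]
  | single w c =>
    rw [permAct, permAct, AddMonoidAlgebra.domCongr_single, res_single, res_single,
      AddMonoidAlgebra.domCongr_single]
    congr 1
    ext j
    cases j <;> simp [dropWt, permWt, hσ]

theorem res_mem {f : LaurentRing (n + 1) (m + 1)} (hf : f ∈ J00 (n + 1) (m + 1)) :
    res n m f ∈ J00 n m := by
  refine ⟨fun σ τ => by rw [← res_permAct, hf.1], fun i p => ?_⟩
  have := Ideal.mem_map_of_mem (res n m) (hf.2 i.succ p.succ)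
  rwa [Ideal.map_span, Set.image_singleton, map_sub, map_add, res_euler_inl, res_euler_inr,
    res_x_succ, res_y_succ] at this

/-- At x_0 = y_0 = 1 numerator and denominator both acquire the factor 1 - t, which cancels. -/
theorem res_chi : PowerSeries.map (res n m : LaurentRing (n + 1) (m + 1) →+* LaurentRing n m)
    (chi (n + 1) (m + 1)) = chi n m := by
  have h1 := congrArg (PowerSeries.map (res n m : LaurentRing (n + 1) (m + 1) →+* LaurentRing n m))
    (prod_mul_chi (n + 1) (m + 1))
  have hX : ∀ a : LaurentRing (n + 1) (m + 1),
      PowerSeries.map (res n m : LaurentRing (n + 1) (m + 1) →+* LaurentRing n m)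
        (1 - PowerSeries.C a * PowerSeries.X) = 1 - PowerSeries.C (res n m a) * PowerSeries.X := by
    intro a; simp
  rw [map_mul, map_prod, map_prod, Fin.prod_univ_succ, Fin.prod_univ_succ] at h1
  simp only [hX, res_x_zero, res_y_zero, res_x_succ, res_y_succ] at h1
  rw [mul_assoc] at h1
  have hne : ∀ p : PowerSeries (LaurentRing n m), PowerSeries.constantCoeff p = 1 → p ≠ 0 := by
    rintro p hp rfl
    simp at hp
  have h2 := mul_left_cancel₀ (hne _ (by simp)) h1
  rw [← prod_mul_chi] at h2
  exact mul_left_cancel₀ (hne _ (constantCoeff_prod_one_sub _ _)) h2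

theorem res_h (k : ℕ) : res n m (h (n + 1) (m + 1) k) = h n m k := by
  rw [h, h, ← res_chi (n := n) (m := m), PowerSeries.coeff_map]; rfl

theorem res_invAct (f : LaurentRing (n + 1) (m + 1)) :
    res n m (invAct f) = invAct (res n m f) := by
  induction f using AddMonoidAlgebra.induction_linear with
  | zero => simp
  | add f g hf hg => rw [map_add, map_add, hf, hg, map_add, map_add]
  | single w c =>
    rw [invAct, invAct, AddMonoidAlgebra.domCongr_single, res_single, res_single,
      AddMonoidAlgebra.domCongr_single]
    congr 1
    ext j; cases j <;> simp [dropWt]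

/-- Each generator is the specialization of the generator of the same name in higher rank. The
induction uses this to lift elements obtained in lower rank. -/
theorem genRing_le_map_res : genRing n m ≤ (genRing (n + 1) (m + 1)).map (res n m).toRingHom := by
  rw [genRing, Subring.closure_le]
  rintro f (((rfl | rfl) | ⟨k, rfl⟩) | ⟨k, rfl⟩)
  · refine ⟨_, Delta_mem, ?_⟩
    change res n m _ = _
    rw [Delta, mono, res_single]
    congr 1
  · refine ⟨_, DeltaStar_mem, ?_⟩
    change res n m _ = _
    rw [DeltaStar, mono, res_single]
    congr 1
  · exact ⟨_, h_mem k, res_h k⟩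
  · refine ⟨_, hStar_mem k, ?_⟩
    change res n m _ = _
    rw [hStar, res_invAct, res_h]; rfl

theorem res_merge (f : LaurentRing (n + 1) (m + 1)) : res n m (merge 0 0 f) = res n m f := by
  induction f using AddMonoidAlgebra.induction_linear with
  | zero => simp
  | add f g hf hg => rw [map_add, map_add, hf, hg, map_add]
  | single w c =>
    rw [merge_single, res_single, res_single]
    congr 1

/-- For an element of J₀₀ the substitution x_0 = y_0 = t gives something independent of t, so its
value is already seen at t = 1. Symmetry carries the vanishing from the pair (0, 0) to all pairs. -/
theorem merge_eq_zero_of_res {f : LaurentRing (n + 1) (m + 1)} (hf : f ∈ J00 (n + 1) (m + 1))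
    (h0 : res n m f = 0) (i : Fin (n + 1)) (p : Fin (m + 1)) : merge i p f = 0 := by
  have h1 : merge 0 0 f = 0 := by
    have e1 : euler (Sum.inr 0) (merge 0 0 f) = 0 := by
      rw [← merge_euler, ← mem_span_sub_iff]; exact hf.2 0 0
    have e2 := euler_inl_merge 0 0 f
    rw [euler_eq_zero_iff] at e1 e2
    -- No exponent of x_0 or y_0 survives, so setting these variables to 1 loses nothing and is
    -- undone by `consWt`.
    have e3 : merge 0 0 f = AddMonoidAlgebra.mapDomainAlgHom ℤ ℤ consWt (res n m (merge 0 0 f)) := by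
      conv_lhs => rw [← AddMonoidAlgebra.sum_coeff_single (merge 0 0 f)]
      conv_rhs => rw [← AddMonoidAlgebra.sum_coeff_single (merge 0 0 f)]
      rw [Finsupp.sum, map_sum, map_sum]
      refine Finset.sum_congr rfl fun w hw => ?_
      rw [res_single, mapDomain_single']
      congr 1
      have hw' := Finsupp.mem_support_iff.1 hw
      ext j
      rcases j with j | j <;> refine Fin.cases ?_ (fun j => ?_) j
      · simpa [consWt] using e2 w hw'
      · simp [consWt, dropWt]
      · simpa [consWt] using e1 w hw'
      · simp [consWt, dropWt]
    rw [e3, res_merge, h0, map_zero]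
  rw [← mem_span_sub_iff, Ideal.mem_span_singleton] at h1 ⊢
  obtain ⟨g, hg⟩ := h1
  refine ⟨permAct (Equiv.swap 0 i) (Equiv.swap 0 p) g, ?_⟩
  conv_lhs => rw [← hf.1 (Equiv.swap 0 i) (Equiv.swap 0 p), hg]
  rw [map_mul, map_sub, permAct_x, permAct_y, Equiv.swap_apply_left, Equiv.swap_apply_left]

/-- Every element of `J₀₀` is a polynomial in `Δ`, `Δ*`, `h_k` and `h_k*`. -/
theorem J00_le_genRing (hR : ∀ n m, genRing n m ≤ J00 n m) (n m : ℕ) : J00 n m ≤ genRing n m := by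
  induction n generalizing m with
  -- Without x's or without y's the product ∏(x_i - y_p) is empty, and every invariant is covered
  -- without induction.
  | zero => intro f hf; exact mem_genRing_of_merge hf.1 fun i => i.elim0
  | succ n ih =>
    cases m with
    | zero => intro f hf; exact mem_genRing_of_merge hf.1 fun _ p => p.elim0
    | succ m =>
      intro f hf
      -- Subtracting a lift `r` of the specialization reduces to an element that vanishes at x_0 =
      -- y_0 = 1; that the difference is still in J₀₀ needs `hR`.
      obtain ⟨r, hr, hr'⟩ := genRing_le_map_res (ih m (res_mem hf))
      have h1 : f - r ∈ J00 (n + 1) (m + 1) := Subring.sub_mem _ hf (hR _ _ hr)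
      have h2 : res n m (f - r) = 0 := by rw [map_sub, sub_eq_zero]; exact hr'.symm
      have := mem_genRing_of_merge h1.1 (merge_eq_zero_of_res h1 h2)
      simpa using (genRing (n + 1) (m + 1)).add_mem this hr

end Restriction

/-! ### Superalgebras and supergroup elements -/

section SuperAlgebra

theorem zmod_two_cases (e : ZMod 2) : e = 0 ∨ e = 1 := by revert e; decide

/-- A two-term direct sum decomposition compatible with products is a grading by `ℤ/2`. -/
abbrev gradedOfIsCompl {B : Type} [Ring B] [Algebra ℂ B] (𝒢 : ZMod 2 → Submodule ℂ B)
    (hc : IsCompl (𝒢 0) (𝒢 1)) (h1 : (1 : B) ∈ 𝒢 0)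
    (hm : ∀ (d e : ZMod 2) (a b : B), a ∈ 𝒢 d → b ∈ 𝒢 e → a * b ∈ 𝒢 (d + e)) : GradedAlgebra 𝒢 :=
  { (DirectSum.IsInternal.chooseDecomposition 𝒢
      ((DirectSum.isInternal_submodule_iff_isCompl 𝒢 (i := 0) (j := 1) (by decide)
        (by ext e; simpa using zmod_two_cases e)).2 hc)) with
    one_mem := h1
    mul_mem := fun {d e a b} ha hb => hm d e a b ha hb }

namespace SuperAlg

variable (A B : SuperAlg)

theorem isCompl_grading : IsCompl (A.grading 0) (A.grading 1) :=
  (DirectSum.isInternal_submodule_iff_isCompl A.grading (i := 0) (j := 1) (by decide)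
    (by ext e; simpa using zmod_two_cases e)).1 (DirectSum.Decomposition.isInternal A.grading)

theorem exists_eq_add (a : A) : ∃ b ∈ A.grading 0, ∃ c ∈ A.grading 1, a = b + c := by
  have : a ∈ A.grading 0 ⊔ A.grading 1 := by rw [A.isCompl_grading.sup_eq_top]; trivial
  obtain ⟨b, hb, c, hc, h⟩ := Submodule.mem_sup.1 this
  exact ⟨b, hb, c, hc, h.symm⟩

theorem eq_zero_of_mem {a : A} (h0 : a ∈ A.grading 0) (h1 : a ∈ A.grading 1) : a = 0 :=
  (Submodule.disjoint_def.1 A.isCompl_grading.disjoint) a h0 h1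

theorem algebraMap_mem (c : ℂ) : algebraMap ℂ A c ∈ A.grading 0 := by
  rw [Algebra.algebraMap_eq_smul_one]
  exact Submodule.smul_mem _ _ (SetLike.one_mem_graded _)

variable {A B}

/-- The parity automorphism, as a linear map. -/
def involLin (A : SuperAlg) : A →ₗ[ℂ] A :=
  (A.grading 0).projectionOnto (A.grading 1) A.isCompl_grading |> fun f =>
    (2 : ℂ) • ((A.grading 0).subtype ∘ₗ f) - LinearMap.id

theorem involLin_of_mem {e : ZMod 2} {a : A} (ha : a ∈ A.grading e) :
    A.involLin a = sgn e • a := by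
  rcases zmod_two_cases e with rfl | rfl
  · have : ((A.grading 0).projectionOnto (A.grading 1) A.isCompl_grading) a = ⟨a, ha⟩ :=
      Submodule.projectionOnto_apply_left _ ⟨a, ha⟩
    simp [involLin, this, sgn, two_smul]
  · have : ((A.grading 0).projectionOnto (A.grading 1) A.isCompl_grading) a = 0 :=
      Submodule.projectionOnto_apply_right _ ⟨a, ha⟩
    simp [involLin, this, sgn]

/-- The parity automorphism `a ↦ (-1)^{|a|} a`. -/
def invol (A : SuperAlg) : A →ₐ[ℂ] A :=
  AlgHom.ofLinearMap A.involLin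
    (by simpa [sgn] using involLin_of_mem (A := A) (e := 0) (SetLike.one_mem_graded _))
    (by
      have key : ∀ {d e : ZMod 2} {a b : A}, a ∈ A.grading d → b ∈ A.grading e →
          A.involLin (a * b) = A.involLin a * A.involLin b := by
        intro d e a b ha hb
        rw [involLin_of_mem ha, involLin_of_mem hb, involLin_of_mem (SetLike.mul_mem_graded ha hb),
          sgn_add, smul_mul_smul_comm]
      intro a b
      obtain ⟨a0, ha0, a1, ha1, rfl⟩ := A.exists_eq_add a
      obtain ⟨b0, hb0, b1, hb1, rfl⟩ := A.exists_eq_add b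
      simp only [map_add, add_mul, mul_add, key ha0 hb0, key ha0 hb1, key ha1 hb0, key ha1 hb1])

theorem invol_of_mem {e : ZMod 2} {a : A} (ha : a ∈ A.grading e) : A.invol a = sgn e • a :=
  involLin_of_mem ha

theorem sgn_mul_self (e : ZMod 2) : sgn e * sgn e = 1 := by revert e; decide

theorem invol_invol (a : A) : A.invol (A.invol a) = a := by
  obtain ⟨a0, ha0, a1, ha1, rfl⟩ := A.exists_eq_add a
  simp only [map_add, invol_of_mem ha0, invol_of_mem ha1, map_zsmul, smul_smul, sgn_mul_self,
    one_smul]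

/-- The parity automorphism as a homomorphism of superalgebras. -/
def involHom (A : SuperAlg) : A.Hom A :=
  ⟨A.invol, fun e a ha => by rw [invol_of_mem ha]; exact zsmul_mem ha _⟩

/-- Odd elements move past arbitrary elements by the parity automorphism. -/
theorem odd_mul {b : A} (hb : b ∈ A.grading 1) (a : A) : b * a = A.invol a * b := by
  obtain ⟨a0, ha0, a1, ha1, rfl⟩ := A.exists_eq_add a
  rw [map_add, invol_of_mem ha0, invol_of_mem ha1, mul_add, add_mul, A.comm_odd b hb a1 ha1,
    ← A.comm_even a0 ha0 b]
  simp [sgn]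

variable (A) in
/-- The even part of a superalgebra. -/
def even : Subalgebra ℂ A where
  carrier := A.grading 0
  mul_mem' := fun ha hb => by simpa using SetLike.mul_mem_graded ha hb
  add_mem' := fun ha hb => Submodule.add_mem _ ha hb
  algebraMap_mem' := A.algebraMap_mem

instance : CommRing A.even :=
  { (inferInstance : Ring A.even) with
    mul_comm := fun a _ => Subtype.ext (A.comm_even _ a.2 _) }

/-- The inclusion of the even part. -/
def evenHom (A : SuperAlg) : (SuperAlg.ofComm A.even).Hom A :=
  ⟨A.even.val, fun e a ha => by
    rcases zmod_two_cases e with rfl | rfl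
    · exact a.2
    · have h0 : a = 0 := by simpa [evenGrading] using ha
      rw [h0, map_zero]; exact Submodule.zero_mem _⟩

/-- Homomorphisms of commutative algebras are homomorphisms of superalgebras. -/
def ofCommHom {R S : Type} [CommRing R] [Algebra ℂ R] [CommRing S] [Algebra ℂ S] (f : R →ₐ[ℂ] S) :
    (SuperAlg.ofComm R).Hom (SuperAlg.ofComm S) :=
  ⟨f, fun e a ha => by
    change a ∈ evenGrading R e at ha
    change f a ∈ evenGrading S e
    rcases zmod_two_cases e with rfl | rfl
    · simp [evenGrading]
    · have h0 : a = 0 := by simpa [evenGrading] using ha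
      rw [h0, map_zero]; exact Submodule.zero_mem _⟩

/-- The structure map `ℂ → A`. -/
def scalarHom (A : SuperAlg) : (SuperAlg.ofComm ℂ).Hom A :=
  ⟨Algebra.ofId ℂ A, fun e a ha => by
    change a ∈ evenGrading ℂ e at ha
    rcases zmod_two_cases e with rfl | rfl
    · exact A.algebraMap_mem a
    · have h0 : a = 0 := by simpa [evenGrading] using ha
      rw [h0, map_zero]; exact Submodule.zero_mem _⟩

/-- The underlying algebra of `A[θ]`, `θ` odd: `a + bθ` is represented by the matrix with rows
`(a, b)` and `(0, (-1)^{|a|} a)`. -/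
def oddSubalg (A : SuperAlg) : Subalgebra ℂ (Matrix (Fin 2) (Fin 2) A) where
  carrier := {M | M 1 0 = 0 ∧ M 1 1 = A.invol (M 0 0)}
  mul_mem' := by
    rintro M N ⟨h1, h2⟩ ⟨h3, h4⟩
    constructor
    · simp [Matrix.mul_apply, Fin.sum_univ_two, h1, h3]
    · simp [Matrix.mul_apply, Fin.sum_univ_two, h1, h2, h3, h4]
  add_mem' := by
    rintro M N ⟨h1, h2⟩ ⟨h3, h4⟩
    exact ⟨by simp [h1, h3], by simp [h2, h4]⟩
  algebraMap_mem' c := by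
    constructor <;> simp [Matrix.algebraMap_matrix_apply]

/-- The element `a + bθ`. -/
def oddMk (a b : A) : A.oddSubalg := ⟨!![a, b; 0, A.invol a], by simp [oddSubalg]⟩

theorem oddMk_surj (M : A.oddSubalg) : M = oddMk (M.1 0 0) (M.1 0 1) := by
  obtain ⟨M, h1, h2⟩ := M
  refine Subtype.ext (Matrix.ext fun i j => ?_)
  fin_cases i <;> fin_cases j <;> simp [oddMk, h1, h2]

/-- The matrix model encodes θ a' = (-1)^{|a'|} a' θ and θ² = 0. -/
theorem oddMk_mul (a b a' b' : A) :
    oddMk a b * oddMk a' b' = oddMk (a * a') (a * b' + b * A.invol a') := by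
  refine Subtype.ext ?_
  simp [oddMk]

theorem oddMk_add (a b a' b' : A) : oddMk a b + oddMk a' b' = oddMk (a + a') (b + b') := by
  refine Subtype.ext ?_
  simp [oddMk]

theorem oddMk_smul (c : ℂ) (a b : A) : c • oddMk a b = oddMk (c • a) (c • b) := by
  refine Subtype.ext ?_
  simp [oddMk]

theorem oddMk_one : oddMk (1 : A) 0 = 1 := by
  refine Subtype.ext ?_
  simp [oddMk, Matrix.one_fin_two]

theorem oddMk_zero : oddMk (0 : A) 0 = 0 := by
  refine Subtype.ext ?_
  ext i j; fin_cases i <;> fin_cases j <;> simp [oddMk]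

theorem oddMk_inj {a b a' b' : A} (h : oddMk a b = oddMk a' b') : a = a' ∧ b = b' := by
  have h1 := congrArg Subtype.val h
  exact ⟨by simpa [oddMk] using congrFun (congrFun h1 0) 0,
    by simpa [oddMk] using congrFun (congrFun h1 0) 1⟩

/-- The grading of `A[θ]`. -/
def oddGrading (A : SuperAlg) (e : ZMod 2) : Submodule ℂ A.oddSubalg where
  carrier := {M | M.1 0 0 ∈ A.grading e ∧ M.1 0 1 ∈ A.grading (e + 1)}
  add_mem' := fun ⟨h1, h2⟩ ⟨h3, h4⟩ => ⟨Submodule.add_mem _ h1 h3, Submodule.add_mem _ h2 h4⟩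
  zero_mem' := ⟨Submodule.zero_mem _, Submodule.zero_mem _⟩
  smul_mem' := fun c _ ⟨h1, h2⟩ => ⟨Submodule.smul_mem _ c h1, Submodule.smul_mem _ c h2⟩

theorem oddMk_mem {e : ZMod 2} {a b : A} (ha : a ∈ A.grading e) (hb : b ∈ A.grading (e + 1)) :
    oddMk a b ∈ A.oddGrading e := ⟨by simpa [oddMk] using ha, by simpa [oddMk] using hb⟩

instance : GradedAlgebra A.oddGrading :=
  gradedOfIsCompl A.oddGrading
    (by
      constructor
      · rw [Submodule.disjoint_def]
        rintro M ⟨h1, h2⟩ ⟨h3, h4⟩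
        rw [oddMk_surj M, A.eq_zero_of_mem h1 h3, A.eq_zero_of_mem h4 h2, oddMk_zero]
      · rw [codisjoint_iff, eq_top_iff]
        intro M _
        obtain ⟨a0, ha0, a1, ha1, ha⟩ := A.exists_eq_add (M.1 0 0)
        obtain ⟨b0, hb0, b1, hb1, hb⟩ := A.exists_eq_add (M.1 0 1)
        rw [oddMk_surj M, ha, hb, add_comm b0 b1, ← oddMk_add]
        exact Submodule.add_mem_sup (oddMk_mem ha0 hb1) (oddMk_mem ha1 hb0))
    (by
      rw [← oddMk_one]
      exact oddMk_mem (SetLike.one_mem_graded _) (Submodule.zero_mem _))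
    (by
      rintro d e M N ⟨h1, h2⟩ ⟨h3, h4⟩
      rw [oddMk_surj M, oddMk_surj N, oddMk_mul]
      refine oddMk_mem (SetLike.mul_mem_graded h1 h3) (Submodule.add_mem _ ?_ ?_)
      · have := SetLike.mul_mem_graded h1 h4
        rwa [← add_assoc] at this
      · rw [invol_of_mem h3]
        have := SetLike.mul_mem_graded h2 (zsmul_mem h3 (sgn e))
        rwa [show d + 1 + e = d + e + 1 by ring] at this)

/-- The superalgebra `A[θ]` with `θ` an odd variable. -/
def adjoinOdd (A : SuperAlg) : SuperAlg where
  carrier := A.oddSubalg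
  grading := A.oddGrading
  comm_even M hM N := by
    obtain ⟨h1, h2⟩ := hM
    rw [oddMk_surj M, oddMk_surj N, oddMk_mul, oddMk_mul]
    congr 1
    · exact A.comm_even _ h1 _
    · rw [zero_add] at h2
      rw [invol_of_mem h1, odd_mul h2, invol_invol, A.comm_even _ h1]
      simp [sgn, add_comm]
  comm_odd M hM N hN := by
    obtain ⟨h1, h2⟩ := hM
    obtain ⟨h3, h4⟩ := hN
    have e11 : (1 : ZMod 2) + 1 = 0 := by decide
    rw [e11] at h2 h4
    have hneg : ∀ a b : A, -oddMk a b = oddMk (-a) (-b) := fun a b => by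
      simpa using oddMk_smul (-1) a b
    rw [oddMk_surj M, oddMk_surj N, oddMk_mul, oddMk_mul, hneg]
    congr 1
    · exact A.comm_odd _ h1 _ h3
    · rw [invol_of_mem h1, invol_of_mem h3, A.comm_even _ h2, ← A.comm_even _ h4]
      simp [sgn, add_comm]

/-- The odd variable `θ`. -/
def theta (A : SuperAlg) : A.adjoinOdd := (oddMk 0 1 : A.oddSubalg)

theorem theta_mem : A.theta ∈ A.adjoinOdd.grading 1 := by
  refine oddMk_mem (Submodule.zero_mem _) ?_
  rw [show (1 : ZMod 2) + 1 = 0 by decide]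
  exact SetLike.one_mem_graded _

/-- The inclusion `A → A[θ]`. -/
def adjoinOddIncl (A : SuperAlg) : A.Hom A.adjoinOdd :=
  ⟨(AlgHom.ofLinearMap
      { toFun := fun a => oddMk a 0
        map_add' := fun a b => by rw [oddMk_add, add_zero]
        map_smul' := fun c a => by rw [RingHom.id_apply, oddMk_smul, smul_zero] }
      oddMk_one (fun a b => by
        change oddMk _ _ = oddMk _ _ * oddMk _ _
        rw [oddMk_mul]; simp) : A →ₐ[ℂ] A.oddSubalg),
    fun e a ha => oddMk_mem ha (Submodule.zero_mem _)⟩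

theorem theta_mul (a : A) :
    A.theta * A.adjoinOddIncl.toAlgHom a = (oddMk 0 (A.invol a) : A.oddSubalg) := by
  exact (oddMk_mul (0 : A) 1 a 0).trans (by simp)

/-- The θ-coefficient of θa is the parity twist of a, and the twist is an involution. This is the
device that strips odd parameters from identities. -/
theorem eq_zero_of_theta_mul {a : A} (h : A.theta * A.adjoinOddIncl.toAlgHom a = 0) : a = 0 := by
  rw [theta_mul] at h
  have h1 := (oddMk_inj (h.trans oddMk_zero.symm)).2
  rw [← A.invol_invol a, h1, map_zero]

/-- The homomorphism `ℂ[θ] → A` that sends `θ` to an odd element `β`. -/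
def thetaEval {β : A} (hβ : β ∈ A.grading 1) : (SuperAlg.ofComm ℂ).adjoinOdd.Hom A :=
  ⟨(AlgHom.ofLinearMap
      { toFun := fun M : (SuperAlg.ofComm ℂ).oddSubalg =>
          algebraMap ℂ A (M.1 0 0 : ℂ) + algebraMap ℂ A (M.1 0 1 : ℂ) * β
        map_add' := fun M N => by
          change algebraMap ℂ A ((M.1 0 0 : ℂ) + (N.1 0 0 : ℂ)) +
            algebraMap ℂ A ((M.1 0 1 : ℂ) + (N.1 0 1 : ℂ)) * β = _
          rw [map_add, map_add, add_mul]; abel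
        map_smul' := fun c M => by
          change algebraMap ℂ A (c * (M.1 0 0 : ℂ)) + algebraMap ℂ A (c * (M.1 0 1 : ℂ)) * β = _
          rw [map_mul, map_mul, RingHom.id_apply, Algebra.smul_def, mul_add, mul_assoc] }
      (by
        change algebraMap ℂ A (1 : ℂ) + algebraMap ℂ A (0 : ℂ) * β = 1
        simp)
      (fun M N => by
        have hb : β * β = 0 := by
          have h1 := A.comm_odd β hβ β hβ
          have h2 : (2 : ℂ) • (β * β) = 0 := by
            rw [two_smul]; nth_rewrite 1 [h1]; simp
          exact (smul_eq_zero.1 h2).resolve_left two_ne_zero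
        have hinv : (SuperAlg.ofComm ℂ).invol (N.1 0 0) = N.1 0 0 := by
          have : N.1 0 0 ∈ (SuperAlg.ofComm ℂ).grading 0 := by
            change _ ∈ evenGrading ℂ 0
            simp [evenGrading]
          rw [invol_of_mem this]; simp [sgn]
        have hmul : M * N = oddMk (M.1 0 0 * N.1 0 0) (M.1 0 0 * N.1 0 1 + M.1 0 1 * N.1 0 0) := by
          conv_lhs => rw [oddMk_surj M, oddMk_surj N, oddMk_mul, hinv]
        rw [hmul]
        change algebraMap ℂ A ((M.1 0 0 : ℂ) * (N.1 0 0 : ℂ)) +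
            algebraMap ℂ A ((M.1 0 0 : ℂ) * (N.1 0 1 : ℂ) + (M.1 0 1 : ℂ) * (N.1 0 0 : ℂ)) * β =
          (algebraMap ℂ A (M.1 0 0 : ℂ) + algebraMap ℂ A (M.1 0 1 : ℂ) * β) *
            (algebraMap ℂ A (N.1 0 0 : ℂ) + algebraMap ℂ A (N.1 0 1 : ℂ) * β)
        generalize (M.1 0 0 : ℂ) = a
        generalize (M.1 0 1 : ℂ) = b
        generalize (N.1 0 0 : ℂ) = c
        generalize (N.1 0 1 : ℂ) = d
        have h3 : algebraMap ℂ A b * β * (algebraMap ℂ A d * β) = 0 := by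
          rw [mul_assoc, ← mul_assoc β, ← Algebra.commutes d β, mul_assoc, hb]; simp
        rw [add_mul, mul_add, mul_add, h3, mul_assoc (algebraMap ℂ A b), ← Algebra.commutes c β]
        simp only [map_mul, map_add, add_mul, mul_assoc]
        abel) : (SuperAlg.ofComm ℂ).oddSubalg →ₐ[ℂ] A),
    fun e M hM => by
      obtain ⟨h1, h2⟩ := hM
      change (M.1 0 0 : ℂ) ∈ evenGrading ℂ e at h1
      change (M.1 0 1 : ℂ) ∈ evenGrading ℂ (e + 1) at h2
      change algebraMap ℂ A (M.1 0 0 : ℂ) + algebraMap ℂ A (M.1 0 1 : ℂ) * β ∈ _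
      rcases zmod_two_cases e with rfl | rfl
      · have h0 : (M.1 0 1 : ℂ) = 0 := by simpa [evenGrading] using h2
        rw [h0, map_zero, zero_mul, add_zero]
        exact A.algebraMap_mem _
      · have h0 : (M.1 0 0 : ℂ) = 0 := by simpa [evenGrading] using h1
        rw [h0, map_zero, zero_add, ← Algebra.smul_def]
        exact Submodule.smul_mem _ _ hβ⟩

theorem thetaEval_apply {β : A} (hβ : β ∈ A.grading 1) (a b : ℂ) :
    (thetaEval hβ).toAlgHom (oddMk (A := SuperAlg.ofComm ℂ) a b : (SuperAlg.ofComm ℂ).oddSubalg) =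
      algebraMap ℂ A a + algebraMap ℂ A b * β := rfl

end SuperAlg

end SuperAlgebra

/-! ### Weights of representations -/

section Torus

variable {ι : Type} [Fintype ι] [DecidableEq ι]

/-- An element of `GL(p)(A)` given by a matrix and its inverse. -/
def mkSGL {p : ι → ZMod 2} {A : SuperAlg} (M N : Matrix ι ι A) (hM : M ∈ SuperMat p A)
    (hN : N ∈ SuperMat p A) (h1 : M * N = 1) (h2 : N * M = 1) : SGL p A :=
  ⟨⟨M, hM⟩, ⟨N, hN⟩, Subtype.ext h1, Subtype.ext h2⟩

theorem sgl_ext {p : ι → ZMod 2} {A : SuperAlg} {g g' : SGL p A}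
    (hg : (g : SuperMat p A).1 = (g' : SuperMat p A).1) : g = g' := Units.ext (Subtype.ext hg)

theorem val_map {p : ι → ZMod 2} {A B : SuperAlg} (φ : A.Hom B) (g : SGL p A) :
    ((SGL.map p φ g : SGL p B) : SuperMat p B).1 = (g : SuperMat p A).1.map φ.toAlgHom := rfl

theorem val_mul {p : ι → ZMod 2} {A : SuperAlg} (g g' : SGL p A) :
    ((g * g' : SGL p A) : SuperMat p A).1 = (g : SuperMat p A).1 * (g' : SuperMat p A).1 := rfl

variable {n m : ℕ} {R : Type} [CommRing R] [Algebra ℂ R]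

/-- The diagonal matrices over a commutative algebra. -/
def torusR (d : Fin n ⊕ Fin m → Rˣ) : SGL (stdParity n m) (SuperAlg.ofComm R) :=
  mkSGL (Matrix.diagonal fun j => (d j : R)) (Matrix.diagonal fun j => ((d j)⁻¹ : Rˣ).val)
    (diagonal_mem _ _) (diagonal_mem _ _)
    ((Matrix.diagonal_mul_diagonal _ _).trans ((by simp :
      _ = Matrix.diagonal fun _ => (1 : R)).trans Matrix.diagonal_one))
    ((Matrix.diagonal_mul_diagonal _ _).trans ((by simp :
      _ = Matrix.diagonal fun _ => (1 : R)).trans Matrix.diagonal_one))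

theorem torus_eq_torusR (t : Fin n ⊕ Fin m → ℂˣ) : torus t = torusR t := rfl

theorem torusR_mul (d e : Fin n ⊕ Fin m → Rˣ) : torusR (d * e) = torusR d * torusR e := by
  refine sgl_ext ?_
  exact (Matrix.diagonal_mul_diagonal _ _).symm

theorem map_torusR {S : Type} [CommRing S] [Algebra ℂ S] (f : R →ₐ[ℂ] S) (d : Fin n ⊕ Fin m → Rˣ) :
    SGL.map _ (SuperAlg.ofCommHom f) (torusR d) = torusR fun j => Units.map f (d j) := by
  refine sgl_ext ?_
  exact Matrix.diagonal_map (map_zero f)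

/-- The monomial `d^w`. -/
def wpow (d : Fin n ⊕ Fin m → Rˣ) (w : Wt n m) : Rˣ := ∏ j, d j ^ w j

theorem wpow_add (d : Fin n ⊕ Fin m → Rˣ) (v w : Wt n m) : wpow d (v + w) = wpow d v * wpow d w := by
  simp [wpow, zpow_add, Finset.prod_mul_distrib]

theorem wpow_zero (d : Fin n ⊕ Fin m → Rˣ) : wpow d (0 : Wt n m) = 1 := by simp [wpow]

theorem wpow_mul (d e : Fin n ⊕ Fin m → Rˣ) (w : Wt n m) :
    wpow (d * e) w = wpow d w * wpow e w := by
  simp [wpow, mul_zpow, Finset.prod_mul_distrib]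

theorem wpow_one (w : Wt n m) : wpow (1 : Fin n ⊕ Fin m → Rˣ) w = 1 := by simp [wpow]

/-- The coordinate ring of the torus. -/
abbrev TorusRing (n m : ℕ) : Type := AddMonoidAlgebra ℂ (Wt n m)

/-- The universal point of the torus. -/
def zU (j : Fin n ⊕ Fin m) : (TorusRing n m)ˣ where
  val := AddMonoidAlgebra.single (Pi.single j 1) 1
  inv := AddMonoidAlgebra.single (-Pi.single j 1) 1
  val_inv := by rw [AddMonoidAlgebra.single_mul_single, add_neg_cancel, mul_one]; rfl
  inv_val := by rw [AddMonoidAlgebra.single_mul_single, neg_add_cancel, mul_one]; rfl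

/-- Evaluation at a point of the torus. -/
def evalT (d : Fin n ⊕ Fin m → Rˣ) : TorusRing n m →ₐ[ℂ] R :=
  AddMonoidAlgebra.lift ℂ R (Wt n m)
    { toFun := fun w => (wpow d w.toAdd : R)
      map_one' := by simp [wpow_zero]
      map_mul' := fun v w => by simp [wpow_add] }

theorem evalT_single (d : Fin n ⊕ Fin m → Rˣ) (w : Wt n m) (c : ℂ) :
    evalT d (AddMonoidAlgebra.single w c) = c • (wpow d w : R) := by
  simp [evalT]

theorem wpow_single (d : Fin n ⊕ Fin m → Rˣ) (j : Fin n ⊕ Fin m) (k : ℤ) :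
    wpow d (Pi.single j k) = d j ^ k := by
  rw [wpow, Finset.prod_eq_single j]
  · simp
  · intro i _ hi; simp [hi]
  · simp

theorem evalT_zU (d : Fin n ⊕ Fin m → Rˣ) (j : Fin n ⊕ Fin m) : evalT d (zU j).val = d j := by
  rw [zU, evalT_single, wpow_single]; simp

theorem evalT_apply (d : Fin n ⊕ Fin m → Rˣ) (f : TorusRing n m) (s : Finset (Wt n m))
    (hs : f.coeff.support ⊆ s) : evalT d f = ∑ w ∈ s, f.coeff w • (wpow d w : R) := by
  conv_lhs => rw [← AddMonoidAlgebra.sum_coeff_single f, Finsupp.sum, map_sum]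
  simp_rw [evalT_single]
  refine Finset.sum_subset hs fun w _ hw => ?_
  rw [Finsupp.notMem_support_iff.1 hw, zero_smul]

theorem wpow_injective {v w : Wt n m} (h0 : ∀ t : Fin n ⊕ Fin m → ℂˣ, wpow t v = wpow t w) :
    v = w := by
  ext j
  -- The torus point with entry 2 at j and 1 elsewhere isolates the exponent at j, since the powers
  -- of 2 have distinct norms.
  have h1 := congrArg (fun u : ℂˣ => ‖(u : ℂ)‖)
    (h0 (Function.update 1 j (Units.mk0 2 two_ne_zero)))
  have h2 : ∀ u : Wt n m, wpow (Function.update 1 j (Units.mk0 (2 : ℂ) two_ne_zero)) u =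
      Units.mk0 (2 : ℂ) two_ne_zero ^ u j := by
    intro u
    rw [wpow, Finset.prod_eq_single j]
    · simp
    · intro i _ hi; simp [hi]
    · simp
  simp only [h2, Units.val_zpow_eq_zpow_val, Units.val_mk0, norm_zpow, Complex.norm_ofNat] at h1
  exact zpow_right_injective₀ (by norm_num) (by norm_num) h1

theorem wpow_zU (v : Wt n m) :
    (wpow (zU : Fin n ⊕ Fin m → _) v : TorusRing n m) = AddMonoidAlgebra.single v 1 := by
  have hz : ∀ (j : Fin n ⊕ Fin m) (k : ℤ), ((zU j ^ k : (TorusRing n m)ˣ) : TorusRing n m) =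
      AddMonoidAlgebra.single (k • Pi.single j 1) 1 := by
    intro j k
    cases k with
    | ofNat k => simp [zU, AddMonoidAlgebra.single_pow]
    | negSucc k =>
      rw [zpow_negSucc, ← inv_pow]
      change (AddMonoidAlgebra.single (-Pi.single j 1) 1 : TorusRing n m) ^ (k + 1) = _
      rw [AddMonoidAlgebra.single_pow, one_pow, Int.negSucc_eq, neg_smul, smul_neg]
      congr 2
  rw [wpow, Units.coe_prod]
  simp_rw [hz]
  rw [AddMonoidAlgebra.prod_single, Finset.prod_const_one]
  congr 1
  ext j
  rw [Finset.sum_apply]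
  simp [Pi.single_apply]

/-- A Laurent polynomial is determined by its values. -/
theorem eq_zero_of_evalT {f : TorusRing n m} (hf : ∀ t : Fin n ⊕ Fin m → ℂˣ, evalT t f = 0) :
    f = 0 := by
  let χ : Wt n m → ((Fin n ⊕ Fin m → ℂˣ) →* ℂ) := fun w =>
    { toFun := fun t => (wpow t w : ℂ)
      map_one' := by simp [wpow_one]
      map_mul' := fun s t => by simp [wpow_mul] }
  have hχ : Function.Injective χ := by
    intro v w hvw
    refine wpow_injective fun t => Units.ext ?_
    exact DFunLike.congr_fun hvw t
  -- Dedekind's independence of characters: distinct exponents define distinct characters of the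
  -- complex torus.
  have hli := (linearIndependent_monoidHom (Fin n ⊕ Fin m → ℂˣ) ℂ).comp χ hχ
  rw [linearIndependent_iff] at hli
  rw [← AddMonoidAlgebra.coeff_eq_zero]
  refine hli f.coeff ?_
  funext t
  have := hf t
  rw [evalT_apply t f _ subset_rfl] at this
  rw [Finsupp.linearCombination_apply, Finsupp.sum, Finset.sum_apply]
  exact this

end Torus

/-! ### Weight projections and supercharacters -/

namespace GLRep

variable {n m : ℕ} (V W : GLRep n m)

/-- The matrix of the universal point of the torus. -/
def univMat : Matrix V.ι V.ι (TorusRing n m) := V.mat (torusR zU)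

/-- The projection onto a weight space. -/
def proj (w : Wt n m) : Matrix V.ι V.ι ℂ := V.univMat.map fun f => f.coeff w

/-- A finite set of weights that contains all weights of `V`. -/
def wts : Finset (Wt n m) := Finset.univ.biUnion fun a : V.ι × V.ι =>
  (V.univMat a.1 a.2).coeff.support

theorem support_subset_wts (i j : V.ι) : (V.univMat i j).coeff.support ⊆ V.wts :=
  fun _ hw => Finset.mem_biUnion.2 ⟨(i, j), Finset.mem_univ _, hw⟩

theorem proj_eq_zero {w : Wt n m} (hw : w ∉ V.wts) : V.proj w = 0 := by
  ext i j
  by_contra hne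
  exact hw (V.support_subset_wts i j (Finsupp.mem_support_iff.2 hne))

variable {R : Type} [CommRing R] [Algebra ℂ R]

/-- Every diagonal point is a specialization of the universal one, so naturality determines the
whole torus action from a single matrix of Laurent polynomials. -/
theorem mat_torusR_eq_map (d : Fin n ⊕ Fin m → Rˣ) :
    V.mat (torusR d) = V.univMat.map (evalT d) := by
  have h1 : SGL.map _ (SuperAlg.ofCommHom (evalT d)) (torusR (zU : Fin n ⊕ Fin m → _)) = torusR d := by
    rw [map_torusR]
    congr 1
    funext j
    exact Units.ext (evalT_zU d j)
  rw [← h1, V.mat_map]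
  rfl

theorem mat_torusR_apply (d : Fin n ⊕ Fin m → Rˣ) (i j : V.ι) :
    V.mat (torusR d) i j = ∑ w ∈ V.wts, V.proj w i j • (wpow d w : R) := by
  rw [mat_torusR_eq_map]
  exact evalT_apply d _ _ (V.support_subset_wts i j)

/-- Multiplicativity is applied to the universal point times the constant point t, over the
coordinate ring of the torus, and coefficients of z^w are compared. -/
theorem proj_mul_torus (t : Fin n ⊕ Fin m → ℂˣ) (w : Wt n m) :
    V.proj w * V.torusMat t = (wpow t w : ℂ) • V.proj w := by
  have h1 : torusR (zU * fun j => Units.map (algebraMap ℂ (TorusRing n m)) (t j)) =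
      torusR (n := n) (m := m) zU *
        SGL.map _ (SuperAlg.ofCommHom (Algebra.ofId ℂ (TorusRing n m))) (torusR t) := by
    rw [torusR_mul, map_torusR]; rfl
  have h2 := congrArg V.mat h1
  rw [V.mat_mul, V.mat_map, mat_torusR_eq_map] at h2
  have h3 : ∀ f : TorusRing n m,
      (evalT (zU * fun j => Units.map (algebraMap ℂ (TorusRing n m)) (t j)) f).coeff w =
        wpow t w * f.coeff w := by
    intro f
    induction f using AddMonoidAlgebra.induction_linear with
    | zero => simp
    | add f g hf hg => rw [map_add, AddMonoidAlgebra.coeff_add, Finsupp.add_apply, hf, hg,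
        AddMonoidAlgebra.coeff_add, Finsupp.add_apply, mul_add]
    | single v c =>
      have e2 : (wpow (fun j => Units.map (algebraMap ℂ (TorusRing n m) : ℂ →* TorusRing n m) (t j)) v :
          TorusRing n m) = AddMonoidAlgebra.single 0 (wpow t v : ℂ) := by
        have : wpow (fun j => Units.map (algebraMap ℂ (TorusRing n m) : ℂ →* TorusRing n m) (t j)) v =
            Units.map (algebraMap ℂ (TorusRing n m) : ℂ →* TorusRing n m) (wpow t v) := by
          simp [wpow, map_prod, map_zpow]
        rw [this]; rfl
      rw [evalT_single, wpow_mul, Units.val_mul]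
      erw [e2]
      rw [wpow_zU, AddMonoidAlgebra.single_mul_single, AddMonoidAlgebra.smul_single, add_zero, one_mul,
        smul_eq_mul, AddMonoidAlgebra.coeff_single, AddMonoidAlgebra.coeff_single]
      by_cases hv : v = w
      · subst hv; simp [mul_comm]
      · rw [Finsupp.single_eq_of_ne' hv, Finsupp.single_eq_of_ne' hv, mul_zero]
  ext i j
  have h4 := congrArg (fun f : TorusRing n m => f.coeff w) (congrFun (congrFun h2 i) j)
  rw [Matrix.mul_apply] at h4 ⊢
  simp only [Matrix.map_apply] at h4
  rw [h3] at h4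
  rw [Matrix.smul_apply, smul_eq_mul]
  refine Eq.trans ?_ h4.symm
  erw [AddMonoidAlgebra.coeff_sum]
  rw [Finsupp.finsetSum_apply]
  refine Finset.sum_congr rfl fun k _ => ?_
  exact (AddMonoidAlgebra.coeff_mul_single_zero _ _ _).symm

theorem torusMat_apply (t : Fin n ⊕ Fin m → ℂˣ) (i j : V.ι) :
    V.torusMat t i j = ∑ w ∈ V.wts, V.proj w i j * (wpow t w : ℂ) := V.mat_torusR_apply t i j

theorem torusMat_eq (t : Fin n ⊕ Fin m → ℂˣ) :
    V.torusMat t = ∑ w ∈ V.wts, (wpow t w : ℂ) • V.proj w := by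
  ext i j
  rw [torusMat_apply, Matrix.sum_apply]
  exact Finset.sum_congr rfl fun w _ => by rw [Matrix.smul_apply, smul_eq_mul, mul_comm]

/-- Expanding t into its weight components in `proj_mul_torus` gives an identity between Laurent
polynomials in t that holds at every complex point, hence coefficientwise. -/
theorem proj_mul_proj (v w : Wt n m) : V.proj v * V.proj w = if v = w then V.proj v else 0 := by
  by_cases hw : w ∈ V.wts
  · ext i j
    let f : TorusRing n m := ∑ u ∈ V.wts, AddMonoidAlgebra.single u ((V.proj v * V.proj u) i j) -
      AddMonoidAlgebra.single v (V.proj v i j)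
    have hf : f = 0 := by
      refine eq_zero_of_evalT fun t => ?_
      have h1 := congrFun (congrFun (V.proj_mul_torus t v) i) j
      rw [torusMat_eq, Finset.mul_sum, Matrix.sum_apply] at h1
      simp only [f, map_sub, map_sum, evalT_single]
      rw [sub_eq_zero]
      refine Eq.trans (Finset.sum_congr rfl fun u _ => ?_) (h1.trans ?_)
      · rw [Matrix.mul_smul, Matrix.smul_apply, smul_eq_mul, smul_eq_mul, mul_comm]
      · rw [Matrix.smul_apply, smul_eq_mul, smul_eq_mul, mul_comm]
    have h2 := congrArg (fun f : TorusRing n m => f.coeff w) hf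
    simp only [f, AddMonoidAlgebra.coeff_sub, AddMonoidAlgebra.coeff_sum, Finsupp.sub_apply,
      Finsupp.finsetSum_apply, AddMonoidAlgebra.coeff_single, Finsupp.single_apply,
      Finset.sum_ite_eq', hw, if_true, AddMonoidAlgebra.coeff_zero, Finsupp.zero_apply] at h2
    rw [sub_eq_zero.1 h2]
    split_ifs <;> rfl
  · rw [V.proj_eq_zero hw, mul_zero]
    split_ifs with h
    · rw [h, V.proj_eq_zero hw]
    · rfl

theorem sum_proj : ∑ w ∈ V.wts, V.proj w = 1 := by
  have h1 := V.torusMat_eq 1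
  simp only [wpow_one, Units.val_one, one_smul] at h1
  rw [← h1, torusMat, torus_eq_torusR, show torusR (1 : Fin n ⊕ Fin m → ℂˣ) = 1 from
    sgl_ext (by simp [torusR, mkSGL]), V.mat_one]

theorem torus_mul_proj (t : Fin n ⊕ Fin m → ℂˣ) (w : Wt n m) :
    V.torusMat t * V.proj w = (wpow t w : ℂ) • V.proj w := by
  rw [torusMat_eq, Finset.sum_mul]
  simp only [Matrix.smul_mul, proj_mul_proj]
  by_cases hw : w ∈ V.wts
  · rw [Finset.sum_eq_single w (fun u _ hu => by rw [if_neg hu, smul_zero])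
      (fun h => absurd hw h), if_pos rfl]
  · rw [V.proj_eq_zero hw, smul_zero]
    refine Finset.sum_eq_zero fun u hu => ?_
    rw [if_neg (fun h : u = w => hw (h ▸ hu)), smul_zero]

theorem univMat_eq_zero {i j : V.ι} (hij : V.parity i ≠ V.parity j) : V.univMat i j = 0 := by
  have h1 := V.mat_mem (torusR (zU : Fin n ⊕ Fin m → _)) i j
  change V.univMat i j ∈ evenGrading _ _ at h1
  have h2 : V.parity i + V.parity j ≠ 0 := by
    intro h0
    apply hij
    revert h0
    generalize V.parity i = a; generalize V.parity j = b
    revert a b; decide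
  simpa [evenGrading, h2] using h1

theorem proj_even {i j : V.ι} (hij : V.parity i ≠ V.parity j) (w : Wt n m) : V.proj w i j = 0 := by
  rw [proj, Matrix.map_apply, V.univMat_eq_zero hij]; rfl

/-- For u ≠ w some complex t separates the two characters, so the projection to weight u kills a
vector of weight w; the projections sum to 1. -/
theorem mem_weightSpace_iff (w : Wt n m) (v : V.ι → ℂ) :
    v ∈ V.weightSpace w ↔ (V.proj w).mulVec v = v := by
  constructor
  · intro hv
    have h0 : ∀ u, u ≠ w → (V.proj u).mulVec v = 0 := by
      intro u hu
      obtain ⟨t, ht⟩ : ∃ t : Fin n ⊕ Fin m → ℂˣ, wpow t u ≠ wpow t w := by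
        by_contra! hc
        exact hu (wpow_injective hc)
      have h1 := congrArg (V.proj u).mulVec (hv t)
      rw [Matrix.mulVec_mulVec, proj_mul_torus, Matrix.smul_mulVec, Matrix.mulVec_smul] at h1
      have h2 : ((wpow t u : ℂ) - (wpow t w : ℂ)) • (V.proj u).mulVec v = 0 := by
        rw [sub_smul, h1]; exact sub_self _
      exact (smul_eq_zero.1 h2).resolve_left (sub_ne_zero.2 fun h => ht (Units.ext h))
    have h1 : (∑ u ∈ V.wts, V.proj u).mulVec v = v := by rw [sum_proj, Matrix.one_mulVec]
    rw [Matrix.sum_mulVec] at h1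
    by_cases hw : w ∈ V.wts
    · rwa [Finset.sum_eq_single w (fun u _ hu => h0 u hu) (fun h => absurd hw h)] at h1
    · rw [Finset.sum_eq_zero fun u hu => h0 u (fun h => hw (h ▸ hu))] at h1
      rw [← h1, Matrix.mulVec_zero]
  · intro hv t
    rw [← hv, Matrix.mulVec_mulVec, torus_mul_proj, Matrix.smul_mulVec]; rfl

/-- The supertrace. -/
def _root_.SuperGL.str {ι : Type} [Fintype ι] {A : Type*} [AddCommGroup A] (p : ι → ZMod 2)
    (M : Matrix ι ι A) : A := ∑ i, sgn (p i) • M i i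

/-- Weight projections are even, so composing with the projection to parity e gives a projection
onto the intersection, and its trace is the dimension. -/
theorem finrank_weight (w : Wt n m) (e : ZMod 2) :
    (Module.finrank ℂ ↥(V.weightSpace w ⊓ V.component e) : ℂ) =
      ∑ i, if V.parity i = e then V.proj w i i else 0 := by
  let E : Matrix V.ι V.ι ℂ := V.proj w * Matrix.diagonal fun i => if V.parity i = e then 1 else 0
  have hE : ∀ i j, E i j = if V.parity j = e then V.proj w i j else 0 := by
    intro i j
    simp [E, Matrix.mul_diagonal]
  have hproj : LinearMap.IsProj (V.weightSpace w ⊓ V.component e) (Matrix.toLin' E) := by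
    constructor
    · intro v
      refine ⟨(V.mem_weightSpace_iff _ _).2 ?_, fun i hi => ?_⟩
      · rw [Matrix.toLin'_apply, Matrix.mulVec_mulVec, ← mul_assoc, proj_mul_proj, if_pos rfl]
      · rw [Matrix.toLin'_apply, Matrix.mulVec, dotProduct]
        refine Finset.sum_eq_zero fun j _ => ?_
        rw [hE]
        split_ifs with hj
        · rw [V.proj_even (fun h => hi (h.trans hj)), zero_mul]
        · rw [zero_mul]
    · rintro v ⟨h1, h2⟩
      rw [Matrix.toLin'_apply, ← Matrix.mulVec_mulVec]
      have h3 : (Matrix.diagonal fun i => if V.parity i = e then (1 : ℂ) else 0).mulVec v = v := by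
        ext i
        rw [Matrix.mulVec_diagonal]
        by_cases hi : V.parity i = e
        · simp [hi]
        · simp [hi, h2 i hi]
      rw [h3]
      exact (V.mem_weightSpace_iff _ _).1 h1
  rw [← hproj.trace, Matrix.trace_toLin'_eq, Matrix.trace]
  exact Finset.sum_congr rfl fun i _ => hE i i

theorem sdimWeight_eq (w : Wt n m) : (V.sdimWeight w : ℂ) = str V.parity (V.proj w) := by
  rw [sdimWeight]
  push_cast
  rw [finrank_weight, finrank_weight, str, ← Finset.sum_sub_distrib]
  refine Finset.sum_congr rfl fun i _ => ?_
  rcases zmod_two_cases (V.parity i) with h | h <;> simp [h, sgn]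

/-- The supercharacter with complex coefficients. -/
def schC : TorusRing n m := str V.parity V.univMat

theorem coeff_schC (w : Wt n m) : V.schC.coeff w = V.sdimWeight w := by
  rw [sdimWeight_eq, schC, str, str, AddMonoidAlgebra.coeff_sum, Finsupp.finsetSum_apply]
  exact Finset.sum_congr rfl fun i _ => rfl

/-- The supercharacter of a representation. -/
def sch : LaurentRing n m := ∑ w ∈ V.wts, AddMonoidAlgebra.single w (V.sdimWeight w)

theorem coeff_sch (w : Wt n m) : V.sch.coeff w = V.sdimWeight w := by
  simp only [sch, AddMonoidAlgebra.coeff_sum, Finsupp.finsetSum_apply,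
    AddMonoidAlgebra.coeff_single, Finsupp.single_apply, Finset.sum_ite_eq']
  split_ifs with hw
  · rfl
  · have h1 := V.sdimWeight_eq w
    rw [V.proj_eq_zero hw] at h1
    have h2 : (V.sdimWeight w : ℂ) = 0 := by rw [h1]; simp [str]
    exact_mod_cast h2.symm

/-- The embedding of Laurent polynomials with integral coefficients into those with complex ones. -/
def _root_.SuperGL.toC (n m : ℕ) : LaurentRing n m →+* TorusRing n m :=
  AddMonoidAlgebra.mapRingHom (Wt n m) (Int.castRingHom ℂ)

theorem _root_.SuperGL.toC_single (w : Wt n m) (c : ℤ) :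
    toC n m (AddMonoidAlgebra.single w c) = AddMonoidAlgebra.single w (c : ℂ) := by simp [toC]

theorem _root_.SuperGL.coeff_toC (f : LaurentRing n m) (w : Wt n m) :
    (toC n m f).coeff w = f.coeff w := by simp [toC]

theorem _root_.SuperGL.toC_injective : Function.Injective (toC n m) := by
  intro f g hfg
  ext w
  have := congrArg (fun f : TorusRing n m => f.coeff w) hfg
  simp only [coeff_toC] at this
  exact_mod_cast this

theorem toC_sch : toC n m V.sch = V.schC := by
  ext w
  rw [coeff_toC, coeff_sch, coeff_schC]

/-- The Kronecker sign involves twice the parity of i on diagonal entries and disappears, so the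
supertrace is multiplicative. -/
theorem schC_tensor : (V.tensor W).schC = V.schC * W.schC := by
  rw [schC, schC, schC, str, str, str, Finset.sum_mul_sum, Fintype.sum_prod_type]
  refine Finset.sum_congr rfl fun i _ => Finset.sum_congr rfl fun k _ => ?_
  change sgn (V.parity i + W.parity k) • (sgn ((V.parity i + V.parity i) * W.parity k) •
    (V.univMat i i * W.univMat k k)) = _
  rw [show V.parity i + V.parity i = 0 by generalize V.parity i = a; revert a; decide, zero_mul,
    sgn_zero, one_smul, sgn_add, smul_mul_smul_comm]

theorem sch_tensor : (V.tensor W).sch = V.sch * W.sch :=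
  toC_injective (by rw [map_mul, toC_sch, toC_sch, toC_sch, schC_tensor])

theorem sch_parityShift : V.parityShift.sch = -V.sch := by
  refine toC_injective ?_
  rw [map_neg, toC_sch, toC_sch, schC, schC, str, str, ← Finset.sum_neg_distrib]
  refine Finset.sum_congr rfl fun i _ => ?_
  change sgn (V.parity i + 1) • V.univMat i i = _
  rw [sgn_add]
  simp [sgn]

theorem sch_triv : (triv n m).sch = 1 := by
  refine toC_injective ?_
  rw [toC_sch, schC, str, map_one]
  have : (triv n m).univMat = 1 := rfl
  rw [this]
  simp [sgn]

variable {V W}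

theorem Hom.mul_univMat (f : V.Hom W) :
    f.toMat.map (algebraMap ℂ (TorusRing n m)) * V.univMat =
      W.univMat * f.toMat.map (algebraMap ℂ (TorusRing n m)) :=
  f.comm (SuperAlg.ofComm (TorusRing n m)) (torusR zU)

theorem Hom.mul_proj (f : V.Hom W) (w : Wt n m) : f.toMat * V.proj w = W.proj w * f.toMat := by
  ext i j
  have h1 := congrArg (fun g : TorusRing n m => g.coeff w) (congrFun (congrFun f.mul_univMat i) j)
  rw [Matrix.mul_apply, Matrix.mul_apply] at h1 ⊢
  simp only [AddMonoidAlgebra.coeff_sum, Finsupp.finsetSum_apply] at h1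
  refine Eq.trans (Finset.sum_congr rfl fun k _ => ?_) (h1.trans
    (Finset.sum_congr rfl fun k _ => ?_))
  · exact (AddMonoidAlgebra.coeff_single_zero_mul _ _ _).symm
  · exact AddMonoidAlgebra.coeff_mul_single_zero _ _ _

theorem Hom.lin_mem_weight (f : V.Hom W) {w : Wt n m} {v : V.ι → ℂ} (hv : v ∈ V.weightSpace w) :
    f.lin v ∈ W.weightSpace w := by
  rw [mem_weightSpace_iff] at hv ⊢
  change (W.proj w).mulVec (f.toMat.mulVec v) = f.toMat.mulVec v
  rw [Matrix.mulVec_mulVec, ← f.mul_proj, ← Matrix.mulVec_mulVec, hv]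

theorem Hom.lin_mem_component (f : V.Hom W) {e : ZMod 2} {v : V.ι → ℂ} (hv : v ∈ V.component e) :
    f.lin v ∈ W.component e := by
  intro k hk
  change ∑ i, f.toMat k i * v i = 0
  refine Finset.sum_eq_zero fun i _ => ?_
  by_cases hi : V.parity i = e
  · rw [f.even k i (fun h => hk (h.trans hi)), zero_mul]
  · rw [hv i hi, mul_zero]

/-- The projection onto the homogeneous component of parity `e`. -/
def compProj (V : GLRep n m) (e : ZMod 2) (v : V.ι → ℂ) : V.ι → ℂ :=
  fun i => if V.parity i = e then v i else 0

theorem compProj_mem (e : ZMod 2) (v : V.ι → ℂ) : V.compProj e v ∈ V.component e :=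
  fun _ hi => if_neg hi

theorem compProj_of_mem {e : ZMod 2} {v : V.ι → ℂ} (hv : v ∈ V.component e) :
    V.compProj e v = v := by
  funext i
  by_cases hi : V.parity i = e
  · simp [compProj, hi]
  · simp [compProj, hi, hv i hi]

theorem Hom.lin_compProj (f : V.Hom W) (e : ZMod 2) (v : V.ι → ℂ) :
    f.lin (V.compProj e v) = W.compProj e (f.lin v) := by
  funext k
  change ∑ i, f.toMat k i * (if V.parity i = e then v i else 0) =
    if W.parity k = e then ∑ i, f.toMat k i * v i else 0
  split_ifs with hk
  · refine Finset.sum_congr rfl fun i _ => ?_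
    split_ifs with hi
    · rfl
    · rw [f.even k i (fun h => hi (h ▸ hk)), zero_mul, zero_mul]
  · refine Finset.sum_eq_zero fun i _ => ?_
    split_ifs with hi
    · rw [f.even k i (fun h => hk (h.trans hi)), zero_mul]
    · rw [mul_zero]

theorem compProj_mem_weight {w : Wt n m} {v : V.ι → ℂ} (e : ZMod 2) (hv : v ∈ V.weightSpace w) :
    V.compProj e v ∈ V.weightSpace w := by
  rw [mem_weightSpace_iff] at hv ⊢
  funext k
  conv_rhs => rw [compProj, ← hv]
  change ∑ i, V.proj w k i * (if V.parity i = e then v i else 0) =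
    if V.parity k = e then ∑ i, V.proj w k i * v i else 0
  split_ifs with hk
  · refine Finset.sum_congr rfl fun i _ => ?_
    split_ifs with hi
    · rfl
    · rw [V.proj_even (fun h => hi (h ▸ hk)), zero_mul, zero_mul]
  · refine Finset.sum_eq_zero fun i _ => ?_
    split_ifs with hi
    · rw [V.proj_even (fun h => hk (h.trans hi)), zero_mul]
    · rw [mul_zero]

/-- Homomorphisms commute with the weight projections and the parity projections, so exactness
passes to every homogeneous piece of every weight space. -/
theorem IsShortExact.finrank_eq {V₁ V₂ : GLRep n m} {f : V₁.Hom V} {g : V.Hom V₂}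
    (h : IsShortExact f g) (w : Wt n m) (e : ZMod 2) :
    Module.finrank ℂ ↥(V.weightSpace w ⊓ V.component e) =
      Module.finrank ℂ ↥(V₁.weightSpace w ⊓ V₁.component e) +
      Module.finrank ℂ ↥(V₂.weightSpace w ⊓ V₂.component e) := by
  obtain ⟨hi, he, hs⟩ := h
  let F : ↥(V₁.weightSpace w ⊓ V₁.component e) →ₗ[ℂ] ↥(V.weightSpace w ⊓ V.component e) :=
    f.lin.restrict fun v hv => ⟨f.lin_mem_weight hv.1, f.lin_mem_component hv.2⟩
  let G : ↥(V.weightSpace w ⊓ V.component e) →ₗ[ℂ] ↥(V₂.weightSpace w ⊓ V₂.component e) :=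
    g.lin.restrict fun v hv => ⟨g.lin_mem_weight hv.1, g.lin_mem_component hv.2⟩
  have hF : Function.Injective F := fun a b hab => Subtype.ext (hi (congrArg Subtype.val hab))
  have hG : Function.Surjective G := by
    rintro ⟨v, hv1, hv2⟩
    obtain ⟨u, hu⟩ := hs v
    have h1 : (V.proj w).mulVec u ∈ V.weightSpace w := by
      rw [mem_weightSpace_iff, Matrix.mulVec_mulVec, proj_mul_proj, if_pos rfl]
    refine ⟨⟨V.compProj e ((V.proj w).mulVec u), compProj_mem_weight e h1, compProj_mem _ _⟩,
      Subtype.ext ?_⟩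
    change g.lin (V.compProj e ((V.proj w).mulVec u)) = v
    rw [g.lin_compProj]
    have h2 : g.lin ((V.proj w).mulVec u) = v := by
      change g.toMat.mulVec _ = v
      rw [Matrix.mulVec_mulVec, g.mul_proj, ← Matrix.mulVec_mulVec]
      change (V₂.proj w).mulVec (g.lin u) = v
      rw [hu]
      exact (V₂.mem_weightSpace_iff _ _).1 hv1
    rw [h2, compProj_of_mem hv2]
  have hFG : LinearMap.range F = LinearMap.ker G := by
    ext ⟨v, hv1, hv2⟩
    constructor
    · rintro ⟨u, hu⟩
      have h1 : f.lin u.1 = v := congrArg Subtype.val hu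
      rw [LinearMap.mem_ker]
      exact Subtype.ext ((he v).2 ⟨_, h1⟩)
    · intro hv
      obtain ⟨u, hu⟩ := (he v).1 (congrArg Subtype.val hv)
      have h1 : u ∈ V₁.weightSpace w := by
        rw [mem_weightSpace_iff]
        apply hi
        change f.toMat.mulVec _ = _
        rw [Matrix.mulVec_mulVec, f.mul_proj, ← Matrix.mulVec_mulVec]
        change (V.proj w).mulVec (f.lin u) = f.lin u
        rw [hu]
        exact (V.mem_weightSpace_iff _ _).1 hv1
      have h2 : u ∈ V₁.component e := by
        have : V₁.compProj e u = u := by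
          apply hi
          rw [f.lin_compProj, hu, compProj_of_mem hv2]
        rw [← this]; exact compProj_mem _ _
      exact ⟨⟨u, h1, h2⟩, Subtype.ext hu⟩
  have h1 := LinearMap.finrank_range_add_finrank_ker G
  rw [← hFG, LinearMap.finrank_range_of_inj hF, LinearMap.range_eq_top.2 hG, finrank_top] at h1
  omega

theorem IsShortExact.sch_eq {V₁ V₂ : GLRep n m} {f : V₁.Hom V} {g : V.Hom V₂}
    (h : IsShortExact f g) : V₁.sch - V.sch + V₂.sch = 0 := by
  ext w
  rw [AddMonoidAlgebra.coeff_add, AddMonoidAlgebra.coeff_sub, Finsupp.add_apply, Finsupp.sub_apply,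
    coeff_sch, coeff_sch, coeff_sch, sdimWeight, sdimWeight, sdimWeight, h.finrank_eq w 0,
    h.finrank_eq w 1]
  push_cast
  simp only [AddMonoidAlgebra.coeff_zero, Finsupp.zero_apply]
  ring

end GLRep

/-- The supercharacter homomorphism. -/
def schHom (n m : ℕ) : GrothRing n m →+* LaurentRing n m :=
  { GrothRing.lift GLRep.sch (fun _ _ h => h.sch_eq)
      (fun V => by rw [V.sch_parityShift, add_neg_cancel]) with
    map_one' := by
      change GrothRing.lift _ _ _ (GrothRing.cls _) = _
      rw [GrothRing.lift_cls, GLRep.sch_triv]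
    map_mul' := by
      intro a b
      let F := GrothRing.lift (n := n) (m := m) GLRep.sch (fun _ _ h => h.sch_eq)
        (fun V => by rw [V.sch_parityShift, add_neg_cancel])
      have h1 : (AddMonoidHom.compHom F).comp GrothRing.mulHom =
          (AddMonoidHom.mul.comp F).compl₂ F := by
        refine GrothRing.hom_ext fun V => GrothRing.hom_ext fun W => ?_
        change F (GrothRing.mulHom (GrothRing.cls V) (GrothRing.cls W)) =
          F (GrothRing.cls V) * F (GrothRing.cls W)
        rw [GrothRing.mulHom_cls, GrothRing.lift_cls, GrothRing.lift_cls, GrothRing.lift_cls,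
          GLRep.sch_tensor]
      exact DFunLike.congr_fun (DFunLike.congr_fun h1 a) b }

theorem schHom_cls {n m : ℕ} (V : GLRep n m) : schHom n m (GrothRing.cls V) = V.sch :=
  GrothRing.lift_cls GLRep.sch (fun _ _ h => h.sch_eq)
    (fun V => by rw [V.sch_parityShift, add_neg_cancel]) V

/-! ### Elementary supermatrices and odd root operators -/

section Elementary

variable {ι : Type} [Fintype ι] [DecidableEq ι] {p : ι → ZMod 2} {A B : SuperAlg}

theorem add_self_parity (e : ZMod 2) : e + e = 0 := by revert e; decide

theorem single_mem {j k : ι} {a : A} (ha : a ∈ A.grading (p j + p k)) :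
    Matrix.single j k a ∈ SuperMat p A := by
  intro i l
  rw [Matrix.single_apply]
  split_ifs with hil
  · rwa [← hil.1, ← hil.2]
  · exact Submodule.zero_mem _

/-- The elementary supermatrix `1 + a E_{jk}`. -/
def elem {j k : ι} (hjk : j ≠ k) (a : A.grading (p j + p k)) : SGL p A :=
  mkSGL (1 + Matrix.single j k a.1) (1 - Matrix.single j k a.1)
    (Subring.add_mem _ (Subring.one_mem _) (single_mem a.2))
    (Subring.sub_mem _ (Subring.one_mem _) (single_mem a.2))
    (by simp [mul_sub, add_mul, Matrix.single_mul_single_of_ne _ _ _ _ hjk.symm])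
    (by simp [mul_add, sub_mul, Matrix.single_mul_single_of_ne _ _ _ _ hjk.symm])

theorem val_elem {j k : ι} (hjk : j ≠ k) (a : A.grading (p j + p k)) :
    ((elem hjk a : SGL p A) : SuperMat p A).1 = 1 + Matrix.single j k a.1 := rfl

theorem elem_add {j k : ι} (hjk : j ≠ k) (a b : A.grading (p j + p k)) :
    (elem hjk (a + b) : SGL p A) = elem hjk a * elem hjk b := by
  refine sgl_ext ?_
  rw [val_mul, val_elem, val_elem, val_elem]
  simp only [Submodule.coe_add, Matrix.single_add, mul_add, add_mul,
    Matrix.single_mul_single_of_ne _ _ _ _ hjk.symm, one_mul, mul_one, add_zero]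
  abel

theorem map_elem (φ : A.Hom B) {j k : ι} (hjk : j ≠ k) (a : A.grading (p j + p k)) :
    SGL.map p φ (elem hjk a) = elem hjk ⟨φ.toAlgHom a.1, φ.map_mem _ _ a.2⟩ := by
  refine sgl_ext ?_
  rw [val_map, val_elem, val_elem]
  ext i l
  simp only [Matrix.map_apply, Matrix.add_apply, Matrix.one_apply, Matrix.single_apply, map_add]
  split_ifs <;> simp

theorem ne_of_odd {j k : ι} (hp : p j + p k = 1) : j ≠ k := by
  rintro rfl
  rw [add_self_parity] at hp
  exact absurd hp (by decide)

/-- The odd elementary supermatrix `1 + β E_{jk}`. -/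
def oddElem {j k : ι} (hp : p j + p k = 1) {β : A} (hβ : β ∈ A.grading 1) : SGL p A :=
  elem (ne_of_odd hp) ⟨β, hp.symm ▸ hβ⟩

theorem val_oddElem {j k : ι} (hp : p j + p k = 1) {β : A} (hβ : β ∈ A.grading 1) :
    ((oddElem hp hβ : SGL p A) : SuperMat p A).1 = 1 + Matrix.single j k β := rfl

theorem map_oddElem (φ : A.Hom B) {j k : ι} (hp : p j + p k = 1) {β : A} (hβ : β ∈ A.grading 1) :
    SGL.map p φ (oddElem hp hβ) = oddElem hp (φ.map_mem _ _ hβ) := map_elem _ _ _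

theorem oddElem_congr {j k : ι} (hp : p j + p k = 1) {β γ : A} (hβ : β ∈ A.grading 1)
    (hγ : γ ∈ A.grading 1) (h : β = γ) : (oddElem hp hβ : SGL p A) = oddElem hp hγ := by
  subst h; rfl

theorem thetaEval_theta {β : A} (hβ : β ∈ A.grading 1) :
    (SuperAlg.thetaEval hβ).toAlgHom (SuperAlg.ofComm ℂ).theta = β := by
  refine (SuperAlg.thetaEval_apply hβ 0 1).trans ?_
  simp

theorem algebraMap_adjoinOdd (c : ℂ) :
    algebraMap ℂ A.adjoinOdd c = A.adjoinOddIncl.toAlgHom (algebraMap ℂ A c) :=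
  (A.adjoinOddIncl.toAlgHom.commutes c).symm

theorem mapC_mul_smul {ι' κ l : Type} [Fintype κ] (M : Matrix ι' κ ℂ) (β : A) (N : Matrix κ l A) :
    M.map (algebraMap ℂ A) * (β • N) = β • (M.map (algebraMap ℂ A) * N) := by
  ext i j
  simp only [Matrix.mul_apply, Matrix.smul_apply, Matrix.map_apply, smul_eq_mul, Finset.mul_sum]
  refine Finset.sum_congr rfl fun x _ => ?_
  rw [← mul_assoc, Algebra.commutes, mul_assoc]

theorem theta_smul_inj {ι' κ : Type} {M N : Matrix ι' κ ℂ}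
    (h : A.theta • M.map (algebraMap ℂ A.adjoinOdd) = A.theta • N.map (algebraMap ℂ A.adjoinOdd)) :
    M.map (algebraMap ℂ A) = N.map (algebraMap ℂ A) := by
  ext i j
  have h1 := congrFun (congrFun h i) j
  simp only [Matrix.smul_apply, Matrix.map_apply, smul_eq_mul] at h1 ⊢
  rw [← sub_eq_zero]
  apply SuperAlg.eq_zero_of_theta_mul
  rw [map_sub, ← algebraMap_adjoinOdd, ← algebraMap_adjoinOdd, mul_sub, h1, sub_self]

end Elementary

/-! ### Torus conjugation and the odd root operators -/

section TorusA

variable {n m : ℕ} (A : SuperAlg)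

/-- The complex points of the torus over a superalgebra. -/
def torusA (t : Fin n ⊕ Fin m → ℂˣ) : SGL (stdParity n m) A := SGL.map _ A.scalarHom (torusR t)

variable {A}

theorem val_torusA (t : Fin n ⊕ Fin m → ℂˣ) :
    ((torusA A t : SGL (stdParity n m) A) : SuperMat (stdParity n m) A).1 =
      Matrix.diagonal fun j => algebraMap ℂ A (t j) :=
  Matrix.diagonal_map (map_zero (algebraMap ℂ A))

theorem torusA_mul_elem (t : Fin n ⊕ Fin m → ℂˣ) {j k : Fin n ⊕ Fin m} (hjk : j ≠ k)
    (a : A.grading (stdParity n m j + stdParity n m k)) :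
    torusA A t * elem hjk a = elem hjk (((t j * (t k)⁻¹ : ℂˣ) : ℂ) • a) * torusA A t := by
  refine sgl_ext ?_
  rw [val_mul, val_mul, val_elem, val_elem, val_torusA, mul_add, add_mul, mul_one, one_mul]
  congr 1
  ext i l
  rw [Matrix.diagonal_mul, Matrix.mul_diagonal, Matrix.single_apply, Matrix.single_apply]
  split_ifs with h
  · obtain ⟨rfl, rfl⟩ := h
    rw [Submodule.coe_smul, Algebra.smul_def, mul_assoc, ← Algebra.commutes, ← mul_assoc, ← map_mul]
    congr 2
    simp
  · simp

end TorusA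

namespace GLRep

variable {n m : ℕ} (V : GLRep n m) {A : SuperAlg}

theorem mat_torusA (t : Fin n ⊕ Fin m → ℂˣ) :
    V.mat (torusA A t) = (V.torusMat t).map (algebraMap ℂ A) := V.mat_map _ _

/-- An operator that is homogeneous for the torus shifts the weight spaces. -/
theorem mul_proj_of_shift {M : Matrix V.ι V.ι ℂ} {α : Wt n m}
    (h : ∀ t, V.torusMat t * M = (wpow t α : ℂ) • (M * V.torusMat t)) (w : Wt n m) :
    M * V.proj w = V.proj (w + α) * M := by
  have key : ∀ u v, u ≠ v + α → V.proj u * M * V.proj v = 0 := by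
    intro u v huv
    obtain ⟨t, ht⟩ : ∃ t : Fin n ⊕ Fin m → ℂˣ, wpow t u ≠ wpow t (v + α) := by
      by_contra! hc
      exact huv (wpow_injective hc)
    have h1 : (wpow t u : ℂ) • (V.proj u * M * V.proj v) =
        (wpow t (v + α) : ℂ) • (V.proj u * M * V.proj v) := by
      calc (wpow t u : ℂ) • (V.proj u * M * V.proj v)
          = V.proj u * (V.torusMat t * M) * V.proj v := by
            rw [← mul_assoc, proj_mul_torus, Matrix.smul_mul, Matrix.smul_mul]
        _ = _ := by
            rw [h, Matrix.mul_smul, Matrix.smul_mul, mul_assoc, mul_assoc, torus_mul_proj,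
              Matrix.mul_smul, Matrix.mul_smul, smul_smul, wpow_add, Units.val_mul,
              mul_comm (wpow t α : ℂ), mul_assoc]
    rw [← sub_eq_zero, ← sub_smul] at h1
    exact (smul_eq_zero.1 h1).resolve_left (sub_ne_zero.2 fun h => ht (Units.ext h))
  have hL : M * V.proj w = V.proj (w + α) * M * V.proj w := by
    conv_lhs => rw [← one_mul M, ← V.sum_proj, Finset.sum_mul, Finset.sum_mul]
    by_cases hw : w + α ∈ V.wts
    · exact Finset.sum_eq_single _ (fun u _ hu => key u w hu) (fun h => absurd hw h)
    · rw [V.proj_eq_zero hw, zero_mul, zero_mul]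
      exact Finset.sum_eq_zero fun u hu => key u w fun h => hw (h ▸ hu)
  have hR : V.proj (w + α) * M = V.proj (w + α) * M * V.proj w := by
    conv_lhs => rw [← mul_one M, ← V.sum_proj, Finset.mul_sum, Finset.mul_sum]
    simp_rw [← mul_assoc]
    by_cases hw : w ∈ V.wts
    · exact Finset.sum_eq_single _ (fun u _ hu => key _ u fun h => hu (add_right_cancel h).symm)
        (fun h => absurd hw h)
    · rw [V.proj_eq_zero hw, mul_zero]
      exact Finset.sum_eq_zero fun u hu => key _ u fun h => hw (add_right_cancel h ▸ hu)
  rw [hL, hR.symm]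

variable {j k : Fin n ⊕ Fin m}

/-- The operator by which the odd root vector `E_{jk}` acts. -/
def oddOp (hp : stdParity n m j + stdParity n m k = 1) : Matrix V.ι V.ι ℂ :=
  (V.mat (oddElem hp (SuperAlg.theta_mem (A := SuperAlg.ofComm ℂ)))).map
    fun M : (SuperAlg.ofComm ℂ).oddSubalg => (M.1 0 1 : ℂ)

/-- By naturality the action of 1 + βE_{jk} is the specialization θ ↦ β of the action over ℂ[θ],
where each entry is of the form c₀ + c₁θ. The part c₀ is read off at β = 0, where the group element
is the identity. -/
theorem mat_oddElem (hp : stdParity n m j + stdParity n m k = 1) {β : A}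
    (hβ : β ∈ A.grading 1) :
    V.mat (oddElem hp hβ) = 1 + β • (V.oddOp hp).map (algebraMap ℂ A) := by
  set g := (oddElem hp (SuperAlg.theta_mem (A := SuperAlg.ofComm ℂ)) : SGL (stdParity n m) _)
    with hg
  have hmap : ∀ {B : SuperAlg} {γ : B} (hγ : γ ∈ B.grading 1),
      oddElem hp hγ = SGL.map (stdParity n m) (SuperAlg.thetaEval hγ) g := by
    intro B γ hγ
    rw [hg, map_oddElem]
    exact oddElem_congr _ _ _ (thetaEval_theta hγ).symm
  have hent : ∀ {B : SuperAlg} {γ : B} (hγ : γ ∈ B.grading 1) (i l : V.ι),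
      V.mat (oddElem hp hγ) i l =
        algebraMap ℂ B ((show (SuperAlg.ofComm ℂ).oddSubalg from V.mat g i l).1 0 0 : ℂ) +
          algebraMap ℂ B (V.oddOp hp i l) * γ := by
    intro B γ hγ i l
    rw [hmap hγ, V.mat_map]
    rfl
  have h0 : ∀ i l, ((show (SuperAlg.ofComm ℂ).oddSubalg from V.mat g i l).1 0 0 : ℂ) =
      (1 : Matrix V.ι V.ι ℂ) i l := by
    intro i l
    have h1 := hent (B := SuperAlg.ofComm ℂ) (γ := 0) (Submodule.zero_mem _) i l
    have h2 : (oddElem hp (Submodule.zero_mem ((SuperAlg.ofComm ℂ).grading 1)) :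
        SGL (stdParity n m) _) = 1 := by
      refine sgl_ext ?_
      rw [val_oddElem, Matrix.single_zero, add_zero]; rfl
    rw [h2, V.mat_one, mul_zero, add_zero] at h1
    exact h1.symm
  ext i l
  rw [hent hβ, h0, Matrix.add_apply, Matrix.smul_apply, Matrix.map_apply, smul_eq_mul,
    Algebra.commutes, Matrix.one_apply, Matrix.one_apply]
  split_ifs <;> simp

theorem oddOp_odd (hp : stdParity n m j + stdParity n m k = 1) {i l : V.ι}
    (hil : V.parity i = V.parity l) : V.oddOp hp i l = 0 := by
  have h1 := V.mat_mem (oddElem hp (SuperAlg.theta_mem (A := SuperAlg.ofComm ℂ))) i l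
  rw [hil, add_self_parity] at h1
  have h2 := h1.2
  change (V.oddOp hp i l) ∈ evenGrading ℂ (0 + 1) at h2
  simpa [evenGrading] using h2

/-- Conjugation by t rescales θ in 1 + θE_{jk} by t_j/t_k; comparing θ-coefficients shows that the
root operator has weight e_j - e_k. -/
theorem torus_mul_oddOp (hp : stdParity n m j + stdParity n m k = 1) (t : Fin n ⊕ Fin m → ℂˣ) :
    V.torusMat t * V.oddOp hp =
      (wpow t (Pi.single j 1 - Pi.single k 1) : ℂ) • (V.oddOp hp * V.torusMat t) := by
  have hw : (wpow t (Pi.single j 1 - Pi.single k 1) : ℂˣ) = t j * (t k)⁻¹ := by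
    rw [sub_eq_add_neg, wpow_add, ← Pi.single_neg, wpow_single, wpow_single, zpow_one, zpow_neg_one]
  have h1 := congrArg V.mat (torusA_mul_elem (A := (SuperAlg.ofComm ℂ).adjoinOdd) t (ne_of_odd hp)
    ⟨(SuperAlg.ofComm ℂ).theta, hp.symm ▸ SuperAlg.theta_mem⟩)
  have h2 : (elem (ne_of_odd hp) (((t j * (t k)⁻¹ : ℂˣ) : ℂ) •
      (⟨(SuperAlg.ofComm ℂ).theta, hp.symm ▸ SuperAlg.theta_mem⟩ :
        (SuperAlg.ofComm ℂ).adjoinOdd.grading (stdParity n m j + stdParity n m k))) :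
      SGL (stdParity n m) (SuperAlg.ofComm ℂ).adjoinOdd) =
      oddElem hp (Submodule.smul_mem _ ((t j * (t k)⁻¹ : ℂˣ) : ℂ)
        (SuperAlg.theta_mem (A := SuperAlg.ofComm ℂ))) := rfl
  rw [h2, V.mat_mul, V.mat_mul, mat_torusA] at h1
  have h3 := V.mat_oddElem hp (SuperAlg.theta_mem (A := SuperAlg.ofComm ℂ))
  change V.mat (elem _ _) = _ at h3
  rw [h3, mat_oddElem, mul_add, add_mul, mul_one, one_mul, add_right_inj, mapC_mul_smul,
    ← Matrix.map_mul, Matrix.smul_mul, ← Matrix.map_mul] at h1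
  have h4 : (((t j * (t k)⁻¹ : ℂˣ) : ℂ) • (SuperAlg.ofComm ℂ).theta) •
      (V.oddOp hp * V.torusMat t).map (algebraMap ℂ (SuperAlg.ofComm ℂ).adjoinOdd) =
      (SuperAlg.ofComm ℂ).theta • (((t j * (t k)⁻¹ : ℂˣ) : ℂ) • (V.oddOp hp * V.torusMat t)).map
        (algebraMap ℂ (SuperAlg.ofComm ℂ).adjoinOdd) := by
    ext i l
    simp only [Matrix.smul_apply, Matrix.map_apply, smul_eq_mul, map_mul]
    rw [Algebra.smul_def, Algebra.commutes, mul_assoc]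
  rw [h4] at h1
  have h5 := theta_smul_inj h1
  rw [hw]
  exact h5

theorem oddOp_mul_proj (hp : stdParity n m j + stdParity n m k = 1) (w : Wt n m) :
    V.oddOp hp * V.proj w = V.proj (w + (Pi.single j 1 - Pi.single k 1)) * V.oddOp hp :=
  V.mul_proj_of_shift (V.torus_mul_oddOp hp) w

end GLRep

/-! ### Supercharacters lie in `J₀₀` -/

section DualNumber

variable {n m : ℕ}

theorem SuperAlg.odd_sq {A : SuperAlg} {β : A} (hβ : β ∈ A.grading 1) : β * β = 0 := by
  have h1 := A.comm_odd β hβ β hβ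
  have h2 : (2 : ℂ) • (β * β) = 0 := by
    rw [two_smul]; nth_rewrite 1 [h1]; simp
  exact (smul_eq_zero.1 h2).resolve_left two_ne_zero

/-- The unit `1 - η` for an element `η` of square zero. -/
def oneSub {R : Type} [CommRing R] (η : R) (h : η * η = 0) : Rˣ where
  val := 1 - η
  inv := 1 + η
  val_inv := by ring_nf; rw [pow_two, h]; ring
  inv_val := by ring_nf; rw [pow_two, h]; ring

theorem oneSub_zpow {R : Type} [CommRing R] (η : R) (h : η * η = 0) (k : ℤ) :
    ((oneSub η h ^ k : Rˣ) : R) = 1 - k * η := by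
  induction k using Int.induction_on with
  | zero => simp
  | succ k ih =>
    rw [zpow_add_one, Units.val_mul, ih]
    change _ * (1 - η) = _
    push_cast
    linear_combination (k : R) * h
  | pred k ih =>
    rw [zpow_sub_one, Units.val_mul, ih]
    change _ * (1 + η) = _
    push_cast
    linear_combination (k : R) * h

end DualNumber

namespace GLRep

variable {n m : ℕ} (V : GLRep n m) {A : SuperAlg}

theorem odd_pair {n m : ℕ} (i : Fin n) (p : Fin m) :
    stdParity n m (Sum.inl i) + stdParity n m (Sum.inr p) = 1 := by simp [stdParity]

theorem odd_pair' {n m : ℕ} (i : Fin n) (p : Fin m) :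
    stdParity n m (Sum.inr p) + stdParity n m (Sum.inl i) = 1 := by simp [stdParity]

/-- The operator by which `E_{ii} + E_{pp}` acts. -/
def cartanOp (i : Fin n) (p : Fin m) : Matrix V.ι V.ι ℂ :=
  ∑ w ∈ V.wts, ((w (Sum.inl i) + w (Sum.inr p) : ℤ) : ℂ) • V.proj w

/-- The relation is read off from the group identity (1 + γE_{pi})(1 + βE_{ip}) = D (1 + βE_{ip})(1
+ γE_{pi}), where D is diagonal with entries 1 - βγ at i and p and 1 elsewhere. Applying the
representation and cancelling the common terms leaves the βγ-part. -/
theorem smul_anticommutator (i : Fin n) (p : Fin m) {β γ : A} (hβ : β ∈ A.grading 1)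
    (hγ : γ ∈ A.grading 1) :
    (β * γ) • (V.oddOp (odd_pair i p) * V.oddOp (odd_pair' i p) +
      V.oddOp (odd_pair' i p) * V.oddOp (odd_pair i p)).map (algebraMap ℂ A) =
    (β * γ) • (V.cartanOp i p).map (algebraMap ℂ A) := by
  have hγβ : γ * β = -(β * γ) := A.comm_odd _ hγ _ hβ
  have hη : β * γ ∈ A.grading 0 := SetLike.mul_mem_graded hβ hγ
  have hηβ : β * γ * β = 0 := by
    rw [mul_assoc, hγβ, mul_neg, ← mul_assoc, SuperAlg.odd_sq hβ, zero_mul, neg_zero]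
  have hηγ : β * γ * γ = 0 := by rw [mul_assoc, SuperAlg.odd_sq hγ, mul_zero]
  let η : A.even := ⟨β * γ, hη⟩
  have hηη : η * η = 0 := Subtype.ext (by
    change β * γ * (β * γ) = 0
    rw [← mul_assoc, hηβ, zero_mul])
  let d : Fin n ⊕ Fin m → A.evenˣ := fun j =>
    if j = Sum.inl i ∨ j = Sum.inr p then oneSub η hηη else 1
  let D : SGL (stdParity n m) A := SGL.map _ A.evenHom (torusR d)
  have hD : (D : SuperMat (stdParity n m) A).1 =
      1 - Matrix.single (Sum.inl i) (Sum.inl i) (β * γ) -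
        Matrix.single (Sum.inr p) (Sum.inr p) (β * γ) := by
    refine (Matrix.diagonal_map (map_zero A.even.val)).trans ?_
    ext a b
    by_cases hab : a = b
    · subst hab
      rw [Matrix.diagonal_apply_eq, Matrix.sub_apply, Matrix.sub_apply, Matrix.one_apply_eq,
        Matrix.single_apply, Matrix.single_apply]
      by_cases h1 : a = Sum.inl i
      · subst h1
        simp [d, oneSub, η]
      · by_cases h2 : a = Sum.inr p
        · subst h2
          simp [d, oneSub, η]
        · simp [d, h1, h2, Ne.symm h1, Ne.symm h2]
    · rw [Matrix.diagonal_apply_ne _ hab, Matrix.sub_apply, Matrix.sub_apply,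
        Matrix.one_apply_ne hab, Matrix.single_apply, Matrix.single_apply, if_neg, if_neg]
      · simp
      · rintro ⟨rfl, rfl⟩; exact hab rfl
      · rintro ⟨rfl, rfl⟩; exact hab rfl
  have hgrp : oddElem (odd_pair' i p) hγ * oddElem (odd_pair i p) hβ =
      D * (oddElem (odd_pair i p) hβ * oddElem (odd_pair' i p) hγ) := by
    refine sgl_ext ?_
    have n1 : (Sum.inl i : Fin n ⊕ Fin m) ≠ Sum.inr p := Sum.inl_ne_inr
    have n2 : (Sum.inr p : Fin n ⊕ Fin m) ≠ Sum.inl i := Sum.inr_ne_inl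
    rw [val_mul, val_mul, val_mul, val_oddElem, val_oddElem, hD]
    simp only [mul_add, add_mul, sub_mul, mul_one, one_mul, Matrix.single_mul_single_same,
      Matrix.single_mul_single_of_ne _ _ _ _ n1, Matrix.single_mul_single_of_ne _ _ _ _ n2, hηβ,
      hηγ, hγβ, Matrix.single_zero]
    rw [show β * γ * (β * γ) = 0 by rw [← mul_assoc, hηβ, zero_mul], Matrix.single_zero]
    have hneg : Matrix.single (Sum.inr p : Fin n ⊕ Fin m) (Sum.inr p : Fin n ⊕ Fin m) (-(β * γ)) =
        -Matrix.single (Sum.inr p : Fin n ⊕ Fin m) (Sum.inr p : Fin n ⊕ Fin m) (β * γ) := by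
      ext a b
      rw [Matrix.neg_apply, Matrix.single_apply, Matrix.single_apply]
      split_ifs <;> simp
    rw [hneg]
    abel
  -- As βγ has square zero, (1 - βγ)^k = 1 - kβγ, so D acts on weight w by 1 - (w_i + w_p)βγ.
  have hmatD : V.mat D = 1 - (β * γ) • (V.cartanOp i p).map (algebraMap ℂ A) := by
    have hw : ∀ w : Wt n m, (wpow d w : A.even) =
        1 - ((w (Sum.inl i) + w (Sum.inr p) : ℤ) : A.even) * η := by
      intro w
      have h1 : wpow d w = oneSub η hηη ^ (w (Sum.inl i) + w (Sum.inr p)) := by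
        rw [wpow, Fintype.prod_sum_type, Finset.prod_eq_single i, Finset.prod_eq_single p, zpow_add]
        · simp [d]
        · intro q _ hq; simp [d, hq]
        · simp
        · intro q _ hq; simp [d, hq]
        · simp
      rw [h1, oneSub_zpow]
    have hsum : ∀ a b, ∑ w ∈ V.wts, V.proj w a b = (1 : Matrix V.ι V.ι ℂ) a b := by
      intro a b
      rw [← V.sum_proj, Matrix.sum_apply]
    ext a b
    rw [V.mat_map, Matrix.map_apply, mat_torusR_apply, map_sum, Matrix.sub_apply,
      Matrix.smul_apply, Matrix.map_apply, cartanOp, Matrix.sum_apply, map_sum]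
    have h1 : (1 : Matrix V.ι V.ι A) a b = algebraMap ℂ A (∑ w ∈ V.wts, V.proj w a b) := by
      rw [hsum, Matrix.one_apply, Matrix.one_apply]; split_ifs <;> simp
    rw [h1, map_sum, smul_eq_mul, Finset.mul_sum, ← Finset.sum_sub_distrib]
    refine Finset.sum_congr rfl fun w _ => ?_
    rw [map_smul, hw]
    change V.proj w a b • A.even.val (1 - _ * η) = _
    rw [map_sub, map_mul, map_one, map_intCast, Matrix.smul_apply, smul_eq_mul, map_mul,
      Algebra.smul_def, mul_sub, mul_one, map_intCast]
    congr 1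
    change _ * (_ * (β * γ)) = _
    rw [← mul_assoc, ← Int.cast_comm, ← A.comm_even _ (hη)]
  have hprod : ∀ (a b : A) (M N : Matrix V.ι V.ι ℂ), (a • M.map (algebraMap ℂ A)) *
      (b • N.map (algebraMap ℂ A)) = (a * b) • (M * N).map (algebraMap ℂ A) := by
    intro a b M N
    rw [Matrix.smul_mul, mapC_mul_smul, smul_smul, ← Matrix.map_mul]
  have h1 := congrArg V.mat hgrp
  rw [V.mat_mul, V.mat_mul, V.mat_mul, hmatD, mat_oddElem, mat_oddElem] at h1
  simp only [mul_add, add_mul, sub_mul, mul_one, one_mul, hprod, hηβ, hηγ, zero_smul, hγβ,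
    neg_smul] at h1
  rw [show β * γ * (β * γ) = 0 by rw [← mul_assoc, hηβ, zero_mul], zero_smul] at h1
  rw [Matrix.map_add _ (fun a b => map_add _ a b), smul_add]
  have h2 := sub_eq_zero.2 h1.symm
  rw [← sub_eq_zero, ← h2]
  abel

/-- The parameters are taken to be two independent odd variables, adjoined one after the other, and
both are then stripped off. -/
theorem anticommutator (i : Fin n) (p : Fin m) :
    V.oddOp (odd_pair i p) * V.oddOp (odd_pair' i p) +
      V.oddOp (odd_pair' i p) * V.oddOp (odd_pair i p) = V.cartanOp i p := by
  let B := (SuperAlg.ofComm ℂ).adjoinOdd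
  have h1 := V.smul_anticommutator (A := B.adjoinOdd) i p SuperAlg.theta_mem
    (B.adjoinOddIncl.map_mem _ _ (SuperAlg.theta_mem (A := SuperAlg.ofComm ℂ)))
  ext a b
  have h2 := congrFun (congrFun h1 a) b
  simp only [Matrix.smul_apply, Matrix.map_apply, smul_eq_mul] at h2
  rw [← sub_eq_zero, ← mul_sub, ← map_sub, algebraMap_adjoinOdd, mul_assoc, ← map_mul] at h2
  have h3 := SuperAlg.eq_zero_of_theta_mul h2
  rw [algebraMap_adjoinOdd] at h3
  have h4 := SuperAlg.eq_zero_of_theta_mul h3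
  exact sub_eq_zero.1 h4

theorem str_eq_trace {ι : Type} [Fintype ι] [DecidableEq ι] {R : Type*} [CommRing R]
    (p : ι → ZMod 2) (M : Matrix ι ι R) :
    str p M = (Matrix.diagonal (fun i => (sgn (p i) : R)) * M).trace := by
  simp [str, Matrix.trace, Matrix.diagonal_mul]

theorem sgn_mul_oddOp {j k : Fin n ⊕ Fin m} (hp : stdParity n m j + stdParity n m k = 1) :
    Matrix.diagonal (fun i => (sgn (V.parity i) : ℂ)) * V.oddOp hp =
      -(V.oddOp hp * Matrix.diagonal (fun i => (sgn (V.parity i) : ℂ))) := by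
  ext a b
  rw [Matrix.neg_apply, Matrix.diagonal_mul, Matrix.mul_diagonal]
  by_cases hab : V.parity a = V.parity b
  · rw [V.oddOp_odd hp hab]; simp
  · rcases zmod_two_cases (V.parity a) with ha | ha <;>
    rcases zmod_two_cases (V.parity b) with hb | hb
    · exact absurd (ha.trans hb.symm) hab
    · simp [ha, hb, sgn]
    · simp [ha, hb, sgn]
    · exact absurd (ha.trans hb.symm) hab

/-- The supertrace is applied to (XY + YX)P_w with X = E_{ip}, Y = E_{pi}. In str(XYP_w) the
operator Y is moved cyclically: this changes the sign, since Y is odd, and replaces w by w plus the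
weight of Y. -/
theorem weight_mul_sdim (i : Fin n) (p : Fin m) (w : Wt n m) :
    ((w (Sum.inl i) + w (Sum.inr p) : ℤ) : ℂ) * V.sdimWeight w =
      str V.parity (V.oddOp (odd_pair' i p) * V.oddOp (odd_pair i p) * V.proj w) -
      str V.parity (V.oddOp (odd_pair' i p) * V.oddOp (odd_pair i p) *
        V.proj (w + (Pi.single (Sum.inr p) 1 - Pi.single (Sum.inl i) 1))) := by
  have h1 : ((w (Sum.inl i) + w (Sum.inr p) : ℤ) : ℂ) • V.proj w = V.cartanOp i p * V.proj w := by
    rw [cartanOp, Finset.sum_mul]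
    simp only [Matrix.smul_mul, proj_mul_proj]
    by_cases hw : w ∈ V.wts
    · rw [Finset.sum_eq_single w (fun u _ hu => by rw [if_neg hu, smul_zero])
        (fun h => absurd hw h), if_pos rfl]
    · rw [V.proj_eq_zero hw, smul_zero]
      exact (Finset.sum_eq_zero fun u hu => by
        rw [if_neg (fun h : u = w => hw (h ▸ hu)), smul_zero]).symm
  set X := V.oddOp (odd_pair i p) with hX
  set Y := V.oddOp (odd_pair' i p) with hY
  have h2 : str V.parity (X * Y * V.proj w) = -str V.parity (Y * X *
      V.proj (w + (Pi.single (Sum.inr p) 1 - Pi.single (Sum.inl i) 1))) := by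
    rw [mul_assoc X, hY, oddOp_mul_proj, ← hY, str_eq_trace, str_eq_trace, ← mul_assoc, ← mul_assoc,
      Matrix.trace_mul_comm, ← mul_assoc, ← mul_assoc, ← mul_assoc, ← mul_assoc]
    rw [hY, sgn_mul_oddOp, ← hY]
    simp
  rw [sdimWeight_eq, str_eq_trace, ← smul_eq_mul, ← Matrix.trace_smul, ← Matrix.mul_smul, h1,
    ← anticommutator, add_mul, mul_add, Matrix.trace_add, ← str_eq_trace, ← str_eq_trace, h2]
  ring

/-- The permutation matrices. -/
def permSGL (σ : Equiv.Perm (Fin n)) (τ : Equiv.Perm (Fin m)) (R : Type) [CommRing R]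
    [Algebra ℂ R] : SGL (stdParity n m) (SuperAlg.ofComm R) :=
  have hmem : ∀ (σ : Equiv.Perm (Fin n)) (τ : Equiv.Perm (Fin m)),
      (Equiv.toPEquiv (Equiv.sumCongr σ τ)).toMatrix ∈
        SuperMat (stdParity n m) (SuperAlg.ofComm R) := by
    intro σ τ i j
    by_cases h : Equiv.sumCongr σ τ i = j
    · have : stdParity n m j = stdParity n m i := by
        rw [← h]; cases i <;> rfl
      rw [this, add_self_parity]
      exact Submodule.mem_top
    · have h0 : (Equiv.toPEquiv (Equiv.sumCongr σ τ)).toMatrix i j = (0 : R) := by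
        rw [PEquiv.toMatrix_apply, if_neg]
        intro h'
        exact h (by simpa using h')
      exact h0 ▸ Submodule.zero_mem (evenGrading R _)
  have hmul : ∀ (σ : Equiv.Perm (Fin n)) (τ : Equiv.Perm (Fin m)),
      ((Equiv.toPEquiv (Equiv.sumCongr σ τ)).toMatrix : Matrix _ _ R) *
        (Equiv.toPEquiv (Equiv.sumCongr σ.symm τ.symm)).toMatrix = 1 := by
    intro σ τ
    rw [← PEquiv.toMatrix_trans, ← Equiv.toPEquiv_trans, ← PEquiv.toMatrix_refl,
      ← Equiv.toPEquiv_refl]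
    congr 2
    ext a
    cases a <;> simp
  mkSGL _ _ (hmem σ τ) (hmem σ.symm τ.symm) (hmul σ τ) (hmul σ.symm τ.symm)

theorem permSGL_mul_torusR (σ : Equiv.Perm (Fin n)) (τ : Equiv.Perm (Fin m)) {R : Type} [CommRing R]
    [Algebra ℂ R] (d : Fin n ⊕ Fin m → Rˣ) :
    permSGL σ τ R * torusR d = torusR (fun j => d (Equiv.sumCongr σ τ j)) * permSGL σ τ R := by
  refine sgl_ext (Matrix.ext fun i j => ?_)
  change ((Equiv.toPEquiv (Equiv.sumCongr σ τ)).toMatrix * Matrix.diagonal _ : Matrix _ _ R) i j =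
    (Matrix.diagonal _ * (Equiv.toPEquiv (Equiv.sumCongr σ τ)).toMatrix : Matrix _ _ R) i j
  rw [Matrix.mul_diagonal, Matrix.diagonal_mul, PEquiv.toMatrix_apply]
  split_ifs with h
  · have h' : Equiv.sumCongr σ τ i = j := by simpa using h
    subst h'
    exact mul_comm _ _
  · simp

/-- Even matrices over a commutative algebra commute with the diagonal sign matrix, so this is
conjugation invariance of the ordinary trace. -/
theorem str_conj {ι : Type} [Fintype ι] [DecidableEq ι] {R : Type} [CommRing R] [Algebra ℂ R]
    {p : ι → ZMod 2} (g : SGL p (SuperAlg.ofComm R)) {M N : Matrix ι ι R}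
    (h : (g : SuperMat p (SuperAlg.ofComm R)).1 * M = N * (g : SuperMat p (SuperAlg.ofComm R)).1) :
    str p N = str p M := by
  set S : Matrix ι ι R := (g : SuperMat p (SuperAlg.ofComm R)).1
  set S' : Matrix ι ι R := ((g⁻¹ : SGL p (SuperAlg.ofComm R)) : SuperMat p (SuperAlg.ofComm R)).1
  have h1 : S' * S = 1 := congrArg Subtype.val g.inv_val
  have h2 : S * S' = 1 := congrArg Subtype.val g.val_inv
  have h3 : N = S * M * S' := by rw [h, mul_assoc, h2, mul_one]
  have h4 : Matrix.diagonal (fun i => (sgn (p i) : R)) * S =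
      S * Matrix.diagonal (fun i => (sgn (p i) : R)) := by
    ext a b
    rw [Matrix.diagonal_mul, Matrix.mul_diagonal]
    by_cases hab : p a = p b
    · rw [hab, mul_comm]
    · have h5 := (g : SuperMat p (SuperAlg.ofComm R)).2 a b
      have h6 : p a + p b ≠ 0 := by
        intro h0
        apply hab
        revert h0
        generalize p a = x; generalize p b = y
        revert x y; decide
      have h7 : S a b = 0 := by
        change S a b ∈ evenGrading R (p a + p b) at h5
        simpa [evenGrading, h6] using h5
      rw [h7, mul_zero, zero_mul]
  rw [str_eq_trace, str_eq_trace, h3, ← mul_assoc, ← mul_assoc, h4, Matrix.trace_mul_comm,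
    ← mul_assoc, ← mul_assoc, h1, one_mul]

/-- Permutation matrices of the even group conjugate the universal torus point into its permuted
version, and the supertrace does not notice conjugation. -/
theorem permAct_sch (σ : Equiv.Perm (Fin n)) (τ : Equiv.Perm (Fin m)) :
    permAct σ τ V.sch = V.sch := by
  set π := Equiv.sumCongr σ τ with hπ
  have h1 : ∀ f : LaurentRing n m,
      toC n m (permAct σ τ f) = evalT (fun j => zU (π j)) (toC n m f) := by
    intro f
    induction f using AddMonoidAlgebra.induction_linear with
    | zero => simp
    | add f g hf hg => rw [map_add, map_add, hf, hg, map_add, map_add]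
    | single w c =>
      rw [toC_single, evalT_single]
      have h2 : wpow (fun j => zU (n := n) (m := m) (π j)) w = wpow zU (permWt π w) := by
        rw [wpow, wpow, ← Equiv.prod_comp π (fun j => zU j ^ permWt π w j)]
        exact Finset.prod_congr rfl fun j _ => by simp [permWt]
      rw [h2, wpow_zU, AddMonoidAlgebra.smul_single, smul_eq_mul, mul_one]
      simp [permAct, toC_single, hπ]
  refine toC_injective ?_
  rw [h1, toC_sch]
  have h2 := congrArg V.mat (permSGL_mul_torusR σ τ (zU : Fin n ⊕ Fin m → _))
  rw [V.mat_mul, V.mat_mul] at h2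
  have h3 := str_conj (V.ρ _ (permSGL σ τ (TorusRing n m))) h2
  rw [mat_torusR_eq_map] at h3
  refine Eq.trans ?_ h3
  rw [schC, str, map_sum, str]
  exact Finset.sum_congr rfl fun i _ => map_zsmul _ _ _

/-- Summed over all weights, `weight_mul_sdim` exhibits the Euler sum as (1 - z^(-α)) times a
Laurent polynomial over ℂ, where z^α = y_p/x_i. The substitution x_i ↦ y_p sends z^α to 1, hence
kills the sum. -/
theorem sch_mem_J00 : V.sch ∈ J00 n m := by
  refine ⟨fun σ τ => V.permAct_sch σ τ, fun i p => ?_⟩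
  rw [mem_span_sub_iff]
  set α : Wt n m := Pi.single (Sum.inr p) 1 - Pi.single (Sum.inl i) 1 with hα
  have hα0 : mergeWt i p α = 0 := by
    ext j
    by_cases h1 : j = Sum.inl i
    · subst h1; simp [mergeWt]
    · by_cases h2 : j = Sum.inr p
      · subst h2; simp [mergeWt, hα]
      · simp [mergeWt, hα, h1, h2]
  let mC : TorusRing n m →ₐ[ℂ] TorusRing n m := AddMonoidAlgebra.mapDomainAlgHom ℂ ℂ (mergeWt i p)
  have hmC : ∀ w c, mC (AddMonoidAlgebra.single w c) = AddMonoidAlgebra.single (mergeWt i p w) c := by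
    intro w c; simp [mC]
  have h1 : ∀ f, toC n m (merge i p f) = mC (toC n m f) := by
    intro f
    induction f using AddMonoidAlgebra.induction_linear with
    | zero => simp
    | add f g hf hg => rw [map_add, map_add, hf, hg, map_add, map_add]
    | single w c => rw [merge_single, toC_single, toC_single, hmC]
  refine toC_injective ?_
  rw [h1, map_zero]
  let d : Wt n m → ℂ := fun w =>
    str V.parity (V.oddOp (odd_pair' i p) * V.oddOp (odd_pair i p) * V.proj w)
  have hd : ∀ w, w ∉ V.wts → d w = 0 := by
    intro w hw
    simp [d, V.proj_eq_zero hw, str]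
  let G : TorusRing n m := ∑ w ∈ V.wts, AddMonoidAlgebra.single w (d w)
  have hG : ∀ w, G.coeff w = d w := by
    intro w
    simp only [G, AddMonoidAlgebra.coeff_sum, Finsupp.finsetSum_apply,
      AddMonoidAlgebra.coeff_single, Finsupp.single_apply, Finset.sum_ite_eq']
    split_ifs with hw
    · rfl
    · exact (hd w hw).symm
  have h2 : toC n m (euler (Sum.inr p) V.sch + euler (Sum.inl i) V.sch) =
      (1 - AddMonoidAlgebra.single (-α) 1) * G := by
    ext w
    rw [sub_mul, one_mul, AddMonoidAlgebra.coeff_sub, Finsupp.sub_apply, hG]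
    have h3 : ((AddMonoidAlgebra.single (-α) 1 : TorusRing n m) * G).coeff w = d (w + α) := by
      have := AddMonoidAlgebra.coeff_single_mul_add G (1 : ℂ) (-α) (w + α)
      rw [neg_add_cancel_comm_assoc] at this
      rw [this, one_mul, hG]
    rw [h3, coeff_toC, AddMonoidAlgebra.coeff_add, Finsupp.add_apply, coeff_euler, coeff_euler,
      coeff_sch, ← V.weight_mul_sdim i p w]
    push_cast
    ring
  rw [h2, map_mul, map_sub, map_one, hmC, map_neg, hα0, neg_zero]
  change (1 - 1) * _ = _
  rw [sub_self, zero_mul]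

end GLRep

theorem schHom_mem_J00 {n m : ℕ} (a : GrothRing n m) : schHom n m a ∈ J00 n m := by
  obtain ⟨a, rfl⟩ := QuotientAddGroup.mk'_surjective (grothSubgroup n m) a
  induction a using FreeAbelianGroup.induction_on with
  | zero => rw [map_zero]; erw [map_zero]; exact Subring.zero_mem _
  | of V => exact (schHom_cls V).symm ▸ V.sch_mem_J00
  | neg V h => rw [map_neg]; erw [map_neg]; exact Subring.neg_mem _ h
  | add a b ha hb => rw [map_add]; erw [map_add]; exact Subring.add_mem _ ha hb

/-! ### The action of elementary supermatrices -/

/-- Evaluation of polynomials at an even element. -/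
def SuperAlg.polyEval {A : SuperAlg} {a : A} (ha : a ∈ A.grading 0) :
    (SuperAlg.ofComm (Polynomial ℂ)).Hom A :=
  ⟨Polynomial.aeval a, fun e f hf => by
    change f ∈ evenGrading (Polynomial ℂ) e at hf
    rcases zmod_two_cases e with rfl | rfl
    · have h1 := (Polynomial.aeval (⟨a, ha⟩ : A.even) f).2
      have h2 := Polynomial.aeval_algHom_apply A.even.val (⟨a, ha⟩ : A.even) f
      exact h2.symm ▸ h1
    · have h0 : f = 0 := by simpa [evenGrading] using hf
      rw [h0, map_zero]; exact Submodule.zero_mem _⟩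

theorem mem_ofComm_zero {R : Type} [CommRing R] [Algebra ℂ R] (a : R) :
    a ∈ (SuperAlg.ofComm R).grading 0 := by
  change a ∈ evenGrading R 0
  simp [evenGrading]

theorem parity_add_cases {ι : Type} (p : ι → ZMod 2) (j k : ι) :
    p j + p k = 0 ∨ p j + p k = 1 := zmod_two_cases _

/-- The even elementary supermatrix `1 + a E_{jk}`. -/
def evenElem {ι : Type} [Fintype ι] [DecidableEq ι] {p : ι → ZMod 2} {A : SuperAlg} {j k : ι}
    (hjk : j ≠ k) (hp : p j + p k = 0) {a : A} (ha : a ∈ A.grading 0) : SGL p A :=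
  elem hjk ⟨a, hp.symm ▸ ha⟩

theorem evenElem_congr {ι : Type} [Fintype ι] [DecidableEq ι] {p : ι → ZMod 2} {A : SuperAlg}
    {j k : ι} (hjk : j ≠ k) (hp : p j + p k = 0) {a b : A} (ha : a ∈ A.grading 0)
    (hb : b ∈ A.grading 0) (h : a = b) : (evenElem hjk hp ha : SGL p A) = evenElem hjk hp hb := by
  subst h; rfl

theorem map_evenElem {ι : Type} [Fintype ι] [DecidableEq ι] {p : ι → ZMod 2} {A B : SuperAlg}
    (φ : A.Hom B) {j k : ι} (hjk : j ≠ k) (hp : p j + p k = 0) {a : A} (ha : a ∈ A.grading 0) :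
    SGL.map p φ (evenElem hjk hp ha) = evenElem hjk hp (φ.map_mem _ _ ha) := map_elem _ _ _

/-! ### Divided powers of even root vectors and root operators -/

namespace GLRep

variable {n m : ℕ} (V : GLRep n m) {A : SuperAlg} {j k : Fin n ⊕ Fin m}

/-- The matrix of the universal even elementary matrix. -/
def evenMat (hjk : j ≠ k) (hp : stdParity n m j + stdParity n m k = 0) :
    Matrix V.ι V.ι (Polynomial ℂ) :=
  V.mat (evenElem hjk hp (mem_ofComm_zero (Polynomial.X : Polynomial ℂ)))

theorem mat_evenElem (hjk : j ≠ k) (hp : stdParity n m j + stdParity n m k = 0) {a : A}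
    (ha : a ∈ A.grading 0) :
    V.mat (evenElem hjk hp ha) = (V.evenMat hjk hp).map (Polynomial.aeval a) := by
  have h1 : evenElem hjk hp ha = SGL.map (stdParity n m) (SuperAlg.polyEval ha)
      (evenElem hjk hp (mem_ofComm_zero (Polynomial.X : Polynomial ℂ))) := by
    rw [map_evenElem]
    exact evenElem_congr _ _ _ _ (Polynomial.aeval_X a).symm
  rw [h1, V.mat_map]
  rfl

/-- The divided powers of the even root vector `E_{jk}`. -/
def evenOp (hjk : j ≠ k) (hp : stdParity n m j + stdParity n m k = 0) (r : ℕ) : Matrix V.ι V.ι ℂ :=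
  (V.evenMat hjk hp).map fun f => f.coeff r

theorem evenOp_zero (hjk : j ≠ k) (hp : stdParity n m j + stdParity n m k = 0) :
    V.evenOp hjk hp 0 = 1 := by
  have h1 := V.mat_evenElem hjk hp (mem_ofComm_zero (0 : ℂ))
  have h2 : (evenElem hjk hp (mem_ofComm_zero (0 : ℂ)) : SGL (stdParity n m) _) = 1 := by
    refine sgl_ext ?_
    change 1 + Matrix.single j k (0 : ℂ) = 1
    simp
  rw [h2, V.mat_one] at h1
  ext a b
  have h3 := congrFun (congrFun h1 a) b
  rw [Matrix.map_apply] at h3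
  refine Eq.trans ?_ h3.symm
  rw [evenOp, Matrix.map_apply, Polynomial.coeff_zero_eq_aeval_zero]

/-- A bound for the degrees in `evenMat`. -/
def evenDeg (hjk : j ≠ k) (hp : stdParity n m j + stdParity n m k = 0) : ℕ :=
  Finset.univ.sup fun a : V.ι × V.ι => (V.evenMat hjk hp a.1 a.2).natDegree

theorem mat_evenElem_eq_sum (hjk : j ≠ k) (hp : stdParity n m j + stdParity n m k = 0) {a : A}
    (ha : a ∈ A.grading 0) :
    V.mat (evenElem hjk hp ha) = 1 + ∑ r ∈ Finset.range (V.evenDeg hjk hp),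
      a ^ (r + 1) • (V.evenOp hjk hp (r + 1)).map (algebraMap ℂ A) := by
  have h1 : V.mat (evenElem hjk hp ha) = ∑ r ∈ Finset.range (V.evenDeg hjk hp + 1),
      a ^ r • (V.evenOp hjk hp r).map (algebraMap ℂ A) := by
    rw [mat_evenElem]
    ext b c
    rw [Matrix.map_apply, Matrix.sum_apply, Polynomial.aeval_eq_sum_range'
      (n := V.evenDeg hjk hp + 1) (Nat.lt_succ_of_le
        (Finset.le_sup (f := fun a : V.ι × V.ι => (V.evenMat hjk hp a.1 a.2).natDegree)
          (Finset.mem_univ (b, c))))]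
    refine Finset.sum_congr rfl fun r _ => ?_
    rw [Matrix.smul_apply, Matrix.map_apply, smul_eq_mul, Algebra.smul_def, Algebra.commutes]
    rfl
  rw [h1, Finset.sum_range_succ', evenOp_zero, pow_zero, one_smul, add_comm]
  congr 1
  exact Matrix.map_one _ (map_zero _) (map_one _)

theorem torus_mul_evenOp (hjk : j ≠ k) (hp : stdParity n m j + stdParity n m k = 0) (r : ℕ)
    (t : Fin n ⊕ Fin m → ℂˣ) :
    V.torusMat t * V.evenOp hjk hp r =
      (wpow t (r • (Pi.single j 1 - Pi.single k 1)) : ℂ) • (V.evenOp hjk hp r * V.torusMat t) := by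
  have hw : (wpow t (r • (Pi.single j 1 - Pi.single k 1)) : ℂˣ) = (t j * (t k)⁻¹) ^ r := by
    induction r with
    | zero => rw [zero_smul, wpow_zero, pow_zero]
    | succ r ih =>
      rw [add_smul, one_smul, wpow_add, ih, sub_eq_add_neg, wpow_add, ← Pi.single_neg, wpow_single,
        wpow_single, zpow_one, zpow_neg_one, pow_succ]
  set c : ℂ := ((t j * (t k)⁻¹ : ℂˣ) : ℂ) with hc
  let B := SuperAlg.ofComm (Polynomial ℂ)
  have h1 := congrArg V.mat (torusA_mul_elem (A := B) t hjk
    ⟨(Polynomial.X : Polynomial ℂ), hp.symm ▸ mem_ofComm_zero _⟩)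
  rw [V.mat_mul, V.mat_mul, mat_torusA] at h1
  have h2 : V.mat (elem hjk (c • (⟨(Polynomial.X : Polynomial ℂ), hp.symm ▸ mem_ofComm_zero _⟩ :
      B.grading (stdParity n m j + stdParity n m k)))) =
      (V.evenMat hjk hp).map (Polynomial.aeval (c • (Polynomial.X : Polynomial ℂ))) :=
    V.mat_evenElem (A := B) hjk hp (mem_ofComm_zero (c • (Polynomial.X : Polynomial ℂ)))
  rw [← hc, h2] at h1
  ext a b
  have h3 := congrArg (fun f : Polynomial ℂ => f.coeff r) (congrFun (congrFun h1 a) b)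
  rw [Matrix.mul_apply, Matrix.mul_apply] at h3
  rw [Matrix.smul_apply, Matrix.mul_apply, Matrix.mul_apply, hw, smul_eq_mul, Finset.mul_sum]
  refine Eq.trans ?_ (h3.trans ?_)
  · refine Eq.trans ?_ (Polynomial.finsetSum_coeff _ _ _).symm
    refine Finset.sum_congr rfl fun i _ => ?_
    exact (Polynomial.coeff_C_mul _).symm
  · refine (Polynomial.finsetSum_coeff _ _ _).trans ?_
    refine Finset.sum_congr rfl fun i _ => ?_
    refine (Polynomial.coeff_mul_C _ _ _).trans ?_
    rw [Matrix.map_apply, ← mul_assoc]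
    congr 1
    rw [Polynomial.smul_eq_C_mul, ← Polynomial.comp_eq_aeval, Polynomial.comp_C_mul_X_coeff,
      mul_comm, Units.val_pow_eq_pow_val]
    rfl

/-- The image of an idempotent is stable under the complex points and the odd root operators. -/
def GenStable (E : Matrix V.ι V.ι ℂ) : Prop :=
  (∀ γ : SGL (stdParity n m) (SuperAlg.ofComm ℂ), E * V.mat γ * E = V.mat γ * E) ∧
    ∀ (j k : Fin n ⊕ Fin m) (hp : stdParity n m j + stdParity n m k = 1),
      E * V.oddOp hp * E = V.oddOp hp * E

/-- Stability under 1 + cE_{jk} for all complex c is a polynomial identity in c, so it holds for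
each coefficient. -/
theorem GenStable.evenOp {E : Matrix V.ι V.ι ℂ} (hE : V.GenStable E) (hjk : j ≠ k)
    (hp : stdParity n m j + stdParity n m k = 0) (r : ℕ) :
    E * V.evenOp hjk hp r * E = V.evenOp hjk hp r * E := by
  have h1 : E.map Polynomial.C * V.evenMat hjk hp * E.map Polynomial.C =
      V.evenMat hjk hp * E.map Polynomial.C := by
    ext1 a b
    refine Polynomial.funext fun c => ?_
    have h2 := congrFun (congrFun (hE.1 (evenElem hjk hp (mem_ofComm_zero c))) a) b
    rw [mat_evenElem] at h2
    have h3 : ∀ M : Matrix V.ι V.ι (Polynomial ℂ), ∀ a b,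
        Polynomial.eval c (M a b) = (M.map (Polynomial.evalRingHom c)) a b := fun _ _ _ => rfl
    have h4 : (E.map Polynomial.C).map (Polynomial.evalRingHom c) = E := by
      ext x y; simp
    rw [h3, h3, Matrix.map_mul, Matrix.map_mul, Matrix.map_mul, h4]
    exact h2
  have h5 : ∀ (M : Matrix V.ι V.ι (Polynomial ℂ)),
      (E.map Polynomial.C * M).map (fun f => f.coeff r) = E * M.map fun f => f.coeff r := by
    intro M
    ext a b
    simp [Matrix.mul_apply, Polynomial.coeff_C_mul]
  have h6 : ∀ (M : Matrix V.ι V.ι (Polynomial ℂ)),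
      (M * E.map Polynomial.C).map (fun f => f.coeff r) = (M.map fun f => f.coeff r) * E := by
    intro M
    ext a b
    simp [Matrix.mul_apply, Polynomial.coeff_mul_C]
  have h7 := congrArg (fun M : Matrix V.ι V.ι (Polynomial ℂ) => M.map fun f => f.coeff r) h1
  simp only [h6, h5] at h7
  exact h7

/-- The operators through which elementary supermatrices act: they shift weights by a positive
multiple of the root and preserve the subspaces stable under the generators. -/
structure IsRootOp (j k : Fin n ⊕ Fin m) (X : Matrix V.ι V.ι ℂ) : Prop where
  shift : ∃ r : ℕ, ∀ w, X * V.proj w = V.proj (w + (r + 1) • (Pi.single j 1 - Pi.single k 1)) * X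
  stable : ∀ E, V.GenStable E → E * X * E = X * E

/-- Even roots contribute their divided powers of order at least one, odd roots a single linear
term. This common form lets later arguments ignore the parity of the root. -/
theorem mat_elem (hjk : j ≠ k) (a : A.grading (stdParity n m j + stdParity n m k)) :
    ∃ (N : ℕ) (c : ℕ → A) (X : ℕ → Matrix V.ι V.ι ℂ), (∀ r, V.IsRootOp j k (X r)) ∧
      V.mat (elem hjk a) = 1 + ∑ r ∈ Finset.range N, c r • (X r).map (algebraMap ℂ A) := by
  obtain ⟨a, ha⟩ := a
  rcases parity_add_cases (stdParity n m) j k with hp | hp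
  · refine ⟨V.evenDeg hjk hp, fun r => a ^ (r + 1), fun r => V.evenOp hjk hp (r + 1),
      fun r => ⟨⟨r, V.mul_proj_of_shift (V.torus_mul_evenOp hjk hp _)⟩,
        fun E hE => hE.evenOp V hjk hp _⟩, ?_⟩
    exact V.mat_evenElem_eq_sum hjk hp (hp ▸ ha)
  · refine ⟨1, fun _ => a, fun _ => V.oddOp hp, fun _ => ⟨⟨0, fun w => ?_⟩, fun E hE => hE.2 _ _ hp⟩,
      ?_⟩
    · rw [zero_add, one_smul]; exact V.oddOp_mul_proj hp w
    · rw [Finset.sum_range_one]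
      exact V.mat_oddElem hp (hp ▸ ha)

end GLRep

/-! ### Triangular factorizations -/

section Unipotent

variable {ι : Type} [Fintype ι] [DecidableEq ι] {p : ι → ZMod 2} {A : SuperAlg}

/-- The condition `hs` makes every product of two of the matrix units involved vanish, so the
product of the elementary matrices is 1 plus the sum of their off-diagonal parts. -/
theorem exists_unipotent (H : Subgroup (SGL p A)) (s : Finset (ι × ι))
    (hs : ∀ x ∈ s, ∀ y ∈ s, x.2 ≠ y.1) (c : ι × ι → A)
    (hc : ∀ x ∈ s, c x ∈ A.grading (p x.1 + p x.2))
    (hH : ∀ x ∈ s, ∀ (hne : x.1 ≠ x.2) (a : A.grading (p x.1 + p x.2)), elem hne a ∈ H) :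
    ∃ l ∈ H, (l : SuperMat p A).1 = 1 + Matrix.of fun i j => if (i, j) ∈ s then c (i, j) else 0 := by
  induction s using Finset.induction_on with
  | empty =>
    refine ⟨1, H.one_mem, ?_⟩
    ext i j
    simp
  | insert x s hx ih =>
    obtain ⟨l, hl, hl'⟩ := ih (fun y hy z hz => hs y (Finset.mem_insert_of_mem hy) z
      (Finset.mem_insert_of_mem hz)) (fun y hy => hc y (Finset.mem_insert_of_mem hy))
      (fun y hy => hH y (Finset.mem_insert_of_mem hy))
    have hxs := Finset.mem_insert_self x s
    have hne : x.1 ≠ x.2 := (hs x hxs x hxs).symm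
    refine ⟨elem hne ⟨c x, hc x hxs⟩ * l, H.mul_mem (hH x hxs hne _) hl, ?_⟩
    rw [val_mul, val_elem, hl', add_mul, one_mul, mul_add, mul_one]
    have h0 : Matrix.single x.1 x.2 (c x) * (Matrix.of fun i j => if (i, j) ∈ s then c (i, j) else 0)
        = 0 := by
      ext i j
      rw [Matrix.mul_apply, Matrix.zero_apply]
      refine Finset.sum_eq_zero fun k _ => ?_
      rw [Matrix.single_apply, Matrix.of_apply]
      by_cases h1 : x.1 = i ∧ x.2 = k
      · rw [if_neg (fun h2 : (k, j) ∈ s =>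
          hs x hxs (k, j) (Finset.mem_insert_of_mem h2) h1.2), mul_zero]
      · rw [if_neg h1, zero_mul]
    rw [h0, add_zero]
    ext i j
    simp only [Matrix.add_apply, Matrix.of_apply, Matrix.single_apply, Finset.mem_insert]
    by_cases h1 : x = (i, j)
    · subst h1
      simp [hx]
    · have h2 : ¬(x.1 = i ∧ x.2 = j) := fun h => h1 (Prod.ext h.1 h.2)
      simp [h2, Ne.symm h1]

end Unipotent

section Factor

variable {n m : ℕ} (A : SuperAlg)

/-- The position of a basis vector in the standard order. -/
def rk : Fin n ⊕ Fin m → ℕ := Sum.elim (fun i => (i : ℕ)) (fun p => n + p)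

theorem rk_injective : Function.Injective (rk (n := n) (m := m)) := by
  rintro (i | i) (j | j) h <;> simp only [rk, Sum.elim_inl, Sum.elim_inr] at h
  · rw [Fin.ext h]
  · have := i.2; omega
  · have := j.2; omega
  · rw [Fin.ext (by omega : (i : ℕ) = j)]

theorem rk_lt (j : Fin n ⊕ Fin m) : rk j < n + m := by
  rcases j with i | i <;> simp only [rk, Sum.elim_inl, Sum.elim_inr] <;> have := i.2 <;> omega

/-- The group generated by the lower triangular elementary supermatrices. -/
def lowerSub : Subgroup (SGL (stdParity n m) A) := Subgroup.closure
  {g | ∃ (j k : Fin n ⊕ Fin m) (hjk : j ≠ k) (a : A.grading (stdParity n m j + stdParity n m k)),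
    rk k < rk j ∧ g = elem hjk a}

/-- The group generated by the upper triangular elementary supermatrices. -/
def upperSub : Subgroup (SGL (stdParity n m) A) := Subgroup.closure
  {g | ∃ (j k : Fin n ⊕ Fin m) (hjk : j ≠ k) (a : A.grading (stdParity n m j + stdParity n m k)),
    rk j < rk k ∧ g = elem hjk a}

variable {A}

theorem elem_mem_lowerSub {j k : Fin n ⊕ Fin m} (hjk : j ≠ k)
    (a : A.grading (stdParity n m j + stdParity n m k)) (h : rk k < rk j) :
    elem hjk a ∈ lowerSub A := Subgroup.subset_closure ⟨j, k, hjk, a, h, rfl⟩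

theorem elem_mem_upperSub {j k : Fin n ⊕ Fin m} (hjk : j ≠ k)
    (a : A.grading (stdParity n m j + stdParity n m k)) (h : rk j < rk k) :
    elem hjk a ∈ upperSub A := Subgroup.subset_closure ⟨j, k, hjk, a, h, rfl⟩

variable {R S : Type} [CommRing R] [Algebra ℂ R] [CommRing S] [Algebra ℂ S]

theorem mul_mem_evenGrading {e : ZMod 2} {a : R} (ha : a ∈ (SuperAlg.ofComm R).grading e) (b : R) :
    a * b ∈ (SuperAlg.ofComm R).grading e := by
  change _ ∈ evenGrading R e at ha
  change _ ∈ evenGrading R e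
  unfold evenGrading at *
  split_ifs at * <;> simp_all

theorem sum_column {k : Fin n ⊕ Fin m} (P : Fin n ⊕ Fin m → Prop) [DecidablePred P]
    (c : Fin n ⊕ Fin m → R) (M : Matrix (Fin n ⊕ Fin m) (Fin n ⊕ Fin m) R) (i j : Fin n ⊕ Fin m) :
    ((1 + Matrix.of fun i j => if (i, j) ∈ (Finset.univ.filter fun x : (Fin n ⊕ Fin m) × _ =>
      x.2 = k ∧ P x.1) then c i else 0) * M) i j = M i j + if P i then c i * M k j else 0 := by
  rw [add_mul, one_mul, Matrix.add_apply, Matrix.mul_apply, Finset.sum_eq_single k]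
  · simp
  · intro b _ hb
    simp [hb]
  · simp

/-- Elimination below the diagonal. -/
theorem exists_lower (f : S →ₐ[ℂ] R) (hf : ∀ a, f a = 1 → IsUnit a)
    (g : SGL (stdParity n m) (SuperAlg.ofComm S))
    (hg : SGL.map (stdParity n m) (SuperAlg.ofCommHom f) g = 1) (K : ℕ) :
    ∃ l ∈ lowerSub (n := n) (m := m) (SuperAlg.ofComm S),
      SGL.map (stdParity n m) (SuperAlg.ofCommHom f) (l * g) = 1 ∧
      ∀ i j, rk j < K → rk j < rk i → ((l * g : SGL (stdParity n m) (SuperAlg.ofComm S)) :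
        SuperMat (stdParity n m) (SuperAlg.ofComm S)).1 i j = 0 := by
  induction K with
  | zero => exact ⟨1, Subgroup.one_mem _, by rwa [one_mul], fun i j h => absurd h (Nat.not_lt_zero _)⟩
  | succ K ih =>
    obtain ⟨l, hl, hl1, hl2⟩ := ih
    by_cases hk : ∃ k : Fin n ⊕ Fin m, rk k = K
    · obtain ⟨k, rfl⟩ := hk
      set g' := l * g with hg'
      set M : Matrix (Fin n ⊕ Fin m) (Fin n ⊕ Fin m) S := g'.val.1 with hM
      have hMf : ∀ i j, f (M i j) = (1 : Matrix _ _ R) i j := by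
        intro i j
        exact congrFun (congrFun (congrArg (fun x : SGL (stdParity n m) (SuperAlg.ofComm R) =>
          x.val.1) hl1) i) j
      -- The operations performed so far specialize to 1 under `f`, so the pivot still specializes
      -- to 1 and is a unit.
      obtain ⟨u, hu⟩ := hf (M k k) (by rw [hMf, Matrix.one_apply_eq])
      obtain ⟨l', hl', hl'v⟩ := exists_unipotent (p := stdParity n m) (A := SuperAlg.ofComm S)
        (lowerSub _) (Finset.univ.filter fun x : (Fin n ⊕ Fin m) × (Fin n ⊕ Fin m) =>
          x.2 = k ∧ rk k < rk x.1)
        (by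
          intro x hx y hy h
          simp only [Finset.mem_filter, Finset.mem_univ, true_and] at hx hy
          rw [← h, hx.1] at hy
          exact lt_irrefl _ hy.2)
        (fun x => -(M x.1 k * (u⁻¹ : Sˣ)))
        (by
          intro x hx
          simp only [Finset.mem_filter, Finset.mem_univ, true_and] at hx
          rw [hx.1]
          exact Submodule.neg_mem _ (mul_mem_evenGrading (g'.val.2 x.1 k) _))
        (by
          intro x hx hne a
          simp only [Finset.mem_filter, Finset.mem_univ, true_and] at hx
          exact elem_mem_lowerSub _ _ (by rw [hx.1]; exact hx.2))
      refine ⟨l' * l, Subgroup.mul_mem _ hl' hl, ?_, ?_⟩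
      · rw [mul_assoc, map_mul, ← hg', hl1, mul_one]
        refine sgl_ext ?_
        rw [val_map, hl'v]
        ext i j
        change f (((1 : Matrix _ _ S) + _) i j) = (1 : Matrix _ _ R) i j
        rw [Matrix.add_apply, map_add, Matrix.of_apply]
        have h1 : f ((1 : Matrix (Fin n ⊕ Fin m) (Fin n ⊕ Fin m) S) i j) =
            (1 : Matrix _ _ R) i j := by
          rw [Matrix.one_apply, Matrix.one_apply]; split_ifs <;> simp
        rw [h1]
        split_ifs with hij
        · simp only [Finset.mem_filter, Finset.mem_univ, true_and] at hij
          change _ + f (-(M i k * _)) = _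
          have hik : i ≠ k := by
            rintro rfl
            exact lt_irrefl _ hij.2
          have h2 : f (M i k) = 0 := (hMf i k).trans (Matrix.one_apply_ne hik)
          rw [map_neg, map_mul, h2, zero_mul, neg_zero, add_zero]
        · rw [map_zero, add_zero]
      · intro i j hj hji
        rw [mul_assoc, ← hg', val_mul, hl'v]
        refine (sum_column (fun i => rk k < rk i) (fun i => -(M i k * (u⁻¹ : Sˣ))) M i j).trans ?_
        rcases Nat.lt_succ_iff_lt_or_eq.1 hj with hj | hj
        · rw [hl2 i j hj hji, hl2 k j hj hj, mul_zero, zero_add, ite_self]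
        · have hjk := rk_injective hj
          subst hjk
          rw [if_pos hji, ← hu, neg_mul, mul_assoc, Units.inv_mul, mul_one, add_neg_cancel]
    · refine ⟨l, hl, hl1, fun i j hj hji => hl2 i j ?_ hji⟩
      rcases Nat.lt_succ_iff_lt_or_eq.1 hj with hj | hj
      · exact hj
      · exact absurd ⟨j, hj⟩ hk

/-- Elimination above the diagonal. -/
theorem exists_upper (g : SGL (stdParity n m) (SuperAlg.ofComm S))
    (hg : ∀ i j, rk j < rk i → (g : SuperMat (stdParity n m) (SuperAlg.ofComm S)).1 i j = 0)
    (hg1 : ∀ i, (g : SuperMat (stdParity n m) (SuperAlg.ofComm S)).1 i i = 1) (K : ℕ) :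
    ∃ u ∈ upperSub (n := n) (m := m) (SuperAlg.ofComm S),
      (∀ i j, rk j < rk i → ((u * g : SGL (stdParity n m) (SuperAlg.ofComm S)) :
        SuperMat (stdParity n m) (SuperAlg.ofComm S)).1 i j = 0) ∧
      (∀ i, ((u * g : SGL (stdParity n m) (SuperAlg.ofComm S)) :
        SuperMat (stdParity n m) (SuperAlg.ofComm S)).1 i i = 1) ∧
      ∀ i j, rk j < K → rk i < rk j → ((u * g : SGL (stdParity n m) (SuperAlg.ofComm S)) :
        SuperMat (stdParity n m) (SuperAlg.ofComm S)).1 i j = 0 := by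
  induction K with
  | zero => exact ⟨1, Subgroup.one_mem _, by simpa using hg, by simpa using hg1,
      fun i j h => absurd h (Nat.not_lt_zero _)⟩
  | succ K ih =>
    obtain ⟨l, hl, hl0, hl1, hl2⟩ := ih
    by_cases hk : ∃ k : Fin n ⊕ Fin m, rk k = K
    · obtain ⟨k, rfl⟩ := hk
      set g' := l * g with hg'
      set M : Matrix (Fin n ⊕ Fin m) (Fin n ⊕ Fin m) S := g'.val.1 with hM
      obtain ⟨l', hl', hl'v⟩ := exists_unipotent (p := stdParity n m) (A := SuperAlg.ofComm S)
        (upperSub _) (Finset.univ.filter fun x : (Fin n ⊕ Fin m) × (Fin n ⊕ Fin m) =>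
          x.2 = k ∧ rk x.1 < rk k)
        (by
          intro x hx y hy h
          simp only [Finset.mem_filter, Finset.mem_univ, true_and] at hx hy
          rw [← h, hx.1] at hy
          exact lt_irrefl _ hy.2)
        (fun x => -M x.1 k)
        (by
          intro x hx
          simp only [Finset.mem_filter, Finset.mem_univ, true_and] at hx
          rw [hx.1]
          exact Submodule.neg_mem _ (g'.val.2 x.1 k))
        (by
          intro x hx hne a
          simp only [Finset.mem_filter, Finset.mem_univ, true_and] at hx
          exact elem_mem_upperSub _ _ (by rw [hx.1]; exact hx.2))
      have hent : ∀ i j, ((l' * g' : SGL (stdParity n m) (SuperAlg.ofComm S)) :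
          SuperMat (stdParity n m) (SuperAlg.ofComm S)).1 i j =
          M i j + if rk i < rk k then -M i k * M k j else 0 := by
        intro i j
        rw [val_mul, hl'v]
        exact sum_column (fun i => rk i < rk k) (fun i => -M i k) M i j
      refine ⟨l' * l, Subgroup.mul_mem _ hl' hl, ?_, ?_, ?_⟩
      · intro i j hji
        rw [mul_assoc, ← hg', hent, hl0 i j hji, zero_add]
        split_ifs with hik
        · rw [hl0 k j (hji.trans hik), mul_zero]
        · rfl
      · intro i
        rw [mul_assoc, ← hg', hent, hl1 i]
        split_ifs with hik
        · rw [hl0 k i hik, mul_zero, add_zero]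
        · rw [add_zero]
      · intro i j hj hij
        rw [mul_assoc, ← hg', hent]
        rcases Nat.lt_succ_iff_lt_or_eq.1 hj with hj | hj
        · rw [hl2 i j hj hij, hl0 k j hj, mul_zero, ite_self, add_zero]
        · have hjk := rk_injective hj
          subst hjk
          rw [if_pos hij, hl1, mul_one, add_neg_cancel]
    · refine ⟨l, hl, hl0, hl1, fun i j hj hij => hl2 i j ?_ hij⟩
      rcases Nat.lt_succ_iff_lt_or_eq.1 hj with hj | hj
      · exact hj
      · exact absurd ⟨j, hj⟩ hk

/-- Triangular factorization of the matrices that are congruent to the identity. -/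
theorem exists_triangular (f : S →ₐ[ℂ] R) (hf : ∀ a, f a = 1 → IsUnit a)
    (g : SGL (stdParity n m) (SuperAlg.ofComm S))
    (hg : SGL.map (stdParity n m) (SuperAlg.ofCommHom f) g = 1) :
    ∃ l ∈ lowerSub (n := n) (m := m) (SuperAlg.ofComm S),
      ∃ d : Fin n ⊕ Fin m → Sˣ, ∃ u ∈ upperSub (n := n) (m := m) (SuperAlg.ofComm S),
        g = l * torusR d * u := by
  obtain ⟨l, hl, hl1, hl2⟩ := exists_lower f hf g hg (n + m)
  set M : Matrix (Fin n ⊕ Fin m) (Fin n ⊕ Fin m) S := (l * g).val.1 with hM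
  have hMf : ∀ i, IsUnit (M i i) := by
    intro i
    refine hf _ ?_
    exact (congrFun (congrFun (congrArg (fun x : SGL (stdParity n m) (SuperAlg.ofComm R) =>
      x.val.1) hl1) i) i).trans (Matrix.one_apply_eq i)
  choose d hd using hMf
  have hdent : ∀ i j, (((torusR d)⁻¹ * (l * g) : SGL (stdParity n m) (SuperAlg.ofComm S)) :
      SuperMat (stdParity n m) (SuperAlg.ofComm S)).1 i j = ((d i)⁻¹ : Sˣ) * M i j := by
    intro i j
    rw [val_mul]
    exact Matrix.diagonal_mul _ _ _ _
  obtain ⟨u, hu, hu0, hu1, hu2⟩ := exists_upper ((torusR d)⁻¹ * (l * g))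
    (fun i j hij => by rw [hdent, hl2 i j (rk_lt j) hij, mul_zero])
    (fun i => by rw [hdent, ← hd, Units.inv_mul]) (n + m)
  have h1 : u * ((torusR d)⁻¹ * (l * g)) = 1 := by
    refine sgl_ext ?_
    ext i j
    by_cases hij : i = j
    · subst hij
      exact (hu1 i).trans (Matrix.one_apply_eq (α := S) i).symm
    · refine Eq.trans ?_ (Matrix.one_apply_ne (α := S) hij).symm
      rcases lt_or_gt_of_ne (fun h => hij (rk_injective h)) with h | h
      · exact hu2 i j (rk_lt j) h
      · exact hu0 i j h
  refine ⟨l⁻¹, Subgroup.inv_mem _ hl, d, u⁻¹, Subgroup.inv_mem _ hu, ?_⟩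
  have h2 := eq_inv_of_mul_eq_one_right h1
  rw [← h2]
  group

/-- The inverse of an even supermatrix over a commutative algebra is even. -/
theorem inv_mem_superMat {ι : Type} [Fintype ι] [DecidableEq ι] {p : ι → ZMod 2}
    {M N : Matrix ι ι R} (hM : M ∈ SuperMat p (SuperAlg.ofComm R)) (h : M * N = 1) :
    N ∈ SuperMat p (SuperAlg.ofComm R) := by
  have h' : N * M = 1 := mul_eq_one_comm.1 h
  -- Over a purely even algebra, where 2 is invertible, evenness means commuting with the sign
  -- matrix, and this property passes to the inverse.
  set s : Matrix ι ι R := Matrix.diagonal fun i => (sgn (p i) : R) with hs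
  have hss : s * s = 1 := by
    rw [hs, Matrix.diagonal_mul_diagonal, ← Matrix.diagonal_one]
    congr 1
    funext i
    rw [← Int.cast_mul, SuperAlg.sgn_mul_self, Int.cast_one]
  have hp : ∀ i j, p i ≠ p j → p i + p j = 1 := by
    intro i j
    generalize p i = a; generalize p j = b
    revert a b; decide
  have hsM : s * M = M * s := by
    ext i j
    rw [Matrix.diagonal_mul, Matrix.mul_diagonal]
    by_cases hij : p i = p j
    · rw [hij, mul_comm]
    · have h1 : M i j ∈ evenGrading R (p i + p j) := hM i j
      rw [hp i j hij] at h1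
      have h2 : M i j = 0 := by simpa [evenGrading] using h1
      rw [h2, mul_zero, zero_mul]
  have h1 : s * N = N * s := by
    calc s * N = N * M * (s * N) := by rw [h', one_mul]
      _ = N * (M * s) * N := by simp only [mul_assoc]
      _ = N * s * (M * N) := by rw [← hsM]; simp only [mul_assoc]
      _ = N * s := by rw [h, mul_one]
  intro i j
  by_cases hij : p i = p j
  · rw [hij, add_self_parity]; exact mem_ofComm_zero _
  · have h2 := congrFun (congrFun h1 i) j
    rw [Matrix.diagonal_mul, Matrix.mul_diagonal] at h2
    have h3 : (2 : ℂ) • N i j = 0 := by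
      rw [two_smul]
      rcases zmod_two_cases (p i) with hi | hi <;> rcases zmod_two_cases (p j) with hj | hj
      · exact absurd (hi.trans hj.symm) hij
      · rw [hi, hj] at h2
        simp only [sgn, if_true, Int.cast_one, one_mul, one_ne_zero, if_false, Int.cast_neg,
          mul_neg, mul_one] at h2
        nth_rewrite 1 [h2]; simp
      · rw [hi, hj] at h2
        simp only [sgn, if_true, Int.cast_one, one_mul, one_ne_zero, if_false, Int.cast_neg,
          neg_mul, mul_one] at h2
        nth_rewrite 1 [← h2]; simp
      · exact absurd (hi.trans hj.symm) hij
    have h4 : N i j = 0 := (smul_eq_zero.1 h3).resolve_left two_ne_zero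
    exact h4 ▸ Submodule.zero_mem _

/-- An even supermatrix over a commutative algebra with invertible determinant. -/
def sglOfDet {ι : Type} [Fintype ι] [DecidableEq ι] {p : ι → ZMod 2} (M : Matrix ι ι R)
    (hM : M ∈ SuperMat p (SuperAlg.ofComm R)) (hd : IsUnit M.det) : SGL p (SuperAlg.ofComm R) :=
  mkSGL M M⁻¹ hM (inv_mem_superMat hM (Matrix.mul_nonsing_inv M hd)) (Matrix.mul_nonsing_inv M hd)
    (Matrix.nonsing_inv_mul M hd)

end Factor

/-! ### Reduction to triangular matrices -/

section Deformation

variable {n m : ℕ} {R : Type} [CommRing R] [Algebra ℂ R]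

/-- The constant coefficient as a homomorphism of algebras. -/
def constCoeffAlg (R : Type) [CommRing R] [Algebra ℂ R] : PowerSeries R →ₐ[ℂ] R :=
  { PowerSeries.constantCoeff with
    commutes' := fun c => by
      change PowerSeries.constantCoeff (algebraMap ℂ (PowerSeries R) c) = _
      rw [PowerSeries.algebraMap_apply, PowerSeries.constantCoeff_C] }

theorem isUnit_of_constCoeffAlg {a : PowerSeries R} (h : constCoeffAlg R a = 1) : IsUnit a := by
  rw [PowerSeries.isUnit_iff_constantCoeff]
  change IsUnit (constCoeffAlg R a)
  rw [h]; exact isUnit_one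

/-- Polynomials as power series. -/
def polyToSeries (R : Type) [CommRing R] [Algebra ℂ R] : Polynomial R →ₐ[ℂ] PowerSeries R :=
  { Polynomial.coeToPowerSeries.ringHom with
    commutes' := fun c => by
      change ((algebraMap ℂ (Polynomial R) c : Polynomial R) : PowerSeries R) = _
      rw [PowerSeries.algebraMap_apply, Polynomial.algebraMap_apply, Polynomial.coe_C] }

/-- Evaluation at `1`. -/
def evalOne (R : Type) [CommRing R] [Algebra ℂ R] : Polynomial R →ₐ[ℂ] R :=
  { Polynomial.evalRingHom 1 with
    commutes' := fun c => by
      change Polynomial.eval 1 (algebraMap ℂ (Polynomial R) c) = _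
      rw [Polynomial.algebraMap_apply, Polynomial.eval_C] }

/-- The segment `1 + ε (g - 1)` from the identity to `g`. -/
def segment (g : SGL (stdParity n m) (SuperAlg.ofComm R)) :
    Matrix (Fin n ⊕ Fin m) (Fin n ⊕ Fin m) (Polynomial R) :=
  Matrix.of fun i j => (1 : Matrix (Fin n ⊕ Fin m) (Fin n ⊕ Fin m) (Polynomial R)) i j +
    Polynomial.X * Polynomial.C ((show R from g.val.1 i j) - (1 : Matrix _ _ R) i j)

theorem segment_mem (g : SGL (stdParity n m) (SuperAlg.ofComm R)) :
    segment g ∈ SuperMat (stdParity n m) (SuperAlg.ofComm (Polynomial R)) := by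
  intro i j
  rcases zmod_two_cases (stdParity n m i + stdParity n m j) with h | h
  · rw [h]; exact mem_ofComm_zero _
  · have hij : i ≠ j := ne_of_odd h
    have h1 : g.val.1 i j ∈ evenGrading R (stdParity n m i + stdParity n m j) := g.val.2 i j
    rw [h] at h1
    have h2 : (show R from g.val.1 i j) = 0 := by simpa [evenGrading] using h1
    have h3 : segment g i j = 0 := by
      rw [segment, Matrix.of_apply, h2, Matrix.one_apply_ne hij, Matrix.one_apply_ne hij]; simp
    exact h3 ▸ Submodule.zero_mem _

theorem eval_segment (g : SGL (stdParity n m) (SuperAlg.ofComm R)) :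
    (segment g).map (evalOne R) = (g.val.1 : Matrix _ _ R) := by
  ext i j
  change Polynomial.eval 1 (segment g i j) = _
  rw [segment, Matrix.of_apply, Polynomial.eval_add, Polynomial.eval_mul, Polynomial.eval_X,
    Polynomial.eval_C, Matrix.one_apply, Matrix.one_apply]
  split_ifs <;> simp

theorem const_segment (g : SGL (stdParity n m) (SuperAlg.ofComm R)) :
    ((segment g).map (polyToSeries R)).map (constCoeffAlg R) = 1 := by
  ext i j
  change PowerSeries.constantCoeff ((segment g i j : Polynomial R) : PowerSeries R) = _
  rw [Polynomial.constantCoeff_coe, segment, Matrix.of_apply, Polynomial.coeff_add,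
    Polynomial.coeff_X_mul_zero, add_zero, Matrix.one_apply, Matrix.one_apply]
  split_ifs <;> simp

theorem isUnit_det_val {ι : Type} [Fintype ι] [DecidableEq ι] {p : ι → ZMod 2}
    (g : SGL p (SuperAlg.ofComm R)) : IsUnit (g.val.1 : Matrix ι ι R).det := by
  have h : (g.val.1 : Matrix ι ι R) * (g⁻¹).val.1 = 1 := congrArg Subtype.val g.val_inv
  exact IsUnit.of_mul_eq_one _ (by rw [← Matrix.det_mul, h, Matrix.det_one])

end Deformation

/-! ### Density of the triangular cell in the commutative points -/

namespace GLRep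

variable {n m : ℕ} (V : GLRep n m) {R : Type} [CommRing R] [Algebra ℂ R]

theorem map_sandwich {κ κ' : Type} {A B : SuperAlg} (φ : A.Hom B) (L : Matrix κ V.ι ℂ)
    (N : Matrix V.ι κ' ℂ) (g : SGL (stdParity n m) A) :
    (L.map (algebraMap ℂ A) * V.mat g * N.map (algebraMap ℂ A)).map φ.toAlgHom =
      L.map (algebraMap ℂ B) * V.mat (SGL.map _ φ g) * N.map (algebraMap ℂ B) := by
  have h1 : ∀ {a b : Type} (M : Matrix a b ℂ), (M.map (algebraMap ℂ A)).map φ.toAlgHom =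
      M.map (algebraMap ℂ B) := by
    intro a b M
    ext i j
    exact φ.toAlgHom.commutes _
  rw [V.mat_map, ← h1 L, ← h1 N]
  exact (Matrix.map_mul (f := (φ.toAlgHom : A →+* B))).trans
    (congrArg (· * _) (Matrix.map_mul (f := (φ.toAlgHom : A →+* B))))

/-- A matrix coefficient vanishes on all commutative points if it vanishes on the products of
lower triangular, diagonal and upper triangular ones. -/
theorem sandwich_eq_zero {κ κ' : Type} (L : Matrix κ V.ι ℂ) (N : Matrix V.ι κ' ℂ)
    (h : ∀ (S : Type) [CommRing S] [Algebra ℂ S],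
      ∀ l ∈ lowerSub (n := n) (m := m) (SuperAlg.ofComm S), ∀ d : Fin n ⊕ Fin m → Sˣ,
      ∀ u ∈ upperSub (n := n) (m := m) (SuperAlg.ofComm S),
      L.map (algebraMap ℂ (SuperAlg.ofComm S)) * V.mat (l * torusR d * u) *
        N.map (algebraMap ℂ (SuperAlg.ofComm S)) = 0)
    (g : SGL (stdParity n m) (SuperAlg.ofComm R)) :
    L.map (algebraMap ℂ (SuperAlg.ofComm R)) * V.mat g *
      N.map (algebraMap ℂ (SuperAlg.ofComm R)) = 0 := by
  -- The points 1 + ε(g - 1) join the identity to g. Inverting the determinant D gives a ring S that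
  -- maps to R by ε ↦ 1 and to R[[ε]]. Over R[[ε]] the point is congruent to 1, hence triangularly
  -- factorizable, so the matrix coefficient vanishes there; it then vanishes over S and, at ε = 1,
  -- on g.
  set D := (segment g).det with hD
  let S := Localization.Away D
  let ιS : Polynomial R →ₐ[ℂ] S := IsScalarTower.toAlgHom ℂ (Polynomial R) S
  have hdet : ∀ {T : Type} [CommRing T] [Algebra ℂ T] (f : Polynomial R →ₐ[ℂ] T),
      f D = ((segment g).map f).det := by
    intro T _ _ f
    rw [hD]
    exact RingHom.map_det (f : Polynomial R →+* T) _
  have hu1 : IsUnit (evalOne R D) := by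
    rw [hdet, eval_segment]
    exact isUnit_det_val g
  have hu2 : IsUnit (polyToSeries R D) := by
    refine isUnit_of_constCoeffAlg ?_
    rw [hdet]
    refine (RingHom.map_det (constCoeffAlg R : PowerSeries R →+* R) _).trans ?_
    have h1 := const_segment g
    change Matrix.det (((segment g).map (polyToSeries R)).map (constCoeffAlg R)) = 1
    rw [h1, Matrix.det_one]
  have hpow : ∀ {T : Type} [CommRing T] [Algebra ℂ T] (f : Polynomial R →ₐ[ℂ] T), IsUnit (f D) →
      ∀ y : Submonoid.powers D, IsUnit (f y) := by
    rintro T _ _ f hf ⟨_, k, rfl⟩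
    change IsUnit (f (D ^ k))
    rw [map_pow]; exact hf.pow k
  let φ₁ : S →ₐ[ℂ] R := IsLocalization.liftAlgHom (M := Submonoid.powers D) (hpow _ hu1)
  let φ₂ : S →ₐ[ℂ] PowerSeries R := IsLocalization.liftAlgHom (M := Submonoid.powers D) (hpow _ hu2)
  have hφ₁ : ∀ f, φ₁ (ιS f) = evalOne R f := fun f => IsLocalization.lift_eq _ f
  have hφ₂ : ∀ f, φ₂ (ιS f) = polyToSeries R f := fun f => IsLocalization.lift_eq _ f
  -- Polynomials embed into power series, and D is already a unit there, so localizing at D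
  -- preserves injectivity.
  have hinj : ∀ s, φ₂ s = 0 → s = 0 := by
    intro s hs
    obtain ⟨⟨f, y⟩, hfy⟩ := IsLocalization.surj (Submonoid.powers D) s
    have h1 : φ₂ (s * ιS y) = φ₂ (ιS f) := congrArg φ₂ hfy
    rw [map_mul, hs, zero_mul, hφ₂] at h1
    have h2 : f = 0 := Polynomial.coe_injective R (h1.symm.trans (Polynomial.coe_zero).symm)
    subst h2
    rw [map_zero] at hfy
    exact (IsUnit.mul_left_eq_zero (IsLocalization.map_units S y)).1 hfy
  have hGmem : (segment g).map ιS ∈ SuperMat (stdParity n m) (SuperAlg.ofComm S) := fun i j =>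
    (SuperAlg.ofCommHom ιS).map_mem _ _ (segment_mem g i j)
  let G : SGL (stdParity n m) (SuperAlg.ofComm S) := sglOfDet ((segment g).map ιS) hGmem (by
    rw [← hdet]
    exact IsLocalization.map_units S (⟨D, Submonoid.mem_powers D⟩ : Submonoid.powers D))
  have hG1 : SGL.map (stdParity n m) (SuperAlg.ofCommHom φ₁) G = g := by
    refine sgl_ext ?_
    rw [← eval_segment g, val_map]
    ext i j
    exact hφ₁ _
  have hG2 : SGL.map (stdParity n m) (SuperAlg.ofCommHom (constCoeffAlg R))
      (SGL.map (stdParity n m) (SuperAlg.ofCommHom φ₂) G) = 1 := by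
    refine sgl_ext ?_
    refine Eq.trans ?_ (const_segment g)
    rw [val_map, val_map]
    ext i j
    exact congrArg (constCoeffAlg R) (hφ₂ _)
  obtain ⟨l, hl, d, u, hu, hldu⟩ := exists_triangular (constCoeffAlg R)
    (fun a => isUnit_of_constCoeffAlg) _ hG2
  have h1 := h (PowerSeries R) l hl d u hu
  rw [← hldu, ← map_sandwich] at h1
  have h2 : L.map (algebraMap ℂ (SuperAlg.ofComm S)) * V.mat G *
      N.map (algebraMap ℂ (SuperAlg.ofComm S)) = 0 := by
    ext i j
    exact hinj _ (congrFun (congrFun h1 i) j)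
  rw [← hG1, ← map_sandwich, h2]
  ext i j
  exact map_zero φ₁

end GLRep

/-! ### Splitting off the odd directions of a point -/

section BlockFactor

variable {n m : ℕ} {A : SuperAlg}

/-- The even part of the upper left block. -/
def blockA (g : SGL (stdParity n m) A) : Matrix (Fin n) (Fin n) A.even :=
  Matrix.of fun i j => ⟨g.val.1 (Sum.inl i) (Sum.inl j), g.val.2 (Sum.inl i) (Sum.inl j)⟩

theorem SuperAlg.isNilpotent_mul {β γ : A} (hβ : β ∈ A.grading 1) (hγ : γ ∈ A.grading 1) :
    IsNilpotent (⟨β * γ, SetLike.mul_mem_graded hβ hγ⟩ : A.even) := by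
  refine ⟨2, Subtype.ext ?_⟩
  change (β * γ) ^ 2 = 0
  rw [pow_two, mul_assoc, ← mul_assoc γ, A.comm_odd γ hγ β hβ, neg_mul, mul_neg, ← mul_assoc,
    ← mul_assoc, SuperAlg.odd_sq hβ]
  simp

/-- Products of odd entries are nilpotent, so modulo the nilradical the upper left blocks of g and
g⁻¹ are inverse to each other. A determinant equal to 1 up to a nilpotent is a unit. -/
theorem isUnit_det_blockA (g : SGL (stdParity n m) A) : IsUnit (blockA g).det := by
  let q := Ideal.Quotient.mk (nilradical A.even)
  have hodd : ∀ (g : SGL (stdParity n m) A) i p, g.val.1 (Sum.inl i) (Sum.inr p) ∈ A.grading 1 :=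
    fun g i p => g.val.2 (Sum.inl i) (Sum.inr p)
  have hodd' : ∀ (g : SGL (stdParity n m) A) i p, g.val.1 (Sum.inr p) (Sum.inl i) ∈ A.grading 1 :=
    fun g i p => g.val.2 (Sum.inr p) (Sum.inl i)
  have h1 : (blockA g * blockA g⁻¹).map q = 1 := by
    ext i j
    have h2 : g.val.1 * (g⁻¹).val.1 = 1 := congrArg Subtype.val g.val_inv
    have h3 := congrFun (congrFun h2 (Sum.inl i)) (Sum.inl j)
    rw [Matrix.mul_apply, Fintype.sum_sum_type] at h3
    have h4 : (blockA g * blockA g⁻¹) i j = (1 : Matrix _ _ A.even) i j -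
        ∑ p : Fin m, (⟨g.val.1 (Sum.inl i) (Sum.inr p) * (g⁻¹).val.1 (Sum.inr p) (Sum.inl j),
          SetLike.mul_mem_graded (hodd g i p) (hodd' g⁻¹ j p)⟩ : A.even) := by
      refine Subtype.ext ?_
      have hv : ∀ a : A.even, (a : A) = A.even.val a := fun _ => rfl
      rw [Matrix.mul_apply, hv, hv, map_sub, map_sum, map_sum]
      refine eq_sub_of_add_eq (h3.trans ?_)
      by_cases hij : i = j
      · subst hij; rw [Matrix.one_apply_eq, Matrix.one_apply_eq, map_one]
      · rw [Matrix.one_apply_ne hij, Matrix.one_apply_ne (fun h => hij (Sum.inl_injective h)),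
          map_zero]
    rw [Matrix.map_apply, h4, map_sub, map_sum, Finset.sum_eq_zero, sub_zero, Matrix.one_apply,
      Matrix.one_apply]
    · split_ifs <;> simp
    · intro p _
      rw [Ideal.Quotient.eq_zero_iff_mem, mem_nilradical]
      exact SuperAlg.isNilpotent_mul (hodd g i p) (hodd' g⁻¹ j p)
  have h2 : q ((blockA g * blockA g⁻¹).det) = 1 := by
    rw [RingHom.map_det]
    change Matrix.det ((blockA g * blockA g⁻¹).map q) = 1
    rw [h1, Matrix.det_one]
  have h3 : IsNilpotent ((blockA g * blockA g⁻¹).det - 1) := by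
    rw [← mem_nilradical, ← Ideal.Quotient.eq_zero_iff_mem]
    change q _ = 0
    rw [map_sub, h2, map_one, sub_self]
  have h4 := h3.isUnit_add_one
  rw [sub_add_cancel, Matrix.det_mul] at h4
  exact isUnit_of_mul_isUnit_left h4

/-- A point with even entries comes from the even part. -/
theorem exists_even_lift {ι : Type} [Fintype ι] [DecidableEq ι] {p : ι → ZMod 2} (g : SGL p A)
    (h1 : ∀ i j, g.val.1 i j ∈ A.grading 0) (h2 : ∀ i j, (g⁻¹).val.1 i j ∈ A.grading 0) :
    ∃ g₀ : SGL p (SuperAlg.ofComm A.even), SGL.map p A.evenHom g₀ = g := by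
  have hmem : ∀ (M : Matrix ι ι A) (hM : M ∈ SuperMat p A) (h : ∀ i j, M i j ∈ A.grading 0),
      (Matrix.of fun i j => (⟨M i j, h i j⟩ : A.even)) ∈
        SuperMat p (SuperAlg.ofComm A.even) := by
    intro M hM h i j
    rcases zmod_two_cases (p i + p j) with hp | hp
    · rw [hp]; exact mem_ofComm_zero _
    · have h0 := hM i j
      rw [hp] at h0
      have h3 : (⟨M i j, h i j⟩ : A.even) = 0 := Subtype.ext (A.eq_zero_of_mem (h i j) h0)
      rw [Matrix.of_apply, h3]; exact Submodule.zero_mem _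
  have hmul : ∀ (M N : Matrix ι ι A) (hM : ∀ i j, M i j ∈ A.grading 0)
      (hN : ∀ i j, N i j ∈ A.grading 0), M * N = 1 →
      (Matrix.of fun i j => (⟨M i j, hM i j⟩ : A.even)) *
        (Matrix.of fun i j => (⟨N i j, hN i j⟩ : A.even)) = 1 := by
    intro M N hM hN h
    ext i j
    rw [Matrix.mul_apply]
    change A.even.val _ = A.even.val _
    rw [map_sum]
    refine (congrFun (congrFun h i) j).trans ?_
    rw [Matrix.one_apply, Matrix.one_apply]
    split_ifs <;> simp
  refine ⟨mkSGL _ _ (hmem g.val.1 g.val.2 h1) (hmem (g⁻¹).val.1 (g⁻¹).val.2 h2)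
    (hmul _ _ h1 h2 (congrArg Subtype.val g.val_inv))
    (hmul _ _ h2 h1 (congrArg Subtype.val g.inv_val)), sgl_ext ?_⟩
  rfl

/-- Every point is the product of a lower odd, an even and an upper odd one. -/
theorem exists_block_factor (g : SGL (stdParity n m) A) :
    ∃ l ∈ lowerSub (n := n) (m := m) A, ∃ g₀ : SGL (stdParity n m) (SuperAlg.ofComm A.even),
      ∃ u ∈ upperSub (n := n) (m := m) A, g = l * SGL.map _ A.evenHom g₀ * u := by
  have hu := isUnit_det_blockA g
  let a : Fin n → Fin n → A := fun i j => g.val.1 (Sum.inl i) (Sum.inl j)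
  let b : Fin n → Fin n → A := fun i j => ((blockA g)⁻¹ i j : A.even)
  have hb : ∀ i j, b i j ∈ A.grading 0 := fun i j => ((blockA g)⁻¹ i j).2
  have hv : ∀ x : A.even, (x : A) = A.even.val x := fun _ => rfl
  have hone : ∀ i j : Fin n, A.even.val ((1 : Matrix (Fin n) (Fin n) A.even) i j) =
      (1 : Matrix (Fin n) (Fin n) A) i j := by
    intro i j
    rw [Matrix.one_apply, Matrix.one_apply]; split_ifs <;> simp
  have hab : ∀ i k, ∑ j, a i j * b j k = (1 : Matrix (Fin n) (Fin n) A) i k := by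
    intro i k
    rw [← hone, ← Matrix.mul_nonsing_inv _ hu, Matrix.mul_apply, map_sum]
    rfl
  have hba : ∀ i k, ∑ j, b i j * a j k = (1 : Matrix (Fin n) (Fin n) A) i k := by
    intro i k
    rw [← hone, ← Matrix.nonsing_inv_mul _ hu, Matrix.mul_apply, map_sum]
    rfl
  -- With upper left block a and lower left block c, row operations with -c a⁻¹ clear the lower left
  -- corner.
  let C : (Fin n ⊕ Fin m) × (Fin n ⊕ Fin m) → A := fun x =>
    Sum.elim (fun i => -∑ j, g.val.1 x.1 (Sum.inl j) * b j i) (fun _ => 0) x.2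
  obtain ⟨l, hl, hlv⟩ := exists_unipotent (p := stdParity n m) (A := A) (lowerSub A)
    (Finset.univ.filter fun x : (Fin n ⊕ Fin m) × (Fin n ⊕ Fin m) => x.1.isRight ∧ x.2.isLeft)
    (by
      rintro ⟨x, x'⟩ hx ⟨y, y'⟩ hy rfl
      simp only [Finset.mem_filter, Finset.mem_univ, true_and] at hx hy
      rcases x' with x' | x' <;> simp_all) C
    (by
      rintro ⟨x | x, y | y⟩ hx <;> simp at hx
      refine Submodule.neg_mem _ (Submodule.sum_mem _ fun j _ => ?_)
      have h0 := SetLike.mul_mem_graded (g.val.2 (Sum.inr x) (Sum.inl j)) (hb j y)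
      rwa [add_zero] at h0)
    (by
      rintro ⟨x | x, y | y⟩ hx hne c <;> simp at hx
      refine elem_mem_lowerSub _ _ ?_
      have := y.2
      simp only [rk, Sum.elim_inl, Sum.elim_inr]
      omega)
  set g' := l * g with hg'
  have hg'1 : ∀ i j, g'.val.1 (Sum.inl i) j = g.val.1 (Sum.inl i) j := by
    intro i j
    rw [hg', val_mul, hlv, add_mul, one_mul, Matrix.add_apply, Matrix.mul_apply,
      Finset.sum_eq_zero, add_zero]
    intro k _
    simp
  have hg'2 : ∀ p j, g'.val.1 (Sum.inr p) (Sum.inl j) = 0 := by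
    intro p j
    rw [hg', val_mul, hlv, add_mul, one_mul, Matrix.add_apply, Matrix.mul_apply,
      Fintype.sum_sum_type]
    simp only [Matrix.of_apply, Finset.mem_filter, Finset.mem_univ, Sum.isRight_inr, Sum.isLeft_inl,
      Sum.isLeft_inr, true_and, and_true, if_true, if_false, Bool.false_eq_true, zero_mul,
      Finset.sum_const_zero, add_zero, C, Sum.elim_inl, neg_mul, Finset.sum_neg_distrib,
      Finset.sum_mul]
    rw [Finset.sum_comm]
    have h1 : ∀ k, ∑ i, g.val.1 (Sum.inr p) (Sum.inl k) * b k i * g.val.1 (Sum.inl i) (Sum.inl j) =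
        g.val.1 (Sum.inr p) (Sum.inl k) * (1 : Matrix (Fin n) (Fin n) A) k j := by
      intro k
      rw [← hba, Finset.mul_sum]
      exact Finset.sum_congr rfl fun i _ => mul_assoc _ _ _
    simp only [h1]
    rw [Finset.sum_eq_single j]
    · rw [Matrix.one_apply_eq, mul_one, add_neg_cancel]
    · intro k _ hk
      rw [Matrix.one_apply_ne hk, mul_zero]
    · simp
  -- Column operations with -a⁻¹ b clear the upper right corner.
  let B : (Fin n ⊕ Fin m) × (Fin n ⊕ Fin m) → A := fun x =>
    Sum.elim (fun i => -∑ j, b i j * g.val.1 (Sum.inl j) x.2) (fun _ => 0) x.1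
  obtain ⟨u, hu', huv⟩ := exists_unipotent (p := stdParity n m) (A := A) (upperSub A)
    (Finset.univ.filter fun x : (Fin n ⊕ Fin m) × (Fin n ⊕ Fin m) => x.1.isLeft ∧ x.2.isRight)
    (by
      rintro ⟨x, x'⟩ hx ⟨y, y'⟩ hy rfl
      simp only [Finset.mem_filter, Finset.mem_univ, true_and] at hx hy
      rcases x' with x' | x' <;> simp_all) B
    (by
      rintro ⟨x | x, y | y⟩ hx <;> simp at hx
      refine Submodule.neg_mem _ (Submodule.sum_mem _ fun j _ => ?_)
      have h0 := SetLike.mul_mem_graded (hb x j) (g.val.2 (Sum.inl j) (Sum.inr y))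
      rwa [zero_add] at h0)
    (by
      rintro ⟨x | x, y | y⟩ hx hne c <;> simp at hx
      refine elem_mem_upperSub _ _ ?_
      have := x.2
      simp only [rk, Sum.elim_inl, Sum.elim_inr]
      omega)
  set g'' := g' * u with hg''
  have hL : ∀ x j, g''.val.1 x (Sum.inl j) = g'.val.1 x (Sum.inl j) := by
    intro x j
    rw [hg'', val_mul, huv, mul_add, mul_one, Matrix.add_apply, Matrix.mul_apply,
      Finset.sum_eq_zero, add_zero]
    intro k _
    simp
  have hR : ∀ i q, g''.val.1 (Sum.inl i) (Sum.inr q) = 0 := by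
    intro i q
    rw [hg'', val_mul, huv, mul_add, mul_one, Matrix.add_apply, Matrix.mul_apply,
      Fintype.sum_sum_type]
    simp only [Matrix.of_apply, Finset.mem_filter, Finset.mem_univ, Sum.isRight_inr, Sum.isLeft_inl,
      Sum.isLeft_inr, true_and, and_true, if_true, if_false, Bool.false_eq_true, mul_zero,
      Finset.sum_const_zero, add_zero, B, Sum.elim_inl, mul_neg, Finset.sum_neg_distrib,
      Finset.mul_sum, hg'1]
    rw [Finset.sum_comm]
    have h1 : ∀ k, ∑ j, g.val.1 (Sum.inl i) (Sum.inl j) * (b j k * g.val.1 (Sum.inl k) (Sum.inr q)) =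
        (1 : Matrix (Fin n) (Fin n) A) i k * g.val.1 (Sum.inl k) (Sum.inr q) := by
      intro k
      rw [← hab, Finset.sum_mul]
      exact Finset.sum_congr rfl fun i _ => (mul_assoc _ _ _).symm
    simp only [h1]
    rw [Finset.sum_eq_single i]
    · rw [Matrix.one_apply_eq, one_mul, add_neg_cancel]
    · intro k _ hk
      rw [Matrix.one_apply_ne hk.symm, zero_mul]
    · simp
  have hA : ∀ i j, g''.val.1 (Sum.inl i) (Sum.inl j) = a i j := fun i j => by rw [hL, hg'1]
  have hC : ∀ p j, g''.val.1 (Sum.inr p) (Sum.inl j) = 0 := fun p j => by rw [hL, hg'2]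
  -- Descent to the even subalgebra also requires the inverse to have even entries; its off-diagonal
  -- blocks vanish because a is invertible.
  have hI1 : ∀ i q, (g''⁻¹).val.1 (Sum.inl i) (Sum.inr q) = 0 := by
    intro i q
    have h1 : ∀ k, ∑ j, a k j * (g''⁻¹).val.1 (Sum.inl j) (Sum.inr q) = 0 := by
      intro k
      have h2 : g''.val.1 * (g''⁻¹).val.1 = 1 := congrArg Subtype.val g''.val_inv
      have h3 := congrFun (congrFun h2 (Sum.inl k)) (Sum.inr q)
      rw [Matrix.mul_apply, Fintype.sum_sum_type, Matrix.one_apply_ne Sum.inl_ne_inr] at h3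
      simpa only [hR, hA, zero_mul, Finset.sum_const_zero, add_zero] using h3
    have h2 : ∑ k, b i k * ∑ j, a k j * (g''⁻¹).val.1 (Sum.inl j) (Sum.inr q) =
        (g''⁻¹).val.1 (Sum.inl i) (Sum.inr q) := by
      simp only [Finset.mul_sum, ← mul_assoc]
      rw [Finset.sum_comm]
      simp only [← Finset.sum_mul, hba]
      rw [Finset.sum_eq_single i]
      · rw [Matrix.one_apply_eq, one_mul]
      · intro k _ hk
        rw [Matrix.one_apply_ne hk.symm, zero_mul]
      · simp
    rw [← h2]
    exact Finset.sum_eq_zero fun k _ => by rw [h1, mul_zero]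
  have hI2 : ∀ p i, (g''⁻¹).val.1 (Sum.inr p) (Sum.inl i) = 0 := by
    intro p i
    have h1 : ∀ k, ∑ j, (g''⁻¹).val.1 (Sum.inr p) (Sum.inl j) * a j k = 0 := by
      intro k
      have h2 : (g''⁻¹).val.1 * g''.val.1 = 1 := congrArg Subtype.val g''.inv_val
      have h3 := congrFun (congrFun h2 (Sum.inr p)) (Sum.inl k)
      rw [Matrix.mul_apply, Fintype.sum_sum_type, Matrix.one_apply_ne Sum.inr_ne_inl] at h3
      simpa only [hC, hA, mul_zero, Finset.sum_const_zero, add_zero] using h3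
    have h2 : ∑ k, (∑ j, (g''⁻¹).val.1 (Sum.inr p) (Sum.inl j) * a j k) * b k i =
        (g''⁻¹).val.1 (Sum.inr p) (Sum.inl i) := by
      simp only [Finset.sum_mul, mul_assoc]
      rw [Finset.sum_comm]
      simp only [← Finset.mul_sum, hab]
      rw [Finset.sum_eq_single i]
      · rw [Matrix.one_apply_eq, mul_one]
      · intro k _ hk
        rw [Matrix.one_apply_ne hk, mul_zero]
      · simp
    rw [← h2]
    exact Finset.sum_eq_zero fun k _ => by rw [h1, zero_mul]
  obtain ⟨g₀, hg₀⟩ := exists_even_lift g''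
    (by
      rintro (i | i) (j | j)
      · exact g''.val.2 (Sum.inl i) (Sum.inl j)
      · rw [hR]; exact Submodule.zero_mem _
      · rw [hC]; exact Submodule.zero_mem _
      · exact g''.val.2 (Sum.inr i) (Sum.inr j))
    (by
      rintro (i | i) (j | j)
      · exact (g''⁻¹).val.2 (Sum.inl i) (Sum.inl j)
      · rw [hI1]; exact Submodule.zero_mem _
      · rw [hI2]; exact Submodule.zero_mem _
      · exact (g''⁻¹).val.2 (Sum.inr i) (Sum.inr j))
  refine ⟨l⁻¹, Subgroup.inv_mem _ hl, g₀, u⁻¹, Subgroup.inv_mem _ hu', ?_⟩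
  rw [hg₀, hg'', hg']
  group

end BlockFactor

/-! ### Stability under the generators implies stability under all points -/

namespace GLRep

variable {n m : ℕ} (V : GLRep n m) {A : SuperAlg}

theorem stable_mul {T : Type*} [Ring T] {e x y : T} (hx : e * x * e = x * e)
    (hy : e * y * e = y * e) : e * (x * y) * e = x * y * e := by
  calc e * (x * y) * e = e * x * (y * e) := by simp only [mul_assoc]
    _ = e * x * e * y * e := by rw [← hy]; simp only [mul_assoc]
    _ = x * (e * y * e) := by rw [hx]; simp only [mul_assoc]
    _ = x * y * e := by rw [hy, mul_assoc]

theorem mat_torusR_eq_sum {S : Type} [CommRing S] [Algebra ℂ S] (d : Fin n ⊕ Fin m → Sˣ) :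
    V.mat (torusR d) = ∑ w ∈ V.wts,
      (wpow d w : SuperAlg.ofComm S) • (V.proj w).map (algebraMap ℂ (SuperAlg.ofComm S)) := by
  ext i j
  rw [mat_torusR_apply, Matrix.sum_apply]
  refine Finset.sum_congr rfl fun w _ => ?_
  rw [Matrix.smul_apply, Matrix.map_apply, smul_eq_mul, Algebra.smul_def]
  exact mul_comm (algebraMap ℂ S _) _

/-- A subspace stable under the generators is stable under all points. -/
theorem GenStable.mat {E : Matrix V.ι V.ι ℂ} (hE : V.GenStable E) (hEE : E * E = E)
    (g : SGL (stdParity n m) A) :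
    E.map (algebraMap ℂ A) * V.mat g * E.map (algebraMap ℂ A) =
      V.mat g * E.map (algebraMap ℂ A) := by
  have hgen : ∀ {B : SuperAlg} {j k : Fin n ⊕ Fin m} (hjk : j ≠ k)
      (a : B.grading (stdParity n m j + stdParity n m k)),
      E.map (algebraMap ℂ B) * V.mat (elem hjk a) * E.map (algebraMap ℂ B) =
        V.mat (elem hjk a) * E.map (algebraMap ℂ B) := by
    intro B j k hjk a
    obtain ⟨N, c, X, hX, h⟩ := V.mat_elem hjk a
    rw [h, mul_add, add_mul, add_mul, mul_one, one_mul, ← Matrix.map_mul, hEE, Finset.mul_sum,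
      Finset.sum_mul, Finset.sum_mul]
    congr 1
    refine Finset.sum_congr rfl fun r _ => ?_
    rw [mapC_mul_smul, Matrix.smul_mul, Matrix.smul_mul, ← Matrix.map_mul, ← Matrix.map_mul,
      ← Matrix.map_mul, (hX r).stable E hE]
  have hmul : ∀ {B : SuperAlg} (g g' : SGL (stdParity n m) B),
      E.map (algebraMap ℂ B) * V.mat g * E.map (algebraMap ℂ B) = V.mat g * E.map (algebraMap ℂ B) →
      E.map (algebraMap ℂ B) * V.mat g' * E.map (algebraMap ℂ B) =
        V.mat g' * E.map (algebraMap ℂ B) →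
      E.map (algebraMap ℂ B) * V.mat (g * g') * E.map (algebraMap ℂ B) =
        V.mat (g * g') * E.map (algebraMap ℂ B) := by
    intro B g g' h h'
    rw [V.mat_mul]
    exact stable_mul h h'
  have hcl : ∀ {B : SuperAlg} (s : Set (SGL (stdParity n m) B)),
      (∀ x ∈ s, ∃ (j k : Fin n ⊕ Fin m) (hjk : j ≠ k)
        (a : B.grading (stdParity n m j + stdParity n m k)), x = elem hjk a) →
      ∀ x ∈ Subgroup.closure s,
        E.map (algebraMap ℂ B) * V.mat x * E.map (algebraMap ℂ B) =
          V.mat x * E.map (algebraMap ℂ B) := by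
    intro B s hs x hx
    induction hx using Subgroup.closure_induction'' with
    | mem x hx =>
      obtain ⟨j, k, hjk, a, rfl⟩ := hs x hx
      exact hgen hjk a
    | inv_mem x hx =>
      obtain ⟨j, k, hjk, a, rfl⟩ := hs x hx
      have h1 : (elem hjk a)⁻¹ = elem hjk (-a) := by
        refine inv_eq_of_mul_eq_one_right ?_
        rw [← elem_add, add_neg_cancel]
        exact sgl_ext (by rw [val_elem]; simp)
      rw [h1]
      exact hgen hjk _
    | one => rw [V.mat_one, mul_one, one_mul, ← Matrix.map_mul, hEE]
    | mul x y _ _ hx hy => exact hmul x y hx hy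
  have hlow : ∀ {B : SuperAlg}, ∀ x ∈ lowerSub (n := n) (m := m) B,
      E.map (algebraMap ℂ B) * V.mat x * E.map (algebraMap ℂ B) =
        V.mat x * E.map (algebraMap ℂ B) := fun x hx => hcl _
    (by rintro x ⟨j, k, hjk, a, -, rfl⟩; exact ⟨j, k, hjk, a, rfl⟩) x hx
  have hup : ∀ {B : SuperAlg}, ∀ x ∈ upperSub (n := n) (m := m) B,
      E.map (algebraMap ℂ B) * V.mat x * E.map (algebraMap ℂ B) =
        V.mat x * E.map (algebraMap ℂ B) := fun x hx => hcl _
    (by rintro x ⟨j, k, hjk, a, -, rfl⟩; exact ⟨j, k, hjk, a, rfl⟩) x hx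
  -- Stability under all complex diagonal matrices is an identity of Laurent polynomials in t, so it
  -- can be read off weight by weight; the torus over any commutative algebra then follows.
  have hproj : ∀ w, E * V.proj w * E = V.proj w * E := by
    intro w
    by_cases hw : w ∈ V.wts
    · ext i j
      let f : TorusRing n m := ∑ u ∈ V.wts,
        AddMonoidAlgebra.single u ((E * V.proj u * E - V.proj u * E) i j)
      have hf : f = 0 := by
        refine eq_zero_of_evalT fun t => ?_
        have h1 := hE.1 (torus t)
        change E * V.torusMat t * E = V.torusMat t * E at h1
        rw [torusMat_eq, Finset.mul_sum, Finset.sum_mul, Finset.sum_mul, ← sub_eq_zero,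
          ← Finset.sum_sub_distrib] at h1
        have h2 := congrFun (congrFun h1 i) j
        rw [Matrix.sum_apply] at h2
        simp only [f, map_sum, evalT_single]
        refine Eq.trans (Finset.sum_congr rfl fun u _ => ?_) h2
        rw [Matrix.mul_smul, Matrix.smul_mul, Matrix.smul_mul, ← smul_sub, Matrix.smul_apply,
          smul_eq_mul, smul_eq_mul, mul_comm]
      have h2 := congrArg (fun f : TorusRing n m => f.coeff w) hf
      simp only [f, AddMonoidAlgebra.coeff_sum, Finsupp.finsetSum_apply,
        AddMonoidAlgebra.coeff_single, Finsupp.single_apply, Finset.sum_ite_eq', hw, if_true,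
        AddMonoidAlgebra.coeff_zero, Finsupp.zero_apply] at h2
      exact sub_eq_zero.1 h2
    · rw [V.proj_eq_zero hw, mul_zero, zero_mul]
  have htor : ∀ {S : Type} [CommRing S] [Algebra ℂ S] (d : Fin n ⊕ Fin m → Sˣ),
      E.map (algebraMap ℂ (SuperAlg.ofComm S)) * V.mat (torusR d) *
        E.map (algebraMap ℂ (SuperAlg.ofComm S)) =
        V.mat (torusR d) * E.map (algebraMap ℂ (SuperAlg.ofComm S)) := by
    intro S _ _ d
    rw [mat_torusR_eq_sum, Finset.mul_sum, Finset.sum_mul, Finset.sum_mul]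
    refine Finset.sum_congr rfl fun w _ => ?_
    rw [mapC_mul_smul, Matrix.smul_mul, Matrix.smul_mul, ← Matrix.map_mul, ← Matrix.map_mul,
      ← Matrix.map_mul, hproj]
  have hone : ∀ {B : SuperAlg}, (1 - E).map (algebraMap ℂ B) = 1 - E.map (algebraMap ℂ B) := by
    intro B
    rw [Matrix.map_sub _ (fun a b => map_sub _ a b), Matrix.map_one _ (map_zero _) (map_one _)]
  have hcomm : ∀ {S : Type} [CommRing S] [Algebra ℂ S]
      (g : SGL (stdParity n m) (SuperAlg.ofComm S)),
      E.map (algebraMap ℂ (SuperAlg.ofComm S)) * V.mat g *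
        E.map (algebraMap ℂ (SuperAlg.ofComm S)) =
        V.mat g * E.map (algebraMap ℂ (SuperAlg.ofComm S)) := by
    intro S _ _ g
    -- Invariance of the image of E is the vanishing of the matrix coefficients between 1 - E and E,
    -- so it suffices to test triangular products.
    have h1 := V.sandwich_eq_zero (1 - E) E (fun T _ _ l hl d u hu => by
      rw [hone, sub_mul, one_mul, sub_mul, sub_eq_zero]
      exact (hmul _ _ (hmul _ _ (hlow l hl) (htor d)) (hup u hu)).symm) g
    rw [hone, sub_mul, one_mul, sub_mul, sub_eq_zero] at h1
    exact h1.symm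
  obtain ⟨l, hl, g₀, u, hu, rfl⟩ := exists_block_factor g
  refine hmul _ _ (hmul _ _ (hlow l hl) ?_) (hup u hu)
  have h1 := V.map_sandwich A.evenHom E E g₀
  have h2 := V.map_sandwich A.evenHom (1 : Matrix V.ι V.ι ℂ) E g₀
  rw [Matrix.map_one _ (map_zero _) (map_one _), Matrix.map_one _ (map_zero _) (map_one _), one_mul,
    one_mul] at h2
  rw [← h1, ← h2, hcomm]

end GLRep

/-! ### Heights of weights and matrix coefficients at the top -/

section Height

variable {n m : ℕ}

/-- The height of a weight, which increases along the upper triangular roots. -/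
def ht : Wt n m →+ ℤ where
  toFun w := -∑ j, (rk j : ℤ) * w j
  map_zero' := by simp
  map_add' v w := by simp [mul_add, Finset.sum_add_distrib]; ring

theorem ht_root (j k : Fin n ⊕ Fin m) : ht (Pi.single j 1 - Pi.single k 1) = (rk k : ℤ) - rk j := by
  have h1 : ∀ j : Fin n ⊕ Fin m, ht (Pi.single j 1) = -(rk j : ℤ) := by
    intro j
    change -∑ i, (rk i : ℤ) * (Pi.single j 1 : Wt n m) i = _
    rw [Finset.sum_eq_single j (fun b _ hb => by simp [hb]) (by simp)]
    simp
  rw [map_sub, h1, h1]; ring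

end Height

namespace GLRep

variable {n m : ℕ} (V : GLRep n m) {A : SuperAlg}

/-- Elementary supermatrices act by 1 plus combinations of root operators, and those operators kill
the columns of N. -/
theorem mul_eq_self_of_closure {κ : Type} (N : Matrix V.ι κ ℂ)
    (s : Set (SGL (stdParity n m) A))
    (hs : ∀ x ∈ s, ∃ (j k : Fin n ⊕ Fin m) (hjk : j ≠ k)
      (a : A.grading (stdParity n m j + stdParity n m k)), x = elem hjk a ∧
        ∀ X, V.IsRootOp j k X → X * N = 0) :
    ∀ x ∈ Subgroup.closure s, V.mat x * N.map (algebraMap ℂ A) = N.map (algebraMap ℂ A) := by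
  have hgen : ∀ x ∈ s, V.mat x * N.map (algebraMap ℂ A) = N.map (algebraMap ℂ A) := by
    intro x hx
    obtain ⟨j, k, hjk, a, rfl, hX⟩ := hs x hx
    obtain ⟨M, c, X, hX', h⟩ := V.mat_elem hjk a
    rw [h, Matrix.add_mul, Matrix.one_mul, Matrix.sum_mul, Finset.sum_eq_zero, add_zero]
    intro r _
    rw [Matrix.smul_mul, ← Matrix.map_mul, hX _ (hX' r)]
    ext; simp
  intro x hx
  induction hx using Subgroup.closure_induction with
  | mem x hx => exact hgen x hx
  | one => rw [V.mat_one, Matrix.one_mul]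
  | mul x y _ _ hx hy => rw [V.mat_mul, Matrix.mul_assoc, hy, hx]
  | inv x _ hx =>
    conv_lhs => rw [← hx, ← Matrix.mul_assoc, ← V.mat_mul, inv_mul_cancel, V.mat_one, Matrix.one_mul]

theorem self_mul_of_closure {κ : Type} (L : Matrix κ V.ι ℂ)
    (s : Set (SGL (stdParity n m) A))
    (hs : ∀ x ∈ s, ∃ (j k : Fin n ⊕ Fin m) (hjk : j ≠ k)
      (a : A.grading (stdParity n m j + stdParity n m k)), x = elem hjk a ∧
        ∀ X, V.IsRootOp j k X → L * X = 0) :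
    ∀ x ∈ Subgroup.closure s, L.map (algebraMap ℂ A) * V.mat x = L.map (algebraMap ℂ A) := by
  have hgen : ∀ x ∈ s, L.map (algebraMap ℂ A) * V.mat x = L.map (algebraMap ℂ A) := by
    intro x hx
    obtain ⟨j, k, hjk, a, rfl, hX⟩ := hs x hx
    obtain ⟨M, c, X, hX', h⟩ := V.mat_elem hjk a
    rw [h, Matrix.mul_add, Matrix.mul_one, Matrix.mul_sum, Finset.sum_eq_zero, add_zero]
    intro r _
    rw [mapC_mul_smul, ← Matrix.map_mul, hX _ (hX' r)]
    ext; simp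
  intro x hx
  induction hx using Subgroup.closure_induction with
  | mem x hx => exact hgen x hx
  | one => rw [V.mat_one, Matrix.mul_one]
  | mul x y _ _ hx hy => rw [V.mat_mul, ← Matrix.mul_assoc, hx, hy]
  | inv x _ hx =>
    conv_lhs => rw [← hx, Matrix.mul_assoc, ← V.mat_mul, mul_inv_cancel, V.mat_one, Matrix.mul_one]

/-- Matrix coefficients between a functional of top height and a weight vector of top height. -/
theorem top_sandwich {κ κ' : Type} (L : Matrix κ V.ι ℂ) (N : Matrix V.ι κ' ℂ) (l : Wt n m)
    (hN : V.proj l * N = N) (hL : ∀ w ∈ V.wts, ht w ≠ ht l → L * V.proj w = 0)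
    (htop : ∀ w ∈ V.wts, ht w ≤ ht l) (hLN : L * N = 0) (g : SGL (stdParity n m) A) :
    L.map (algebraMap ℂ A) * V.mat g * N.map (algebraMap ℂ A) = 0 := by
  have hup : ∀ {B : SuperAlg}, ∀ x ∈ upperSub (n := n) (m := m) B,
      V.mat x * N.map (algebraMap ℂ B) = N.map (algebraMap ℂ B) := by
    intro B
    refine V.mul_eq_self_of_closure N _ ?_
    rintro x ⟨j, k, hjk, a, hlt, rfl⟩
    refine ⟨j, k, hjk, a, rfl, fun X hX => ?_⟩
    obtain ⟨r, hr⟩ := hX.shift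
    -- A raising operator would move the weight `l` above the maximal height.
    rw [← hN, ← Matrix.mul_assoc, hr, V.proj_eq_zero, Matrix.zero_mul, Matrix.zero_mul]
    intro hw
    have h1 := htop _ hw
    rw [map_add, map_nsmul, ht_root, nsmul_eq_mul] at h1
    push_cast at h1
    have h2 : (rk j : ℤ) < rk k := by exact_mod_cast hlt
    nlinarith
  have hlow : ∀ {B : SuperAlg}, ∀ x ∈ lowerSub (n := n) (m := m) B,
      L.map (algebraMap ℂ B) * V.mat x = L.map (algebraMap ℂ B) := by
    intro B
    refine V.self_mul_of_closure L _ ?_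
    rintro x ⟨j, k, hjk, a, hlt, rfl⟩
    refine ⟨j, k, hjk, a, rfl, fun X hX => ?_⟩
    obtain ⟨r, hr⟩ := hX.shift
    -- A lowering operator lands strictly below the top height, where L vanishes.
    rw [← Matrix.mul_one X, ← V.sum_proj, Finset.mul_sum, Matrix.mul_sum]
    refine Finset.sum_eq_zero fun w hw => ?_
    rw [hr, ← Matrix.mul_assoc]
    by_cases hw' : w + (r + 1) • (Pi.single j 1 - Pi.single k 1) ∈ V.wts
    · rw [hL _ hw', Matrix.zero_mul]
      have h1 := htop w hw
      rw [map_add, map_nsmul, ht_root, nsmul_eq_mul]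
      push_cast
      have h2 : (rk k : ℤ) < rk j := by exact_mod_cast hlt
      have h3 : 0 < ((r : ℤ) + 1) * ((rk j : ℤ) - rk k) := by
        apply mul_pos <;> omega
      intro h4
      nlinarith
    · rw [V.proj_eq_zero hw', Matrix.mul_zero, Matrix.zero_mul]
  have hcomm : ∀ {S : Type} [CommRing S] [Algebra ℂ S]
      (g : SGL (stdParity n m) (SuperAlg.ofComm S)),
      L.map (algebraMap ℂ (SuperAlg.ofComm S)) * V.mat g *
        N.map (algebraMap ℂ (SuperAlg.ofComm S)) = 0 := by
    intro S _ _ g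
    refine V.sandwich_eq_zero L N (fun T _ _ x hx d u hu => ?_) g
    rw [V.mat_mul, V.mat_mul, ← Matrix.mul_assoc, ← Matrix.mul_assoc, hlow x hx, Matrix.mul_assoc,
      hup u hu, mat_torusR_eq_sum, Matrix.mul_assoc, Matrix.sum_mul, Matrix.mul_sum]
    refine Finset.sum_eq_zero fun w hw => ?_
    -- Only the torus factor is left. It acts on N through the weight `l` alone, and L N = 0.
    have h1 : L * (V.proj w * N) = 0 := by
      by_cases hwl : w = l
      · rw [hwl, hN, hLN]
      · rw [← hN, ← Matrix.mul_assoc (V.proj w), proj_mul_proj, if_neg hwl, Matrix.zero_mul,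
          Matrix.mul_zero]
    rw [Matrix.smul_mul, mapC_mul_smul, ← Matrix.map_mul, ← Matrix.map_mul, h1]
    ext; simp
  obtain ⟨x, hx, g₀, u, hu, rfl⟩ := exists_block_factor g
  rw [V.mat_mul, V.mat_mul, ← Matrix.mul_assoc, ← Matrix.mul_assoc, hlow x hx, Matrix.mul_assoc,
    hup u hu, ← map_sandwich, hcomm]
  ext; simp

end GLRep

/-! ### Subrepresentations and quotients -/

namespace GLRep

variable {n m : ℕ} (V : GLRep n m) {A : SuperAlg}

theorem sandwich_mem {ι κ κ' : Type} [Fintype ι] [DecidableEq ι] {p : ι → ZMod 2}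
    {q : κ → ZMod 2} {q' : κ' → ZMod 2} {L : Matrix κ ι ℂ} {N : Matrix ι κ' ℂ}
    (hL : ∀ a i, q a ≠ p i → L a i = 0) (hN : ∀ i b, p i ≠ q' b → N i b = 0) {M : Matrix ι ι A}
    (hM : M ∈ SuperMat p A) (a : κ) (b : κ') :
    (L.map (algebraMap ℂ A) * M * N.map (algebraMap ℂ A)) a b ∈ A.grading (q a + q' b) := by
  rw [Matrix.mul_apply]
  refine Submodule.sum_mem _ fun j _ => ?_
  rw [Matrix.mul_apply, Finset.sum_mul]
  refine Submodule.sum_mem _ fun i _ => ?_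
  by_cases h1 : q a = p i
  · by_cases h2 : p j = q' b
    · rw [h1, ← h2, Matrix.map_apply, Matrix.map_apply, ← Algebra.smul_def, ← Algebra.commutes,
        ← Algebra.smul_def]
      exact Submodule.smul_mem _ _ (Submodule.smul_mem _ _ (hM i j))
    · rw [show (N.map (algebraMap ℂ A)) j b = 0 by rw [Matrix.map_apply, hN j b h2, map_zero], mul_zero]
      exact Submodule.zero_mem _
  · rw [Matrix.map_apply, hL a i h1, map_zero, zero_mul, zero_mul]; exact Submodule.zero_mem _

/-- An even idempotent whose image is a subrepresentation. -/
structure IsInv (E : Matrix V.ι V.ι ℂ) : Prop where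
  idem : E * E = E
  even : ∀ i j, V.parity i ≠ V.parity j → E i j = 0
  inv : ∀ (A : SuperAlg) (g : SGL (stdParity n m) A),
    E.map (algebraMap ℂ A) * V.mat g * E.map (algebraMap ℂ A) = V.mat g * E.map (algebraMap ℂ A)

/-- An even idempotent splits off a superspace. -/
theorem exists_split {E : Matrix V.ι V.ι ℂ} (hE : E * E = E)
    (heven : ∀ i j, V.parity i ≠ V.parity j → E i j = 0) :
    ∃ (κ : Type) (_ : Fintype κ) (_ : DecidableEq κ) (q : κ → ZMod 2) (F : Matrix V.ι κ ℂ)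
      (G : Matrix κ V.ι ℂ), (∀ i a, V.parity i ≠ q a → F i a = 0) ∧
        (∀ a i, q a ≠ V.parity i → G a i = 0) ∧ F * G = E ∧ G * F = 1 := by
  -- The image of E is the sum of its two homogeneous parts. Bases of these parts give the columns
  -- of F, and coordinates of the projected standard vectors give G.
  let U : ZMod 2 → Submodule ℂ (V.ι → ℂ) := fun e =>
    LinearMap.range (Matrix.toLin' E) ⊓ V.component e
  let D : ZMod 2 → Matrix V.ι V.ι ℂ := fun e =>
    Matrix.diagonal fun i => if V.parity i = e then 1 else 0
  have hED : ∀ e i j, (E * D e) i j = if V.parity j = e then E i j else 0 := by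
    intro e i j
    simp [D, Matrix.mul_diagonal]
  let T : ∀ e, (V.ι → ℂ) →ₗ[ℂ] U e := fun e => (Matrix.toLin' (E * D e)).codRestrict (U e) (by
    intro v
    refine ⟨⟨(D e).mulVec v, ?_⟩, fun i hi => ?_⟩
    · rw [Matrix.toLin'_apply, Matrix.toLin'_apply, Matrix.mulVec_mulVec]
    · rw [Matrix.toLin'_apply]
      refine Finset.sum_eq_zero fun j _ => ?_
      change (E * D e) i j * v j = 0
      rw [hED]
      split_ifs with hj
      · rw [heven i j (fun h => hi (h.trans hj)), zero_mul]
      · rw [zero_mul])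
  have hT : ∀ e v, ((T e v : U e) : V.ι → ℂ) = (E * D e).mulVec v := fun e v => rfl
  have hEfix : ∀ e, ∀ u : U e, E.mulVec u.1 = u.1 := by
    intro e u
    obtain ⟨v, hv⟩ := u.2.1
    rw [← hv, Matrix.toLin'_apply, Matrix.mulVec_mulVec, hE]
  have hDU : ∀ e e' (u : U e'), (D e).mulVec u.1 = if e = e' then u.1 else 0 := by
    intro e e' u
    have hu : ∀ i, V.parity i ≠ e' → u.1 i = 0 := u.2.2
    ext i
    rw [Matrix.mulVec_diagonal]
    by_cases he : e = e'
    · subst he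
      rw [if_pos rfl]
      split_ifs with hi
      · rw [one_mul]
      · rw [zero_mul, hu i hi]
    · rw [if_neg he]
      split_ifs with hi
      · rw [hu i (fun h => he (hi.symm.trans h)), mul_zero]; rfl
      · rw [zero_mul]; rfl
  let b : ∀ e, Module.Basis (Fin (Module.finrank ℂ (U e))) ℂ (U e) := fun e => Module.finBasis ℂ (U e)
  let F : Matrix V.ι (Σ e : ZMod 2, Fin (Module.finrank ℂ (U e))) ℂ :=
    Matrix.of fun i a => (b a.1 a.2).1 i
  let G : Matrix (Σ e : ZMod 2, Fin (Module.finrank ℂ (U e))) V.ι ℂ :=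
    Matrix.of fun a j => (b a.1).repr (T a.1 (Pi.single j 1)) a.2
  have hG : ∀ a v, G.mulVec v a = (b a.1).repr (T a.1 v) a.2 := by
    intro a v
    conv_rhs => rw [pi_eq_sum_univ' v, map_sum, map_sum, Finsupp.finsetSum_apply]
    refine Finset.sum_congr rfl fun j _ => ?_
    rw [map_smul, map_smul, Finsupp.smul_apply, smul_eq_mul, mul_comm]
    congr 3
  refine ⟨_, inferInstance, inferInstance, fun a => a.1, F, G, ?_, ?_, ?_, ?_⟩
  · intro i a hia
    exact (b a.1 a.2).2.2 i hia
  · intro a i hai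
    have h1 : T a.1 (Pi.single i 1) = 0 := by
      refine Subtype.ext ?_
      rw [hT]
      ext k
      rw [Matrix.mulVec_single_one, Matrix.col_apply, hED, if_neg (Ne.symm hai)]
      rfl
    simp only [G, Matrix.of_apply, h1, map_zero, Finsupp.zero_apply]
  · ext i j
    rw [Matrix.mul_apply, Fintype.sum_sigma]
    have h1 : ∀ e, ∑ a, F i ⟨e, a⟩ * G ⟨e, a⟩ j = (E * D e) i j := by
      intro e
      have h2 := congrArg (fun u : U e => u.1 i) ((b e).sum_repr (T e (Pi.single j 1)))
      simp only [hT, Matrix.mulVec_single_one, Matrix.col_apply] at h2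
      rw [← h2, Submodule.coe_sum, Finset.sum_apply]
      refine Finset.sum_congr rfl fun a _ => ?_
      rw [Submodule.coe_smul, Pi.smul_apply, smul_eq_mul, mul_comm]
      rfl
    simp only [h1, hED]
    rw [Finset.sum_ite_eq]
    simp
  · ext a a'
    have h1 : (G * F) a a' = G.mulVec (b a'.1 a'.2).1 a := rfl
    rw [h1, hG]
    obtain ⟨e, a⟩ := a
    obtain ⟨e', a'⟩ := a'
    have h2 : T e (b e' a').1 = if h : e = e' then h ▸ b e' a' else 0 := by
      refine Subtype.ext ?_
      rw [hT, ← Matrix.mulVec_mulVec, hDU]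
      split_ifs with he
      · subst he
        exact hEfix e _
      · rw [Matrix.mulVec_zero]; rfl
    by_cases he : e = e'
    · subst he
      rw [dif_pos rfl] at h2
      simp only [h2, Module.Basis.repr_self, Matrix.one_apply, Finsupp.single_apply]
      simp [eq_comm]
    · rw [dif_neg he] at h2
      simp only [h2, map_zero, Finsupp.zero_apply]
      rw [Matrix.one_apply_ne]
      rintro ⟨⟩
      exact he rfl

variable {V}

/-- The subrepresentation and the quotient cut out by an invariant idempotent. -/
theorem IsInv.exists_shortExact {E : Matrix V.ι V.ι ℂ} (hE : V.IsInv E) :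
    ∃ (V₁ V₂ : GLRep n m) (f : V₁.Hom V) (g : V.Hom V₂) (f' : Matrix V₁.ι V.ι ℂ),
      IsShortExact f g ∧ f.toMat * f' = E ∧ f' * f.toMat = 1 ∧
        ∀ a i, V₁.parity a ≠ V.parity i → f' a i = 0 := by
  obtain ⟨κ, _, _, q, F, G, hF, hG, hFG, hGF⟩ := V.exists_split hE.idem hE.even
  have hone : ∀ i j, V.parity i ≠ V.parity j → (1 - E) i j = 0 := by
    intro i j hij
    rw [Matrix.sub_apply, hE.even i j hij, Matrix.one_apply_ne (fun h => hij (by rw [h])), sub_zero]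
  obtain ⟨κ', _, _, q', F', G', hF', hG', hFG', hGF'⟩ := V.exists_split
    (E := 1 - E) (by rw [mul_sub, mul_one, sub_mul, one_mul, hE.idem]; simp) hone
  have hEF : E * F = F := by rw [← hFG, Matrix.mul_assoc, hGF, Matrix.mul_one]
  have hG'E : G' * E = 0 := by
    have h1 : G' * (1 - E) = G' := by rw [← hFG', ← Matrix.mul_assoc, hGF', Matrix.one_mul]
    rw [Matrix.mul_sub, Matrix.mul_one, sub_eq_self] at h1
    exact h1
  -- F G = E is the identity on the invariant image, which makes g ↦ G g F multiplicative. For the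
  -- quotient, G' g E = 0 gives G' g (F' G') = G' g in the same way.
  have hρF : ∀ {A : SuperAlg} (g : SGL (stdParity n m) A),
      F.map (algebraMap ℂ A) * G.map (algebraMap ℂ A) * (V.mat g * F.map (algebraMap ℂ A)) =
        V.mat g * F.map (algebraMap ℂ A) := by
    intro A g
    rw [← Matrix.map_mul, hFG]
    conv_rhs => rw [← hEF, Matrix.map_mul, ← Matrix.mul_assoc, ← hE.inv]
    rw [Matrix.mul_assoc _ (E.map _), ← Matrix.map_mul, hEF, Matrix.mul_assoc]
  have hGρ : ∀ {A : SuperAlg} (g : SGL (stdParity n m) A),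
      G'.map (algebraMap ℂ A) * V.mat g * (F'.map (algebraMap ℂ A) * G'.map (algebraMap ℂ A)) =
        G'.map (algebraMap ℂ A) * V.mat g := by
    intro A g
    have h1 : G'.map (algebraMap ℂ A) * (V.mat g * E.map (algebraMap ℂ A)) = 0 := by
      rw [← hE.inv, ← Matrix.mul_assoc, ← Matrix.mul_assoc, ← Matrix.map_mul, hG'E]
      ext; simp
    rw [← Matrix.map_mul, hFG', Matrix.map_sub _ (fun a b => map_sub _ a b),
      Matrix.map_one _ (map_zero _) (map_one _), Matrix.mul_sub, Matrix.mul_one, Matrix.mul_assoc,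
      h1, sub_zero]
  let V₁ : GLRep n m := ofMat κ q
    (fun {A} g => G.map (algebraMap ℂ A) * V.mat g * F.map (algebraMap ℂ A))
    (fun {A} g => sandwich_mem hG hF (V.mat_mem g))
    (fun {A} => by
      rw [V.mat_one, Matrix.mul_one, ← Matrix.map_mul, hGF]
      exact Matrix.map_one _ (map_zero _) (map_one _))
    (fun {A} g g' => by
      rw [V.mat_mul]
      conv_lhs => rw [Matrix.mul_assoc, Matrix.mul_assoc, ← hρF g']
      simp only [Matrix.mul_assoc])
    (fun {A B} φ g => (V.map_sandwich φ G F g).symm)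
  let V₂ : GLRep n m := ofMat κ' q'
    (fun {A} g => G'.map (algebraMap ℂ A) * V.mat g * F'.map (algebraMap ℂ A))
    (fun {A} g => sandwich_mem hG' hF' (V.mat_mem g))
    (fun {A} => by
      rw [V.mat_one, Matrix.mul_one, ← Matrix.map_mul, hGF']
      exact Matrix.map_one _ (map_zero _) (map_one _))
    (fun {A} g g' => by
      rw [V.mat_mul]
      conv_lhs => rw [← Matrix.mul_assoc, ← hGρ g]
      simp only [Matrix.mul_assoc])
    (fun {A B} φ g => (V.map_sandwich φ G' F' g).symm)
  let f : V₁.Hom V :=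
    { toMat := F
      even := hF
      comm := fun A g => by
        change F.map _ * (G.map _ * V.mat g * F.map _) = _
        rw [← hρF]
        simp only [Matrix.mul_assoc] }
  let g : V.Hom V₂ :=
    { toMat := G'
      even := hG'
      comm := fun A g => by
        change _ = (G'.map _ * V.mat g * F'.map _) * G'.map _
        rw [Matrix.mul_assoc _ (F'.map _), hGρ] }
  refine ⟨V₁, V₂, f, g, G, ⟨?_, ?_, ?_⟩, hFG, hGF, hG⟩
  · intro v w hvw
    have h1 := congrArg G.mulVec hvw
    change G.mulVec (F.mulVec v) = G.mulVec (F.mulVec w) at h1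
    rwa [Matrix.mulVec_mulVec, Matrix.mulVec_mulVec, hGF, Matrix.one_mulVec, Matrix.one_mulVec] at h1
  · intro v
    constructor
    · intro hv
      change G'.mulVec v = 0 at hv
      refine ⟨G.mulVec v, ?_⟩
      change F.mulVec (G.mulVec v) = v
      have h1 := congrArg F'.mulVec hv
      rw [Matrix.mulVec_mulVec, hFG', Matrix.mulVec_zero, Matrix.sub_mulVec, Matrix.one_mulVec,
        sub_eq_zero] at h1
      rw [Matrix.mulVec_mulVec, hFG, ← h1]
    · rintro ⟨u, rfl⟩
      change G'.mulVec (F.mulVec u) = 0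
      rw [Matrix.mulVec_mulVec, ← hEF, ← Matrix.mul_assoc, hG'E, Matrix.zero_mul, Matrix.zero_mulVec]
  · intro v
    refine ⟨F'.mulVec v, ?_⟩
    change G'.mulVec (F'.mulVec v) = v
    rw [Matrix.mulVec_mulVec, hGF', Matrix.one_mulVec]

/-- A graded subspace is the image of an even idempotent. -/
theorem exists_even_idempotent (U : Submodule ℂ (V.ι → ℂ))
    (hU : ∀ v ∈ U, (fun i => (sgn (V.parity i) : ℂ) * v i) ∈ U) :
    ∃ E : Matrix V.ι V.ι ℂ, E * E = E ∧ (∀ i j, V.parity i ≠ V.parity j → E i j = 0) ∧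
      (∀ v, E.mulVec v ∈ U) ∧ ∀ v ∈ U, E.mulVec v = v := by
  obtain ⟨π, hπ⟩ := U.exists_isCompl
  let P : (V.ι → ℂ) →ₗ[ℂ] (V.ι → ℂ) := U.subtype ∘ₗ U.projectionOnto π hπ
  have hP1 : ∀ v, P v ∈ U := fun v => (U.projectionOnto π hπ v).2
  have hP2 : ∀ v ∈ U, P v = v := fun v hv =>
    congrArg Subtype.val (Submodule.projectionOnto_apply_left hπ ⟨v, hv⟩)
  let E₀ := LinearMap.toMatrix' P
  have hE₀ : ∀ v, E₀.mulVec v = P v := fun v => by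
    rw [← Matrix.toLin'_apply, Matrix.toLin'_toMatrix']
  let s : Matrix V.ι V.ι ℂ := Matrix.diagonal fun i => (sgn (V.parity i) : ℂ)
  have hs : ∀ v, s.mulVec v = fun i => (sgn (V.parity i) : ℂ) * v i := fun v => by
    ext i; rw [Matrix.mulVec_diagonal]
  have hss : ∀ v, s.mulVec (s.mulVec v) = v := fun v => by
    rw [hs, hs]
    ext i
    rw [← mul_assoc, ← Int.cast_mul, SuperAlg.sgn_mul_self, Int.cast_one, one_mul]
  -- Averaging an arbitrary projection onto U over conjugation by the parity operator makes it even,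
  -- and it remains a projection onto U because U is graded.
  let E : Matrix V.ι V.ι ℂ := (1 / 2 : ℂ) • (E₀ + s * E₀ * s)
  have hEv : ∀ v, E.mulVec v = (1 / 2 : ℂ) • (P v + s.mulVec (P (s.mulVec v))) := by
    intro v
    rw [Matrix.smul_mulVec, Matrix.add_mulVec, hE₀, ← Matrix.mulVec_mulVec, ← Matrix.mulVec_mulVec,
      hE₀]
  have h1 : ∀ v, E.mulVec v ∈ U := by
    intro v
    rw [hEv]
    refine Submodule.smul_mem _ _ (Submodule.add_mem _ (hP1 v) ?_)
    rw [hs]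
    exact hU _ (hP1 _)
  have h2 : ∀ v ∈ U, E.mulVec v = v := by
    intro v hv
    rw [hEv, hP2 v hv, hP2 (s.mulVec v) (by rw [hs]; exact hU v hv), hss, ← two_smul ℂ v, smul_smul]
    norm_num
  refine ⟨E, ?_, ?_, h1, h2⟩
  · apply Matrix.toLin'.injective
    ext1 v
    ext1
    rw [LinearMap.comp_apply, LinearMap.comp_apply, Matrix.toLin'_apply, Matrix.toLin'_apply,
      ← Matrix.mulVec_mulVec, h2 _ (h1 _)]
  · intro i j hij
    change (1 / 2 : ℂ) * (E₀ i j + (s * E₀ * s) i j) = 0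
    rw [Matrix.mul_diagonal, Matrix.diagonal_mul]
    have h3 : (sgn (V.parity i) : ℂ) * sgn (V.parity j) = -1 := by
      rcases zmod_two_cases (V.parity i) with hi | hi <;>
      rcases zmod_two_cases (V.parity j) with hj | hj
      · exact absurd (hi.trans hj.symm) hij
      · simp [hi, hj, sgn]
      · simp [hi, hj, sgn]
      · exact absurd (hi.trans hj.symm) hij
    rw [mul_right_comm, h3]
    ring

/-- A graded subspace stable under the generators is the image of an invariant idempotent. -/
theorem exists_isInv (U : Submodule ℂ (V.ι → ℂ))
    (hU : ∀ v ∈ U, (fun i => (sgn (V.parity i) : ℂ) * v i) ∈ U)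
    (hγ : ∀ (γ : SGL (stdParity n m) (SuperAlg.ofComm ℂ)), ∀ v ∈ U,
      Matrix.mulVec (α := ℂ) (V.mat γ) v ∈ U)
    (hX : ∀ (j k : Fin n ⊕ Fin m) (hp : stdParity n m j + stdParity n m k = 1), ∀ v ∈ U,
      (V.oddOp hp).mulVec v ∈ U) :
    ∃ E, V.IsInv E ∧ (∀ v, E.mulVec v ∈ U) ∧ ∀ v ∈ U, E.mulVec v = v := by
  obtain ⟨E, h1, h2, h3, h4⟩ := exists_even_idempotent U hU
  have hst : ∀ M : Matrix V.ι V.ι ℂ, (∀ v ∈ U, M.mulVec v ∈ U) → E * M * E = M * E := by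
    intro M hM
    apply Matrix.toLin'.injective
    ext1 v
    ext1
    rw [LinearMap.comp_apply, LinearMap.comp_apply, Matrix.toLin'_apply, Matrix.toLin'_apply,
      ← Matrix.mulVec_mulVec, ← Matrix.mulVec_mulVec, ← Matrix.mulVec_mulVec,
      h4 _ (hM _ (h3 _))]
  have hgen : V.GenStable E := ⟨fun γ => hst _ (hγ γ), fun j k hp => hst _ (hX j k hp)⟩
  exact ⟨E, ⟨h1, h2, fun A g => hgen.mat V h1 g⟩, h3, h4⟩

end GLRep

/-! ### Simple representations and their highest weights -/

namespace GLRep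

variable {n m : ℕ} (V : GLRep n m) {A : SuperAlg}

open Matrix

/-- A representation is simple if it is nonzero and has no proper graded subrepresentation. -/
def IsSimple : Prop := Nonempty V.ι ∧ ∀ E, V.IsInv E → E = 0 ∨ E = 1

/-- The graded subspaces stable under the complex points and the odd root operators. -/
structure IsStable (U : Submodule ℂ (V.ι → ℂ)) : Prop where
  graded : ∀ v ∈ U, (fun i => (sgn (V.parity i) : ℂ) * v i) ∈ U
  points : ∀ (γ : SGL (stdParity n m) (SuperAlg.ofComm ℂ)), ∀ v ∈ U,
    Matrix.mulVec (α := ℂ) (V.mat γ) v ∈ U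
  odd : ∀ (j k : Fin n ⊕ Fin m) (hp : stdParity n m j + stdParity n m k = 1), ∀ v ∈ U,
    (V.oddOp hp).mulVec v ∈ U

variable {V}

theorem IsSimple.eq_bot_or_top (hV : V.IsSimple) {U : Submodule ℂ (V.ι → ℂ)} (hU : V.IsStable U) :
    U = ⊥ ∨ U = ⊤ := by
  obtain ⟨E, hE, h1, h2⟩ := exists_isInv U hU.graded hU.points hU.odd
  rcases hV.2 E hE with rfl | rfl
  · left
    rw [Submodule.eq_bot_iff]
    intro v hv
    rw [← h2 v hv, Matrix.zero_mulVec]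
  · right
    rw [Submodule.eq_top_iff']
    intro v
    rw [← Matrix.one_mulVec v]
    exact h1 v

variable (V)

/-- The functionals that vanish on the subrepresentation generated by `u`. -/
def ann (u : V.ι → ℂ) : Submodule ℂ (V.ι → ℂ) where
  carrier := {l | ∀ (A : SuperAlg) (g : SGL (stdParity n m) A),
    (replicateRow Unit l).map (algebraMap ℂ A) * V.mat g *
      (replicateCol Unit u).map (algebraMap ℂ A) = 0}
  add_mem' := by
    intro l l' hl hl' A g
    rw [replicateRow_add, Matrix.map_add _ (fun a b => map_add _ a b), Matrix.add_mul,
      Matrix.add_mul, hl, hl', add_zero]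
  zero_mem' := by
    intro A g
    rw [replicateRow_zero, Matrix.map_zero _ (map_zero _), Matrix.zero_mul, Matrix.zero_mul]
  smul_mem' := by
    intro c l hl A g
    have h1 : (replicateRow Unit (c • l)).map (algebraMap ℂ A) =
        c • (replicateRow Unit l).map (algebraMap ℂ A) := by
      ext i j
      simp [Algebra.smul_def]
    rw [h1, Matrix.smul_mul, Matrix.smul_mul, hl, smul_zero]

/-- The subrepresentation generated by `u`. -/
def cyc (u : V.ι → ℂ) : Submodule ℂ (V.ι → ℂ) where
  carrier := {v | ∀ l ∈ V.ann u, l ⬝ᵥ v = 0}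
  add_mem' := fun hv hw l hl => by rw [dotProduct_add, hv l hl, hw l hl, add_zero]
  zero_mem' := fun l _ => dotProduct_zero l
  smul_mem' := fun c v hv l hl => by rw [dotProduct_smul, hv l hl, smul_zero]

variable {V}

theorem mem_cyc_self (u : V.ι → ℂ) : u ∈ V.cyc u := by
  intro l hl
  have h1 := hl (SuperAlg.ofComm ℂ) 1
  rw [V.mat_one, Matrix.mul_one] at h1
  have h2 := congrFun (congrFun h1 ()) ()
  exact h2

/-- `cyc` is defined as the common kernel of `ann`, so stability is checked on functionals. This
fits the matrix coefficients that `sandwich_eq_zero` controls. -/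
theorem mulVec_mem_cyc {u : V.ι → ℂ} {M : Matrix V.ι V.ι ℂ} (hM : ∀ l ∈ V.ann u, l ᵥ* M ∈ V.ann u)
    {v : V.ι → ℂ} (hv : v ∈ V.cyc u) : M *ᵥ v ∈ V.cyc u := by
  intro l hl
  rw [dotProduct_mulVec]
  exact hv _ (hM l hl)

/-- The entry (i, j) of the action has parity |i| + |j|, so applying the parity automorphism of A to
the entries amounts to conjugating by the sign matrix. -/
theorem sgn_mul_mat (g : SGL (stdParity n m) A) :
    (diagonal fun i => (sgn (V.parity i) : ℂ)).map (algebraMap ℂ A) * V.mat g =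
      V.mat (SGL.map _ A.involHom g) *
        (diagonal fun i => (sgn (V.parity i) : ℂ)).map (algebraMap ℂ A) := by
  rw [V.mat_map, Matrix.diagonal_map (map_zero _)]
  ext i j
  rw [Matrix.diagonal_mul, Matrix.mul_diagonal, Matrix.map_apply]
  change _ = A.invol (V.mat g i j) * _
  rw [SuperAlg.invol_of_mem (V.mat_mem g i j), map_intCast, map_intCast, sgn_add, zsmul_eq_mul,
    ← Int.cast_comm, ← mul_assoc, ← Int.cast_mul, mul_comm (sgn _) (sgn (V.parity j)), ← mul_assoc,
    SuperAlg.sgn_mul_self, one_mul]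

/-- Each operator is transferred to the group element in the definition of `ann`: the parity
operator twists g, up to the sign of the homogeneous vector u; a complex point multiplies g; an odd
root operator is the θ-coefficient of (1 + θE_{jk})g over A[θ]. -/
theorem cyc_isStable {u : V.ι → ℂ} {e : ZMod 2} (hu : u ∈ V.component e) :
    V.IsStable (V.cyc u) := by
  constructor
  · intro v hv
    have h1 : (fun i => (sgn (V.parity i) : ℂ) * v i) =
        (diagonal fun i => (sgn (V.parity i) : ℂ)) *ᵥ v := by
      ext i; rw [Matrix.mulVec_diagonal]
    rw [h1]
    refine mulVec_mem_cyc (fun l hl A g => ?_) hv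
    have h2 : (diagonal fun i => (sgn (V.parity i) : ℂ)) * replicateCol Unit u =
        (sgn e : ℂ) • replicateCol Unit u := by
      ext i j
      rw [Matrix.diagonal_mul, Matrix.smul_apply, smul_eq_mul, replicateCol_apply]
      by_cases hi : V.parity i = e
      · rw [hi]
      · rw [hu i hi, mul_zero, mul_zero]
    have h3 : ((sgn e : ℂ) • replicateCol Unit u).map (algebraMap ℂ A) =
        (sgn e : ℂ) • (replicateCol Unit u).map (algebraMap ℂ A) := by
      ext i j; simp [Algebra.smul_def]
    rw [replicateRow_vecMul, Matrix.map_mul, Matrix.mul_assoc _ _ (V.mat g), sgn_mul_mat,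
      ← Matrix.mul_assoc, Matrix.mul_assoc _ _ ((replicateCol Unit u).map _), ← Matrix.map_mul, h2,
      h3, Matrix.mul_smul, hl, smul_zero]
  · intro γ v hv
    refine mulVec_mem_cyc (M := V.mat γ) (fun l hl A g => ?_) hv
    have h1 : (replicateRow Unit (l ᵥ* (show Matrix V.ι V.ι ℂ from V.mat γ))).map (algebraMap ℂ A) =
        (replicateRow Unit l).map (algebraMap ℂ A) * V.mat (SGL.map _ A.scalarHom γ) := by
      rw [V.mat_map, replicateRow_vecMul, Matrix.map_mul]
      rfl
    refine (congrArg (fun M => M * V.mat g * _) h1).trans ?_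
    rw [Matrix.mul_assoc ((replicateRow Unit l).map _), ← V.mat_mul]
    exact hl A _
  · intro j k hp v hv
    refine mulVec_mem_cyc (fun l hl A g => ?_) hv
    have h1 := hl A.adjoinOdd (oddElem hp SuperAlg.theta_mem * SGL.map _ A.adjoinOddIncl g)
    have h2 := hl A.adjoinOdd (SGL.map _ A.adjoinOddIncl g)
    rw [V.mat_mul, mat_oddElem, Matrix.add_mul, Matrix.one_mul, Matrix.mul_add, Matrix.add_mul, h2,
      zero_add, Matrix.smul_mul, mapC_mul_smul, Matrix.smul_mul, ← Matrix.mul_assoc,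
      ← Matrix.map_mul, ← replicateRow_vecMul, ← map_sandwich] at h1
    ext i i'
    exact SuperAlg.eq_zero_of_theta_mul (congrFun (congrFun h1 i) i')

theorem mem_ann_of_top {u l : V.ι → ℂ} {w₀ : Wt n m} (hu : V.proj w₀ *ᵥ u = u)
    (hl : ∀ w ∈ V.wts, ht w ≠ ht w₀ → l ᵥ* V.proj w = 0) (htop : ∀ w ∈ V.wts, ht w ≤ ht w₀)
    (hlu : l ⬝ᵥ u = 0) : l ∈ V.ann u := by
  intro A g
  refine V.top_sandwich _ _ w₀ ?_ ?_ htop ?_ g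
  · rw [← replicateCol_mulVec, hu]
  · intro w hw hne
    rw [← replicateRow_vecMul, hl w hw hne, replicateRow_zero]
  · ext i j
    exact hlu

theorem proj_ne_zero {w : Wt n m} (hw : w ∈ V.wts) : V.proj w ≠ 0 := by
  obtain ⟨a, -, ha⟩ := Finset.mem_biUnion.1 hw
  intro h
  exact (Finsupp.mem_support_iff.1 ha) (congrFun (congrFun h a.1) a.2)

variable (V) in
/-- `w₀` is the only weight of maximal height; its weight space is a line of parity `e`. -/
structure IsTop (w₀ : Wt n m) (e : ZMod 2) : Prop where
  line : ∃ u φ : V.ι → ℂ, u ∈ V.component e ∧ V.proj w₀ = vecMulVec u φ ∧ φ ⬝ᵥ u = 1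
  le : ∀ w ∈ V.wts, ht w ≤ ht w₀
  unique : ∀ w ∈ V.wts, ht w = ht w₀ → w = w₀

/-- A homogeneous vector u of maximal height generates V. A functional supported in top height that
kills u annihilates everything u generates, so it is zero. Hence the whole top-height part of V is
the line through u, which gives multiplicity one and uniqueness together. -/
theorem IsSimple.exists_isTop (hV : V.IsSimple) : ∃ w₀ e, V.IsTop w₀ e := by
  have hne : V.wts.Nonempty := by
    by_contra h
    rw [Finset.not_nonempty_iff_eq_empty] at h
    have h1 := V.sum_proj
    rw [h, Finset.sum_empty] at h1
    obtain ⟨i⟩ := hV.1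
    have := congrFun (congrFun h1 i) i
    simp at this
  obtain ⟨w₀, hw₀, hmax⟩ := Finset.exists_max_image V.wts ht hne
  obtain ⟨j, hj⟩ : ∃ j, (V.proj w₀) *ᵥ Pi.single j 1 ≠ 0 := by
    by_contra! hc
    refine proj_ne_zero hw₀ ?_
    ext i j
    have := congrFun (hc j) i
    rwa [Matrix.mulVec_single_one] at this
  set u := (V.proj w₀) *ᵥ Pi.single j 1 with hu
  have huc : u ∈ V.component (V.parity j) := by
    intro i hi
    rw [hu, Matrix.mulVec_single_one]
    exact V.proj_even hi w₀
  have hPu : V.proj w₀ *ᵥ u = u := by rw [hu, Matrix.mulVec_mulVec, proj_mul_proj, if_pos rfl]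
  have hcyc : V.cyc u = ⊤ := by
    rcases hV.eq_bot_or_top (cyc_isStable huc) with h | h
    · have := mem_cyc_self u
      rw [h, Submodule.mem_bot] at this
      exact absurd this hj
    · exact h
  have hann : ∀ l ∈ V.ann u, l = 0 := by
    intro l hl
    ext i
    have h1 : Pi.single i 1 ∈ V.cyc u := by rw [hcyc]; trivial
    have h2 := h1 l hl
    simpa using h2
  set P := ∑ w ∈ V.wts.filter (fun w => ht w = ht w₀), V.proj w with hP
  have hPw : ∀ w ∈ V.wts, P * V.proj w = if ht w = ht w₀ then V.proj w else 0 := by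
    intro w hw
    rw [hP, Finset.sum_mul]
    simp only [proj_mul_proj]
    rw [Finset.sum_ite_eq']
    simp [hw]
  have hwP : ∀ w ∈ V.wts, ht w = ht w₀ → V.proj w * P = V.proj w := by
    intro w hw hht
    rw [hP, Finset.mul_sum]
    simp only [proj_mul_proj]
    rw [Finset.sum_ite_eq]
    simp [hw, hht]
  have hPuu : P *ᵥ u = u := by
    rw [← hPu, Matrix.mulVec_mulVec, hPw w₀ hw₀, if_pos rfl]
  have key : ∀ l : V.ι → ℂ, l ⬝ᵥ u = 0 → l ᵥ* P = 0 := by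
    intro l hl
    refine hann _ (mem_ann_of_top hPu (fun w hw hne => ?_) hmax ?_)
    · rw [Matrix.vecMul_vecMul, hPw w hw, if_neg hne, Matrix.vecMul_zero]
    · rw [← dotProduct_mulVec, hPuu, hl]
  obtain ⟨i₀, hi₀⟩ : ∃ i, u i ≠ 0 := by
    by_contra! hc
    exact hj (funext hc)
  -- By `key` row i of P is u i / u i₀ times row i₀, so P has rank one with column vector u.
  let φ : V.ι → ℂ := fun k => P i₀ k / u i₀
  have hPuφ : P = vecMulVec u φ := by
    ext i k
    have h1 := key (Pi.single i 1 - (u i / u i₀) • Pi.single i₀ 1) (by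
      rw [sub_dotProduct, smul_dotProduct, single_one_dotProduct, single_one_dotProduct, smul_eq_mul,
        div_mul_cancel₀ _ hi₀, sub_self])
    rw [Matrix.sub_vecMul, Matrix.smul_vecMul, Matrix.single_one_vecMul, Matrix.single_one_vecMul]
      at h1
    have h2 := congrFun h1 k
    simp only [Pi.sub_apply, Pi.smul_apply, Matrix.row_apply, smul_eq_mul, Pi.zero_apply] at h2
    rw [vecMulVec_apply, sub_eq_zero.1 h2]
    simp only [φ]
    field_simp
  have hφu : φ ⬝ᵥ u = 1 := by
    have h1 := congrFun hPuu i₀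
    change ∑ k, P i₀ k * u k = u i₀ at h1
    change ∑ k, P i₀ k / u i₀ * u k = 1
    simp only [div_mul_eq_mul_div]
    rw [← Finset.sum_div, h1, div_self hi₀]
  have huniq : ∀ w ∈ V.wts, ht w = ht w₀ → w = w₀ := by
    intro w hw hht
    by_contra hne
    refine proj_ne_zero hw ?_
    rw [← hwP w hw hht, hPuφ, Matrix.mul_vecMulVec, ← hPu, Matrix.mulVec_mulVec, proj_mul_proj,
      if_neg hne, Matrix.zero_mulVec, zero_vecMulVec]
  have hline : V.proj w₀ = vecMulVec u φ := by
    rw [← hPuφ, hP, Finset.sum_eq_single w₀]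
    · intro w hw hne
      rw [Finset.mem_filter] at hw
      exact absurd (huniq w hw.1 hw.2) hne
    · intro h
      rw [Finset.mem_filter] at h
      exact absurd (And.intro hw₀ (Eq.refl (ht w₀))) h
  clear_value φ u
  exact ⟨w₀, V.parity j, { line := ⟨u, φ, huc, hline, hφu⟩, le := hmax, unique := huniq }⟩

theorem IsTop.sdimWeight {w₀ : Wt n m} {e : ZMod 2} (h : V.IsTop w₀ e) :
    V.sdimWeight w₀ = sgn e := by
  obtain ⟨u, φ, hu, h1, h2⟩ := h.line
  have h3 : (V.sdimWeight w₀ : ℂ) = (sgn e : ℤ) := by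
    rw [sdimWeight_eq, h1, str]
    have h4 : ∀ i, sgn (V.parity i) • vecMulVec u φ i i = (sgn e : ℂ) * (φ i * u i) := by
      intro i
      rw [vecMulVec_apply, zsmul_eq_mul]
      by_cases hi : V.parity i = e
      · rw [hi, mul_comm (u i)]
      · rw [hu i hi]; simp
    simp only [h4]
    rw [← Finset.mul_sum]
    change _ * (φ ⬝ᵥ u) = _
    rw [h2, mul_one]
  exact_mod_cast h3

end GLRep

/-! ### Simple representations are determined by their highest weights -/

namespace GLRep

variable {n m : ℕ} {U V W : GLRep n m} {A : SuperAlg}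

open Matrix

/-- Composition of homomorphisms. -/
def Hom.comp (g : V.Hom W) (f : U.Hom V) : U.Hom W where
  toMat := g.toMat * f.toMat
  even k i hki := by
    rw [Matrix.mul_apply]
    refine Finset.sum_eq_zero fun j _ => ?_
    by_cases h : W.parity k = V.parity j
    · rw [f.even j i (fun h' => hki (h.trans h')), mul_zero]
    · rw [g.even k j h, zero_mul]
  comm A x := by
    rw [Matrix.map_mul, Matrix.mul_assoc, f.comm, ← Matrix.mul_assoc, g.comm, Matrix.mul_assoc]

theorem Hom.comp_lin (g : V.Hom W) (f : U.Hom V) (v : U.ι → ℂ) :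
    (g.comp f).lin v = g.lin (f.lin v) := (Matrix.mulVec_mulVec _ _ _).symm

theorem Hom.mul_oddOp (f : V.Hom W) {j k : Fin n ⊕ Fin m}
    (hp : stdParity n m j + stdParity n m k = 1) :
    f.toMat * V.oddOp hp = W.oddOp hp * f.toMat := by
  have h1 := f.comm _ (oddElem hp (SuperAlg.theta_mem (A := SuperAlg.ofComm ℂ)))
  rw [mat_oddElem, mat_oddElem, Matrix.mul_add, Matrix.add_mul, Matrix.mul_one, Matrix.one_mul,
    add_right_inj, mapC_mul_smul, Matrix.smul_mul, ← Matrix.map_mul, ← Matrix.map_mul] at h1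
  exact theta_smul_inj h1

theorem Hom.lin_sgn (f : V.Hom W) (v : V.ι → ℂ) :
    f.lin (fun i => (sgn (V.parity i) : ℂ) * v i) = fun k => (sgn (W.parity k) : ℂ) * f.lin v k := by
  ext k
  change ∑ i, f.toMat k i * _ = _ * ∑ i, f.toMat k i * v i
  rw [Finset.mul_sum]
  refine Finset.sum_congr rfl fun i _ => ?_
  by_cases h : W.parity k = V.parity i
  · rw [h]; ring
  · rw [f.even k i h]; ring

theorem Hom.lin_mat (f : V.Hom W) (γ : SGL (stdParity n m) (SuperAlg.ofComm ℂ)) (v : V.ι → ℂ) :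
    f.lin (Matrix.mulVec (α := ℂ) (V.mat γ) v) = Matrix.mulVec (α := ℂ) (W.mat γ) (f.lin v) := by
  have h1 : (f.toMat * (show Matrix _ _ ℂ from V.mat γ)) =
      (show Matrix _ _ ℂ from W.mat γ) * f.toMat := f.comm (SuperAlg.ofComm ℂ) γ
  exact (Matrix.mulVec_mulVec _ _ _).trans ((congrArg (fun M => M *ᵥ v) h1).trans
    (Matrix.mulVec_mulVec _ _ _).symm)

theorem Hom.lin_oddOp (f : V.Hom W) {j k : Fin n ⊕ Fin m}
    (hp : stdParity n m j + stdParity n m k = 1) (v : V.ι → ℂ) :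
    f.lin (V.oddOp hp *ᵥ v) = W.oddOp hp *ᵥ f.lin v :=
  (Matrix.mulVec_mulVec _ _ _).trans ((congrArg (fun M => M *ᵥ v) (f.mul_oddOp hp)).trans
    (Matrix.mulVec_mulVec _ _ _).symm)

theorem IsStable.map {S : Submodule ℂ (V.ι → ℂ)} (hS : V.IsStable S) (f : V.Hom W) :
    W.IsStable (S.map f.lin) := by
  constructor
  · rintro _ ⟨v, hv, rfl⟩
    exact ⟨_, hS.graded v hv, f.lin_sgn v⟩
  · rintro γ _ ⟨v, hv, rfl⟩
    exact ⟨_, hS.points γ v hv, f.lin_mat γ v⟩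
  · rintro j k hp _ ⟨v, hv, rfl⟩
    exact ⟨_, hS.odd j k hp v hv, f.lin_oddOp hp v⟩

theorem IsStable.comap {S : Submodule ℂ (W.ι → ℂ)} (hS : W.IsStable S) (f : V.Hom W) :
    V.IsStable (S.comap f.lin) := by
  constructor
  · intro v hv
    rw [Submodule.mem_comap, f.lin_sgn]
    exact hS.graded _ hv
  · intro γ v hv
    rw [Submodule.mem_comap, f.lin_mat]
    exact hS.points γ _ hv
  · intro j k hp v hv
    rw [Submodule.mem_comap, f.lin_oddOp]
    exact hS.odd j k hp _ hv

variable (V W)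

/-- The direct sum. -/
abbrev dsum : GLRep n m :=
  ofMat (V.ι ⊕ W.ι) (Sum.elim V.parity W.parity) (fun {_} g => fromBlocks (V.mat g) 0 0 (W.mat g))
    (fun g => by
      rintro (i | i) (j | j)
      · exact V.mat_mem g i j
      · exact Submodule.zero_mem _
      · exact Submodule.zero_mem _
      · exact W.mat_mem g i j)
    (by intro A; rw [V.mat_one, W.mat_one, fromBlocks_one])
    (fun g g' => by rw [V.mat_mul, W.mat_mul, fromBlocks_multiply]; simp)
    (fun φ g => by
      rw [V.mat_map, W.mat_map, fromBlocks_map, Matrix.map_zero _ (map_zero _),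
        Matrix.map_zero _ (map_zero _)])

theorem dsum_mat (g : SGL (stdParity n m) A) :
    (V.dsum W).mat g = fromBlocks (V.mat g) 0 0 (W.mat g) := rfl

theorem dsum_proj (w : Wt n m) : (V.dsum W).proj w = fromBlocks (V.proj w) 0 0 (W.proj w) := by
  ext (i | i) (j | j) <;> rfl

/-- The first projection of a direct sum. -/
def fstHom : (V.dsum W).Hom V where
  toMat := Matrix.of fun i a => Sum.elim (fun j => if i = j then 1 else 0) (fun _ => 0) a
  even := by
    rintro k (i | i) h
    · refine if_neg ?_
      rintro rfl
      exact h rfl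
    · rfl
  comm A g := by
    rw [dsum_mat]
    ext i (j | j) <;> simp [Matrix.mul_apply, Fintype.sum_sum_type, apply_ite]

/-- The second projection of a direct sum. -/
def sndHom : (V.dsum W).Hom W where
  toMat := Matrix.of fun i a => Sum.elim (fun _ => 0) (fun j => if i = j then 1 else 0) a
  even := by
    rintro k (i | i) h
    · rfl
    · refine if_neg ?_
      rintro rfl
      exact h rfl
  comm A g := by
    rw [dsum_mat]
    ext i (j | j) <;> simp [Matrix.mul_apply, Fintype.sum_sum_type, apply_ite]

/-- The first inclusion of a direct sum. -/
def inlHom : V.Hom (V.dsum W) where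
  toMat := Matrix.of fun a i => Sum.elim (fun j => if j = i then 1 else 0) (fun _ => 0) a
  even := by
    rintro (i | i) k h
    · refine if_neg ?_
      rintro rfl
      exact h rfl
    · rfl
  comm A g := by
    rw [dsum_mat]
    ext (j | j) i <;> simp [Matrix.mul_apply, Fintype.sum_sum_type, apply_ite]

/-- The second inclusion of a direct sum. -/
def inrHom : W.Hom (V.dsum W) where
  toMat := Matrix.of fun a i => Sum.elim (fun _ => 0) (fun j => if j = i then 1 else 0) a
  even := by
    rintro (i | i) k h
    · rfl
    · refine if_neg ?_
      rintro rfl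
      exact h rfl
  comm A g := by
    rw [dsum_mat]
    ext (j | j) i <;> simp [Matrix.mul_apply, Fintype.sum_sum_type, apply_ite]

theorem fstHom_lin (v : V.ι ⊕ W.ι → ℂ) : (V.fstHom W).lin v = fun i => v (Sum.inl i) := by
  ext i
  change ∑ a : V.ι ⊕ W.ι, Sum.elim (fun j => if i = j then (1 : ℂ) else 0) (fun _ => 0) a * v a = _
  simp [Fintype.sum_sum_type]

theorem sndHom_lin (v : V.ι ⊕ W.ι → ℂ) : (V.sndHom W).lin v = fun i => v (Sum.inr i) := by
  ext i
  change ∑ a : V.ι ⊕ W.ι, Sum.elim (fun _ => (0 : ℂ)) (fun j => if i = j then 1 else 0) a * v a = _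
  simp [Fintype.sum_sum_type]

theorem inlHom_lin (v : V.ι → ℂ) : (V.inlHom W).lin v = Sum.elim v (0 : W.ι → ℂ) := by
  ext (i | i)
  · change ∑ j, (if i = j then (1 : ℂ) else 0) * v j = v i
    simp
  · change ∑ j, (0 : ℂ) * v j = 0
    simp

theorem inrHom_lin (v : W.ι → ℂ) : (V.inrHom W).lin v = Sum.elim (0 : V.ι → ℂ) v := by
  ext (i | i)
  · change ∑ j, (0 : ℂ) * v j = 0
    simp
  · change ∑ j, (if i = j then (1 : ℂ) else 0) * v j = v i
    simp

variable {V W}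

theorem cls_zero : GrothRing.cls (zero n m) = 0 := by
  let w : (zero n m).Hom (zero n m) :=
    { toMat := 0
      even := fun _ _ _ => rfl
      comm := fun A g => by ext k; exact k.elim }
  have hw : IsShortExact w w := by
    refine ⟨fun v w _ => ?_, fun v => ⟨fun _ => ⟨0, ?_⟩, fun _ => ?_⟩, fun v => ⟨0, ?_⟩⟩ <;>
      · funext k; exact k.elim
  simpa using GrothRing.cls_exact hw

theorem Hom.cls_eq (f : V.Hom W) (hf : Function.Bijective f.lin) :
    GrothRing.cls V = GrothRing.cls W := by
  let z : W.Hom (zero n m) :=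
    { toMat := 0
      even := fun _ _ _ => rfl
      comm := fun A g => by ext k; exact k.elim }
  have h : IsShortExact f z := by
    refine ⟨hf.1, fun v => ⟨fun _ => hf.2 v, fun _ => ?_⟩, fun v => ⟨0, ?_⟩⟩ <;>
      · funext k; exact k.elim
  have h1 := GrothRing.cls_exact h
  rw [cls_zero, add_zero, sub_eq_zero] at h1
  exact h1

/-- If `L` and `L'` are simple, a subrepresentation of an extension of `L` by `L'` that neither
contains `L'` nor lies in it projects isomorphically onto `L`. -/
theorem bijective_of_simple {M L L' S : GLRep n m} (hL : L.IsSimple) (hL' : L'.IsSimple)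
    {U : Submodule ℂ (M.ι → ℂ)} (hU : M.IsStable U) (f : S.Hom M) (hf : Function.Injective f.lin)
    (hfU : LinearMap.range f.lin = U) (p : M.Hom L) (q : L'.Hom M)
    (hpq : ∀ v, p.lin v = 0 → ∃ y, q.lin y = v) {u : M.ι → ℂ} (hu : u ∈ U) (hpu : p.lin u ≠ 0)
    {y : L'.ι → ℂ} (hy : q.lin y ∉ U) : Function.Bijective (p.comp f).lin := by
  constructor
  · rw [← LinearMap.ker_eq_bot, LinearMap.ker_eq_bot']
    intro v hv
    rw [Hom.comp_lin] at hv
    obtain ⟨z, hz⟩ := hpq _ hv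
    have h1 : U.comap q.lin = ⊥ := by
      rcases hL'.eq_bot_or_top (hU.comap q) with h | h
      · exact h
      · have : y ∈ U.comap q.lin := by rw [h]; trivial
        exact absurd this hy
    have h2 : z ∈ U.comap q.lin := by
      rw [Submodule.mem_comap, hz, ← hfU]
      exact ⟨v, rfl⟩
    rw [h1, Submodule.mem_bot] at h2
    rw [h2, map_zero] at hz
    exact hf (hz.symm.trans (map_zero _).symm)
  · intro x
    have h1 : U.map p.lin = ⊤ := by
      rcases hL.eq_bot_or_top (hU.map p) with h | h
      · have : p.lin u ∈ U.map p.lin := ⟨u, hu, rfl⟩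
        rw [h, Submodule.mem_bot] at this
        exact absurd this hpu
      · exact h
    have h2 : x ∈ U.map p.lin := by rw [h1]; trivial
    obtain ⟨v, hv, rfl⟩ := h2
    rw [SetLike.mem_coe, ← hfU] at hv
    obtain ⟨s, rfl⟩ := hv
    exact ⟨s, Hom.comp_lin _ _ _⟩

/-- A graph argument: let S be the subrepresentation of L ⊕ L' generated by the sum (u, u') of the
top vectors. The functional (φ, -φ') annihilates S but not u or u' alone, so S contains neither
summand. By simplicity both projections of S are isomorphisms. -/
theorem IsSimple.cls_eq {L L' : GLRep n m} (hL : L.IsSimple) (hL' : L'.IsSimple) {w₀ : Wt n m}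
    {e : ZMod 2} (h : L.IsTop w₀ e) (h' : L'.IsTop w₀ e) :
    GrothRing.cls L = GrothRing.cls L' := by
  obtain ⟨u, φ, hu, hP, hφ⟩ := h.line
  obtain ⟨u', φ', hu', hP', hφ'⟩ := h'.line
  let M := L.dsum L'
  let u₂ : M.ι → ℂ := Sum.elim u u'
  let l : M.ι → ℂ := Sum.elim φ (-φ')
  have hu₂ : u₂ ∈ M.component e := by
    rintro (i | i) hi
    · exact hu i hi
    · exact hu' i hi
  have hPu : L.proj w₀ *ᵥ u = u := by
    rw [hP, Matrix.vecMulVec_mulVec, hφ]; simp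
  have hPu' : L'.proj w₀ *ᵥ u' = u' := by
    rw [hP', Matrix.vecMulVec_mulVec, hφ']; simp
  have hφP : φ ᵥ* L.proj w₀ = φ := by
    rw [hP, Matrix.vecMul_vecMulVec, hφ, one_smul]
  have hφP' : φ' ᵥ* L'.proj w₀ = φ' := by
    rw [hP', Matrix.vecMul_vecMulVec, hφ', one_smul]
  have hMw : ∀ w ∈ M.wts, w ∈ L.wts ∨ w ∈ L'.wts := by
    intro w hw
    by_contra! hc
    refine proj_ne_zero hw ?_
    rw [dsum_proj, L.proj_eq_zero hc.1, L'.proj_eq_zero hc.2, fromBlocks_zero]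
  have htop : ∀ w ∈ M.wts, ht w ≤ ht w₀ := fun w hw => (hMw w hw).elim (h.le w) (h'.le w)
  have hl : l ∈ M.ann u₂ := by
    refine mem_ann_of_top (w₀ := w₀) ?_ ?_ htop ?_
    · rw [dsum_proj, fromBlocks_mulVec]
      change Sum.elim (L.proj w₀ *ᵥ u + 0 *ᵥ u') (0 *ᵥ u + L'.proj w₀ *ᵥ u') = _
      rw [hPu, hPu', Matrix.zero_mulVec, Matrix.zero_mulVec, add_zero, zero_add]
    · intro w hw hne
      have hne' : w₀ ≠ w := fun h => hne (by rw [h])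
      have hA : φ ᵥ* L.proj w = 0 := by
        rw [← hφP, Matrix.vecMul_vecMul, proj_mul_proj, if_neg hne', Matrix.vecMul_zero]
      have hB : (-φ') ᵥ* L'.proj w = 0 := by
        rw [Matrix.neg_vecMul, ← hφP', Matrix.vecMul_vecMul, proj_mul_proj, if_neg hne',
          Matrix.vecMul_zero, neg_zero]
      rw [dsum_proj, vecMul_fromBlocks]
      change Sum.elim (φ ᵥ* L.proj w + (-φ') ᵥ* 0) (φ ᵥ* 0 + (-φ') ᵥ* L'.proj w) = _
      rw [hA, hB, Matrix.vecMul_zero, Matrix.vecMul_zero, add_zero, add_zero]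
      ext (i | i) <;> rfl
    · change Sum.elim φ (-φ') ⬝ᵥ Sum.elim u u' = 0
      rw [sumElim_dotProduct_sumElim, neg_dotProduct, hφ, hφ', add_neg_cancel]
  have hne : u ≠ 0 := by
    rintro rfl
    rw [dotProduct_zero] at hφ
    exact zero_ne_one hφ
  have hne' : u' ≠ 0 := by
    rintro rfl
    rw [dotProduct_zero] at hφ'
    exact zero_ne_one hφ'
  have hst := cyc_isStable hu₂
  obtain ⟨E, hE, hE1, hE2⟩ := exists_isInv _ hst.graded hst.points hst.odd
  obtain ⟨S, S', f, g, f', hex, hff', hf'f, -⟩ := hE.exists_shortExact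
  have hrange : LinearMap.range f.lin = M.cyc u₂ := by
    ext v
    constructor
    · rintro ⟨s, rfl⟩
      have h1 : f.lin s = E *ᵥ (f.lin s) := by
        change f.toMat *ᵥ s = E *ᵥ (f.toMat *ᵥ s)
        rw [Matrix.mulVec_mulVec, ← hff', Matrix.mul_assoc, hf'f, Matrix.mul_one]
      rw [h1]
      exact hE1 _
    · intro hv
      refine ⟨f' *ᵥ v, ?_⟩
      change f.toMat *ᵥ (f' *ᵥ v) = v
      rw [Matrix.mulVec_mulVec, hff', hE2 v hv]
  have b1 : Function.Bijective ((L.fstHom L').comp f).lin := by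
    refine bijective_of_simple hL hL' hst f hex.1 hrange _ (L.inrHom L') ?_ (mem_cyc_self u₂) ?_
      (y := u') ?_
    · intro v hv
      refine ⟨fun i => v (Sum.inr i), ?_⟩
      rw [fstHom_lin] at hv
      rw [inrHom_lin]
      ext (i | i)
      · exact (congrFun hv i).symm
      · rfl
    · rw [fstHom_lin]; exact hne
    · intro hmem
      have h1 := hmem l hl
      rw [inrHom_lin] at h1
      change Sum.elim φ (-φ') ⬝ᵥ Sum.elim (0 : L.ι → ℂ) u' = 0 at h1
      rw [sumElim_dotProduct_sumElim, neg_dotProduct, hφ', dotProduct_zero] at h1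
      norm_num at h1
  have b2 : Function.Bijective ((L.sndHom L').comp f).lin := by
    refine bijective_of_simple hL' hL hst f hex.1 hrange _ (L.inlHom L') ?_ (mem_cyc_self u₂) ?_
      (y := u) ?_
    · intro v hv
      refine ⟨fun i => v (Sum.inl i), ?_⟩
      rw [sndHom_lin] at hv
      rw [inlHom_lin]
      ext (i | i)
      · rfl
      · exact (congrFun hv i).symm
    · rw [sndHom_lin]; exact hne'
    · intro hmem
      have h1 := hmem l hl
      rw [inlHom_lin] at h1
      change Sum.elim φ (-φ') ⬝ᵥ Sum.elim u (0 : L'.ι → ℂ) = 0 at h1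
      rw [sumElim_dotProduct_sumElim, hφ, dotProduct_zero, add_zero] at h1
      exact one_ne_zero h1
  rw [← Hom.cls_eq _ b1, Hom.cls_eq _ b2]

end GLRep

/-! ### The basis of simple representations, injectivity and saturation -/

namespace GLRep

variable {n m : ℕ} {U V W : GLRep n m} {A : SuperAlg}

open Matrix

theorem IsShortExact.card_eq {V₁ V₂ : GLRep n m} {f : V₁.Hom V} {g : V.Hom V₂}
    (h : IsShortExact f g) : Fintype.card V.ι = Fintype.card V₁.ι + Fintype.card V₂.ι := by
  have h1 := LinearMap.finrank_range_add_finrank_ker g.lin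
  rw [LinearMap.exact_iff.1 h.2.1, LinearMap.finrank_range_of_inj h.1,
    LinearMap.range_eq_top.2 h.2.2, finrank_top] at h1
  simp only [Module.finrank_fintype_fun_eq_card] at h1
  omega

/-- Induction on the dimension: a nontrivial invariant idempotent writes the class as a sum of
classes of two representations of smaller dimension. -/
theorem cls_mem_of_simple (S : AddSubgroup (GrothRing n m))
    (hS : ∀ L : GLRep n m, L.IsSimple → GrothRing.cls L ∈ S) (V : GLRep n m) :
    GrothRing.cls V ∈ S := by
  induction hd : Fintype.card V.ι using Nat.strong_induction_on generalizing V with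
  | _ d ih =>
    rcases isEmpty_or_nonempty V.ι with hV | hV
    · let z : V.Hom (zero n m) :=
        { toMat := 0
          even := fun _ _ _ => rfl
          comm := fun A g => by ext k; exact k.elim }
      have hz : Function.Bijective z.lin :=
        ⟨fun v w _ => funext fun i => (hV.false i).elim, fun v => ⟨0, funext fun k => k.elim⟩⟩
      rw [z.cls_eq hz, cls_zero]
      exact S.zero_mem
    by_cases hs : V.IsSimple
    · exact hS V hs
    obtain ⟨E, hE, hE0, hE1⟩ : ∃ E, V.IsInv E ∧ E ≠ 0 ∧ E ≠ 1 := by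
      by_contra! hc
      exact hs ⟨hV, fun E hE => or_iff_not_imp_left.2 (hc E hE)⟩
    obtain ⟨V₁, V₂, f, g, f', hex, hff, hf'f, -⟩ := hE.exists_shortExact
    have hcard := hex.card_eq
    have h1 : 0 < Fintype.card V₁.ι := by
      rw [Fintype.card_pos_iff]
      by_contra hc
      rw [not_nonempty_iff] at hc
      refine hE0 (hff.symm.trans ?_)
      ext i j
      rw [Matrix.mul_apply, Fintype.sum_empty]
      rfl
    have h2 : 0 < Fintype.card V₂.ι := by
      rw [Fintype.card_pos_iff]
      by_contra hc
      rw [not_nonempty_iff] at hc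
      refine hE1 (Matrix.toLin'.injective (LinearMap.ext fun v => ?_))
      obtain ⟨s, hs⟩ := (hex.2.1 v).1 (funext fun i => (hc.false i).elim)
      rw [Matrix.toLin'_one, LinearMap.id_apply, Matrix.toLin'_apply, ← hs]
      change E *ᵥ (f.toMat *ᵥ s) = f.toMat *ᵥ s
      rw [Matrix.mulVec_mulVec, ← hff, Matrix.mul_assoc, hf'f, Matrix.mul_one]
    have h3 := GrothRing.cls_exact hex
    have h4 : GrothRing.cls V = GrothRing.cls V₁ + GrothRing.cls V₂ := by
      rw [← sub_eq_zero, ← neg_eq_zero, ← h3]; abel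
    rw [h4]
    exact S.add_mem (ih _ (by omega) V₁ rfl) (ih _ (by omega) V₂ rfl)

theorem IsSimple.parityShift (hV : V.IsSimple) : V.parityShift.IsSimple := by
  refine ⟨hV.1, fun E hE => hV.2 E ⟨hE.idem, fun i j hij => hE.even i j fun h => hij ?_, hE.inv⟩⟩
  exact add_right_cancel h

theorem IsTop.parityShift {w : Wt n m} {e : ZMod 2} (hV : V.IsTop w e) :
    V.parityShift.IsTop w (e + 1) := by
  obtain ⟨u, φ, hu, h1, h2⟩ := hV.line
  exact ⟨⟨u, φ, fun i hi => hu i fun h => hi (congrArg (· + 1) h), h1, h2⟩, hV.le, hV.unique⟩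

variable (n m) in
/-- The highest weights of the simple representations with an even highest weight vector. -/
abbrev DomWt : Type := {w : Wt n m // ∃ L : GLRep n m, L.IsSimple ∧ L.IsTop w 0}

/-- A simple representation with a given highest weight. -/
def simpleRep (l : DomWt n m) : GLRep n m := l.2.choose

theorem simpleRep_isSimple (l : DomWt n m) : (simpleRep l).IsSimple := l.2.choose_spec.1

theorem simpleRep_isTop (l : DomWt n m) : (simpleRep l).IsTop l.1 0 := l.2.choose_spec.2

/-- A simple representation with odd top vector has minus the class of its parity shift, so one
simple representation for each highest weight suffices. -/
theorem mem_span_simpleRep (a : GrothRing n m) :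
    a ∈ Submodule.span ℤ (Set.range fun l : DomWt n m => GrothRing.cls (simpleRep l)) := by
  set S := Submodule.span ℤ (Set.range fun l : DomWt n m => GrothRing.cls (simpleRep l)) with hS
  have h0 : ∀ (L : GLRep n m) (w : Wt n m), L.IsSimple → L.IsTop w 0 → GrothRing.cls L ∈ S := by
    intro L w hL hw
    rw [hL.cls_eq (simpleRep_isSimple ⟨w, L, hL, hw⟩) hw (simpleRep_isTop ⟨w, L, hL, hw⟩)]
    exact Submodule.subset_span ⟨_, rfl⟩
  have h1 : ∀ V : GLRep n m, GrothRing.cls V ∈ S := by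
    refine cls_mem_of_simple S.toAddSubgroup fun L hL => ?_
    obtain ⟨w, e, hw⟩ := hL.exists_isTop
    have he : ∀ e : ZMod 2, e = 0 ∨ e = 1 := by decide
    rcases he e with rfl | rfl
    · exact h0 L w hL hw
    · rw [eq_neg_of_add_eq_zero_left (GrothRing.cls_shift L)]
      exact S.neg_mem (h0 _ w hL.parityShift hw.parityShift)
  obtain ⟨a, rfl⟩ := QuotientAddGroup.mk'_surjective (grothSubgroup n m) a
  induction a using FreeAbelianGroup.induction_on with
  | zero => exact S.zero_mem
  | of V => exact h1 V
  | neg V _ => exact S.neg_mem (h1 V)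
  | add a b ha hb => exact S.add_mem ha hb

/-- Unitriangularity of the supercharacters of the simple representations. -/
theorem mem_of_coeff_mem (b : DomWt n m →₀ ℂ) (G : AddSubgroup ℂ)
    (hb : ∀ w, (b.sum fun l c => c * ((simpleRep l).sdimWeight w : ℂ)) ∈ G) (l : DomWt n m) :
    b l ∈ G := by
  classical
  by_contra hl
  -- Among the coefficients outside G one with highest weight of maximal height is chosen. At that
  -- weight its representation contributes the coefficient itself; every other representation either
  -- has its coefficient in G or does not have this weight at all.
  obtain ⟨l₀, hl₀, hmax⟩ := Finset.exists_max_image (b.support.filter fun l => b l ∉ G)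
    (fun l => ht l.1) ⟨l, Finset.mem_filter.2
      ⟨Finsupp.mem_support_iff.2 fun h => hl (h ▸ G.zero_mem), hl⟩⟩
  rw [Finset.mem_filter] at hl₀
  refine hl₀.2 ?_
  have h1 := hb l₀.1
  rw [Finsupp.sum, ← Finset.add_sum_erase _ _ hl₀.1, (simpleRep_isTop l₀).sdimWeight, sgn_zero,
    Int.cast_one, mul_one] at h1
  refine (G.add_mem_cancel_right (G.sum_mem fun k hk => ?_)).1 h1
  rw [Finset.mem_erase] at hk
  by_cases hkG : b k ∈ G
  · rw [mul_comm, ← zsmul_eq_mul]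
    exact G.zsmul_mem hkG _
  · have h2 : l₀.1 ∉ (simpleRep k).wts := by
      intro hmem
      have h3 := (simpleRep_isTop k).le _ hmem
      have h4 := hmax k (Finset.mem_filter.2 ⟨hk.2, hkG⟩)
      exact hk.1 (Subtype.ext ((simpleRep_isTop k).unique _ hmem (le_antisymm h3 h4)).symm)
    have h5 : ((simpleRep k).sdimWeight l₀.1 : ℂ) = 0 := by
      rw [sdimWeight_eq, proj_eq_zero _ h2, str]
      simp
    rw [h5, mul_zero]
    exact G.zero_mem

theorem schHom_sum (c : DomWt n m →₀ ℤ) :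
    schHom n m (c.sum fun l a => a • GrothRing.cls (simpleRep l)) =
      c.sum fun l a => a • (simpleRep l).sch := by
  rw [map_finsuppSum]
  simp only [map_zsmul, schHom_cls]

/-- The unitriangularity statement is used with the zero subgroup of ℂ, where it says that the
simple supercharacters are linearly independent. -/
theorem _root_.SuperGL.schHom_injective : Function.Injective (schHom n m) := by
  rw [injective_iff_map_eq_zero]
  intro a ha
  obtain ⟨c, rfl⟩ := Finsupp.mem_span_range_iff_exists_finsupp.1 (mem_span_simpleRep a)
  rw [schHom_sum] at ha
  have h1 : c = 0 := by
    ext l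
    have h2 := mem_of_coeff_mem (c.mapRange (Int.cast : ℤ → ℂ) Int.cast_zero) ⊥ (fun w => ?_) l
    · simpa using h2
    · have h3 := congrArg (fun f : LaurentRing n m => ((f.coeff w : ℤ) : ℂ)) ha
      rw [AddSubgroup.mem_bot, Finsupp.sum_mapRange_index (by simp), ← Int.cast_zero (R := ℂ)]
      refine Eq.trans ?_ h3
      simp only [Finsupp.sum, AddMonoidAlgebra.coeff_sum, Finsupp.finsetSum_apply,
        AddMonoidAlgebra.coeff_smul, Finsupp.smul_apply, coeff_sch, smul_eq_mul]
      push_cast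
      rfl
  rw [h1, Finsupp.sum_zero_index]

theorem schC_mem_span_simpleRep (V : GLRep n m) :
    V.schC ∈ Submodule.span ℂ (Set.range fun l : DomWt n m => (simpleRep l).schC) := by
  obtain ⟨c, hc⟩ := Finsupp.mem_span_range_iff_exists_finsupp.1 (mem_span_simpleRep (GrothRing.cls V))
  rw [← toC_sch, ← schHom_cls, ← hc, schHom_sum, map_finsuppSum]
  refine Submodule.sum_mem _ fun l _ => ?_
  beta_reduce
  rw [map_zsmul, toC_sch]
  exact zsmul_mem (Submodule.subset_span (Set.mem_range_self l)) _

/-- An integral Laurent polynomial that is a complex combination of supercharacters is an integral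
combination of supercharacters. -/
theorem mem_range_schHom {f : LaurentRing n m}
    (hf : toC n m f ∈ Submodule.span ℂ (Set.range (schC : GLRep n m → TorusRing n m))) :
    f ∈ (schHom n m).range := by
  have h1 : toC n m f ∈ Submodule.span ℂ (Set.range fun l : DomWt n m => (simpleRep l).schC) := by
    refine Submodule.span_le.2 ?_ hf
    rintro _ ⟨V, rfl⟩
    exact schC_mem_span_simpleRep V
  obtain ⟨b, hb⟩ := Finsupp.mem_span_range_iff_exists_finsupp.1 h1
  -- With the subgroup ℤ of ℂ, integrality of the Laurent coefficients forces integrality of the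
  -- multiplicities.
  have h2 := mem_of_coeff_mem b (Int.castAddHom ℂ).range (fun w => by
    refine ⟨f.coeff w, ?_⟩
    have h3 := congrArg (fun f : TorusRing n m => f.coeff w) hb
    change ((f.coeff w : ℤ) : ℂ) = _
    rw [← coeff_toC]
    refine h3.symm.trans ?_
    simp only [Finsupp.sum, AddMonoidAlgebra.coeff_sum, Finsupp.finsetSum_apply,
      AddMonoidAlgebra.coeff_smul, Finsupp.smul_apply, coeff_schC, smul_eq_mul])
  choose c hc using h2
  refine ⟨∑ l ∈ b.support, c l • GrothRing.cls (simpleRep l), toC_injective ?_⟩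
  rw [map_sum, map_sum, ← hb, Finsupp.sum]
  refine Finset.sum_congr rfl fun l _ => ?_
  rw [map_zsmul, map_zsmul, schHom_cls, toC_sch, ← hc l, Int.coe_castAddHom, Int.cast_smul_eq_zsmul]

end GLRep

/-! ### Supertraces of equivariant operators and power sums -/

/-- Only entries of F between indices of equal parity are nonzero, so the two signs agree term by
term. -/
theorem str_mul_comm {ι κ : Type} [Fintype ι] [Fintype κ] {R : Type*} [CommRing R]
    {p : ι → ZMod 2} {q : κ → ZMod 2} {F : Matrix ι κ R} (G : Matrix κ ι R)
    (hF : ∀ i a, p i ≠ q a → F i a = 0) : str p (F * G) = str q (G * F) := by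
  simp only [str, Matrix.mul_apply, Finset.smul_sum]
  rw [Finset.sum_comm]
  refine Finset.sum_congr rfl fun a _ => Finset.sum_congr rfl fun i _ => ?_
  by_cases h : p i = q a
  · rw [h, mul_comm]
  · rw [hF i a h]; simp

theorem str_add {ι : Type} [Fintype ι] {A : Type*} [AddCommGroup A] (p : ι → ZMod 2)
    (M N : Matrix ι ι A) : str p (M + N) = str p M + str p N := by
  simp [str, Finset.sum_add_distrib]

theorem str_smul {ι : Type} [Fintype ι] {A : Type*} [AddCommGroup A] [Module ℂ A]
    (p : ι → ZMod 2) (c : ℂ) (M : Matrix ι ι A) : str p (c • M) = c • str p M := by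
  simp only [str, Finset.smul_sum, Matrix.smul_apply]
  exact Finset.sum_congr rfl fun i _ => smul_comm _ _ _

namespace GLRep

variable {n m : ℕ} {U V W : GLRep n m} {A : SuperAlg}

open Matrix

variable (n m) in
/-- The space of complex combinations of supercharacters. -/
def charSpan : Submodule ℂ (TorusRing n m) := Submodule.span ℂ (Set.range schC)

theorem schC_mem (V : GLRep n m) : V.schC ∈ charSpan n m := Submodule.subset_span ⟨V, rfl⟩

theorem one_mem_charSpan : (1 : TorusRing n m) ∈ charSpan n m := by
  rw [← map_one (toC n m), ← sch_triv, toC_sch]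
  exact schC_mem _

theorem mul_mem_charSpan {f g : TorusRing n m} (hf : f ∈ charSpan n m) (hg : g ∈ charSpan n m) :
    f * g ∈ charSpan n m := by
  have h1 := Submodule.mul_mem_mul hf hg
  rw [charSpan, Submodule.span_mul_span] at h1
  refine Submodule.span_le.2 ?_ h1
  rintro _ ⟨_, ⟨V, rfl⟩, _, ⟨W, rfl⟩, rfl⟩
  beta_reduce
  rw [← schC_tensor]
  exact schC_mem _

theorem map_algebraMap_smul_one (a : ℂ) :
    (a • (1 : Matrix V.ι V.ι ℂ)).map (algebraMap ℂ A) = a • (1 : Matrix V.ι V.ι A) := by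
  ext i j
  by_cases h : i = j
  · subst h; simp [Algebra.algebraMap_eq_smul_one]
  · simp [h]

/-- The endomorphism `c - a`. -/
def Hom.subSmul (c : V.Hom V) (a : ℂ) : V.Hom V where
  toMat := c.toMat - a • 1
  even i j hij := by
    rw [Matrix.sub_apply, c.even i j hij, Matrix.smul_apply,
      Matrix.one_apply_ne (fun h => hij (by rw [h])), smul_zero, sub_zero]
  comm A g := by
    rw [Matrix.map_sub _ (fun a b => map_sub _ a b), map_algebraMap_smul_one, Matrix.sub_mul,
      Matrix.mul_sub, c.comm, Matrix.smul_mul, Matrix.mul_smul, Matrix.one_mul, Matrix.mul_one]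

theorem isStable_top : V.IsStable ⊤ :=
  ⟨fun _ _ => trivial, fun _ _ _ => trivial, fun _ _ _ _ _ => trivial⟩

/-- An endomorphism factors through its image. -/
theorem Hom.exists_image (c : V.Hom V) : ∃ (W : GLRep n m) (q : V.Hom W) (f : W.Hom V),
    c.toMat = f.toMat * q.toMat ∧ Function.Injective f.lin ∧
      LinearMap.range f.lin = LinearMap.range c.lin := by
  obtain ⟨E, hE, h1, h2⟩ := exists_isInv _ (isStable_top.map c).graded (isStable_top.map c).points
    (isStable_top.map c).odd
  obtain ⟨W, W', f, g, f', hex, hff, hf'f, hf'⟩ := hE.exists_shortExact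
  have hEc : E * c.toMat = c.toMat := by
    refine Matrix.toLin'.injective (LinearMap.ext fun v => ?_)
    rw [Matrix.toLin'_mul, LinearMap.comp_apply, Matrix.toLin'_apply, Matrix.toLin'_apply]
    exact h2 _ ⟨v, trivial, rfl⟩
  have hfm : ∀ {B : SuperAlg}, (f.toMat.map (algebraMap ℂ B)) * f'.map (algebraMap ℂ B) =
      E.map (algebraMap ℂ B) := by
    intro B; rw [← Matrix.map_mul, hff]
  have hfm' : ∀ {B : SuperAlg}, f'.map (algebraMap ℂ B) * (f.toMat.map (algebraMap ℂ B)) = 1 := by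
    intro B; rw [← Matrix.map_mul, hf'f, Matrix.map_one _ (map_zero _) (map_one _)]
  let q : V.Hom W :=
    { toMat := f' * c.toMat
      even := fun k i hki => by
        rw [Matrix.mul_apply]
        refine Finset.sum_eq_zero fun j _ => ?_
        by_cases h : W.parity k = V.parity j
        · rw [c.even j i (fun h' => hki (h.trans h')), mul_zero]
        · rw [hf' k j h, zero_mul]
      comm := fun B x => by
        have h3 : E.map (algebraMap ℂ B) * c.toMat.map (algebraMap ℂ B) =
            c.toMat.map (algebraMap ℂ B) := by rw [← Matrix.map_mul, hEc]
        calc (f' * c.toMat).map (algebraMap ℂ B) * V.mat x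
            = f'.map (algebraMap ℂ B) * (V.mat x * c.toMat.map (algebraMap ℂ B)) := by
              rw [Matrix.map_mul, Matrix.mul_assoc, c.comm]
          _ = f'.map (algebraMap ℂ B) * (V.mat x * f.toMat.map (algebraMap ℂ B)) *
                (f'.map (algebraMap ℂ B) * c.toMat.map (algebraMap ℂ B)) := by
              conv_lhs => rw [← h3, ← hfm]
              simp only [Matrix.mul_assoc]
          _ = W.mat x * (f' * c.toMat).map (algebraMap ℂ B) := by
              rw [← f.comm, ← Matrix.mul_assoc (f'.map _), hfm', Matrix.one_mul, Matrix.map_mul] }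
  have hfq : c.toMat = f.toMat * q.toMat := by
    change c.toMat = f.toMat * (f' * c.toMat)
    rw [← Matrix.mul_assoc, hff, hEc]
  refine ⟨W, q, f, hfq, hex.1, le_antisymm ?_ ?_⟩
  · rintro _ ⟨s, rfl⟩
    have h3 : f.lin s = E *ᵥ (f.toMat *ᵥ s) := by
      change f.toMat *ᵥ s = _
      rw [Matrix.mulVec_mulVec, ← hff, Matrix.mul_assoc, hf'f, Matrix.mul_one]
    rw [h3]
    obtain ⟨v, -, hv⟩ := h1 (f.toMat *ᵥ s)
    exact ⟨v, hv⟩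
  · rintro _ ⟨v, rfl⟩
    refine ⟨q.toMat *ᵥ v, ?_⟩
    change f.toMat *ᵥ _ = c.toMat *ᵥ v
    rw [Matrix.mulVec_mulVec, ← hfq]

/-- The supertrace of the torus twisted by an equivariant endomorphism is a combination of
supercharacters. -/
theorem str_hom_mem (V : GLRep n m) (c : V.Hom V) :
    str V.parity (c.toMat.map (algebraMap ℂ (TorusRing n m)) * V.univMat) ∈ charSpan n m := by
  induction hd : Fintype.card V.ι using Nat.strong_induction_on generalizing V with
  | _ d ih =>
    rcases isEmpty_or_nonempty V.ι with hV | hV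
    · rw [str, Fintype.sum_empty]
      exact Submodule.zero_mem _
    -- Subtracting an eigenvalue a leaves an endomorphism factoring as f q through an image W of
    -- smaller dimension. By cyclicity its twisted supertrace is that of q f on W, and the scalar
    -- part contributes a times the supercharacter of V.
    obtain ⟨a, ha⟩ := Module.End.exists_eigenvalue (c.lin : Module.End ℂ (V.ι → ℂ))
    obtain ⟨v, hv⟩ := ha.exists_hasEigenvector
    obtain ⟨W, q, f, hfq, hf, hr⟩ := (c.subSmul a).exists_image
    have hker : v ∈ LinearMap.ker (c.subSmul a).lin := by
      have h1 : c.toMat *ᵥ v = a • v := hv.apply_eq_smul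
      change (c.toMat - a • 1) *ᵥ v = 0
      rw [Matrix.sub_mulVec, h1, Matrix.smul_mulVec, Matrix.one_mulVec, sub_self]
    have hcard : Fintype.card W.ι < d := by
      have h1 := LinearMap.finrank_range_add_finrank_ker (c.subSmul a).lin
      rw [← hr, LinearMap.finrank_range_of_inj hf] at h1
      simp only [Module.finrank_fintype_fun_eq_card] at h1
      have h2 : 0 < Module.finrank ℂ (LinearMap.ker (c.subSmul a).lin) := by
        rw [Module.finrank_pos_iff_exists_ne_zero]
        exact ⟨⟨v, hker⟩, fun h => hv.2 (congrArg Subtype.val h)⟩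
      omega
    have h1 := ih _ hcard W (q.comp f) rfl
    have hc : c.toMat = f.toMat * q.toMat + a • 1 := by
      rw [← hfq]; exact (sub_add_cancel _ _).symm
    have hsm := map_algebraMap_smul_one (V := V) (A := SuperAlg.ofComm (TorusRing n m)) a
    have hcm : c.toMat.map (algebraMap ℂ (TorusRing n m)) =
        f.toMat.map (algebraMap ℂ (TorusRing n m)) * q.toMat.map (algebraMap ℂ (TorusRing n m)) +
          a • (1 : Matrix V.ι V.ι (TorusRing n m)) := by
      rw [hc, Matrix.map_add _ (fun a b => map_add _ a b), Matrix.map_mul]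
      exact congrArg _ hsm
    have hfe : ∀ i b, V.parity i ≠ W.parity b →
        f.toMat.map (algebraMap ℂ (TorusRing n m)) i b = 0 := by
      intro i b h
      rw [Matrix.map_apply, f.even i b h, map_zero]
    rw [hcm, Matrix.add_mul, str_add, Matrix.smul_mul, str_smul, Matrix.one_mul, Matrix.mul_assoc,
      str_mul_comm _ hfe, Matrix.mul_assoc, ← f.mul_univMat, ← Matrix.mul_assoc, ← Matrix.map_mul]
    exact Submodule.add_mem _ h1 (Submodule.smul_mem _ _ (schC_mem V))

/-! ### Cyclic permutations of tensor powers -/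

variable (V W) in
/-- The braiding of the first two factors. -/
def swapHom : (V.tensor (V.tensor W)).Hom (V.tensor (V.tensor W)) where
  toMat := Matrix.of fun (a b : V.ι × V.ι × W.ι) =>
    if b = (a.2.1, a.1, a.2.2) then (sgn (V.parity a.1 * V.parity a.2.1) : ℂ) else 0
  even := by
    rintro ⟨i, j, k⟩ b hne
    refine if_neg ?_
    rintro rfl
    refine hne ?_
    change V.parity i + (V.parity j + W.parity k) = V.parity j + (V.parity i + W.parity k)
    ring
  comm A g := by
    ext ⟨i, j, k⟩ ⟨i', j', k'⟩
    rw [Matrix.mul_apply, Matrix.mul_apply]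
    have hL := Finset.sum_eq_single (s := Finset.univ) (f := fun c : V.ι × V.ι × W.ι =>
      algebraMap ℂ A (if c = (j, i, k) then (sgn (V.parity i * V.parity j) : ℂ) else 0) *
        (V.tensor (V.tensor W)).mat g c (i', j', k')) (j, i, k)
      (fun b _ hb => by simp [hb]) (by simp)
    have hR := Finset.sum_eq_single (s := Finset.univ) (f := fun c : V.ι × V.ι × W.ι =>
      (V.tensor (V.tensor W)).mat g (i, j, k) c * algebraMap ℂ A
        (if (i', j', k') = (c.2.1, c.1, c.2.2) then (sgn (V.parity c.1 * V.parity c.2.1) : ℂ) else 0))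
      (j', i', k')
      (fun b _ hb => by
        rw [if_neg, map_zero, mul_zero]
        rintro h
        refine hb ?_
        simp only [Prod.mk.injEq] at h
        ext
        · exact h.2.1.symm
        · exact h.1.symm
        · exact h.2.2.symm) (by simp)
    refine hL.trans (Eq.trans ?_ hR.symm)
    rw [if_pos rfl, if_pos rfl, map_intCast, map_intCast, ← zsmul_eq_mul, ← zsmul_eq_mul']
    change sgn (V.parity i * V.parity j) •
      (sgn ((V.parity j + V.parity i') * (V.parity i + W.parity k)) • (V.mat g j i' *
        (sgn ((V.parity i + V.parity j') * W.parity k) • (V.mat g i j' * W.mat g k k')))) =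
      sgn (V.parity j' * V.parity i') •
      (sgn ((V.parity i + V.parity j') * (V.parity j + W.parity k)) • (V.mat g i j' *
        (sgn ((V.parity j + V.parity i') * W.parity k) • (V.mat g j i' * W.mat g k k'))))
    simp only [mul_smul_comm, ← mul_assoc]
    rw [A.mul_comm_sgn (V.mat_mem g j i') (V.mat_mem g i j')]
    simp only [smul_mul_assoc, smul_smul]
    congr 1
    generalize V.parity i = a; generalize V.parity j = b; generalize V.parity i' = c
    generalize V.parity j' = d; generalize W.parity k = e
    revert a b c d e; decide

variable (V) in
/-- The tensor powers of `V`. -/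
def tpow : ℕ → GLRep n m
  | 0 => triv n m
  | k + 1 => V.tensor (tpow k)

variable (V) in
/-- The identity. -/
def idHom : V.Hom V where
  toMat := 1
  even i j hij := Matrix.one_apply_ne fun h => hij (by rw [h])
  comm A g := by
    rw [Matrix.map_one _ (map_zero _) (map_one _), Matrix.one_mul, Matrix.mul_one]

variable (V) in
/-- The cyclic permutation of the factors of a tensor power. -/
def cycHom : ∀ k, (V.tensor (V.tpow k)).Hom (V.tensor (V.tpow k))
  | 0 => (V.tensor (V.tpow 0)).idHom
  | k + 1 => ((cycHom k).tensorLeft V).comp (V.swapHom (V.tpow k))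

theorem cycHom_succ_diag (k : ℕ) (i j : V.ι) (a : (V.tpow k).ι) :
    (V.cycHom (k + 1)).toMat (i, j, a) (i, j, a) =
      if i = j then (sgn (V.parity i) : ℂ) * (V.cycHom k).toMat (i, a) (i, a) else 0 := by
  change ∑ c : V.ι × V.ι × (V.tpow k).ι, (if i = c.1 then (V.cycHom k).toMat (j, a) c.2 else 0) *
    (if (i, j, a) = (c.2.1, c.1, c.2.2) then (sgn (V.parity c.1 * V.parity c.2.1) : ℂ) else 0) = _
  rw [Finset.sum_eq_single (j, i, a)]
  · by_cases h : i = j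
    · subst h
      simp only [if_true]
      rw [mul_comm, show V.parity i * V.parity i = V.parity i by
        generalize V.parity i = e; revert e; decide]
    · rw [if_neg h, if_neg h, zero_mul]
  · rintro ⟨b, c, d⟩ _ hb
    rw [if_neg (c := (i, j, a) = _), mul_zero]
    intro h
    simp only [Prod.mk.injEq] at h
    exact hb (by rw [h.1, h.2.1, h.2.2])
  · simp

theorem tensor_univMat_apply (i j : V.ι) (a b : W.ι) : (V.tensor W).univMat (i, a) (j, b) =
    sgn ((V.parity i + V.parity j) * W.parity a) • (V.univMat i j * W.univMat a b) := rfl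

theorem tensor_univMat_diag (i : V.ι) (a : W.ι) : (V.tensor W).univMat (i, a) (i, a) =
    V.univMat i i * W.univMat a a := by
  rw [tensor_univMat_apply, show V.parity i + V.parity i = 0 by
    generalize V.parity i = e; revert e; decide, zero_mul, sgn_zero, one_smul]

theorem tensor_isDiag (hV : V.univMat.IsDiag) (hW : W.univMat.IsDiag) :
    (V.tensor W).univMat.IsDiag := by
  rintro ⟨i, a⟩ ⟨j, b⟩ hne
  rw [tensor_univMat_apply]
  by_cases hij : i = j
  · subst hij
    rw [hW (fun h : a = b => hne (by rw [h])), mul_zero, smul_zero]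
  · rw [hV hij, zero_mul, smul_zero]

theorem tpow_isDiag (hV : V.univMat.IsDiag) (k : ℕ) : (V.tpow k).univMat.IsDiag := by
  induction k with
  | zero => exact isDiag_one
  | succ k ih => exact tensor_isDiag hV ih

/-- A cyclic permutation has nonzero diagonal entries only at constant tuples (i, …, i). There the
braiding signs combine with the parities of the factors into the single sign of i. -/
theorem sum_cycHom {d : V.ι → TorusRing n m} (hd : V.univMat = diagonal d) (k : ℕ) (i : V.ι) :
    ∑ a : (V.tpow k).ι, sgn (V.parity i + (V.tpow k).parity a) •
      ((V.cycHom k).toMat (i, a) (i, a) • (V.tensor (V.tpow k)).univMat (i, a) (i, a)) =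
        sgn (V.parity i) • d i ^ (k + 1) := by
  induction k with
  | zero =>
    have h1 : ∀ a : (V.tpow 0).ι, (V.cycHom 0).toMat (i, a) (i, a) = 1 := fun a =>
      Matrix.one_apply_eq _
    have h2 : ∀ a : (V.tpow 0).ι, (V.tpow 0).univMat a a = 1 := fun a => Matrix.one_apply_eq _
    have h3 : ∀ a : (V.tpow 0).ι, (V.tpow 0).parity a = 0 := fun a => rfl
    simp only [h1, h2, h3, tensor_univMat_diag, hd, diagonal_apply_eq, mul_one, one_smul, add_zero,
      zero_add, pow_one]
    exact Fintype.sum_unique (ι := Unit) _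
  | succ k ih =>
    have h1 : ∀ (j : V.ι) (a : (V.tpow k).ι), sgn (V.parity i + (V.tpow (k + 1)).parity (j, a)) •
        ((V.cycHom (k + 1)).toMat (i, j, a) (i, j, a) •
          (V.tensor (V.tpow (k + 1))).univMat (i, j, a) (i, j, a)) =
        if i = j then d i * (sgn (V.parity i + (V.tpow k).parity a) •
          ((V.cycHom k).toMat (i, a) (i, a) • (V.tensor (V.tpow k)).univMat (i, a) (i, a)))
        else 0 := by
      intro j a
      rw [cycHom_succ_diag]
      by_cases hij : i = j
      · subst hij
        have h2 : (V.tensor (V.tpow (k + 1))).univMat (i, i, a) (i, i, a) =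
            d i * (V.tensor (V.tpow k)).univMat (i, a) (i, a) := by
          rw [← diagonal_apply_eq d i, ← hd]
          exact tensor_univMat_diag (W := V.tpow (k + 1)) i (i, a)
        have h3 : (V.tpow (k + 1)).parity (i, a) = V.parity i + (V.tpow k).parity a := rfl
        have h4 : sgn (V.parity i + (V.parity i + (V.tpow k).parity a)) * sgn (V.parity i) =
            sgn (V.parity i + (V.tpow k).parity a) := by
          generalize V.parity i = e; generalize (V.tpow k).parity a = e'
          revert e e'; decide
        rw [if_pos rfl, if_pos rfl, h2, h3, ← h4, mul_smul, mul_smul, Int.cast_smul_eq_zsmul,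
          mul_smul_comm, mul_smul_comm, mul_smul_comm]
      · rw [if_neg hij, if_neg hij, zero_smul, smul_zero]
    refine (Fintype.sum_prod_type (α₁ := V.ι) (α₂ := (V.tpow k).ι) _).trans ?_
    simp only [h1]
    rw [Finset.sum_eq_single i]
    · simp only [if_true]
      rw [← Finset.mul_sum, ih, mul_smul_comm, ← pow_succ']
    · intro j _ hj
      simp [hj.symm]
    · simp

/-- The sum is the supertrace of the torus twisted by the cyclic permutation of k + 1 copies of V,
an equivariant operator, so `str_hom_mem` applies. -/
theorem powerSum_mem {d : V.ι → TorusRing n m} (hd : V.univMat = diagonal d) (k : ℕ) :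
    ∑ i, sgn (V.parity i) • d i ^ (k + 1) ∈ charSpan n m := by
  have h1 := str_hom_mem _ (V.cycHom k)
  have h2 := tensor_isDiag (hd ▸ isDiag_diagonal d) (tpow_isDiag (V := V) (hd ▸ isDiag_diagonal d) k)
  convert h1 using 1
  rw [str]
  refine Eq.trans ?_ (Fintype.sum_prod_type (α₁ := V.ι) (α₂ := (V.tpow k).ι) _).symm
  refine Finset.sum_congr rfl fun i _ => ?_
  rw [← sum_cycHom hd k i]
  refine Finset.sum_congr rfl fun a _ => ?_
  rw [Matrix.mul_apply, Finset.sum_eq_single (i, a)]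
  · rw [Matrix.map_apply, Algebra.smul_def ((V.cycHom k).toMat (i, a) (i, a))]
    rfl
  · intro b _ hb
    rw [h2 hb, mul_zero]
  · exact fun h => absurd (Finset.mem_univ _) h

end GLRep

/-! ### Newton's identities and the generators `h_k`, `h_k*` -/

section Newton

open PowerSeries

variable {R : Type*} [CommRing R]

theorem one_sub_mul_mk (a : R) :
    (1 - C a * X) * PowerSeries.mk (fun r => a ^ (r + 1)) = C a := by
  ext k
  rw [sub_mul, one_mul, map_sub, mul_assoc, coeff_C_mul, coeff_mk]
  cases k with
  | zero => simp
  | succ k => rw [mul_comm X, coeff_succ_mul_X, coeff_mk, coeff_C, if_neg (by omega)]; ring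

theorem derivative_prod_one_sub {κ : Type*} (s : Finset κ) (a : κ → R) :
    derivative R (∏ i ∈ s, (1 - C (a i) * X)) =
      -((∏ i ∈ s, (1 - C (a i) * X)) * ∑ i ∈ s, PowerSeries.mk fun r => a i ^ (r + 1)) := by
  classical
  induction s using Finset.induction_on with
  | empty => simp
  | insert i s hi ih =>
    rw [Finset.prod_insert hi, Finset.sum_insert hi, Derivation.leibniz, ih, smul_eq_mul,
      smul_eq_mul]
    have h1 : derivative R (1 - C (a i) * X) =
        -((1 - C (a i) * X) * PowerSeries.mk (fun r => a i ^ (r + 1))) := by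
      rw [one_sub_mul_mk, map_sub, Derivation.leibniz, derivative_C, derivative_X]
      simp
    rw [h1]
    ring

end Newton

/-- The super power sum `∑ xᵢ^k - ∑ y_p^k`. -/
def psum (n m k : ℕ) : LaurentRing n m := ∑ i : Fin n, x i ^ k - ∑ p : Fin m, y p ^ k

/-- Logarithmic derivative of ∏(1 - y_p t)/∏(1 - x_i t): each factor contributes a geometric series,
with opposite signs for numerator and denominator. -/
theorem derivative_chi (n m : ℕ) : PowerSeries.derivative _ (chi n m) =
    chi n m * PowerSeries.mk fun r => psum n m (r + 1) := by
  have h1 := congrArg (PowerSeries.derivative _) (prod_mul_chi n m)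
  have h2 : (PowerSeries.mk fun r => psum n m (r + 1)) =
      (∑ i : Fin n, PowerSeries.mk fun r => x i ^ (r + 1)) -
        ∑ p : Fin m, PowerSeries.mk fun r => y p ^ (r + 1) := by
    ext1 k
    simp [psum]
  have hu : IsUnit (∏ i : Fin n, (1 - PowerSeries.C (x (m := m) i) * PowerSeries.X)) := by
    rw [PowerSeries.isUnit_iff_constantCoeff]
    simp
  refine hu.mul_left_cancel ?_
  rw [Derivation.leibniz, derivative_prod_one_sub, derivative_prod_one_sub, smul_eq_mul, smul_eq_mul,
    ← prod_mul_chi] at h1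
  rw [h2]
  linear_combination h1

theorem newton (n m k : ℕ) : ((k : LaurentRing n m) + 1) * h n m (k + 1) =
    ∑ a ∈ Finset.HasAntidiagonal.antidiagonal k, h n m a.1 * psum n m (a.2 + 1) := by
  have h1 := congrArg (PowerSeries.coeff k) (derivative_chi n m)
  rw [PowerSeries.coeff_derivative, PowerSeries.coeff_mul] at h1
  simp only [PowerSeries.coeff_mk] at h1
  rw [mul_comm]
  exact h1

theorem h_zero (n m : ℕ) : h n m 0 = 1 := by
  have h1 := congrArg PowerSeries.constantCoeff (prod_mul_chi n m)
  rw [h, PowerSeries.coeff_zero_eq_constantCoeff_apply]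
  simpa using h1

namespace GLRep

variable {n m : ℕ} {A : SuperAlg}

/-- Newton's identities determine (k + 1)h_{k+1} from smaller h's and power sums. The division by k
+ 1 is the reason for working with complex combinations. The homomorphism φ is arbitrary so that h_k
and h_k* are treated at once. -/
theorem map_h_mem (φ : LaurentRing n m →+* TorusRing n m)
    (hφ : ∀ k, φ (psum n m (k + 1)) ∈ charSpan n m) (k : ℕ) : φ (h n m k) ∈ charSpan n m := by
  induction k using Nat.strong_induction_on with
  | _ k ih =>
    cases k with
    | zero => rw [h_zero, map_one]; exact one_mem_charSpan
    | succ k =>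
      have h1 : ((k : ℂ) + 1) • φ (h n m (k + 1)) ∈ charSpan n m := by
        have h2 := congrArg φ (newton n m k)
        rw [map_mul, map_add, map_natCast, map_one, map_sum] at h2
        rw [Algebra.smul_def, map_add, map_natCast, map_one, h2]
        refine Submodule.sum_mem _ fun a ha => ?_
        rw [map_mul]
        rw [Finset.HasAntidiagonal.mem_antidiagonal] at ha
        exact mul_mem_charSpan (ih _ (by omega)) (hφ _)
      have h3 := Submodule.smul_mem _ ((k : ℂ) + 1)⁻¹ h1
      rwa [smul_smul, inv_mul_cancel₀ (Nat.cast_add_one_ne_zero k), one_smul] at h3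

/-! ### The standard representation, its dual and their power sums -/

variable (n m)

/-- The standard representation. -/
abbrev std : GLRep n m :=
  ofMat (Fin n ⊕ Fin m) (stdParity n m) (fun {_} g => g.val.1) (fun g => g.val.2) rfl
    (fun _ _ => rfl) (fun _ _ => rfl)

/-- The dual of the standard representation. -/
abbrev stdDual : GLRep n m :=
  ofMat (Fin n ⊕ Fin m) (stdParity n m)
    -- The sign is that of the supertranspose; it compensates the sign from exchanging two odd
    -- entries when the transposed inverses are multiplied.
    (fun {_} g => Matrix.of fun i j =>
      sgn (stdParity n m i * (stdParity n m i + stdParity n m j)) • (g⁻¹).val.1 j i)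
    (fun {A} g i j => by
      have h1 := (g⁻¹).val.2 j i
      rw [add_comm] at h1
      exact zsmul_mem h1 _)
    (by
      intro A
      rw [inv_one]
      ext i j
      change sgn (stdParity n m i * (stdParity n m i + stdParity n m j)) • (1 : Matrix _ _ A) j i = _
      by_cases hij : i = j
      · subst hij
        rw [show stdParity n m i + stdParity n m i = 0 by
          generalize stdParity n m i = e; revert e; decide]
        simp [sgn_zero]
      · rw [Matrix.one_apply_ne hij, Matrix.one_apply_ne (Ne.symm hij), smul_zero])
    (fun {A} g g' => by
      ext i j
      rw [mul_inv_rev, Matrix.mul_apply]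
      change sgn (stdParity n m i * (stdParity n m i + stdParity n m j)) •
        ((g'⁻¹).val.1 * (g⁻¹).val.1) j i = _
      rw [Matrix.mul_apply, Finset.smul_sum]
      refine Finset.sum_congr rfl fun k _ => ?_
      rw [A.mul_comm_sgn ((g'⁻¹).val.2 j k) ((g⁻¹).val.2 k i), Matrix.of_apply, Matrix.of_apply,
        smul_mul_smul_comm, smul_smul]
      congr 1
      generalize stdParity n m i = a; generalize stdParity n m j = b
      generalize stdParity n m k = c
      revert a b c; decide)
    (fun {A B} φ g => by
      ext i j
      rw [← map_inv]
      change sgn (stdParity n m i * (stdParity n m i + stdParity n m j)) •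
          φ.toAlgHom ((g⁻¹).val.1 j i) =
        φ.toAlgHom (sgn (stdParity n m i * (stdParity n m i + stdParity n m j)) •
          (g⁻¹).val.1 j i)
      rw [map_zsmul])

theorem std_univMat : (std n m).univMat = Matrix.diagonal fun j => (zU j : TorusRing n m) := rfl

theorem stdDual_univMat : (stdDual n m).univMat =
    Matrix.diagonal fun j => ((zU j)⁻¹ : (TorusRing n m)ˣ).val := by
  refine Matrix.ext fun i j => ?_
  change sgn (stdParity n m i * (stdParity n m i + stdParity n m j)) •
    (Matrix.diagonal fun j => ((zU j)⁻¹ : (TorusRing n m)ˣ).val) j i = _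
  by_cases hij : i = j
  · subst hij
    rw [show stdParity n m i + stdParity n m i = 0 by
      generalize stdParity n m i = e; revert e; decide, mul_zero, sgn_zero, one_smul]
  · rw [Matrix.diagonal_apply_ne _ hij, Matrix.diagonal_apply_ne _ (Ne.symm hij), smul_zero]

variable {n m}

theorem toC_psum (k : ℕ) : toC n m (psum n m k) =
    ∑ j, sgn (stdParity n m j) • (zU j : TorusRing n m) ^ k := by
  have hx : ∀ i : Fin n, toC n m (x i) = (zU (Sum.inl i : Fin n ⊕ Fin m)).val := fun i => by
    rw [x, mono, toC_single, Int.cast_one]; rfl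
  have hy : ∀ p : Fin m, toC n m (y p) = (zU (Sum.inr p : Fin n ⊕ Fin m)).val := fun p => by
    rw [y, mono, toC_single, Int.cast_one]; rfl
  simp [psum, Fintype.sum_sum_type, stdParity, sgn, hx, hy, sub_eq_add_neg]

theorem toC_invAct_psum (k : ℕ) : toC n m (invAct (psum n m k)) =
    ∑ j, sgn (stdParity n m j) • (((zU j)⁻¹ : (TorusRing n m)ˣ).val) ^ k := by
  have hx : ∀ i : Fin n, toC n m (invAct (x i)) = ((zU (Sum.inl i : Fin n ⊕ Fin m))⁻¹).val :=
    fun i => by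
      rw [x, mono, invAct, AddMonoidAlgebra.domCongr_single, toC_single, Int.cast_one]; rfl
  have hy : ∀ p : Fin m, toC n m (invAct (y p)) = ((zU (Sum.inr p : Fin n ⊕ Fin m))⁻¹).val :=
    fun p => by
      rw [y, mono, invAct, AddMonoidAlgebra.domCongr_single, toC_single, Int.cast_one]; rfl
  simp only [psum, map_sub, map_sum, map_pow, hx, hy, Fintype.sum_sum_type, stdParity, Sum.elim_inl,
    Sum.elim_inr]
  simp [sgn, sub_eq_add_neg]

theorem h_mem_range (k : ℕ) : h n m k ∈ (schHom n m).range :=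
  mem_range_schHom (map_h_mem (toC n m) (fun k => by
    rw [toC_psum]
    exact powerSum_mem (std_univMat n m) k) k)

theorem hStar_mem_range (k : ℕ) : hStar n m k ∈ (schHom n m).range :=
  mem_range_schHom (map_h_mem ((toC n m).comp (invAct : LaurentRing n m ≃ₐ[ℤ] _).toRingHom)
    (fun k => by
      change toC n m (invAct (psum n m (k + 1))) ∈ _
      rw [toC_invAct_psum]
      exact powerSum_mem (stdDual_univMat n m) k) k)

end GLRep

/-! ### The Berezinian -/

section Berezinian

variable {n m : ℕ} {A B : SuperAlg}

open Matrix

/-- The lower right block of a supermatrix. -/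
def blockD (g : SGL (stdParity n m) A) : Matrix (Fin m) (Fin m) A.even :=
  Matrix.of fun p q => ⟨g.val.1 (Sum.inr p) (Sum.inr q), g.val.2 (Sum.inr p) (Sum.inr q)⟩

/-- The Berezinian `det a * det (d - c a⁻¹ b)⁻¹`; the second factor is the determinant of the lower
right block of the inverse supermatrix. -/
def ber (g : SGL (stdParity n m) A) : A.even := (blockA g).det * (blockD g⁻¹).det

theorem ber_one : ber (1 : SGL (stdParity n m) A) = 1 := by
  have h1 : blockA (1 : SGL (stdParity n m) A) = 1 := by
    ext i j
    change (1 : Matrix (Fin n ⊕ Fin m) (Fin n ⊕ Fin m) A) (Sum.inl i) (Sum.inl j) = _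
    by_cases h : i = j
    · subst h; rw [Matrix.one_apply_eq, Matrix.one_apply_eq]; rfl
    · rw [Matrix.one_apply_ne h, Matrix.one_apply_ne (fun h' => h (Sum.inl_injective h'))]; rfl
  have h2 : blockD (1 : SGL (stdParity n m) A) = 1 := by
    ext i j
    change (1 : Matrix (Fin n ⊕ Fin m) (Fin n ⊕ Fin m) A) (Sum.inr i) (Sum.inr j) = _
    by_cases h : i = j
    · subst h; rw [Matrix.one_apply_eq, Matrix.one_apply_eq]; rfl
    · rw [Matrix.one_apply_ne h, Matrix.one_apply_ne (fun h' => h (Sum.inr_injective h'))]; rfl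
  rw [ber, inv_one, h1, h2, det_one, det_one, mul_one]

theorem coe_even_sum {κ : Type*} (s : Finset κ) (f : κ → A.even) :
    ((∑ i ∈ s, f i : A.even) : A) = ∑ i ∈ s, (f i : A) := map_sum A.even.val f s

/-- When the upper right blocks of e and e⁻¹ vanish, the upper left block of e g and the lower right
block of (e g)⁻¹ are products of the corresponding blocks, and determinants over the commutative
even part multiply. -/
theorem ber_mul_of_lower {e : SGL (stdParity n m) A}
    (h1 : ∀ i p, e.val.1 (Sum.inl i) (Sum.inr p) = 0)
    (h2 : ∀ i p, (e⁻¹).val.1 (Sum.inl i) (Sum.inr p) = 0) (g : SGL (stdParity n m) A) :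
    ber (e * g) = ber e * ber g := by
  have hA : blockA (e * g) = blockA e * blockA g := by
    ext i j
    rw [Matrix.mul_apply, coe_even_sum]
    change (e.val.1 * g.val.1) (Sum.inl i) (Sum.inl j) = _
    rw [Matrix.mul_apply, Fintype.sum_sum_type]
    simp only [h1, zero_mul, Finset.sum_const_zero, add_zero]
    rfl
  have hD : blockD (g⁻¹ * e⁻¹) = blockD g⁻¹ * blockD e⁻¹ := by
    ext p q
    rw [Matrix.mul_apply, coe_even_sum]
    change ((g⁻¹).val.1 * (e⁻¹).val.1) (Sum.inr p) (Sum.inr q) = _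
    rw [Matrix.mul_apply, Fintype.sum_sum_type]
    simp only [h2, mul_zero, Finset.sum_const_zero, zero_add]
    rfl
  rw [ber, ber, ber, _root_.mul_inv_rev, hA, hD, det_mul, det_mul]
  ring

/-- Both blocks change by a factor that is a rank-one perturbation of 1. By the matrix determinant
lemma the determinants acquire the factors 1 + az and 1 + za, with a and z odd. Since za = -az and
(az)² = 0, these factors are inverse to each other. -/
theorem ber_upper_mul (i : Fin n) (p : Fin m)
    (a : A.grading (stdParity n m (Sum.inl i) + stdParity n m (Sum.inr p)))
    (g : SGL (stdParity n m) A) :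
    ber (elem (j := Sum.inl i) (k := Sum.inr p) Sum.inl_ne_inr a * g) = ber g := by
  set e : SGL (stdParity n m) A := elem (j := Sum.inl i) (k := Sum.inr p) Sum.inl_ne_inr a with he
  have ha : a.1 ∈ A.grading 1 := a.2
  have hcr : ∀ {k : ℕ} (u v : Fin k → A.even) (r s : Fin k),
      (replicateCol Unit u * replicateRow Unit v) r s = u r * v s := by
    intro k u v r s
    rw [Matrix.mul_apply, Fintype.sum_unique]
    rfl
  set N := blockA g with hN
  have hNu : IsUnit N.det := isUnit_det_blockA g
  have hc : ∀ q j, g.val.1 (Sum.inr q) (Sum.inl j) ∈ A.grading 1 :=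
    fun q j => g.val.2 (Sum.inr q) (Sum.inl j)
  let z : Fin m → A := fun q => ∑ j, g.val.1 (Sum.inr q) (Sum.inl j) * (N⁻¹ j i : A)
  have hz : ∀ q, z q ∈ A.grading 1 := fun q => Submodule.sum_mem _ fun j _ => by
    have := SetLike.mul_mem_graded (hc q j) (N⁻¹ j i).2
    rwa [add_zero] at this
  let w : Fin n → A.even := fun j => ⟨a.1 * g.val.1 (Sum.inr p) (Sum.inl j),
    SetLike.mul_mem_graded ha (hc p j)⟩
  let t : Fin m → A.even := fun q => ⟨z q * a.1, SetLike.mul_mem_graded (hz q) ha⟩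
  let θz : A.even := ⟨a.1 * z p, SetLike.mul_mem_graded ha (hz p)⟩
  have hA : blockA (e * g) =
      (1 + replicateCol Unit (Pi.single i (1 : A.even)) * replicateRow Unit (w ᵥ* N⁻¹)) * N := by
    rw [Matrix.add_mul, Matrix.one_mul, Matrix.mul_assoc, ← replicateRow_vecMul, vecMul_vecMul,
      nonsing_inv_mul _ hNu, vecMul_one]
    ext r s
    change (((1 + Matrix.single (Sum.inl i) (Sum.inr p) a.1) * g.val.1 :
      Matrix (Fin n ⊕ Fin m) (Fin n ⊕ Fin m) A)) (Sum.inl r) (Sum.inl s) =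
      (N r s : A) + ((replicateCol Unit (Pi.single i (1 : A.even)) * replicateRow Unit w) r s : A.even)
    rw [Matrix.add_mul, Matrix.one_mul, Matrix.add_apply, hcr]
    congr 1
    by_cases hr : r = i
    · subst hr
      rw [Matrix.single_mul_apply_same, Pi.single_eq_same, one_mul]
    · rw [Matrix.single_mul_apply_of_ne _ _ _ _ _ (fun h => hr (Sum.inl_injective h)),
        Pi.single_eq_of_ne hr, zero_mul]
      rfl
  have hdA : (blockA (e * g)).det = (1 + θz) * N.det := by
    rw [hA, det_mul, det_one_add_replicateCol_mul_replicateRow, dotProduct_single_one]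
    congr 2
    refine Subtype.ext ?_
    change ((∑ j, w j * N⁻¹ j i : A.even) : A) = a.1 * z p
    rw [coe_even_sum, Finset.mul_sum]
    refine Finset.sum_congr rfl fun j _ => ?_
    exact mul_assoc _ _ _
  set D := blockD g⁻¹ with hD
  -- From g⁻¹ g = 1, the lower left block of g⁻¹ is minus its lower right block times c a⁻¹, where a
  -- and c are the left blocks of g; z is a column of c a⁻¹.
  have hinv : ∀ q, (g⁻¹).val.1 (Sum.inr q) (Sum.inl i) = -∑ q', (D q q' : A) * z q' := by
    intro q
    have h1 : ∀ j, ∑ k, (g⁻¹).val.1 (Sum.inr q) (Sum.inl k) * (N k j : A) +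
        ∑ q', (D q q' : A) * g.val.1 (Sum.inr q') (Sum.inl j) = 0 := by
      intro j
      have h2 : (g⁻¹).val.1 * g.val.1 = 1 := congrArg Subtype.val g.inv_val
      have h3 := congrFun (congrFun h2 (Sum.inr q)) (Sum.inl j)
      rw [Matrix.mul_apply, Fintype.sum_sum_type, Matrix.one_apply_ne Sum.inr_ne_inl] at h3
      exact h3
    have h4 : ∀ k, ∑ j, (N k j : A) * (N⁻¹ j i : A) = if k = i then 1 else 0 := by
      intro k
      have h5 := congrArg (Subtype.val) (congrFun (congrFun (mul_nonsing_inv N hNu) k) i)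
      rw [Matrix.mul_apply, coe_even_sum, Matrix.one_apply] at h5
      refine Eq.trans h5 ?_
      split_ifs <;> rfl
    have h6 : ∑ j, (∑ k, (g⁻¹).val.1 (Sum.inr q) (Sum.inl k) * (N k j : A)) * (N⁻¹ j i : A) =
        (g⁻¹).val.1 (Sum.inr q) (Sum.inl i) := by
      simp only [Finset.sum_mul, mul_assoc]
      rw [Finset.sum_comm]
      simp only [← Finset.mul_sum, h4, mul_ite, mul_one, mul_zero]
      rw [Finset.sum_ite_eq', if_pos (Finset.mem_univ _)]
    have h7 : ∑ j, (∑ q', (D q q' : A) * g.val.1 (Sum.inr q') (Sum.inl j)) * (N⁻¹ j i : A) =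
        ∑ q', (D q q' : A) * z q' := by
      simp only [Finset.sum_mul, mul_assoc]
      rw [Finset.sum_comm]
      simp only [← Finset.mul_sum]
      rfl
    rw [← h6, ← h7, ← Finset.sum_neg_distrib]
    refine Finset.sum_congr rfl fun j _ => ?_
    rw [eq_neg_of_add_eq_zero_left (h1 j), neg_mul]
  have hDm : blockD (e * g)⁻¹ =
      D * (1 + replicateCol Unit t * replicateRow Unit (Pi.single p (1 : A.even))) := by
    rw [Matrix.mul_add, Matrix.mul_one, ← Matrix.mul_assoc, ← replicateCol_mulVec, _root_.mul_inv_rev]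
    ext q s
    change (((g⁻¹).val.1 * (1 - Matrix.single (Sum.inl i) (Sum.inr p) a.1) :
      Matrix (Fin n ⊕ Fin m) (Fin n ⊕ Fin m) A)) (Sum.inr q) (Sum.inr s) =
      (D q s : A) + ((replicateCol Unit (D *ᵥ t) * replicateRow Unit (Pi.single p (1 : A.even))) q s : A.even)
    rw [Matrix.mul_sub, Matrix.mul_one, Matrix.sub_apply, hcr, sub_eq_add_neg]
    congr 1
    by_cases hs : s = p
    · subst hs
      rw [Matrix.mul_single_apply_same, Pi.single_eq_same, mul_one, hinv, neg_mul, neg_neg]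
      change _ = ((∑ q', D q q' * t q' : A.even) : A)
      rw [coe_even_sum, Finset.sum_mul]
      exact Finset.sum_congr rfl fun q' _ => mul_assoc _ _ _
    · rw [Matrix.mul_single_apply_of_ne _ _ _ _ _ (fun h => hs (Sum.inr_injective h)),
        Pi.single_eq_of_ne hs, mul_zero, neg_zero]
      rfl
  have hdD : (blockD (e * g)⁻¹).det = D.det * (1 + t p) := by
    rw [hDm, det_mul, det_one_add_replicateCol_mul_replicateRow, single_one_dotProduct]
  have hprod : (1 + θz) * (1 + t p) = 1 := by
    refine Subtype.ext ?_
    change (1 + a.1 * z p) * (1 + z p * a.1) = 1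
    have h1 : z p * a.1 = -(a.1 * z p) := A.comm_odd _ (hz p) _ ha
    have h2 : a.1 * z p * (a.1 * z p) = 0 := by
      rw [mul_assoc, ← mul_assoc (z p), h1, neg_mul, mul_neg, ← mul_assoc, ← mul_assoc,
        SuperAlg.odd_sq ha, zero_mul, zero_mul, neg_zero]
    rw [h1, mul_add, mul_one, add_mul, one_mul, mul_neg, h2]
    simp
  change (blockA (e * g)).det * (blockD (e * g)⁻¹).det = N.det * D.det
  rw [hdA, hdD]
  linear_combination (N.det * D.det) * hprod

/-- The points whose left multiplication is compatible with the Berezinian form a submonoid. It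
contains the elementary supermatrices and the points of the even part, and these generate by the
block factorization. -/
theorem ber_mul (g g' : SGL (stdParity n m) A) : ber (g * g') = ber g * ber g' := by
  let S : Submonoid (SGL (stdParity n m) A) :=
    { carrier := {e | ∀ g, ber (e * g) = ber e * ber g}
      one_mem' := fun g => by rw [one_mul, ber_one, one_mul]
      mul_mem' := fun {e e'} he he' g => by rw [mul_assoc, he, he', he, mul_assoc] }
  have helem : ∀ (j k : Fin n ⊕ Fin m) (hjk : j ≠ k)
      (a : A.grading (stdParity n m j + stdParity n m k)), elem hjk a ∈ S := by
    intro j k hjk a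
    have hlow : (∀ i p, ¬ (j = Sum.inl i ∧ k = Sum.inr p)) → elem hjk a ∈ S := by
      intro h
      have h1 : ∀ i p, Matrix.single j k a.1 (Sum.inl i) (Sum.inr p) = 0 := fun i p => by
        rw [Matrix.single_apply, if_neg (h i p)]
      have h2 : ∀ i p, (1 : Matrix (Fin n ⊕ Fin m) (Fin n ⊕ Fin m) A) (Sum.inl i) (Sum.inr p) = 0 :=
        fun i p => Matrix.one_apply_ne Sum.inl_ne_inr
      refine ber_mul_of_lower (fun i p => ?_) fun i p => ?_
      · change (1 + Matrix.single j k a.1) (Sum.inl i) (Sum.inr p) = 0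
        rw [Matrix.add_apply, h1, h2, add_zero]
      · change (1 - Matrix.single j k a.1) (Sum.inl i) (Sum.inr p) = 0
        rw [Matrix.sub_apply, h1, h2, sub_zero]
    rcases j with i | p
    · rcases k with i' | p
      · exact hlow fun _ _ h => Sum.inl_ne_inr h.2
      · intro g
        have h1 := ber_upper_mul i p a 1
        rw [mul_one, ber_one] at h1
        rw [ber_upper_mul, h1, one_mul]
    · exact hlow fun _ _ h => Sum.inr_ne_inl h.1
  have hsub : ∀ T : Set (SGL (stdParity n m) A), (∀ e ∈ T, ∃ (j k : Fin n ⊕ Fin m) (hjk : j ≠ k)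
      (a : A.grading (stdParity n m j + stdParity n m k)), e = elem hjk a) →
      ∀ e ∈ Subgroup.closure T, e ∈ S := by
    intro T hT e he
    induction he using Subgroup.closure_induction'' with
    | one => exact S.one_mem
    | mem e he =>
      obtain ⟨j, k, hjk, a, rfl⟩ := hT e he
      exact helem j k hjk a
    | inv_mem e he =>
      obtain ⟨j, k, hjk, a, rfl⟩ := hT e he
      have h1 : (elem hjk a : SGL (stdParity n m) A)⁻¹ = elem hjk (-a) := by
        refine sgl_ext ?_
        change 1 - Matrix.single j k a.1 = 1 + Matrix.single j k (-a.1)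
        rw [← Matrix.single_neg, sub_eq_add_neg]
      rw [h1]
      exact helem j k hjk (-a)
    | mul e e' _ _ he he' => exact S.mul_mem he he'
  obtain ⟨l, hl, g₀, u, hu, rfl⟩ := exists_block_factor g
  have h0 : SGL.map _ A.evenHom g₀ ∈ S := by
    have h1 : ∀ (g₀ : SGL (stdParity n m) (SuperAlg.ofComm A.even)) i p,
        g₀.val.1 (Sum.inl i) (Sum.inr p) = 0 := by
      intro g₀ i p
      have h2 := g₀.val.2 (Sum.inl i) (Sum.inr p)
      change g₀.val.1 (Sum.inl i) (Sum.inr p) ∈ evenGrading A.even 1 at h2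
      simpa [evenGrading] using h2
    refine ber_mul_of_lower (fun i p => ?_) fun i p => ?_
    · rw [val_map, Matrix.map_apply, h1, map_zero]
    · rw [← map_inv, val_map, Matrix.map_apply, h1, map_zero]
  refine S.mul_mem (S.mul_mem (hsub _ ?_ l hl) h0) (hsub _ ?_ u hu) g'
  · rintro e ⟨j, k, hjk, a, -, rfl⟩
    exact ⟨j, k, hjk, a, rfl⟩
  · rintro e ⟨j, k, hjk, a, -, rfl⟩
    exact ⟨j, k, hjk, a, rfl⟩

/-- The even part of a homomorphism. -/
def SuperAlg.Hom.evenMap (φ : A.Hom B) : A.even →+* B.even :=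
  (φ.toAlgHom.toRingHom.comp A.even.val.toRingHom).codRestrict B.even fun a => φ.map_mem 0 _ a.2

theorem ber_map (φ : A.Hom B) (g : SGL (stdParity n m) A) :
    ber (SGL.map _ φ g) = φ.evenMap (ber g) := by
  rw [ber, ber, map_mul, RingHom.map_det, RingHom.map_det, ← map_inv]
  rfl

theorem ber_torusR {R : Type} [CommRing R] [Algebra ℂ R] (d : Fin n ⊕ Fin m → Rˣ) :
    ((ber (torusR d) : (SuperAlg.ofComm R).even) : R) =
      (∏ i : Fin n, (d (Sum.inl i) : R)) * ∏ p : Fin m, ((d (Sum.inr p))⁻¹ : Rˣ).val := by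
  let f : (SuperAlg.ofComm R).even →+* R := (SuperAlg.ofComm R).even.val.toRingHom
  change f (ber (torusR d)) = _
  rw [ber, map_mul, RingHom.map_det, RingHom.map_det, ← det_diagonal, ← det_diagonal]
  congr 2
  · ext i j
    change Matrix.diagonal (fun j => (d j : R)) (Sum.inl i) (Sum.inl j) = _
    by_cases h : i = j
    · subst h; rw [diagonal_apply_eq, diagonal_apply_eq]
    · rw [diagonal_apply_ne _ h, diagonal_apply_ne _ (fun h' => h (Sum.inl_injective h'))]
  · ext i j
    change Matrix.diagonal (fun j => ((d j)⁻¹ : Rˣ).val) (Sum.inr i) (Sum.inr j) = _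
    by_cases h : i = j
    · subst h; rw [diagonal_apply_eq, diagonal_apply_eq]
    · rw [diagonal_apply_ne _ h, diagonal_apply_ne _ (fun h' => h (Sum.inr_injective h'))]

end Berezinian

/-! ### The Berezinian characters and `Δ`, `Δ*` -/

namespace GLRep

variable (n m : ℕ)

/-- The one-dimensional even representation given by a natural character. -/
abbrev ofChar (χ : ∀ {A : SuperAlg}, SGL (stdParity n m) A → A.even)
    (hone : ∀ {A : SuperAlg}, χ (1 : SGL (stdParity n m) A) = 1)
    (hmul : ∀ {A : SuperAlg} (g g' : SGL (stdParity n m) A), χ (g * g') = χ g * χ g')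
    (hmap : ∀ {A B} (φ : SuperAlg.Hom A B) (g : SGL (stdParity n m) A),
      (χ (SGL.map (stdParity n m) φ g) : B) = φ.toAlgHom (χ g : A)) : GLRep n m :=
  ofMat Unit (fun _ => 0) (fun {_} g => Matrix.of fun _ _ => (χ g).1) (fun g _ _ => (χ g).2)
    (by
      intro A
      rw [hone]
      exact Matrix.ext fun _ _ => rfl)
    (fun g g' => by
      rw [hmul]
      refine Matrix.ext fun _ _ => ?_
      rw [Matrix.mul_apply, Fintype.sum_unique]
      rfl)
    (fun φ g => by
      refine Matrix.ext fun _ _ => ?_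
      exact hmap φ g)

/-- The Berezinian representation. -/
abbrev berRep : GLRep n m :=
  ofChar n m (fun {_} g => ber g) ber_one ber_mul (fun φ g => by rw [ber_map]; rfl)

/-- The dual of the Berezinian representation. -/
abbrev berDual : GLRep n m :=
  ofChar n m (fun {_} g => ber g⁻¹) (by intro A; rw [inv_one, ber_one])
    (fun g g' => by rw [_root_.mul_inv_rev, ber_mul, mul_comm])
    (fun φ g => by rw [← map_inv, ber_map]; rfl)

variable {n m}

theorem torusR_inv {R : Type} [CommRing R] [Algebra ℂ R] (d : Fin n ⊕ Fin m → Rˣ) :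
    (torusR d)⁻¹ = torusR d⁻¹ := by
  refine sgl_ext ?_
  rfl

theorem wpow_berezinian {R : Type} [CommRing R] [Algebra ℂ R] (d : Fin n ⊕ Fin m → Rˣ) (s : ℤ) :
    wpow d (Sum.elim (fun _ => s) (fun _ => -s)) =
      (∏ i : Fin n, d (Sum.inl i)) ^ s * (∏ p : Fin m, (d (Sum.inr p))⁻¹) ^ s := by
  rw [wpow, Fintype.prod_sum_type, ← Finset.prod_zpow, ← Finset.prod_zpow]
  simp

/-- On the torus the Berezinian is x_1⋯x_n / (y_1⋯y_m), and its representation is one-dimensional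
and even. -/
theorem DeltaStar_mem_range : DeltaStar n m ∈ (schHom n m).range := by
  refine ⟨GrothRing.cls (berRep n m), toC_injective ?_⟩
  rw [schHom_cls, toC_sch, DeltaStar, mono, toC_single, Int.cast_one, ← wpow_zU, wpow_berezinian,
    zpow_one, zpow_one, Units.val_mul, Units.coe_prod, Units.coe_prod, ← ber_torusR, schC, str]
  exact (Fintype.sum_unique (ι := Unit) _).trans (one_smul ℤ _)

theorem Delta_mem_range : Delta n m ∈ (schHom n m).range := by
  refine ⟨GrothRing.cls (berDual n m), toC_injective ?_⟩
  have h1 : (ber (torusR (zU : Fin n ⊕ Fin m → (TorusRing n m)ˣ))⁻¹ :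
      (SuperAlg.ofComm (TorusRing n m)).even).1 =
      AddMonoidAlgebra.single (Sum.elim (fun _ => -1) (fun _ => 1)) 1 := by
    have h2 := wpow_berezinian (zU : Fin n ⊕ Fin m → (TorusRing n m)ˣ) (-1)
    rw [neg_neg] at h2
    rw [torusR_inv, ← wpow_zU, h2]
    refine (ber_torusR _).trans ?_
    rw [← Units.coe_prod, ← Units.coe_prod, ← Units.val_mul]
    simp
  rw [schHom_cls, toC_sch, Delta, mono, toC_single, Int.cast_one, ← h1, schC, str]
  exact (Fintype.sum_unique (ι := Unit) _).trans (one_smul ℤ _)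

end GLRep

/-! ### The supercharacter isomorphism -/

theorem genRing_le_range (n m : ℕ) : genRing n m ≤ (schHom n m).range := by
  rw [genRing, Subring.closure_le]
  rintro f (((rfl | rfl) | ⟨k, rfl⟩) | ⟨k, rfl⟩)
  · exact GLRep.Delta_mem_range
  · exact GLRep.DeltaStar_mem_range
  · exact GLRep.h_mem_range k
  · exact GLRep.hStar_mem_range k

theorem range_schHom_le (n m : ℕ) : (schHom n m).range ≤ J00 n m := by
  rintro _ ⟨a, rfl⟩
  exact schHom_mem_J00 a

/-- That the generators lie in J₀₀ is not computed directly: they are supercharacters of virtual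
representations, and supercharacters lie in J₀₀. The reverse inclusion uses this in every rank
because of the induction. -/
theorem genRing_eq (n m : ℕ) : genRing n m = J00 n m :=
  le_antisymm ((genRing_le_range n m).trans (range_schHom_le n m))
    (J00_le_genRing (fun n m => (genRing_le_range n m).trans (range_schHom_le n m)) n m)

/-- The supercharacter isomorphism. -/
def schEquiv (n m : ℕ) : GrothRing n m ≃+* J00 n m :=
  RingEquiv.ofBijective ((schHom n m).codRestrict (J00 n m) schHom_mem_J00)
    ⟨fun a b hab => schHom_injective (congrArg Subtype.val hab), fun f => by
      obtain ⟨a, ha⟩ := genRing_le_range n m ((genRing_eq n m).ge f.2)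
      exact ⟨a, Subtype.ext ha⟩⟩

end SuperGL

end

theorem mainTheorem6 (n m : ℕ) :
    Subring.closure ({SuperGL.Delta n m, SuperGL.DeltaStar n m} ∪
        Set.range (SuperGL.h n m) ∪ Set.range (SuperGL.hStar n m)) = SuperGL.J00 n m ∧
    ∃ Sch : SuperGL.GrothRing n m ≃+* SuperGL.J00 n m,
      ∀ (V : SuperGL.GLRep n m) (w : SuperGL.Wt n m),
        (Sch (SuperGL.GrothRing.cls V) : SuperGL.LaurentRing n m).coeff w = V.sdimWeight w := by
  refine ⟨SuperGL.genRing_eq n m, SuperGL.schEquiv n m, fun V w => ?_⟩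
  rw [← V.coeff_sch, ← SuperGL.schHom_cls]
  rfl
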